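/- Let $p$ be an odd prime, let $r\ge 1$, and let $A=\mathbb F_p[x]/(x^{r+1})$, graded with $|x|$ a positive even number. Conventions. Consider commutative graded $\mathbb F_p$-algebras $B$ concentrated in non-negative even degrees with $b^p=b$ for $b\in B^0$. A free one on a set of homogeneous generators is the polynomial algebra on them modulo $z^p=z$ for the generators $z$ of degree $0$. For such $B$, $\overline\Omega(B)$ is the graded commutative algebra generated by the elements $b\in B$ (degree $|b|$) and symbols $\mathbf d b$ (degree $|b|-1$), where $B\to\overline\Omega(B)$ is an algebra map and $\mathbf d$ is linear with $\mathbf d(bb')=b\,\mathbf db'+b'\,\mathbf db$; it carries the de Rham differential, i.e. the signed derivation with $b\mapsto\mathbf db$, $\mathbf db\mapsto 0$. A simplicial object $P_\bullet$ with an augmentation $P_\bullet\to A$ is an almost free resolution if $\pi_0P_\bullet\cong A$, $\pi_iP_\bullet=0$ for $i>0$, and each $P_q$ is free on a set $X_q$ of homogeneous elements such that degeneracies map $X_q$ to $X_{q+1}$. The derived functors are $H_i(A;\overline\Omega)=\pi_i\overline\Omega(P_\bullet)$, computed from the normalized complex $N_i=\bigcap_{j=1}^i\ker d_j$ with differential $d_0$,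 and bigraded by $(i,\text{internal degree})$. The product is induced by the shuffle product $\rho(u\otimes v)=\sum_{(\mu,\nu)}(-1)^{\epsilon(\mu)}s_\nu(u)s_\mu(v)$, the sum being over $(i,j)$-shuffles and $\epsilon(\mu)=\sum_{k=1}^i(\mu_k-(k-1))$. Bigraded algebras are commutative in the sense $ab=(-1)^{ii'+nn'}ba$ for $a,b$ of bidegrees $(i,n)$, $(i',n')$; free algebras $\mathbb F_p[a_i,b_i]$ and tensor products below are taken in this sense. Let $R_q=\mathbb F_p[x,y_1,\dots,y_q]$ with $|y_j|=(r+1)|x|$, $d_i(x)=s_i(x)=x$, $s_i(y_j)=y_j$ for $i\ge j$, $s_i(y_j)=y_{j+1}$ for $i<j$, $d_i(y_j)=y_{j-1}$ for $i<j$ and $d_i(y_j)=y_j$ for $i\ge j$, where $y_0:=x^{r+1}$ and $y_j:=0$ in $R_q$ for $j>q$. Let $\theta$ be the signed derivation of $\overline\Omega(R_q)$ with $\theta(x)=\theta(y_j)=0$, $\theta(\mathbf dx)=x$, $\theta(\mathbf dy_j)=(r+1)y_j$. Theorem. $R_\bullet$, with $x\mapsto x$, $y_j\mapsto 0$, is an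 almost free resolution of $A$. Let $P_\bullet$ be any almost free resolution of $A$. There is a simplicial map $R_\bullet\to P_\bullet$ over $A$, and for every such map $f$ (in particular for the identity of $R_\bullet$) the following holds for $H_*(A;\overline\Omega)=\pi_*\overline\Omega(P_\bullet)$, where $[u]$ denotes the class of $\overline\Omega(f)(u)$. (1) If $p\mid r+1$, there is an isomorphism of bigraded algebras $$H_*(A;\overline\Omega)\cong \mathbb F_p[x]/(x^{r+1})\otimes\Lambda(\mathbf dx)\otimes\Gamma[\omega],$$ where $\|x\|=(0,|x|)$, $\|\mathbf dx\|=(0,|x|-1)$, $\|\gamma_i(\omega)\|=(i,i((r+1)|x|-1))$, and $x=[x]$, $\mathbf dx=[\mathbf dx]$, $\gamma_i(\omega)=[\mathbf dy_1\cdots\mathbf dy_i]$. The de Rham differential induces the map $\mathbf d_*$ on $H_*(A;\overline\Omega)$ that is a derivation, $\mathbf d_*(ab)=\mathbf d_*(a)b+(-1)^na\,\mathbf d_*(b)$ for $a$ of internal degree $n$, with $x\mapsto\mathbf dx$, $\mathbf dx\mapsto0$, $\gamma_i(\omega)\mapsto0$. (2) If $p\nmid r+1$, there is an isomorphism of bigraded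 algebras $$H_*(A;\overline\Omega)\cong\mathbb F_p[a_i,b_i\mid i\ge0]/I_r,$$ where $I_r$ is generated, for $i,j\ge0$, by $$a_ia_j,\quad b_ib_j-\tbinom{i+j}{i}b_0b_{i+j},\quad a_ib_j-\tbinom{i+j}{i}b_0a_{i+j},\quad b_0^rb_i,\quad b_0^ra_i,$$ with $\|a_i\|=(i,i((r+1)|x|-1)+|x|-1)$, $\|b_i\|=\|a_i\|+(0,1)$, and $a_i=[\mathbf dx\,\mathbf dy_1\cdots\mathbf dy_i]$, $b_i=[\theta(\mathbf dx\,\mathbf dy_1\cdots\mathbf dy_i)]$. The de Rham differential induces the map $\mathbf d_*$, a derivation in the same sense, with $a_i\mapsto0$, $b_i\mapsto(1+(r+1)i)a_i$. -/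

import Mathlib

open CategoryTheory
open scoped DirectSum

noncomputable section

namespace DerivedDeRham

/-- The object `X_n` of `n`-simplices of a simplicial object `X`. -/
abbrev lv {C : Type*} [Category C] (X : SimplicialObject C) (n : ℕ) : C :=
  X.obj (Opposite.op (SimplexCategory.mk n))

/-- The algebra of `n`-simplices of a simplicial algebra. -/
abbrev alv {p : ℕ} (V : SimplicialObject (AlgCat.{0} (ZMod p))) (n : ℕ) : Type :=
  (lv V n).carrier

/-! ### Graded algebras concentrated in even degrees

An object is a commutative `ℕ`-graded `𝔽_p`-algebra `A` which is concentrated in even degrees and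
satisfies `a ^ p = a` for `a ∈ A⁰`.  For odd `p` the operations `λ` and `β` are identically zero on
such an algebra, so these are the objects of `ℱ` that are concentrated in even degrees, and the
degree preserving algebra maps are the morphisms of `ℱ` between them. -/

/-- Even graded commutative `𝔽_p`-algebras with `a ^ p = a` in degree zero. -/
structure EvenAlg (p : ℕ) where
  carrier : Type
  [commRing : CommRing carrier]
  [algebra : Algebra (ZMod p) carrier]
  /-- the homogeneous components -/
  gr : ℕ → Submodule (ZMod p) carrier
  gradedMonoid : SetLike.GradedMonoid gr
  isInternal : DirectSum.IsInternal gr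
  gr_odd : ∀ n, Odd n → gr n = ⊥
  pow_p : ∀ a ∈ gr 0, a ^ p = a

attribute [instance] EvenAlg.commRing EvenAlg.algebra

/-- Morphisms are the degree preserving algebra maps. -/
@[ext]
structure EvenAlg.Hom {p : ℕ} (A B : EvenAlg p) where
  toAlgHom : A.carrier →ₐ[ZMod p] B.carrier
  map_gr : ∀ n, ∀ a ∈ A.gr n, toAlgHom a ∈ B.gr n

instance EvenAlg.instCategory (p : ℕ) : Category (EvenAlg p) where
  Hom A B := EvenAlg.Hom A B
  id A := ⟨AlgHom.id _ _, fun _ _ h => h⟩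
  comp f g := ⟨g.toAlgHom.comp f.toAlgHom, fun n _ h => g.map_gr n _ (f.map_gr n _ h)⟩

/-- The underlying algebra. -/
def EvenAlg.forgetGr (p : ℕ) : EvenAlg p ⥤ AlgCat.{0} (ZMod p) where
  obj A := AlgCat.of (ZMod p) A.carrier
  map f := AlgCat.ofHom f.toAlgHom
  map_id _ := rfl
  map_comp _ _ := rfl

/-- `A` is a free object on the set `X` of homogeneous elements: it is the polynomial algebra on
`X` modulo the relations `z ^ p = z` for the generators `z ∈ X` of degree zero. -/
structure EvenAlg.IsFreeOn {p : ℕ} (A : EvenAlg p) (X : Set A.carrier) : Prop where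
  homogeneous : ∀ z ∈ X, ∃ n, z ∈ A.gr n
  surjective : Function.Surjective
    (MvPolynomial.aeval (R := ZMod p) (Subtype.val : X → A.carrier))
  ker_eq : RingHom.ker (MvPolynomial.aeval (R := ZMod p) (Subtype.val : X → A.carrier)) =
    Ideal.span {f | ∃ z : X, z.1 ∈ A.gr 0 ∧ f = MvPolynomial.X z ^ p - MvPolynomial.X z}

/-! ### Homotopy of simplicial algebras -/

section Homotopy

variable {p : ℕ} (V : SimplicialObject (AlgCat.{0} (ZMod p)))

/-- The normalized chains `N_i V = ⋂_{j=1}^{i} ker d_j`. -/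
def normalized : (i : ℕ) → Submodule (ZMod p) (alv V i)
  | 0 => ⊤
  | i + 1 => ⨅ j : Fin (i + 1), LinearMap.ker (V.δ j.succ).hom.toLinearMap

/-- The cycles of the normalized chain complex, whose differential is `d_0`. -/
def cycles : (i : ℕ) → Submodule (ZMod p) (alv V i)
  | 0 => ⊤
  | i + 1 => normalized V (i + 1) ⊓ LinearMap.ker (V.δ (n := i) 0).hom.toLinearMap

/-- The boundaries of the normalized chain complex. -/
def boundaries (i : ℕ) : Submodule (ZMod p) (alv V i) :=
  (normalized V (i + 1)).map (V.δ (n := i) 0).hom.toLinearMap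

/-- The homotopy group `π_i V`. -/
abbrev Htpy (i : ℕ) : Type := cycles V i ⧸ (boundaries V i).submoduleOf (cycles V i)

/-- The graded vector space `π_* V`. -/
abbrev HtpyAll : Type := ⨁ i, Htpy V i

variable {V} in
/-- The homotopy class of a cycle, as an element of `π_* V`. -/
def htpyClass {i : ℕ} (u : alv V i) (hu : u ∈ cycles V i) : HtpyAll V :=
  DirectSum.lof (ZMod p) ℕ (fun i => Htpy V i) i (Submodule.Quotient.mk ⟨u, hu⟩)

/-- If `V` is degreewise graded by `gr`, this is the part of `π_* V` of bidegree `(i, n)`: the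
classes of cycles in `V_i` of internal degree `n`. -/
def htpyGr (gr : ∀ i : ℕ, ℕ → Submodule (ZMod p) (alv V i)) (i n : ℕ) :
    Submodule (ZMod p) (HtpyAll V) :=
  (((gr i n).submoduleOf (cycles V i)).map
    ((boundaries V i).submoduleOf (cycles V i)).mkQ).map
      (DirectSum.lof (ZMod p) ℕ (fun i => Htpy V i) i)

end Homotopy

/-- For `S ⊆ {0, …, n-1}` with `m` elements, the monotone surjection `[n] → [m]`,
`t ↦ #{k ∈ S | k < t}`, which identifies `k` and `k + 1` exactly for `k ∉ S`. -/
def collapse {n : ℕ} (S : Finset (Fin n)) (m : ℕ) : Fin (n + 1) →o Fin (m + 1) where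
  toFun t := ⟨min (S.filter fun k => k.val < t.val).card m, by omega⟩
  monotone' s t h := by
    refine Fin.mk_le_mk.2 (min_le_min_right _ (Finset.card_le_card fun k hk => ?_))
    simp only [Finset.mem_filter] at hk ⊢
    exact ⟨hk.1, lt_of_lt_of_le hk.2 h⟩

/-- The iterated degeneracy `s_{ν_r} ⋯ s_{ν_1} : V_m → V_n`, where `ν_1 < ⋯ < ν_r` are the elements
of `{0, …, n-1} ∖ S` and `S` has `m` elements. -/
def degen {p : ℕ} (V : SimplicialObject (AlgCat.{0} (ZMod p))) {n : ℕ} (S : Finset (Fin n)) (m : ℕ) :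
    alv V m →ₐ[ZMod p] alv V n :=
  (V.map (SimplexCategory.mkHom (collapse S m)).op).hom

/-- The shuffle product `ρ(u ⊗ v) = ∑_{(μ,ν)} (-1)^{ε(μ)} s_ν(u) s_μ(v)` over the `(i,j)`-shuffles
of `{0, …, i+j-1}`, where `ε(μ) = ∑_{k=1}^{i} (μ_k - (k-1))`; here `μ_k - (k-1)` is written as the
number of elements of `ν` below `μ_k`. -/
def shuffle {p : ℕ} (V : SimplicialObject (AlgCat.{0} (ZMod p))) {i j : ℕ}
    (u : alv V i) (v : alv V j) : alv V (i + j) :=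
  ∑ μ ∈ Finset.powersetCard i (Finset.univ : Finset (Fin (i + j))),
    (-1 : ZMod p) ^ (∑ k ∈ μ, (μᶜ.filter fun a => a < k).card) •
      (degen V μ i u * degen V μᶜ j v)

/-! ### Almost free resolutions -/

/-- `ε : P ⟶ A` is an almost free simplicial resolution of `A`: there are free generating sets
`X_q ⊆ P_q` of homogeneous elements that are closed under the degeneracy maps, and `ε` induces
`π_0 P ≅ A` and `π_i P = 0` for `i > 0`. -/
structure IsAlmostFreeResolution {p : ℕ} {A : EvenAlg p} (P : SimplicialObject (EvenAlg p))
    (ε : P ⟶ (SimplicialObject.const (EvenAlg p)).obj A) : Prop where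
  almostFree : ∃ X : ∀ q : ℕ, Set (lv P q).carrier,
    (∀ q, (lv P q).IsFreeOn (X q)) ∧
    ∀ q (i : Fin (q + 1)), ∀ z ∈ X q, (P.σ i).toAlgHom z ∈ X (q + 1)
  surjective : Function.Surjective (EvenAlg.Hom.toAlgHom (ε.app (Opposite.op (SimplexCategory.mk 0))))
  ker_eq : ∀ z : (lv P 0).carrier, EvenAlg.Hom.toAlgHom (ε.app (Opposite.op (SimplexCategory.mk 0))) z = 0 ↔
    z ∈ boundaries (((SimplicialObject.whiskering _ _).obj (EvenAlg.forgetGr p)).obj P) 0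
  exact : ∀ i : ℕ,
    cycles (((SimplicialObject.whiskering _ _).obj (EvenAlg.forgetGr p)).obj P) (i + 1) =
      boundaries (((SimplicialObject.whiskering _ _).obj (EvenAlg.forgetGr p)).obj P) (i + 1)

/-! ### The functor `Ω̄` -/

section Omega

/-- Generators of `Ω̄(A)`: the elements `a` and the symbols `da`. -/
inductive OmegaGen (A : Type) : Type
  | el : A → OmegaGen A
  | d : A → OmegaGen A

/-- The relations of `Ω̄(A)`: `a ↦ a` is a map of algebras, `d` is an `𝔽_p`-linear derivation, and
`Ω̄(A)` is graded commutative with the `a` in even and the `da` in odd degrees. -/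
inductive OmegaRel (p : ℕ) (A : Type) [CommRing A] [Algebra (ZMod p) A] :
    FreeAlgebra (ZMod p) (OmegaGen A) → FreeAlgebra (ZMod p) (OmegaGen A) → Prop
  | el_add (a b : A) : OmegaRel p A (FreeAlgebra.ι _ (.el (a + b)))
      (FreeAlgebra.ι _ (.el a) + FreeAlgebra.ι _ (.el b))
  | el_algebraMap (c : ZMod p) : OmegaRel p A (FreeAlgebra.ι _ (.el (algebraMap _ A c)))
      (algebraMap _ _ c)
  | el_mul (a b : A) : OmegaRel p A (FreeAlgebra.ι _ (.el (a * b)))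
      (FreeAlgebra.ι _ (.el a) * FreeAlgebra.ι _ (.el b))
  | d_add (a b : A) : OmegaRel p A (FreeAlgebra.ι _ (.d (a + b)))
      (FreeAlgebra.ι _ (.d a) + FreeAlgebra.ι _ (.d b))
  | d_smul (c : ZMod p) (a : A) : OmegaRel p A (FreeAlgebra.ι _ (.d (c • a)))
      (c • FreeAlgebra.ι _ (.d a))
  | d_mul (a b : A) : OmegaRel p A (FreeAlgebra.ι _ (.d (a * b)))
      (FreeAlgebra.ι _ (.el a) * FreeAlgebra.ι _ (.d b) +
        FreeAlgebra.ι _ (.el b) * FreeAlgebra.ι _ (.d a))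
  | el_comm_d (a b : A) : OmegaRel p A (FreeAlgebra.ι _ (.el a) * FreeAlgebra.ι _ (.d b))
      (FreeAlgebra.ι _ (.d b) * FreeAlgebra.ι _ (.el a))
  | d_comm_d (a b : A) : OmegaRel p A (FreeAlgebra.ι _ (.d a) * FreeAlgebra.ι _ (.d b))
      (-(FreeAlgebra.ι _ (.d b) * FreeAlgebra.ι _ (.d a)))
  | d_sq (a : A) : OmegaRel p A (FreeAlgebra.ι _ (.d a) * FreeAlgebra.ι _ (.d a)) 0

variable (p : ℕ) (A : Type) [CommRing A] [Algebra (ZMod p) A]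

/-- The algebra `Ω̄(A)` of an even graded algebra `A`, that is, its algebraic de Rham algebra. -/
def Omega : Type := RingQuot (OmegaRel p A)

instance : Ring (Omega p A) := inferInstanceAs (Ring (RingQuot (OmegaRel p A)))

instance : Algebra (ZMod p) (Omega p A) :=
  inferInstanceAs (Algebra (ZMod p) (RingQuot (OmegaRel p A)))

/-- The projection from the free algebra on the generators. -/
def Omega.mk : FreeAlgebra (ZMod p) (OmegaGen A) →ₐ[ZMod p] Omega p A :=
  RingQuot.mkAlgHom (ZMod p) (OmegaRel p A)

variable {A} in
theorem Omega.mk_rel {u v : FreeAlgebra (ZMod p) (OmegaGen A)} (h : OmegaRel p A u v) :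
    Omega.mk p A u = Omega.mk p A v :=
  RingQuot.mkAlgHom_rel (ZMod p) h

variable {A}

/-- The element `a` of `Ω̄(A)`. -/
def Omega.el (a : A) : Omega p A :=
  Omega.mk p A (FreeAlgebra.ι _ (.el a))

/-- The element `da` of `Ω̄(A)`. -/
def Omega.d (a : A) : Omega p A :=
  Omega.mk p A (FreeAlgebra.ι _ (.d a))

theorem Omega.el_add (a b : A) : Omega.el p (a + b) = Omega.el p a + Omega.el p b := by
  simpa [Omega.el, Omega.d] using Omega.mk_rel p (OmegaRel.el_add (p := p) a b)

theorem Omega.el_algebraMap (c : ZMod p) :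
    Omega.el p (algebraMap _ A c) = algebraMap _ _ c := by
  simpa [Omega.el, Omega.d] using Omega.mk_rel p (OmegaRel.el_algebraMap (p := p) (A := A) c)

theorem Omega.el_mul (a b : A) : Omega.el p (a * b) = Omega.el p a * Omega.el p b := by
  simpa [Omega.el, Omega.d] using Omega.mk_rel p (OmegaRel.el_mul (p := p) a b)

theorem Omega.d_add (a b : A) : Omega.d p (a + b) = Omega.d p a + Omega.d p b := by
  simpa [Omega.el, Omega.d] using Omega.mk_rel p (OmegaRel.d_add (p := p) a b)

theorem Omega.d_smul (c : ZMod p) (a : A) : Omega.d p (c • a) = c • Omega.d p a := by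
  simpa [Omega.el, Omega.d] using Omega.mk_rel p (OmegaRel.d_smul (p := p) c a)

theorem Omega.d_mul (a b : A) :
    Omega.d p (a * b) = Omega.el p a * Omega.d p b + Omega.el p b * Omega.d p a := by
  simpa [Omega.el, Omega.d] using Omega.mk_rel p (OmegaRel.d_mul (p := p) a b)

theorem Omega.el_comm_d (a b : A) :
    Omega.el p a * Omega.d p b = Omega.d p b * Omega.el p a := by
  simpa [Omega.el, Omega.d] using Omega.mk_rel p (OmegaRel.el_comm_d (p := p) a b)

theorem Omega.d_comm_d (a b : A) :
    Omega.d p a * Omega.d p b = -(Omega.d p b * Omega.d p a) := by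
  simpa [Omega.el, Omega.d] using Omega.mk_rel p (OmegaRel.d_comm_d (p := p) a b)

theorem Omega.d_sq (a : A) : Omega.d p a * Omega.d p a = 0 := by
  simpa [Omega.el, Omega.d] using Omega.mk_rel p (OmegaRel.d_sq (p := p) a)

theorem Omega.el_comm_el (a b : A) :
    Omega.el p a * Omega.el p b = Omega.el p b * Omega.el p a := by
  rw [← Omega.el_mul, mul_comm, Omega.el_mul]

theorem Omega.el_smul (c : ZMod p) (a : A) : Omega.el p (c • a) = c • Omega.el p a := by
  rw [Algebra.smul_def, Omega.el_mul, Omega.el_algebraMap, Algebra.smul_def]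

/-- The universal property of `Ω̄(A)`. -/
def Omega.lift {B : Type} [Ring B] [Algebra (ZMod p) B] (f : OmegaGen A → B)
    (h : ∀ ⦃u v⦄, OmegaRel p A u v → FreeAlgebra.lift (ZMod p) f u = FreeAlgebra.lift (ZMod p) f v) :
    Omega p A →ₐ[ZMod p] B :=
  RingQuot.liftAlgHom (ZMod p) ⟨FreeAlgebra.lift (ZMod p) f, h⟩

theorem Omega.lift_el {B : Type} [Ring B] [Algebra (ZMod p) B] (f : OmegaGen A → B)
    (h : ∀ ⦃u v⦄, OmegaRel p A u v → FreeAlgebra.lift (ZMod p) f u = FreeAlgebra.lift (ZMod p) f v)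
    (a : A) : Omega.lift p f h (Omega.el p a) = f (.el a) :=
  (RingQuot.liftAlgHom_mkAlgHom_apply ..).trans (FreeAlgebra.lift_ι_apply ..)

theorem Omega.lift_d {B : Type} [Ring B] [Algebra (ZMod p) B] (f : OmegaGen A → B)
    (h : ∀ ⦃u v⦄, OmegaRel p A u v → FreeAlgebra.lift (ZMod p) f u = FreeAlgebra.lift (ZMod p) f v)
    (a : A) : Omega.lift p f h (Omega.d p a) = f (.d a) :=
  (RingQuot.liftAlgHom_mkAlgHom_apply ..).trans (FreeAlgebra.lift_ι_apply ..)

theorem Omega.algHom_ext {B : Type} [Ring B] [Algebra (ZMod p) B] {f g : Omega p A →ₐ[ZMod p] B}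
    (h1 : ∀ a : A, f (Omega.el p a) = g (Omega.el p a))
    (h2 : ∀ a : A, f (Omega.d p a) = g (Omega.d p a)) : f = g := by
  apply RingQuot.ringQuot_ext' (S := ZMod p) (s := OmegaRel p A)
  apply FreeAlgebra.hom_ext
  funext x
  cases x with
  | el a => exact h1 a
  | d a => exact h2 a

/-- `Ω̄` on morphisms: `a ↦ f a` and `da ↦ d(f a)`. -/
def Omega.map {B : Type} [CommRing B] [Algebra (ZMod p) B] (f : A →ₐ[ZMod p] B) :
    Omega p A →ₐ[ZMod p] Omega p B :=
  Omega.lift p (fun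
    | .el a => Omega.el p (f a)
    | .d a => Omega.d p (f a)) (by
    intro u v h
    cases h with
    | el_add a b => simp [Omega.el_add]
    | el_algebraMap c => simp [Omega.el_algebraMap]
    | el_mul a b => simp [Omega.el_mul]
    | d_add a b => simp [Omega.d_add]
    | d_smul c a => simp [Omega.d_smul]
    | d_mul a b => simp [Omega.d_mul]
    | el_comm_d a b => simp [Omega.el_comm_d]
    | d_comm_d a b => simpa using Omega.d_comm_d p (f a) (f b)
    | d_sq a => simp [Omega.d_sq])

/-- The sign involution `w ↦ (-1)^{|w|} w` of `Ω̄(A)`: `a ↦ a` and `da ↦ -da`. -/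
def Omega.bar : Omega p A →ₐ[ZMod p] Omega p A :=
  Omega.lift p (fun
    | .el a => Omega.el p a
    | .d a => -Omega.d p a) (by
    intro u v h
    cases h with
    | el_add a b => simp [Omega.el_add]
    | el_algebraMap c => simp [Omega.el_algebraMap]
    | el_mul a b => simp [Omega.el_mul]
    | d_add a b => simp [Omega.d_add, add_comm]
    | d_smul c a => simp [Omega.d_smul]
    | d_mul a b => simp [Omega.d_mul, add_comm]
    | el_comm_d a b => simp [Omega.el_comm_d]
    | d_comm_d a b => simpa using Omega.d_comm_d p a b
    | d_sq a => simp [Omega.d_sq])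

/-- The matrix `((-1)^{|g|} g, δ g; 0, g)` for a generator `g` of `Ω̄(A)`. -/
def Omega.mat (δ : OmegaGen A → Omega p A) : OmegaGen A → Matrix (Fin 2) (Fin 2) (Omega p A)
  | .el a => !![Omega.el p a, δ (.el a); 0, Omega.el p a]
  | .d a => !![-Omega.d p a, δ (.d a); 0, Omega.d p a]

/-- The values `δ` on generators are compatible with the relations of `Ω̄(A)`. -/
def Omega.Compatible (δ : OmegaGen A → Omega p A) : Prop :=
  ∀ ⦃u v⦄, OmegaRel p A u v →
    FreeAlgebra.lift (ZMod p) (Omega.mat p δ) u = FreeAlgebra.lift (ZMod p) (Omega.mat p δ) v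

/-- The signed derivation `∂` of `Ω̄(A)`, `∂(wv) = ∂(w)v + (-1)^{|w|} w∂(v)`, with prescribed
values `δ` on the generators: the upper right entry of the algebra map
`w ↦ ((-1)^{|w|} w, ∂w; 0, w)`. -/
def Omega.signedDer (δ : OmegaGen A → Omega p A) (h : Omega.Compatible p δ) :
    Omega p A →ₗ[ZMod p] Omega p A :=
  Matrix.entryLinearMap (ZMod p) (Omega p A) (0 : Fin 2) (1 : Fin 2) ∘ₗ
    (Omega.lift p (Omega.mat p δ) h).toLinearMap

theorem Omega.signedDer_el (δ : OmegaGen A → Omega p A) (h : Omega.Compatible p δ) (a : A) :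
    Omega.signedDer p δ h (Omega.el p a) = δ (.el a) :=
  congrFun (congrFun (Omega.lift_el p (Omega.mat p δ) h a) 0) 1

theorem Omega.signedDer_d (δ : OmegaGen A → Omega p A) (h : Omega.Compatible p δ) (a : A) :
    Omega.signedDer p δ h (Omega.d p a) = δ (.d a) :=
  congrFun (congrFun (Omega.lift_d p (Omega.mat p δ) h a) 0) 1

theorem Omega.induction {C : Omega p A → Prop} (hel : ∀ a : A, C (Omega.el p a))
    (hd : ∀ a : A, C (Omega.d p a)) (hadd : ∀ u v, C u → C v → C (u + v))
    (hmul : ∀ u v, C u → C v → C (u * v)) (w : Omega p A) : C w := by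
  obtain ⟨w, rfl⟩ : ∃ v, Omega.mk p A v = w :=
    RingQuot.mkAlgHom_surjective (ZMod p) (OmegaRel p A) w
  induction w using FreeAlgebra.induction with
  | grade0 c => simpa [Omega.el_algebraMap] using hel (algebraMap _ A c)
  | grade1 g =>
    cases g with
    | el a => exact hel a
    | d a => exact hd a
  | mul u v hu hv => simpa using hmul _ _ hu hv
  | add u v hu hv => simpa using hadd _ _ hu hv

theorem Omega.lift_mat (δ : OmegaGen A → Omega p A) (h : Omega.Compatible p δ) (w : Omega p A) :
    Omega.lift p (Omega.mat p δ) h w = !![Omega.bar p w, Omega.signedDer p δ h w; 0, w] := by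
  have key : Omega.lift p (Omega.mat p δ) h w 0 0 = Omega.bar p w ∧
      Omega.lift p (Omega.mat p δ) h w 1 0 = 0 ∧ Omega.lift p (Omega.mat p δ) h w 1 1 = w := by
    induction w using Omega.induction with
    | hel a =>
      rw [Omega.lift_el p (Omega.mat p δ) h a]
      simp [Omega.lift_el, Omega.mat, Omega.bar]
    | hd a =>
      rw [Omega.lift_d p (Omega.mat p δ) h a]
      simp [Omega.lift_d, Omega.mat, Omega.bar]
    | hadd u v hu hv => simp [hu, hv]
    | hmul u v hu hv => simp [Matrix.mul_apply, hu, hv]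
  ext i j
  fin_cases i <;> fin_cases j <;> simp [key, Omega.signedDer]

theorem Omega.signedDer_mul (δ : OmegaGen A → Omega p A) (h : Omega.Compatible p δ)
    (w v : Omega p A) : Omega.signedDer p δ h (w * v) =
      Omega.signedDer p δ h w * v + Omega.bar p w * Omega.signedDer p δ h v := by
  have := congrFun (congrFun (map_mul (Omega.lift p (Omega.mat p δ) h) w v) 0) 1
  simpa [Omega.lift_mat, Matrix.mul_apply, add_comm] using this

/-- The values of the de Rham differential on generators: `a ↦ da`, `da ↦ 0`. -/
def Omega.deRhamVal : OmegaGen A → Omega p A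
  | .el a => Omega.d p a
  | .d _ => 0

theorem Omega.compatible_deRham : Omega.Compatible p (Omega.deRhamVal p (A := A)) := by
  intro u v h
  cases h with
  | el_add a b => simp [Omega.mat, Omega.deRhamVal, Omega.el_add, Omega.d_add]
  | el_algebraMap c =>
    have h0 : Omega.d p (algebraMap (ZMod p) A c) = 0 := by
      have h1 : Omega.d p (1 : A) = 0 := by
        have := Omega.d_mul p (1 : A) 1
        have h2 : Omega.el p (1 : A) = 1 := by simpa using Omega.el_algebraMap p (A := A) 1
        simpa [h2] using this
      rw [Algebra.algebraMap_eq_smul_one, Omega.d_smul, h1, smul_zero]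
    ext i j
    fin_cases i <;> fin_cases j <;>
      simp [Omega.mat, Omega.deRhamVal, Omega.el_algebraMap, h0, Matrix.algebraMap_matrix_apply]
  | el_mul a b =>
    simp [Omega.mat, Omega.deRhamVal, Omega.el_mul, Omega.d_mul, Omega.el_comm_d]
  | d_add a b => simp [Omega.mat, Omega.deRhamVal, Omega.d_add, add_comm]
  | d_smul c a => simp [Omega.mat, Omega.deRhamVal, Omega.d_smul]
  | d_mul a b =>
    simp [Omega.mat, Omega.deRhamVal, Omega.d_mul, add_comm, Omega.d_comm_d p a b]
  | el_comm_d a b =>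
    simp [Omega.mat, Omega.deRhamVal, Omega.el_comm_d, Omega.d_comm_d p a b]
  | d_comm_d a b => simp [Omega.mat, Omega.deRhamVal, Omega.d_comm_d p a b]
  | d_sq a =>
    ext i j
    fin_cases i <;> fin_cases j <;> simp [Omega.mat, Omega.deRhamVal, Omega.d_sq]

/-- The de Rham differential `𝐝 : Ω̄(A) → Ω̄(A)`: the signed derivation with `a ↦ da`, `da ↦ 0`. -/
def Omega.deRham : Omega p A →ₗ[ZMod p] Omega p A :=
  Omega.signedDer p (Omega.deRhamVal p) (Omega.compatible_deRham p)

variable {p} in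
/-- The values of the contraction with a derivation `E` on generators: `a ↦ 0`, `da ↦ E a`. -/
def Omega.contractVal (E : Derivation (ZMod p) A A) : OmegaGen A → Omega p A
  | .el _ => 0
  | .d a => Omega.el p (E a)

variable {p} in
theorem Omega.compatible_contract (E : Derivation (ZMod p) A A) :
    Omega.Compatible p (Omega.contractVal E) := by
  intro u v h
  cases h with
  | el_add a b => simp [Omega.mat, Omega.contractVal, Omega.el_add]
  | el_algebraMap c =>
    ext i j
    fin_cases i <;> fin_cases j <;>
      simp [Omega.mat, Omega.contractVal, Omega.el_algebraMap, Matrix.algebraMap_matrix_apply]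
  | el_mul a b => simp [Omega.mat, Omega.contractVal, Omega.el_mul]
  | d_add a b => simp [Omega.mat, Omega.contractVal, Omega.d_add, Omega.el_add, add_comm]
  | d_smul c a => simp [Omega.mat, Omega.contractVal, Omega.d_smul, Omega.el_smul]
  | d_mul a b =>
    simp [Omega.mat, Omega.contractVal, Omega.d_mul, Omega.el_add, Omega.el_mul, add_comm]
  | el_comm_d a b =>
    simp [Omega.mat, Omega.contractVal, Omega.el_comm_d, Omega.el_comm_el p a]
  | d_comm_d a b =>
    simp [Omega.mat, Omega.contractVal, Omega.el_comm_d, Omega.d_comm_d p a b, add_comm]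
  | d_sq a =>
    ext i j
    fin_cases i <;> fin_cases j <;>
      simp [Omega.mat, Omega.contractVal, Omega.d_sq, Omega.el_comm_d]

variable {p} in
/-- The contraction of `Ω̄(A)` with a derivation `E` of `A`: the signed derivation with `a ↦ 0`,
`da ↦ E a`. -/
def Omega.contract (E : Derivation (ZMod p) A A) : Omega p A →ₗ[ZMod p] Omega p A :=
  Omega.signedDer p (Omega.contractVal E) (Omega.compatible_contract E)

end Omega

/-- The functor `Ω̄`. -/
def omegaBar (p : ℕ) : EvenAlg p ⥤ AlgCat.{0} (ZMod p) where
  obj A := AlgCat.of (ZMod p) (Omega p A.carrier)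
  map f := AlgCat.ofHom (Omega.map p f.toAlgHom)
  map_id A := by
    apply AlgCat.hom_ext
    apply Omega.algHom_ext <;> intro a
    · exact Omega.lift_el p _ _ a
    · exact Omega.lift_d p _ _ a
  map_comp {A B C} f g := by
    apply AlgCat.hom_ext
    apply Omega.algHom_ext <;> intro a
    · refine (Omega.lift_el p _ _ a).trans (Eq.symm ?_)
      exact (congrArg _ (Omega.lift_el p _ _ a)).trans (Omega.lift_el p _ _ _)
    · refine (Omega.lift_d p _ _ a).trans (Eq.symm ?_)
      exact (congrArg _ (Omega.lift_d p _ _ a)).trans (Omega.lift_d p _ _ _)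

/-- The part `Ω̄(A)^n` of degree `n`: it is spanned by the elements `a · da_1 ⋯ da_k` with
homogeneous `a, a_1, …, a_k` for which `|a| + ∑ (|a_l| - 1) = n`. -/
def Omega.gr {p : ℕ} (A : EvenAlg p) (n : ℕ) : Submodule (ZMod p) (Omega p A.carrier) :=
  Submodule.span (ZMod p) {w | ∃ (k : ℕ) (m : ℕ) (a : A.carrier) (e : Fin k → ℕ)
    (b : Fin k → A.carrier), a ∈ A.gr m ∧ (∀ l, b l ∈ A.gr (e l)) ∧ m + ∑ l, e l = n + k ∧
    w = Omega.el p a * (List.ofFn fun l => Omega.d p (b l)).prod}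

/-- The simplicial algebra `Ω̄ P_•`. -/
abbrev omegaSimp {p : ℕ} (P : SimplicialObject (EvenAlg p)) :
    SimplicialObject (AlgCat.{0} (ZMod p)) :=
  ((SimplicialObject.whiskering _ _).obj (omegaBar p)).obj P

/-- The internal grading of `Ω̄ P_i`. -/
def omegaSimpGr {p : ℕ} (P : SimplicialObject (EvenAlg p)) (i n : ℕ) :
    Submodule (ZMod p) (alv (omegaSimp P) i) :=
  Omega.gr (lv P i) n

/-! ### Truncated polynomial algebras and the resolution `R_•` -/

section Trunc

variable (p r : ℕ)

/-- `𝔽_p[x]/(x^{r+1})`. -/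
abbrev TruncPoly : Type :=
  Polynomial (ZMod p) ⧸ Ideal.span {(Polynomial.X : Polynomial (ZMod p)) ^ (r + 1)}

/-- The generator of `𝔽_p[x]/(x^{r+1})`. -/
def TruncPoly.x : TruncPoly p r := Ideal.Quotient.mk _ Polynomial.X

/-- The component of degree `n` of `𝔽_p[x]/(x^{r+1})`, where `|x| = N`. -/
def TruncPoly.gr (N n : ℕ) : Submodule (ZMod p) (TruncPoly p r) :=
  Submodule.span (ZMod p) {z | ∃ j : ℕ, j * N = n ∧ z = TruncPoly.x p r ^ j}

variable {p r} in
theorem TruncPoly.x_pow : TruncPoly.x p r ^ (r + 1) = 0 := by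
  rw [TruncPoly.x, ← map_pow]
  exact Ideal.Quotient.eq_zero_iff_mem.2 (Ideal.subset_span rfl)

variable {p r} in
theorem TruncPoly.gr_mem (N j : ℕ) : TruncPoly.x p r ^ j ∈ TruncPoly.gr p r N (j * N) :=
  Submodule.subset_span ⟨j, rfl, rfl⟩

instance TruncPoly.gradedMonoid (N : ℕ) : SetLike.GradedMonoid (TruncPoly.gr p r N) where
  one_mem := by simpa using TruncPoly.gr_mem (p := p) (r := r) N 0
  mul_mem i j a b ha hb := by
    have h := Submodule.mul_mem_mul ha hb
    rw [TruncPoly.gr, TruncPoly.gr, Submodule.span_mul_span] at h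
    refine Submodule.span_mono ?_ h
    rintro _ ⟨_, ⟨k, hk, rfl⟩, _, ⟨l, hl, rfl⟩, rfl⟩
    exact ⟨k + l, by rw [add_mul, hk, hl], (pow_add _ _ _).symm⟩

/-- The element `x` in the direct sum of the homogeneous components. -/
def TruncPoly.dx (N : ℕ) : ⨁ n, TruncPoly.gr p r N n :=
  DirectSum.of (fun n => TruncPoly.gr p r N n) N
    ⟨TruncPoly.x p r, by simpa using TruncPoly.gr_mem (p := p) (r := r) N 1⟩

theorem TruncPoly.dx_pow (N j : ℕ) : TruncPoly.dx p r N ^ j =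
    DirectSum.of (fun n => TruncPoly.gr p r N n) (j * N) ⟨_, TruncPoly.gr_mem N j⟩ := by
  rw [TruncPoly.dx, DirectSum.ofPow]
  refine DirectSum.of_eq_of_gradedMonoid_eq ?_
  exact Sigma.subtype_ext (smul_eq_mul _ _) rfl

/-- The decomposition of `𝔽_p[x]/(x^{r+1})` into homogeneous components. -/
def TruncPoly.decompose (N : ℕ) : TruncPoly p r →ₐ[ZMod p] ⨁ n, TruncPoly.gr p r N n :=
  Ideal.Quotient.liftₐ _ (Polynomial.aeval (TruncPoly.dx p r N)) (by
    intro a ha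
    refine (Ideal.span_le (I := RingHom.ker (Polynomial.aeval (R := ZMod p)
      (TruncPoly.dx p r N)))).2 ?_ ha
    rintro _ rfl
    simp only [SetLike.mem_coe, RingHom.mem_ker, map_pow, Polynomial.aeval_X]
    rw [TruncPoly.dx_pow]
    have : (⟨_, TruncPoly.gr_mem N (r + 1)⟩ : TruncPoly.gr p r N ((r + 1) * N)) = 0 :=
      Subtype.ext TruncPoly.x_pow
    rw [this, map_zero])

theorem TruncPoly.decompose_x (N : ℕ) :
    TruncPoly.decompose p r N (TruncPoly.x p r) = TruncPoly.dx p r N :=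
  (Ideal.Quotient.liftₐ_apply _ _ _ _).trans
    ((Ideal.Quotient.lift_mk _ _ _).trans (Polynomial.aeval_X _))

theorem TruncPoly.isInternal (N : ℕ) : DirectSum.IsInternal (TruncPoly.gr p r N) := by
  have h1 : (DirectSum.coeAlgHom (TruncPoly.gr p r N)).comp (TruncPoly.decompose p r N) =
      AlgHom.id (ZMod p) (TruncPoly p r) := by
    apply Ideal.Quotient.algHom_ext
    apply Polynomial.algHom_ext
    have := TruncPoly.decompose_x p r N
    rw [TruncPoly.x] at this
    simp [this, TruncPoly.dx, TruncPoly.x]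
  have h2 : ∀ (n : ℕ) (z : TruncPoly.gr p r N n), TruncPoly.decompose p r N (z : TruncPoly p r) =
      DirectSum.of (fun n => TruncPoly.gr p r N n) n z := by
    rintro n ⟨z, hz⟩
    induction hz using Submodule.span_induction with
    | mem z h =>
      obtain ⟨j, rfl, rfl⟩ := h
      simp [TruncPoly.decompose_x, TruncPoly.dx_pow]
    | zero =>
      rw [map_zero]
      exact (map_zero _).symm
    | add a b ha hb iha ihb =>
      dsimp only at iha ihb ⊢
      rw [map_add, iha, ihb, ← map_add]
      rfl
    | smul c a ha iha =>
      dsimp only at iha ⊢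
      rw [map_smul, iha]
      exact ((DirectSum.lof (ZMod p) ℕ (fun n => TruncPoly.gr p r N n) n).map_smul c ⟨a, ha⟩).symm
  let _ := GradedAlgebra.ofAlgHom (TruncPoly.gr p r N) (TruncPoly.decompose p r N) h1 h2
  exact DirectSum.Decomposition.isInternal (TruncPoly.gr p r N)

variable [Fact p.Prime] {N : ℕ} (hN : 0 < N) (hE : Even N)

/-- The truncated polynomial algebra `𝔽_p[x]/(x^{r+1})` with `|x| = N` positive and even. -/
def trunc : EvenAlg p where
  carrier := TruncPoly p r
  gr := TruncPoly.gr p r N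
  gradedMonoid := TruncPoly.gradedMonoid p r N
  isInternal := TruncPoly.isInternal p r N
  gr_odd n hn := by
    refine Submodule.span_eq_bot.2 ?_
    rintro _ ⟨j, rfl, -⟩
    exact absurd (hE.mul_left j) (Nat.not_even_iff_odd.2 hn)
  pow_p a ha := by
    have h : TruncPoly.gr p r N 0 ≤ Submodule.span (ZMod p) {1} := by
      refine Submodule.span_mono ?_
      rintro _ ⟨j, hj, rfl⟩
      obtain rfl : j = 0 := by simpa [hN.ne'] using hj
      simp
    obtain ⟨c, rfl⟩ := Submodule.mem_span_singleton.1 (h ha)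
    rw [smul_pow, one_pow, ZMod.pow_card]

/-- The degrees of the generators of `R_q = 𝔽_p[x, y_1, …, y_q]`: `|x| = N`, `|y_j| = (r+1) N`.
The variable `x` is `none`, and `y_{j+1}` is `some j` for `0 ≤ j < q`. -/
def resWeight (N q : ℕ) : Option (Fin q) → ℕ
  | none => N
  | some _ => (r + 1) * N

variable {r} in
theorem resWeight_pos {N : ℕ} (hN : 0 < N) (q : ℕ) (i : Option (Fin q)) : resWeight r N q i ≠ 0 := by
  cases i <;> simp [resWeight, hN.ne']

variable {r} in
theorem resWeight_even {N : ℕ} (hE : Even N) (q : ℕ) (i : Option (Fin q)) : Even (resWeight r N q i) := by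
  cases i
  · exact hE
  · exact hE.mul_left _

/-- The object `R_q = 𝔽_p[x, y_1, …, y_q]`. -/
def resObj (q : ℕ) : EvenAlg p where
  carrier := MvPolynomial (Option (Fin q)) (ZMod p)
  gr := MvPolynomial.weightedHomogeneousSubmodule (ZMod p) (resWeight r N q)
  gradedMonoid := MvPolynomial.WeightedHomogeneousSubmodule.gradedMonoid
  isInternal := by
    let _ := MvPolynomial.weightedGradedAlgebra (ZMod p) (resWeight r N q)
    exact DirectSum.Decomposition.isInternal _
  gr_odd n hn := by
    rw [Submodule.eq_bot_iff]
    intro f hf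
    refine MvPolynomial.IsWeightedHomogeneous.eq_zero_of_no_monomials hf fun d hd => ?_
    refine Nat.not_even_iff_odd.2 hn (hd ▸ ?_)
    rw [Finsupp.weight_apply]
    exact Finset.even_sum _ fun i _ => (resWeight_even hE q i).mul_left _
  pow_p f hf := by
    have h := (MvPolynomial.isWeightedHomogeneous_zero_iff_weightedTotalDegree_eq_zero).1 hf
    rw [MvPolynomial.weightedTotalDegree_eq_zero_iff
      (MvPolynomial.nonTorsionWeight_of (resWeight_pos hN q))] at h
    have h' : f = MvPolynomial.C (f.coeff 0) := by
      ext d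
      rw [MvPolynomial.coeff_C]
      split_ifs with hd
      · rw [← hd]
      · by_contra h0
        exact hd (Finsupp.ext fun i => (h d (MvPolynomial.mem_support_iff.2 h0) i).symm)
    rw [h', ← map_pow, ZMod.pow_card]

/-- The element `y_j` of `R_q` for `1 ≤ j ≤ q`, with the conventions `y_0 = x^{r+1}` and `y_j = 0`
for `j > q`. -/
def resY (q j : ℕ) : MvPolynomial (Option (Fin q)) (ZMod p) :=
  if j = 0 then MvPolynomial.X none ^ (r + 1)
  else if h : j - 1 < q then MvPolynomial.X (some ⟨j - 1, h⟩) else 0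

/-- The images of the generators of `R_b` under the algebra map induced by a monotone map
`θ : [a] → [b]`: `x ↦ x` and `y_j ↦ y_{j'}`, where `j' = #{k ∈ [a] | θ(k) < j}`. -/
def resVal {a b : ℕ} (θ : Fin (a + 1) →o Fin (b + 1)) :
    Option (Fin b) → MvPolynomial (Option (Fin a)) (ZMod p)
  | none => MvPolynomial.X none
  | some j => resY p r a (Finset.univ.filter fun k => (θ k).val < j.val + 1).card

theorem resVal_homogeneous {a b : ℕ} (θ : Fin (a + 1) →o Fin (b + 1)) (i : Option (Fin b)) :
    (resVal p r θ i).IsWeightedHomogeneous (resWeight r N a) (resWeight r N b i) := by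
  cases i with
  | none => exact MvPolynomial.isWeightedHomogeneous_X _ _ none
  | some j =>
    simp only [resVal, resY]
    split_ifs with h1 h2
    · exact (MvPolynomial.isWeightedHomogeneous_X (ZMod p) (resWeight r N a) none).pow (r + 1)
    · exact MvPolynomial.isWeightedHomogeneous_X (ZMod p) (resWeight r N a) (some _)
    · exact MvPolynomial.isWeightedHomogeneous_zero _ _ _

theorem resVal_y {a b : ℕ} (θ : Fin (a + 1) →o Fin (b + 1)) (j : ℕ) :
    MvPolynomial.aeval (resVal p r θ) (resY p r b j) =
      resY p r a (Finset.univ.filter fun k => (θ k).val < j).card := by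
  rcases Nat.eq_zero_or_pos j with rfl | hj
  · simp [resY, resVal]
  · rw [resY, if_neg hj.ne']
    split_ifs with h
    · rw [MvPolynomial.aeval_X, resVal]
      simp [Nat.sub_add_cancel hj]
    · have : (Finset.univ.filter fun k => (θ k).val < j) = Finset.univ :=
        Finset.filter_true_of_mem fun k _ => by have := (θ k).isLt; omega
      rw [this, map_zero, Finset.card_univ, Fintype.card_fin, resY, if_neg (by omega),
        dif_neg (by omega)]

theorem resVal_id (a : ℕ) (i : Option (Fin a)) :
    resVal p r (OrderHom.id : Fin (a + 1) →o Fin (a + 1)) i = MvPolynomial.X i := by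
  cases i with
  | none => rfl
  | some j =>
    have : (Finset.univ.filter fun k : Fin (a + 1) => k.val < j.val + 1).card = j.val + 1 := by
      have h := Fin.card_filter_val_lt (n := a + 1) (m := j.val + 1)
      rw [h]; omega
    refine (congrArg (resY p r a) this).trans ?_
    rw [resY, if_neg (by omega), dif_pos (by simp)]
    simp

theorem resVal_comp {a b c : ℕ} (θ : Fin (a + 1) →o Fin (b + 1)) (φ : Fin (b + 1) →o Fin (c + 1))
    (i : Option (Fin c)) :
    MvPolynomial.aeval (resVal p r θ) (resVal p r φ i) = resVal p r (φ.comp θ) i := by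
  cases i with
  | none => simp [resVal]
  | some j =>
    simp only [resVal]
    rw [resVal_y]
    congr 2
    ext k
    simp only [Finset.mem_filter, Finset.mem_univ, true_and, OrderHom.comp_coe,
      Function.comp_apply]
    constructor
    · intro h
      by_contra h'
      have hs : (Finset.univ.filter fun l => (φ l).val < j.val + 1) ⊆ Finset.univ.filter
          fun l : Fin (b + 1) => l.val < (θ k).val := by
        intro l hl
        simp only [Finset.mem_filter, Finset.mem_univ, true_and] at hl ⊢
        by_contra hlt
        have : φ (θ k) ≤ φ l := φ.monotone (not_lt.1 hlt)
        exact h' (lt_of_le_of_lt this hl)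
      have := Finset.card_le_card hs
      rw [Fin.card_filter_val_lt] at this
      omega
    · intro h
      have hs : (Finset.univ.filter fun l : Fin (b + 1) => l.val < (θ k).val + 1) ⊆
          Finset.univ.filter fun l => (φ l).val < j.val + 1 := by
        intro l hl
        simp only [Finset.mem_filter, Finset.mem_univ, true_and] at hl ⊢
        have : φ l ≤ φ (θ k) := φ.monotone (Nat.lt_succ_iff.1 hl)
        exact lt_of_le_of_lt this h
      have := Finset.card_le_card hs
      rw [Fin.card_filter_val_lt] at this
      have := (θ k).isLt
      omega

/-- The algebra map `R_b → R_a` induced by a monotone map `θ : [a] → [b]`. -/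
def resHom {a b : ℕ} (θ : Fin (a + 1) →o Fin (b + 1)) :
    MvPolynomial (Option (Fin b)) (ZMod p) →ₐ[ZMod p] MvPolynomial (Option (Fin a)) (ZMod p) :=
  MvPolynomial.aeval (resVal p r θ)

theorem resHom_id (a : ℕ) : resHom p r (OrderHom.id : Fin (a + 1) →o Fin (a + 1)) =
    AlgHom.id (ZMod p) _ :=
  MvPolynomial.algHom_ext fun i => by
    rw [resHom, MvPolynomial.aeval_X, resVal_id, AlgHom.id_apply]

theorem resHom_comp {a b c : ℕ} (θ : Fin (a + 1) →o Fin (b + 1))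
    (φ : Fin (b + 1) →o Fin (c + 1)) :
    resHom p r (φ.comp θ) = (resHom p r θ).comp (resHom p r φ) :=
  MvPolynomial.algHom_ext fun i => by
    rw [AlgHom.comp_apply, resHom, resHom, resHom, MvPolynomial.aeval_X, MvPolynomial.aeval_X,
      resVal_comp]

/-- The algebra map `R_q → 𝔽_p[x]/(x^{r+1})`, `x ↦ x`, `y_j ↦ 0`. -/
def resAugHom (q : ℕ) : MvPolynomial (Option (Fin q)) (ZMod p) →ₐ[ZMod p] TruncPoly p r :=
  MvPolynomial.aeval fun i => i.elim (TruncPoly.x p r) fun _ => 0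

theorem resAugHom_comp {a b : ℕ} (θ : Fin (a + 1) →o Fin (b + 1)) :
    (resAugHom p r a).comp (resHom p r θ) = resAugHom p r b :=
  MvPolynomial.algHom_ext fun i => by
    rw [AlgHom.comp_apply, resHom, resAugHom, resAugHom, MvPolynomial.aeval_X,
      MvPolynomial.aeval_X]
    cases i with
    | none => exact MvPolynomial.aeval_X _ _
    | some j =>
      simp only [resVal, resY]
      split_ifs
      · simpa using TruncPoly.x_pow
      · simp
      · simp

theorem isWeightedHomogeneous_aeval {σ : Type} {B : EvenAlg p} (w : σ → ℕ) (g : σ → B.carrier)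
    (hg : ∀ i, g i ∈ B.gr (w i)) (n : ℕ) (f : MvPolynomial σ (ZMod p))
    (hf : f.IsWeightedHomogeneous w n) : MvPolynomial.aeval g f ∈ B.gr n := by
  have := B.gradedMonoid
  rw [MvPolynomial.aeval_def, MvPolynomial.eval₂_eq]
  refine Submodule.sum_mem _ fun d hd => ?_
  rw [← Algebra.smul_def]
  refine Submodule.smul_mem _ _ ?_
  have hw := hf (MvPolynomial.mem_support_iff.1 hd)
  rw [← hw, Finsupp.weight_apply]
  exact SetLike.prod_mem_graded (A := B.gr) (fun i => d i • w i) _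
    fun i _ => SetLike.pow_mem_graded _ (hg i)

/-- The simplicial resolution `R_•` of `𝔽_p[x]/(x^{r+1})`.  On generators the face and degeneracy
maps are `s_i(x) = d_i(x) = x`; `s_i(y_j) = y_j` for `i ≥ j`, `s_i(y_j) = y_{j+1}` for `i < j`;
`d_i(y_j) = y_{j-1}` for `i < j`, `d_i(y_j) = y_j` for `i ≥ j`, with `y_0 = x^{r+1}` and
`y_j = 0` in `R_q` for `j > q`. -/
def res : SimplicialObject (EvenAlg p) where
  obj a := resObj p r hN hE a.unop.len
  map {_ b} θ :=
    { toAlgHom := resHom p r (SimplexCategory.Hom.toOrderHom θ.unop)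
      map_gr := isWeightedHomogeneous_aeval p (B := resObj p r hN hE b.unop.len) _ _
        (resVal_homogeneous p r _) }
  map_id a := EvenAlg.Hom.ext (resHom_id p r a.unop.len)
  map_comp θ φ := EvenAlg.Hom.ext (resHom_comp p r (SimplexCategory.Hom.toOrderHom φ.unop)
    (SimplexCategory.Hom.toOrderHom θ.unop))

/-- The augmentation `R_• → 𝔽_p[x]/(x^{r+1})`: `x ↦ x` and `y_j ↦ 0`. -/
def resAug : res p r hN hE ⟶ (SimplicialObject.const (EvenAlg p)).obj (trunc p r hN hE) where
  app a :=
    { toAlgHom := resAugHom p r a.unop.len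
      map_gr := isWeightedHomogeneous_aeval p (B := trunc p r hN hE) _ _ (by
        rintro (_ | j)
        · have h := TruncPoly.gr_mem (p := p) (r := r) N 1
          rw [one_mul, pow_one] at h
          exact h
        · exact Submodule.zero_mem _) }
  naturality _ _ θ :=
    EvenAlg.Hom.ext (resAugHom_comp p r (SimplexCategory.Hom.toOrderHom θ.unop))

/-- The derivation of `R_q` with `x ↦ x` and `y_j ↦ (r+1) y_j`. -/
def resEuler (q : ℕ) : Derivation (ZMod p) (MvPolynomial (Option (Fin q)) (ZMod p))
    (MvPolynomial (Option (Fin q)) (ZMod p)) :=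
  MvPolynomial.mkDerivation (ZMod p) fun
    | none => MvPolynomial.X none
    | some j => ((r : ZMod p) + 1) • MvPolynomial.X (some j)

/-- The signed derivation `θ` of `Ω̄(R_q)`: `θ(x) = 0`, `θ(y_j) = 0`, `θ(dx) = x`,
`θ(dy_j) = (r+1) y_j`. -/
def resTheta (q : ℕ) : alv (omegaSimp (res p r hN hE)) q →ₗ[ZMod p]
    alv (omegaSimp (res p r hN hE)) q :=
  Omega.contract (resEuler p r q)

/-- The element `x` of `Ω̄(R_q)`. -/
def resX (q : ℕ) : alv (omegaSimp (res p r hN hE)) q :=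
  Omega.el p (MvPolynomial.X none : MvPolynomial (Option (Fin q)) (ZMod p))

/-- The element `dx` of `Ω̄(R_q)`. -/
def resDX (q : ℕ) : alv (omegaSimp (res p r hN hE)) q :=
  Omega.d p (MvPolynomial.X none : MvPolynomial (Option (Fin q)) (ZMod p))

/-- The element `dy_1 dy_2 ⋯ dy_q` of `Ω̄(R_q)`. -/
def resOmega (q : ℕ) : alv (omegaSimp (res p r hN hE)) q :=
  (List.ofFn fun j : Fin q =>
    Omega.d p (MvPolynomial.X (some j) : MvPolynomial (Option (Fin q)) (ZMod p))).prod

end Trunc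

/-! ### Bigraded commutative algebras -/

section Bigraded

/-- The relations of the bigraded commutative `𝔽_p`-algebra with generators `g` of bidegree
`bideg g = (i, n)` and relators `rel`: one has `g h = (-1)^{i i' + n n'} h g` for generators of
bidegrees `(i, n)` and `(i', n')`, and `w = 0` for each relator `w`. -/
inductive BigradedRel (p : ℕ) {G : Type} (bideg : G → ℕ × ℕ)
    (rel : Set (FreeAlgebra (ZMod p) G)) : FreeAlgebra (ZMod p) G → FreeAlgebra (ZMod p) G → Prop
  | comm (g h : G) : BigradedRel p bideg rel
      (FreeAlgebra.ι (ZMod p) g * FreeAlgebra.ι (ZMod p) h)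
      ((-1 : ZMod p) ^ ((bideg g).1 * (bideg h).1 + (bideg g).2 * (bideg h).2) •
        (FreeAlgebra.ι (ZMod p) h * FreeAlgebra.ι (ZMod p) g))
  | rel (w : FreeAlgebra (ZMod p) G) (hw : w ∈ rel) : BigradedRel p bideg rel w 0

/-- The bigraded commutative `𝔽_p`-algebra (`p` odd) with given generators and relators. -/
def BigradedAlg (p : ℕ) {G : Type} (bideg : G → ℕ × ℕ) (rel : Set (FreeAlgebra (ZMod p) G)) :
    Type :=
  RingQuot (BigradedRel p bideg rel)

variable {p : ℕ} {G : Type} {bideg : G → ℕ × ℕ} {rel : Set (FreeAlgebra (ZMod p) G)}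

instance : Ring (BigradedAlg p bideg rel) :=
  inferInstanceAs (Ring (RingQuot (BigradedRel p bideg rel)))

instance : Algebra (ZMod p) (BigradedAlg p bideg rel) :=
  inferInstanceAs (Algebra (ZMod p) (RingQuot (BigradedRel p bideg rel)))

/-- The generator `g` of a bigraded commutative algebra. -/
def BigradedAlg.gen (g : G) : BigradedAlg p bideg rel :=
  RingQuot.mkAlgHom (ZMod p) (BigradedRel p bideg rel) (FreeAlgebra.ι (ZMod p) g)

variable (p bideg rel) in
/-- The part of bidegree `(i, n)`: it is spanned by the products of generators whose bidegrees
add up to `(i, n)`. -/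
def BigradedAlg.gr (i n : ℕ) : Submodule (ZMod p) (BigradedAlg p bideg rel) :=
  Submodule.span (ZMod p) {w | ∃ l : List G, (l.map bideg).sum = (i, n) ∧
    w = (l.map BigradedAlg.gen).prod}

end Bigraded

/-- The generators `x`, `dx`, `γ_i(ω)` of `𝔽_p[x]/(x^{r+1}) ⊗ Λ(dx) ⊗ Γ[ω]`. -/
inductive GenDiv : Type
  | x : GenDiv
  | dx : GenDiv
  | γ : ℕ → GenDiv

/-- `‖x‖ = (0, |x|)`, `‖dx‖ = (0, |x| - 1)`, `‖γ_i(ω)‖ = (i, i((r+1)|x| - 1))`, where `|x| = N`. -/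
def GenDiv.bideg (r N : ℕ) : GenDiv → ℕ × ℕ
  | .x => (0, N)
  | .dx => (0, N - 1)
  | .γ i => (i, i * ((r + 1) * N - 1))

/-- The relations of the bigraded tensor product `𝔽_p[x]/(x^{r+1}) ⊗ Λ(dx) ⊗ Γ[ω]`: `x^{r+1} = 0`,
`(dx)² = 0`, `γ_0 = 1` and `γ_i γ_j = (i+j choose i) γ_{i+j}`. -/
inductive GenDiv.Relator (p r : ℕ) : FreeAlgebra (ZMod p) GenDiv → Prop
  | x_pow : GenDiv.Relator p r (FreeAlgebra.ι (ZMod p) .x ^ (r + 1))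
  | dx_sq : GenDiv.Relator p r (FreeAlgebra.ι (ZMod p) .dx ^ 2)
  | γ_zero : GenDiv.Relator p r (FreeAlgebra.ι (ZMod p) (.γ 0) - 1)
  | γ_mul (i j : ℕ) : GenDiv.Relator p r
      (FreeAlgebra.ι (ZMod p) (.γ i) * FreeAlgebra.ι (ZMod p) (.γ j) -
        ((i + j).choose i : ZMod p) • FreeAlgebra.ι (ZMod p) (.γ (i + j)))

/-- The generators `a_i`, `b_i`. -/
inductive GenNonDiv : Type
  | a : ℕ → GenNonDiv
  | b : ℕ → GenNonDiv

/-- `‖a_i‖ = (i, i((r+1)|x| - 1) + |x| - 1)` and `‖b_i‖ = ‖a_i‖ + (0, 1)`, where `|x| = N`. -/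
def GenNonDiv.bideg (r N : ℕ) : GenNonDiv → ℕ × ℕ
  | .a i => (i, i * ((r + 1) * N - 1) + (N - 1))
  | .b i => (i, i * ((r + 1) * N - 1) + (N - 1) + 1)

/-- The generators of the ideal `I_r`. -/
inductive GenNonDiv.Relator (p r : ℕ) : FreeAlgebra (ZMod p) GenNonDiv → Prop
  | a_mul_a (i j : ℕ) : GenNonDiv.Relator p r
      (FreeAlgebra.ι (ZMod p) (.a i) * FreeAlgebra.ι (ZMod p) (.a j))
  | b_mul_b (i j : ℕ) : GenNonDiv.Relator p r
      (FreeAlgebra.ι (ZMod p) (.b i) * FreeAlgebra.ι (ZMod p) (.b j) -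
        ((i + j).choose i : ZMod p) •
          (FreeAlgebra.ι (ZMod p) (.b 0) * FreeAlgebra.ι (ZMod p) (.b (i + j))))
  | a_mul_b (i j : ℕ) : GenNonDiv.Relator p r
      (FreeAlgebra.ι (ZMod p) (.a i) * FreeAlgebra.ι (ZMod p) (.b j) -
        ((i + j).choose i : ZMod p) •
          (FreeAlgebra.ι (ZMod p) (.b 0) * FreeAlgebra.ι (ZMod p) (.a (i + j))))
  | b_pow_mul_b (i : ℕ) : GenNonDiv.Relator p r
      (FreeAlgebra.ι (ZMod p) (.b 0) ^ r * FreeAlgebra.ι (ZMod p) (.b i))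
  | b_pow_mul_a (i : ℕ) : GenNonDiv.Relator p r
      (FreeAlgebra.ι (ZMod p) (.b 0) ^ r * FreeAlgebra.ι (ZMod p) (.a i))

/-- The bigraded algebra `𝔽_p[x]/(x^{r+1}) ⊗ Λ(dx) ⊗ Γ[ω]`. -/
abbrev AlgDiv (p r N : ℕ) : Type := BigradedAlg p (GenDiv.bideg r N) {w | GenDiv.Relator p r w}

/-- The bigraded algebra `𝔽_p[a_i, b_i | i ≥ 0]/I_r`. -/
abbrev AlgNonDiv (p r N : ℕ) : Type :=
  BigradedAlg p (GenNonDiv.bideg r N) {w | GenNonDiv.Relator p r w}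

/-! ### Isomorphisms with `π_* Ω̄ P` -/

section Iso

variable {p : ℕ} (P : SimplicialObject (EvenAlg p))

/-- A linear isomorphism `Φ` from an algebra `M` with bigrading `gr` to `π_* Ω̄ P` is an isomorphism
of bigraded algebras, where the product on `π_* Ω̄ P` is induced by the shuffle product of cycles
(part of the assertion is that the shuffle product of two cycles is a cycle). -/
structure IsBigradedAlgIso {M : Type} [Ring M] [Algebra (ZMod p) M]
    (gr : ℕ → ℕ → Submodule (ZMod p) M) (Φ : M ≃ₗ[ZMod p] HtpyAll (omegaSimp P)) : Prop where
  map_one : Φ 1 = htpyClass (i := 0) 1 Submodule.mem_top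
  map_mul : ∀ (i j : ℕ) (u : alv (omegaSimp P) i) (v : alv (omegaSimp P) j)
    (hu : u ∈ cycles (omegaSimp P) i) (hv : v ∈ cycles (omegaSimp P) j),
    ∃ h : shuffle (omegaSimp P) u v ∈ cycles (omegaSimp P) (i + j),
      Φ (Φ.symm (htpyClass u hu) * Φ.symm (htpyClass v hv)) =
        htpyClass (shuffle (omegaSimp P) u v) h
  map_gr : ∀ i n, (gr i n).map Φ.toLinearMap =
    htpyGr (V := omegaSimp P) (omegaSimpGr P) i n

/-- Under `Φ`, the map `D` corresponds to the map `𝐝_*` of `π_* Ω̄ P` induced by the de Rham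
differential (part of the assertion is that `𝐝` maps cycles to cycles). -/
def IsInducedDeRham {M : Type} [Ring M] [Algebra (ZMod p) M]
    (Φ : M ≃ₗ[ZMod p] HtpyAll (omegaSimp P)) (D : M →ₗ[ZMod p] M) : Prop :=
  ∀ (i : ℕ) (u : alv (omegaSimp P) i) (hu : u ∈ cycles (omegaSimp P) i),
    ∃ h : (Omega.deRham p u : alv (omegaSimp P) i) ∈ cycles (omegaSimp P) i,
      Φ (D (Φ.symm (htpyClass u hu))) = htpyClass (Omega.deRham p u : alv (omegaSimp P) i) h

/-- `D` is a signed derivation with respect to the internal degree: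
`D(m m') = D(m) m' + (-1)^n m D(m')` for `m` of bidegree `(i, n)`. -/
def IsSignedDerivation {M : Type} [Ring M] [Algebra (ZMod p) M]
    (gr : ℕ → ℕ → Submodule (ZMod p) M) (D : M →ₗ[ZMod p] M) : Prop :=
  ∀ (i n : ℕ) (m m' : M), m ∈ gr i n → D (m * m') = D m * m' + (-1 : M) ^ n * (m * D m')

variable {P} in
/-- The element `z ∈ π_* Ω̄ P` is represented by the image of `u ∈ Ω̄ R_i` under a simplicial map
`f : R ⟶ P` (part of the assertion is that this image is a cycle). -/
def IsRepresentedBy {R : SimplicialObject (EvenAlg p)} (f : R ⟶ P) {i : ℕ}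
    (u : alv (omegaSimp R) i) (z : HtpyAll (omegaSimp P)) : Prop :=
  ∃ h : Omega.map p (EvenAlg.Hom.toAlgHom (f.app (Opposite.op (SimplexCategory.mk i)))) u ∈
    cycles (omegaSimp P) i, z = htpyClass (V := omegaSimp P) _ h

end Iso

end DerivedDeRham

end

open DerivedDeRham

noncomputable section

/-! Three reductions turn the computation into linear algebra over `A`.

Comparison. Let `P` be free on generators closed under degeneracies and let `Q → A` be acyclic. A
map `P → Q` over `A` is built dimension by dimension: the value on a degenerate generator is forced,
and a nondegenerate generator is sent to a simplex with prescribed faces, which exists by acyclicity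
(`IsAlmostFreeResolution.exists_filler`). Carrying this out with a simplicial set `K` of parameters
and values prescribed on a simplicial subset (`LiftProblem.exists_solution`) gives existence of maps
when `K` is a point, and homotopies between any two maps when `K = Δ[1]`. A family of algebra maps
indexed by `Δ[1]` passes through the functor `Ω̄`, so the homotopy of `Ω̄ P` may be computed from
`R_•`.

Coefficients. With `y_0 = x^{r+1}`, the monomials of `R_q` are uniquely `x^a y_0^{n_0} ⋯ y_q^{n_q}`
with `a ≤ r`, and a simplicial operator only relabels the indices of the `y_j` monotonically.
Replacing `y_j` by `y_{max(i,j)}` therefore commutes with operators and deforms the identity into a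
projection onto `A` (`contraction`, `resHom_contraction`).

Forms. There is an isomorphism `Ω̄(R_q) ≅ R_q ⊗ Λ(dx, dy_1, …, dy_q)`, on which operators act on the
`dy_j` as on the `y_j`, with the twist `dy_0 = (r+1) x^r dx` (`toForm_map`). Among the faces only
`d_0` sees the twist, and the twist disappears modulo `dx`. The contraction of the coefficients
applies to the untwisted object only; treating the part modulo `dx` and the multiples of `dx` one
after the other transfers the conclusion to the twisted one: a cycle that vanishes over `A` is a
boundary (`mem_boundaries_formSimp_of_red`). Over `A` the normalized complex in dimension `q`
consists of the forms `a dy_1⋯dy_q + b dx dy_1⋯dy_q` (`exists_eq_topForm`), and `d_0` sends such a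
form to `a (r+1) x^r dx dy_1⋯dy_{q-1}` (`tw_δ_zero_topForm`). So a class in dimension `q` is a pair
`(a, b)`, with `a (r+1) x^r = 0` if `q > 0` and with `b` taken modulo `(r+1) x^r`.

If `p ∣ r+1` both conditions are void and `dy_1⋯dy_q` is a cycle. Otherwise `a` must be a multiple
of `x` for `q > 0` and `b` counts modulo `x^r`; the pairs `(0, 1)` and `(x, 0)` are the symbols of
`dx dy_1⋯dy_i` and of its contraction `θ`. In a shuffle product the sign of a shuffle is the sign
that sorts the `dy_j`, so all `(i+j choose i)` terms agree (`symb_shuffle`). The contraction `θ` is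
simplicial because the weights `1` and `r+1` are compatible with `y_0 = x^{r+1}`, and Cartan's
formula gives the factor `1 + (r+1) i`. The abstract presentations are matched with the algebra of
pairs by a normal form argument (`GammaAlg.injective_and_mem_range`). -/

namespace DerivedDeRham

/-! ### Simplicial algebras -/

section Simplicial

open SimplexCategory

variable {p : ℕ} (V : SimplicialObject (AlgCat.{0} (ZMod p)))

/-- The simplicial operator of `V` attached to a morphism of the simplex category. -/
def op {a b : ℕ} (θ : SimplexCategory.mk a ⟶ SimplexCategory.mk b) : alv V b →ₐ[ZMod p] alv V a :=
  (V.map θ.op).hom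

theorem op_id (a : ℕ) (v : alv V a) : op V (𝟙 (SimplexCategory.mk a)) v = v := by
  simp [op]

theorem op_comp {a b c : ℕ} (θ : SimplexCategory.mk a ⟶ SimplexCategory.mk b)
    (φ : SimplexCategory.mk b ⟶ SimplexCategory.mk c) (v : alv V c) :
    op V (θ ≫ φ) v = op V θ (op V φ v) := by
  simp [op]

theorem mem_normalized_succ {n : ℕ} {u : alv V (n + 1)} :
    u ∈ normalized V (n + 1) ↔ ∀ j : Fin (n + 1), op V (δ j.succ) u = 0 := by
  simp only [normalized, Submodule.mem_iInf, LinearMap.mem_ker]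
  rfl

theorem mem_cycles_succ {n : ℕ} {u : alv V (n + 1)} :
    u ∈ cycles V (n + 1) ↔ ∀ j : Fin (n + 2), op V (δ j) u = 0 := by
  rw [cycles, Submodule.mem_inf, mem_normalized_succ, Fin.forall_fin_succ (n := n + 1), and_comm]
  rfl

theorem mem_boundaries {n : ℕ} {u : alv V n} :
    u ∈ boundaries V n ↔ ∃ w ∈ normalized V (n + 1), op V (δ 0) w = u :=
  Iff.rfl

variable {V}

/-- A non-surjective monotone map factors through a coface, and all faces of a cycle vanish. With
the converse `mem_cycles_of_op` this describes cycles without choosing faces, so any family of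
linear maps that is natural in the operators preserves them. -/
theorem op_eq_zero_of_mem_cycles {m n : ℕ} {u : alv V n} (hu : u ∈ cycles V n)
    (θ : SimplexCategory.mk m ⟶ SimplexCategory.mk n)
    (hθ : ¬ Function.Surjective (SimplexCategory.Hom.toOrderHom θ)) : op V θ u = 0 := by
  cases n with
  | zero =>
    refine absurd (fun x => ⟨0, ?_⟩) hθ
    exact Subsingleton.elim (α := Fin 1) _ _
  | succ n =>
    obtain ⟨i, θ', rfl⟩ := eq_comp_δ_of_not_surjective θ hθ
    rw [op_comp V, (mem_cycles_succ V).1 hu, map_zero]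

theorem mem_cycles_of_op {n : ℕ} {u : alv V n}
    (h : ∀ (m : ℕ) (θ : SimplexCategory.mk m ⟶ SimplexCategory.mk n),
      ¬ Function.Surjective (SimplexCategory.Hom.toOrderHom θ) → op V θ u = 0) :
    u ∈ cycles V n := by
  cases n with
  | zero => exact Submodule.mem_top
  | succ n =>
    rw [mem_cycles_succ]
    intro j
    refine h n _ fun hs => ?_
    obtain ⟨t, ht⟩ := hs j
    exact Fin.succAbove_ne j t ht

/-- The composite is an endomap of a finite set, so surjectivity would give injectivity; but both
`i` and `i+1` are in the image of `δ j` and `σ i` identifies them. -/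
theorem δ_comp_σ_not_surjective {n : ℕ} (j : Fin (n + 2)) (i : Fin (n + 1))
    (h1 : j ≠ i.castSucc) (h2 : j ≠ i.succ) :
    ¬ Function.Surjective (SimplexCategory.Hom.toOrderHom (δ j ≫ σ i)) := by
  intro hs
  have hi : Function.Injective (SimplexCategory.Hom.toOrderHom (δ j ≫ σ i)) :=
    Finite.injective_iff_surjective.2 hs
  obtain ⟨t1, ht1⟩ := Fin.exists_succAbove_eq h1.symm
  obtain ⟨t2, ht2⟩ := Fin.exists_succAbove_eq h2.symm
  have : t1 = t2 := by
    apply hi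
    change Fin.predAbove i (j.succAbove t1) = Fin.predAbove i (j.succAbove t2)
    rw [ht1, ht2]
    simp
  rw [this, ht2] at ht1
  exact absurd ht1 (Fin.castSucc_lt_succ).ne'

theorem op_δ_σ_castSucc {n : ℕ} (i : Fin (n + 1)) (u : alv V n) :
    op V (δ i.castSucc) (op V (σ i) u) = u := by
  rw [← op_comp, δ_comp_σ_self, op_id]

theorem op_δ_σ_succ {n : ℕ} (i : Fin (n + 1)) (u : alv V n) :
    op V (δ i.succ) (op V (σ i) u) = u := by
  rw [← op_comp, δ_comp_σ_succ, op_id]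

theorem op_δ_σ_of_mem_cycles {n : ℕ} {u : alv V n} (hu : u ∈ cycles V n) (j : Fin (n + 2))
    (i : Fin (n + 1)) (h1 : j ≠ i.castSucc) (h2 : j ≠ i.succ) :
    op V (δ j) (op V (σ i) u) = 0 := by
  rw [← op_comp]
  exact op_eq_zero_of_mem_cycles hu _ (δ_comp_σ_not_surjective j i h1 h2)

/-- A cycle that is the only nonzero face of some simplex is a boundary. -/
theorem mem_boundaries_of_single_face {n : ℕ} {c : alv V n} (hc : c ∈ cycles V n)
    (i : Fin (n + 2)) (q : alv V (n + 1)) (hq : op V (δ i) q = c)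
    (h0 : ∀ j, j ≠ i → op V (δ j) q = 0) : c ∈ boundaries V n := by
  induction i using Fin.induction generalizing q with
  | zero =>
    exact (mem_boundaries V).2 ⟨q, (mem_normalized_succ V).2 fun j => h0 _ (Fin.succ_ne_zero j), hq⟩
  | succ i ih =>
    -- The faces `i` and `i+1` of `s_i c` are both `c` and the others vanish, so subtracting `q`
    -- moves the only nonzero face from `i+1` down to `i`.
    refine ih (op V (σ i) c - q) ?_ fun j hj => ?_
    · rw [map_sub, op_δ_σ_castSucc, h0 _ (Fin.castSucc_lt_succ).ne, sub_zero]
    · by_cases h : j = i.succ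
      · rw [h, map_sub, op_δ_σ_succ, hq, sub_self]
      · rw [map_sub, op_δ_σ_of_mem_cycles hc j i hj h, h0 j h, sub_zero]

theorem boundaries_le_cycles (n : ℕ) : boundaries V n ≤ cycles V n := by
  intro u hu
  cases n with
  | zero => exact Submodule.mem_top
  | succ n =>
    obtain ⟨w, hw, rfl⟩ := (mem_boundaries V).1 hu
    rw [mem_cycles_succ]
    intro j
    rw [mem_normalized_succ] at hw
    have := δ_comp_δ (n := n) (Fin.zero_le j)
    rw [← op_comp]
    have e : δ j ≫ δ 0 = δ 0 ≫ δ j.succ := by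
      rw [this]; rfl
    rw [e, op_comp, hw, map_zero]

/-- The step function `[n] → [1]` with `i` zeros. -/
def step (n i : ℕ) : Fin (n + 1) →o Fin 2 where
  toFun t := if t.val < i then 0 else 1
  monotone' s t h := by
    have : s.val ≤ t.val := h
    dsimp only
    split_ifs
    · exact le_rfl
    · exact Fin.zero_le _
    · omega
    · exact le_rfl

/-- A simplicial homotopy: a linear map `V_n → W_n` for each `s : [n] → [1]`, natural in `n`. -/
structure LinHomotopy (V W : SimplicialObject (AlgCat.{0} (ZMod p))) where
  toFun (n : ℕ) (s : Fin (n + 1) →o Fin 2) : alv V n →ₗ[ZMod p] alv W n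
  natural {a b : ℕ} (θ : SimplexCategory.mk a ⟶ SimplexCategory.mk b) (s : Fin (b + 1) →o Fin 2)
    (v : alv V b) : op W θ (toFun b s v) =
      toFun a (s.comp (SimplexCategory.Hom.toOrderHom θ)) (op V θ v)

variable {W : SimplicialObject (AlgCat.{0} (ZMod p))} (H : LinHomotopy V W)

theorem LinHomotopy.mem_cycles {n : ℕ} (s : Fin (n + 1) →o Fin 2) {u : alv V n}
    (hu : u ∈ cycles V n) : H.toFun n s u ∈ cycles W n :=
  mem_cycles_of_op fun m θ hθ => by
    rw [H.natural, op_eq_zero_of_mem_cycles hu θ hθ, map_zero]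

theorem step_comp_δ_castSucc {n : ℕ} (i : Fin (n + 1)) :
    (step (n + 1) (i + 1)).comp (SimplexCategory.Hom.toOrderHom (δ i.castSucc)) = step n i := by
  refine OrderHom.ext _ _ (funext fun t => ?_)
  change (if (i.castSucc.succAbove t).val < i.val + 1 then (0 : Fin 2) else 1) =
    if t.val < i.val then (0 : Fin 2) else 1
  congr 1
  rw [eq_iff_iff]
  simp only [Fin.succAbove, Fin.lt_def]
  split_ifs with h <;> simp at h ⊢ <;> omega

theorem step_comp_δ_succ {n : ℕ} (i : Fin (n + 1)) :
    (step (n + 1) (i + 1)).comp (SimplexCategory.Hom.toOrderHom (δ i.succ)) = step n (i + 1) := by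
  refine OrderHom.ext _ _ (funext fun t => ?_)
  change (if (i.succ.succAbove t).val < i.val + 1 then (0 : Fin 2) else 1) =
    if t.val < i.val + 1 then (0 : Fin 2) else 1
  congr 1
  rw [eq_iff_iff]
  simp only [Fin.succAbove, Fin.lt_def]
  split_ifs with h <;> simp at h ⊢ <;> omega

/-- Evaluating the homotopy on `s_i u` along the step function with `i+1` zeros gives a simplex
whose faces `i` and `i+1` are the two terms and whose other faces vanish. Subtracting a degenerate
simplex with the second term at both places leaves a single nonzero face, equal to the difference.
-/
theorem LinHomotopy.step_sub_mem_boundaries {n : ℕ} {u : alv V n} (hu : u ∈ cycles V n)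
    (i : Fin (n + 1)) :
    H.toFun n (step n i) u - H.toFun n (step n (i + 1)) u ∈ boundaries W n := by
  have hc := H.mem_cycles (step n i) hu
  have hc' := H.mem_cycles (step n (i + 1)) hu
  refine mem_boundaries_of_single_face (Submodule.sub_mem _ hc hc') i.castSucc
    (H.toFun (n + 1) (step (n + 1) (i + 1)) (op V (σ i) u) -
      op W (σ i) (H.toFun n (step n (i + 1)) u)) ?_ fun j hj => ?_
  · rw [map_sub, H.natural, op_δ_σ_castSucc, op_δ_σ_castSucc, step_comp_δ_castSucc]
  · by_cases h : j = i.succ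
    · rw [h, map_sub, H.natural, op_δ_σ_succ, op_δ_σ_succ, step_comp_δ_succ, sub_self]
    · rw [map_sub, H.natural, op_δ_σ_of_mem_cycles hu j i hj h,
        op_δ_σ_of_mem_cycles hc' j i hj h, map_zero, sub_zero]

/-- The two ends of a simplicial homotopy agree on homotopy groups. -/
theorem LinHomotopy.sub_mem_boundaries {n : ℕ} {u : alv V n} (hu : u ∈ cycles V n) :
    H.toFun n (step n 0) u - H.toFun n (step n (n + 1)) u ∈ boundaries W n := by
  have h : ∀ i, i ≤ n + 1 →
      H.toFun n (step n 0) u - H.toFun n (step n i) u ∈ boundaries W n := by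
    intro i
    induction i with
    | zero => intro _; rw [sub_self]; exact Submodule.zero_mem _
    | succ i ih =>
      intro hi
      have := Submodule.add_mem _ (ih (by omega)) (H.step_sub_mem_boundaries hu ⟨i, hi⟩)
      rwa [sub_add_sub_cancel] at this
  exact h _ le_rfl

/-- Compatible families of candidate faces can be realized except for the zeroth face. -/
theorem exists_horn_filler {n : ℕ} (y : Fin (n + 2) → alv V n)
    (hy : ∀ (m : ℕ), m < n → ∀ (i j : Fin (n + 2))
      (θ θ' : SimplexCategory.mk m ⟶ SimplexCategory.mk n),
      θ ≫ δ i = θ' ≫ δ j → op V θ (y i) = op V θ' (y j)) :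
    ∃ w : alv V (n + 1), ∀ j : Fin (n + 1), op V (δ j.succ) w = y j.succ := by
  -- Moore's filling argument: the faces are corrected one at a time from the highest index
  -- downwards.
  have h : ∀ t : ℕ, t ≤ n + 1 → ∃ w : alv V (n + 1), ∀ j : Fin (n + 1), n + 1 - t ≤ j.val →
      op V (δ j.succ) w = y j.succ := by
    intro t
    induction t with
    | zero => exact fun _ => ⟨0, fun j hj => absurd j.isLt (by omega)⟩
    | succ t ih =>
      intro ht
      obtain ⟨w, hw⟩ := ih (by omega)
      obtain ⟨k, hk⟩ : ∃ k : Fin (n + 1), k.val = n - t := ⟨⟨n - t, by omega⟩, rfl⟩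
      -- The degenerate correction repairs face `k+1`. The faces `j+1` with `j > k` are undisturbed:
      -- there `d_{j+1} s_k = s_k d_j`, and `d_j` kills the defect because the prescribed faces are
      -- compatible.
      refine ⟨w + op V (σ k) (y k.succ - op V (δ k.succ) w), fun j hj => ?_⟩
      rcases eq_or_ne j k with rfl | hjk
      · rw [map_add, op_δ_σ_succ, add_sub_cancel]
      · have hlt : k < j := by
          have : j.val ≠ k.val := fun h => hjk (Fin.ext h)
          rw [Fin.lt_def]; omega
        have hwj := hw j (by have : k.val < j.val := hlt; omega)
        have e0 : op V (δ j.succ) (op V (σ k) (y k.succ - op V (δ k.succ) w)) = 0 := by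
          obtain _ | n := n
          · exact absurd hlt (by omega)
          · obtain ⟨i, rfl⟩ := Fin.exists_succ_eq.2 ((Fin.zero_le k).trans_lt hlt).ne'
            obtain ⟨l, rfl⟩ := Fin.exists_castSucc_eq.2 (hlt.trans_le (Fin.le_last _)).ne
            have hli : l.castSucc < i.succ := hlt
            rw [← op_comp, δ_comp_σ_of_gt hlt, op_comp, map_sub]
            have e : δ i.succ ≫ δ l.castSucc.succ = δ l.succ ≫ δ i.succ.succ :=
              (δ_comp_δ (i := l.succ) (j := i.succ)
                (Fin.succ_le_succ_iff.2 (Fin.le_def.2 (Nat.lt_succ_iff.1 hli)))).symm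
            rw [← op_comp, e, op_comp, hwj,
              hy n (Nat.lt_succ_self n) _ _ _ _ e, sub_self, map_zero]
        rw [map_add, hwj, e0, add_zero]
  obtain ⟨w, hw⟩ := h (n + 1) le_rfl
  exact ⟨w, fun j => hw j (by omega)⟩

/-- A normalized element that is a sum of degenerate elements vanishes. -/
theorem eq_zero_of_mem_normalized_of_degenerate {n : ℕ} {u : alv V (n + 1)}
    (hu : u ∈ normalized V (n + 1))
    (hd : u ∈ ⨆ k : Fin (n + 1), LinearMap.range (op V (σ k)).toLinearMap) : u = 0 := by
  -- Induction on a bound for the indices of the degeneracies that are used; at each stage the top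
  -- degeneracy is traded for lower ones.
  have key : ∀ K : ℕ, K ≤ n + 1 →
      u ∈ ⨆ k : Fin (n + 1), ⨆ _ : k.val < K, LinearMap.range (op V (σ k)).toLinearMap →
      u = 0 := by
    intro K
    induction K with
    | zero => intro _ h; simpa using h
    | succ K ih =>
      intro hK h
      refine ih (by omega) ?_
      set D := ⨆ k : Fin (n + 1), ⨆ _ : k.val < K, LinearMap.range (op V (σ k)).toLinearMap
      obtain ⟨L, hL⟩ : ∃ L : Fin (n + 1), L.val = K := ⟨⟨K, hK⟩, rfl⟩
      have hle : (⨆ k : Fin (n + 1), ⨆ _ : k.val < K + 1,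
          LinearMap.range (op V (σ k)).toLinearMap) ≤
          LinearMap.range (op V (σ L)).toLinearMap ⊔ D := by
        refine iSup₂_le fun k hk => ?_
        rcases Nat.lt_succ_iff_lt_or_eq.1 hk with h' | h'
        · exact le_sup_of_le_right (le_iSup₂_of_le k h' le_rfl)
        · obtain rfl : k = L := Fin.ext (h'.trans hL.symm)
          exact le_sup_left
      obtain ⟨_, ⟨w, rfl⟩, v, hv, huv⟩ := Submodule.mem_sup.1 (hle h)
      -- Writing `u = s_L w + v` with `v ∈ D`, the vanishing of `d_{L+1} u` gives `w = -d_{L+1} v`.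
      -- It remains to see that `s_L d_{L+1}` preserves the span `D` of the lower degenerate
      -- elements.
      have hD : D ≤ D.comap ((op V (σ L)).toLinearMap ∘ₗ (op V (δ L.succ)).toLinearMap) := by
        refine iSup₂_le fun k hk => ?_
        rintro _ ⟨z, rfl⟩
        rw [Submodule.mem_comap]
        change op V (σ L) (op V (δ L.succ) (op V (σ k) z)) ∈ D
        rw [← op_comp, ← op_comp, Category.assoc]
        -- For `k < L` the composite still identifies `k` and `k+1`, hence factors through `σ k`.
        obtain ⟨φ, hφ⟩ := eq_σ_comp_of_not_injective' (σ L ≫ δ L.succ ≫ σ k) k (by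
          change Fin.predAbove k (L.succ.succAbove (L.predAbove k.castSucc)) =
            Fin.predAbove k (L.succ.succAbove (L.predAbove k.succ))
          have h1 : L.predAbove k.castSucc = k :=
            Fin.predAbove_castSucc_of_le _ _ (by rw [Fin.le_def]; omega)
          have h2 : (L.predAbove k.succ).val = k.val + 1 := by
            rw [Fin.predAbove_of_le_castSucc _ _ (by rw [Fin.le_def]; simp; omega)]
            simp
          rw [h1, Fin.succAbove_of_castSucc_lt _ _ (by rw [Fin.lt_def]; simp; omega),
            Fin.succAbove_of_castSucc_lt _ _ (by rw [Fin.lt_def]; simp; omega)]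
          have h3 : (L.predAbove k.succ).castSucc = k.succ := Fin.ext (by simp [h2])
          rw [h3]
          simp)
        rw [hφ, op_comp]
        exact Submodule.mem_iSup_of_mem k (Submodule.mem_iSup_of_mem hk ⟨_, rfl⟩)
      have h0 := (mem_normalized_succ V).1 hu L
      rw [← huv, map_add] at h0
      have h1 : w = -op V (δ L.succ) v := by
        rw [eq_neg_iff_add_eq_zero]
        exact (congrArg (· + _) (op_δ_σ_succ L w)).symm.trans h0
      rw [← huv, h1, map_neg]
      exact Submodule.add_mem _ (Submodule.neg_mem _ (hD hv)) hv
  refine key (n + 1) le_rfl ?_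
  exact iSup_le (fun k => le_iSup₂_of_le (f := fun (k : Fin (n + 1)) (_ : k.val < n + 1) =>
    LinearMap.range (op V (σ k)).toLinearMap) k k.isLt le_rfl) hd

end Simplicial

/-! ### Homogeneous components and free algebras -/

namespace EvenAlg

variable {p : ℕ}

/-- The projection onto the homogeneous component of degree `n`. -/
def proj (A : EvenAlg p) (n : ℕ) : A.carrier →ₗ[ZMod p] A.carrier :=
  (A.gr n).subtype ∘ₗ DirectSum.component (ZMod p) ℕ (fun n => A.gr n) n ∘ₗ
    (LinearEquiv.ofBijective (DirectSum.coeLinearMap A.gr) A.isInternal).symm.toLinearMap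

theorem proj_mem (A : EvenAlg p) (n : ℕ) (a : A.carrier) : A.proj n a ∈ A.gr n :=
  Subtype.prop _

theorem proj_of_mem (A : EvenAlg p) {m : ℕ} (n : ℕ) {a : A.carrier} (ha : a ∈ A.gr m) :
    A.proj n a = if m = n then a else 0 := by
  have h : (LinearEquiv.ofBijective (DirectSum.coeLinearMap A.gr) A.isInternal).symm a =
      DirectSum.lof (ZMod p) ℕ (fun n => A.gr n) m ⟨a, ha⟩ := by
    rw [LinearEquiv.symm_apply_eq]
    exact (DirectSum.coeLinearMap_lof A.gr m ⟨a, ha⟩).symm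
  simp only [proj, LinearMap.comp_apply, LinearEquiv.coe_coe, h]
  split_ifs with hmn
  · subst hmn
    rw [DirectSum.component.lof_self]
    rfl
  · rw [DirectSum.component.of, dif_neg hmn, map_zero]

theorem induction_homogeneous (A : EvenAlg p) {C : A.carrier → Prop}
    (hom : ∀ n, ∀ a ∈ A.gr n, C a) (add : ∀ a b, C a → C b → C (a + b)) (a : A.carrier) : C a := by
  have h : a ∈ ⨆ n, A.gr n := by
    rw [A.isInternal.submodule_iSup_eq_top]
    exact Submodule.mem_top
  exact Submodule.iSup_induction A.gr (motive := C) h hom (hom 0 0 (Submodule.zero_mem _)) add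

theorem Hom.map_proj {A B : EvenAlg p} (φ : EvenAlg.Hom A B) (n : ℕ) (a : A.carrier) :
    φ.toAlgHom (A.proj n a) = B.proj n (φ.toAlgHom a) := by
  induction a using A.induction_homogeneous with
  | hom m a ha =>
    rw [proj_of_mem A n ha, proj_of_mem B n (φ.map_gr m a ha)]
    split_ifs
    · rfl
    · exact map_zero _
  | add a b ha hb => rw [map_add, map_add, ha, hb, map_add, map_add]

open Classical in
/-- The least degree of a homogeneous element. -/
def deg (A : EvenAlg p) (a : A.carrier) : ℕ :=
  if h : ∃ n, a ∈ A.gr n then Nat.find h else 0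

theorem mem_gr_deg {A : EvenAlg p} {a : A.carrier} (h : ∃ n, a ∈ A.gr n) :
    a ∈ A.gr (A.deg a) := by
  classical
  rw [deg, dif_pos h]
  exact Nat.find_spec h

theorem deg_eq_zero {A : EvenAlg p} {a : A.carrier} (h : a ∈ A.gr 0) : A.deg a = 0 := by
  classical
  rw [deg, dif_pos ⟨0, h⟩, Nat.find_eq_zero]
  exact h

namespace IsFreeOn

variable {A : EvenAlg p} {X : Set A.carrier}

theorem algHom_ext (hX : A.IsFreeOn X) {B : Type} [CommRing B] [Algebra (ZMod p) B] {φ ψ : A.carrier →ₐ[ZMod p] B}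
    (h : ∀ z ∈ X, φ z = ψ z) : φ = ψ := by
  have : φ.comp (MvPolynomial.aeval (R := ZMod p) (Subtype.val : X → A.carrier)) =
      ψ.comp (MvPolynomial.aeval (R := ZMod p) (Subtype.val : X → A.carrier)) := by
    refine MvPolynomial.algHom_ext fun z => ?_
    simpa using h z z.2
  ext a
  obtain ⟨f, rfl⟩ := hX.surjective a
  exact DFunLike.congr_fun this f

theorem exists_algHom (hX : A.IsFreeOn X) {B : Type} [CommRing B] [Algebra (ZMod p) B] (v : X → B)
    (hv : ∀ z : X, z.1 ∈ A.gr 0 → v z ^ p = v z) :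
    ∃ φ : A.carrier →ₐ[ZMod p] B, ∀ z : X, φ z = v z := by
  set π := MvPolynomial.aeval (R := ZMod p) (Subtype.val : X → A.carrier)
  have hk : ∀ f ∈ RingHom.ker π, MvPolynomial.aeval (R := ZMod p) v f = 0 := by
    intro f hf
    rw [hX.ker_eq] at hf
    refine (Ideal.span_le (I := RingHom.ker (MvPolynomial.aeval (R := ZMod p) v))).2 ?_ hf
    rintro _ ⟨z, hz, rfl⟩
    simp [hv z hz]
  refine ⟨(Ideal.Quotient.liftₐ (RingHom.ker π) (MvPolynomial.aeval (R := ZMod p) v) hk).comp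
    (Ideal.quotientKerAlgEquivOfSurjective hX.surjective).symm.toAlgHom, fun z => ?_⟩
  have h1 : (Ideal.quotientKerAlgEquivOfSurjective hX.surjective).symm z.1 =
      Ideal.Quotient.mk (RingHom.ker π) (MvPolynomial.X z) := by
    rw [AlgEquiv.symm_apply_eq]
    refine Eq.trans ?_ (Ideal.quotientKerAlgEquivOfSurjective_mk hX.surjective _).symm
    simp
  change Ideal.Quotient.liftₐ (RingHom.ker π) _ hk
    ((Ideal.quotientKerAlgEquivOfSurjective hX.surjective).symm z.1) = _
  rw [h1]
  exact (Ideal.Quotient.lift_mk _ _ _).trans (MvPolynomial.aeval_X _ _)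

/-- A homogeneous element may be presented by an inhomogeneous polynomial in the generators.
Evaluation carries weighted components to homogeneous components (`key`), so the polynomial can be
replaced by its component of weight `n`, on which the claim is visible. -/
theorem mem_gr_of_forall [Fact p.Prime] (hX : A.IsFreeOn X) {B : EvenAlg p} (φ : A.carrier →ₐ[ZMod p] B.carrier)
    (h : ∀ z ∈ X, φ z ∈ B.gr (A.deg z)) (n : ℕ) (a : A.carrier) (ha : a ∈ A.gr n) :
    φ a ∈ B.gr n := by
  classical
  obtain ⟨f, rfl⟩ := hX.surjective a
  set w : X → ℕ := fun z => A.deg z.1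
  have hw : ∀ z : X, z.1 ∈ A.gr (w z) := fun z => mem_gr_deg (hX.homogeneous z z.2)
  have key : ∀ g : MvPolynomial X (ZMod p),
      A.proj n (MvPolynomial.aeval (R := ZMod p) (Subtype.val : X → A.carrier) g) =
      MvPolynomial.aeval (R := ZMod p) (Subtype.val : X → A.carrier)
        (MvPolynomial.weightedHomogeneousComponent w n g) := by
    intro g
    induction g using MvPolynomial.induction_on' with
    | monomial m c =>
      have hc : MvPolynomial.IsWeightedHomogeneous w (MvPolynomial.monomial m c) _ :=
        MvPolynomial.isWeightedHomogeneous_monomial w m c rfl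
      rw [MvPolynomial.weightedHomogeneousComponent_of_mem hc,
        proj_of_mem A n (isWeightedHomogeneous_aeval p w _ hw _ _ hc)]
      split_ifs with h1 h2 h2
      · rfl
      · exact absurd h1.symm h2
      · exact absurd h2.symm h1
      · exact (map_zero _).symm
    | add f g hf hg => rw [map_add, map_add, map_add, map_add, hf, hg]
  have h1 := key f
  rw [proj_of_mem A n ha, if_pos rfl] at h1
  rw [h1, ← AlgHom.comp_apply]
  have h2 : φ.comp (MvPolynomial.aeval (R := ZMod p) (Subtype.val : X → A.carrier)) =
      MvPolynomial.aeval (R := ZMod p) fun z : X => φ z.1 :=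
    MvPolynomial.algHom_ext fun z => by simp
  rw [h2]
  exact isWeightedHomogeneous_aeval p w _ (fun z => h z z.2) n _
    (MvPolynomial.weightedHomogeneousComponent_isWeightedHomogeneous n f)

end IsFreeOn

end EvenAlg

/-! ### Simplicial operators and fillers -/

section Fillers

open SimplexCategory

variable {p : ℕ}

/-- The simplicial operator of `P` attached to a morphism of the simplex category. -/
def eop (P : SimplicialObject (EvenAlg p)) {a b : ℕ}
    (θ : SimplexCategory.mk a ⟶ SimplexCategory.mk b) : EvenAlg.Hom (lv P b) (lv P a) :=
  P.map θ.op

theorem eop_id (P : SimplicialObject (EvenAlg p)) (a : ℕ) (z : (lv P a).carrier) :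
    (eop P (𝟙 (SimplexCategory.mk a))).toAlgHom z = z := by
  have : eop P (𝟙 (SimplexCategory.mk a)) = 𝟙 (lv P a) := P.map_id _
  rw [this]; rfl

theorem eop_comp (P : SimplicialObject (EvenAlg p)) {a b c : ℕ}
    (θ : SimplexCategory.mk a ⟶ SimplexCategory.mk b)
    (φ : SimplexCategory.mk b ⟶ SimplexCategory.mk c) (z : (lv P c).carrier) :
    (eop P (θ ≫ φ)).toAlgHom z = (eop P θ).toAlgHom ((eop P φ).toAlgHom z) := by
  have : P.map (θ ≫ φ).op = P.map φ.op ≫ P.map θ.op := P.map_comp _ _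
  rw [eop, this]; rfl

/-- The underlying simplicial algebra. -/
abbrev forgetSimp (P : SimplicialObject (EvenAlg p)) : SimplicialObject (AlgCat.{0} (ZMod p)) :=
  ((SimplicialObject.whiskering _ _).obj (EvenAlg.forgetGr p)).obj P

variable {A : EvenAlg p}

/-- The augmentation in degree `n`. -/
def aug {P : SimplicialObject (EvenAlg p)} (ε : P ⟶ (SimplicialObject.const (EvenAlg p)).obj A)
    (n : ℕ) : EvenAlg.Hom (lv P n) A :=
  ε.app (Opposite.op (SimplexCategory.mk n))

theorem aug_eop {P : SimplicialObject (EvenAlg p)}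
    (ε : P ⟶ (SimplicialObject.const (EvenAlg p)).obj A) {a b : ℕ}
    (θ : SimplexCategory.mk a ⟶ SimplexCategory.mk b) (z : (lv P b).carrier) :
    (aug ε a).toAlgHom ((eop P θ).toAlgHom z) = (aug ε b).toAlgHom z := by
  have h : P.map θ.op ≫ ε.app (Opposite.op (SimplexCategory.mk a)) =
      ε.app (Opposite.op (SimplexCategory.mk b)) :=
    (ε.naturality θ.op).trans (Category.comp_id _)
  exact DFunLike.congr_fun (congrArg EvenAlg.Hom.toAlgHom h) z

variable {Q : SimplicialObject (EvenAlg p)}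
  {ε : Q ⟶ (SimplicialObject.const (EvenAlg p)).obj A}

theorem IsAlmostFreeResolution.exists_preimage (hQ : IsAlmostFreeResolution Q ε) {d : ℕ}
    {a : A.carrier} (ha : a ∈ A.gr d) :
    ∃ e ∈ (lv Q 0).gr d, (aug ε 0).toAlgHom e = a := by
  obtain ⟨e, he⟩ := hQ.surjective a
  refine ⟨_, EvenAlg.proj_mem _ d e, ?_⟩
  rw [EvenAlg.Hom.map_proj]
  refine (congrArg (A.proj d) he).trans ?_
  rw [EvenAlg.proj_of_mem A d ha, if_pos rfl]

/-- The horn filler `w` realizes all faces except the zeroth. The defect `c = y_0 - d_0 w` is killed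
by the augmentation if `n = 0` and is a cycle if `n > 0`, so acyclicity writes it as `d_0 v` with
`v` normalized, and `w + v` has all the required faces. Homogeneity costs nothing, since projecting
to degree `d` commutes with the faces. -/
theorem IsAlmostFreeResolution.exists_filler (hQ : IsAlmostFreeResolution Q ε) {n d : ℕ}
    (y : Fin (n + 2) → (lv Q n).carrier) (hd : ∀ i, y i ∈ (lv Q n).gr d)
    (a : A.carrier) (hε : ∀ i, (aug ε n).toAlgHom (y i) = a)
    (hy : ∀ (m : ℕ), m < n → ∀ (i j : Fin (n + 2))
      (θ θ' : SimplexCategory.mk m ⟶ SimplexCategory.mk n), θ ≫ δ i = θ' ≫ δ j →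
      (eop Q θ).toAlgHom (y i) = (eop Q θ').toAlgHom (y j)) :
    ∃ e ∈ (lv Q (n + 1)).gr d, ∀ i, (eop Q (δ i)).toAlgHom e = y i := by
  suffices ∃ e : (lv Q (n + 1)).carrier, ∀ i, (eop Q (δ i)).toAlgHom e = y i by
    obtain ⟨e, he⟩ := this
    refine ⟨_, EvenAlg.proj_mem _ d e, fun i => ?_⟩
    rw [EvenAlg.Hom.map_proj, he, EvenAlg.proj_of_mem _ d (hd i), if_pos rfl]
  obtain ⟨w, hw⟩ : ∃ w : (lv Q (n + 1)).carrier, ∀ j : Fin (n + 1),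
      (eop Q (δ j.succ)).toAlgHom w = y j.succ := exists_horn_filler (V := forgetSimp Q) y hy
  obtain ⟨c, hc⟩ : ∃ c : (lv Q n).carrier, c = y 0 - (eop Q (δ 0)).toAlgHom w := ⟨_, rfl⟩
  have hb : c ∈ boundaries (forgetSimp Q) n := by
    cases n with
    | zero =>
      rw [← hQ.ker_eq c]
      change (aug ε 0).toAlgHom c = 0
      have h1 : (aug ε 0).toAlgHom ((eop Q (δ (Fin.succ (0 : Fin 1)))).toAlgHom w) = a := by
        rw [← hε (Fin.succ (0 : Fin 1))]
        exact congrArg _ (hw 0)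
      rw [hc, map_sub, hε, aug_eop, ← h1, aug_eop, sub_self]
    | succ n =>
      refine (hQ.exact n).le ?_
      refine (mem_cycles_succ (forgetSimp Q)).2 fun j => ?_
      have e : δ j ≫ δ 0 = δ 0 ≫ δ j.succ := by
        have := δ_comp_δ (n := n) (Fin.zero_le j)
        rw [this]; rfl
      have h1 : (eop Q (δ j)).toAlgHom ((eop Q (δ 0)).toAlgHom w) =
          (eop Q (δ 0)).toAlgHom (y j.succ) := by
        rw [← eop_comp, e, eop_comp]
        exact congrArg _ (hw j)
      change (eop Q (δ j)).toAlgHom c = 0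
      rw [hc, map_sub, h1, hy n (Nat.lt_succ_self n) _ _ _ _ e, sub_self]
  obtain ⟨v, hv, hvc⟩ : ∃ v : (lv Q (n + 1)).carrier, v ∈ normalized (forgetSimp Q) (n + 1) ∧
      (eop Q (δ 0)).toAlgHom v = c := (mem_boundaries (forgetSimp Q)).1 hb
  refine ⟨w + v, fun i => ?_⟩
  rw [map_add]
  refine Fin.cases ?_ (fun i => ?_) i
  · rw [hvc, hc, add_sub_cancel]
  · have h1 : (eop Q (δ i.succ)).toAlgHom v = 0 := (mem_normalized_succ (forgetSimp Q)).1 hv i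
    rw [h1, hw, add_zero]

end Fillers

/-! ### Lifting against acyclic augmentations -/

section Lifting

open SimplexCategory Simplicial

variable {p : ℕ}

/-- The action of a morphism of the simplex category on a simplicial set. -/
def kop (K : SSet.{0}) {a b : ℕ} (θ : SimplexCategory.mk a ⟶ SimplexCategory.mk b)
    (k : K _⦋b⦌) : K _⦋a⦌ :=
  K.map θ.op k

theorem kop_id (K : SSet.{0}) (a : ℕ) (k : K _⦋a⦌) :
    kop K (𝟙 (SimplexCategory.mk a)) k = k := by
  simp [kop]

theorem kop_comp (K : SSet.{0}) {a b c : ℕ} (θ : SimplexCategory.mk a ⟶ SimplexCategory.mk b)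
    (φ : SimplexCategory.mk b ⟶ SimplexCategory.mk c) (k : K _⦋c⦌) :
    kop K (θ ≫ φ) k = kop K θ (kop K φ k) := by
  simp [kop]

/-- The product of the simplicial set underlying `P` with `K`. -/
def prodSet (P : SimplicialObject (EvenAlg p)) (K : SSet.{0}) : SSet.{0} where
  obj n := (P.obj n).carrier × K.obj n
  map θ := TypeCat.ofHom fun y => ((P.map θ).toAlgHom y.1, K.map θ y.2)
  map_id n := by
    ext y
    · change (P.map (𝟙 n)).toAlgHom y.1 = y.1
      rw [P.map_id]; rfl
    · change K.map (𝟙 n) y.2 = y.2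
      simp
  map_comp θ φ := by
    ext y
    · change (P.map (θ ≫ φ)).toAlgHom y.1 = _
      rw [P.map_comp]; rfl
    · change K.map (θ ≫ φ) y.2 = K.map φ (K.map θ y.2)
      simp

theorem kop_prodSet (P : SimplicialObject (EvenAlg p)) (K : SSet.{0}) {a b : ℕ}
    (θ : SimplexCategory.mk a ⟶ SimplexCategory.mk b) (z : (lv P b).carrier) (k : K _⦋b⦌) :
    kop (prodSet P K) θ (z, k) = ((eop P θ).toAlgHom z, kop K θ k) :=
  rfl

/-- Data for a relative lifting problem: `P` is free on `X`, `Q ⟶ A` is acyclic, and a natural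
family of maps `P_n ⟶ Q_n` over `A`, indexed by the simplices of a simplicial set `K`, has been
prescribed on a simplicial subset `L`. -/
structure LiftProblem {A : EvenAlg p} {P Q : SimplicialObject (EvenAlg p)}
    (εP : P ⟶ (SimplicialObject.const (EvenAlg p)).obj A)
    (εQ : Q ⟶ (SimplicialObject.const (EvenAlg p)).obj A) (K : SSet.{0}) where
  X : ∀ q : ℕ, Set (lv P q).carrier
  free : ∀ q, (lv P q).IsFreeOn (X q)
  degen : ∀ q (i : Fin (q + 1)), ∀ z ∈ X q, (eop P (σ i)).toAlgHom z ∈ X (q + 1)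
  acyclic : IsAlmostFreeResolution Q εQ
  L : ∀ n : ℕ, Set (K _⦋n⦌)
  L_map : ∀ {a b : ℕ} (θ : SimplexCategory.mk a ⟶ SimplexCategory.mk b), ∀ k ∈ L b, kop K θ k ∈ L a
  G : ∀ (n : ℕ) (k : K _⦋n⦌), k ∈ L n → EvenAlg.Hom (lv P n) (lv Q n)
  G_natural : ∀ {a b : ℕ} (θ : SimplexCategory.mk a ⟶ SimplexCategory.mk b) (k : K _⦋b⦌)
    (hk : k ∈ L b) (z : (lv P b).carrier), (eop Q θ).toAlgHom ((G b k hk).toAlgHom z) =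
      (G a (kop K θ k) (L_map θ k hk)).toAlgHom ((eop P θ).toAlgHom z)
  G_aug : ∀ (n : ℕ) (k : K _⦋n⦌) (hk : k ∈ L n) (z : (lv P n).carrier),
    (aug εQ n).toAlgHom ((G n k hk).toAlgHom z) = (aug εP n).toAlgHom z

namespace LiftProblem

variable {A : EvenAlg p} {P Q : SimplicialObject (EvenAlg p)}
  {εP : P ⟶ (SimplicialObject.const (EvenAlg p)).obj A}
  {εQ : Q ⟶ (SimplicialObject.const (EvenAlg p)).obj A} {K : SSet.{0}}
  (D : LiftProblem εP εQ K)

/-- The conditions on the value `v` at the generator `z` of the lift indexed by `k`, in terms of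
the lifts in lower dimensions. -/
structure Good (n : ℕ) (prev : ∀ m, m < n → K _⦋m⦌ → (lv P m).carrier → (lv Q m).carrier)
    (k : K _⦋n⦌) (z : (lv P n).carrier) (v : (lv Q n).carrier) : Prop where
  given : ∀ hk : k ∈ D.L n, v = (D.G n k hk).toAlgHom z
  mem_gr : v ∈ (lv Q n).gr ((lv P n).deg z)
  aug_eq : (aug εQ n).toAlgHom v = (aug εP n).toAlgHom z
  face : ∀ m (hm : m < n) (θ : SimplexCategory.mk m ⟶ SimplexCategory.mk n),
    (eop Q θ).toAlgHom v = prev m hm (kop K θ k) ((eop P θ).toAlgHom z)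
  degeneracy : ∀ m (hm : m < n) (θ : SimplexCategory.mk n ⟶ SimplexCategory.mk m)
    (s : SimplexCategory.mk m ⟶ SimplexCategory.mk n) (k' : K _⦋m⦌) (z' : (lv P m).carrier),
    s ≫ θ = 𝟙 _ → k = kop K θ k' → z = (eop P θ).toAlgHom z' →
      v = (eop Q θ).toAlgHom (prev m hm k' z')

open Classical in
/-- The lifts, chosen by recursion on the dimension. -/
def fn (n : ℕ) (k : K _⦋n⦌) : (lv P n).carrier → (lv Q n).carrier :=
  if h : ∃ φ : (lv P n).carrier →ₐ[ZMod p] (lv Q n).carrier,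
    ∀ z ∈ D.X n, D.Good n (fun m _ => fn m) k z (φ z)
  -- The zero branch is never taken: `exists_and_natural` establishes the condition in every
  -- dimension.
  then h.choose else fun _ => 0
termination_by n

/-- The lifts in dimension `n` exist. -/
def Exists (n : ℕ) : Prop :=
  ∀ k : K _⦋n⦌, ∃ φ : (lv P n).carrier →ₐ[ZMod p] (lv Q n).carrier,
    ∀ z ∈ D.X n, D.Good n (fun m _ => D.fn m) k z (φ z)

/-- The lifts in dimensions `a`, `b` are natural. -/
def Natural (a b : ℕ) : Prop :=
  ∀ (θ : SimplexCategory.mk a ⟶ SimplexCategory.mk b) (k : K _⦋b⦌) (z : (lv P b).carrier),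
    (eop Q θ).toAlgHom (D.fn b k z) = D.fn a (kop K θ k) ((eop P θ).toAlgHom z)

variable {D}

theorem exists_algHom {n : ℕ} (h : D.Exists n) (k : K _⦋n⦌) :
    ∃ φ : (lv P n).carrier →ₐ[ZMod p] (lv Q n).carrier, D.fn n k = φ ∧
      ∀ z ∈ D.X n, D.Good n (fun m _ => D.fn m) k z (φ z) := by
  refine ⟨(h k).choose, ?_, (h k).choose_spec⟩
  rw [fn, dif_pos (h k)]

theorem exists_hom [Fact p.Prime] {n : ℕ} (h : D.Exists n) (k : K _⦋n⦌) :
    ∃ φ : EvenAlg.Hom (lv P n) (lv Q n), (∀ z, D.fn n k z = φ.toAlgHom z) ∧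
      (∀ hk, φ = D.G n k hk) ∧
      (∀ z, (aug εQ n).toAlgHom (φ.toAlgHom z) = (aug εP n).toAlgHom z) ∧
      ∀ z ∈ D.X n, D.Good n (fun m _ => D.fn m) k z (φ.toAlgHom z) := by
  obtain ⟨φ, h1, h2⟩ := exists_algHom h k
  refine ⟨⟨φ, (D.free n).mem_gr_of_forall φ fun z hz => (h2 z hz).mem_gr⟩, fun z => by rw [h1],
    fun hk => ?_, fun z => ?_, h2⟩
  · exact EvenAlg.Hom.ext ((D.free n).algHom_ext fun z hz => (h2 z hz).given hk)
  · exact DFunLike.congr_fun ((D.free n).algHom_ext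
      (φ := (aug εQ n).toAlgHom.comp φ) (ψ := (aug εP n).toAlgHom)
      fun z hz => (h2 z hz).aug_eq) z

/-- Simplices outside of the maximal dimension have unique values. -/
theorem eq_of_decomposition {n : ℕ} (hN : ∀ a b, a < n → b < n → D.Natural a b)
    {m₁ m₂ : ℕ} (h₁ : m₁ < n) (h₂ : m₂ < n)
    (θ₁ : SimplexCategory.mk n ⟶ SimplexCategory.mk m₁) [Epi θ₁]
    (θ₂ : SimplexCategory.mk n ⟶ SimplexCategory.mk m₂) [Epi θ₂]
    (k₁ : K _⦋m₁⦌) (k₂ : K _⦋m₂⦌) (z₁ : (lv P m₁).carrier) (z₂ : (lv P m₂).carrier)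
    (hk : kop K θ₁ k₁ = kop K θ₂ k₂)
    (hz : (eop P θ₁).toAlgHom z₁ = (eop P θ₂).toAlgHom z₂) :
    (eop Q θ₁).toAlgHom (D.fn m₁ k₁ z₁) = (eop Q θ₂).toAlgHom (D.fn m₂ k₂ z₂) := by
  -- By the Eilenberg–Zilber lemma in the simplicial set `P × K`, each pair is a degeneracy of a
  -- unique nondegenerate pair along a unique surjection. Naturality below `n` expresses the lift
  -- through that pair, so two degenerate expressions of one simplex give the same value.
  have key : ∀ (m : ℕ) (_ : m < n) (k : K _⦋m⦌) (z : (lv P m).carrier),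
      ∃ (l : ℕ) (_ : l < n) (g : SimplexCategory.mk m ⟶ SimplexCategory.mk l) (_ : Epi g)
        (y : (prodSet P K).nonDegenerate l), (z, k) = kop (prodSet P K) g y.1 ∧
        D.fn m k z = (eop Q g).toAlgHom (D.fn l y.1.2 y.1.1) := by
    intro m hm k z
    obtain ⟨l, g, hg, y, hy⟩ := (prodSet P K).exists_nonDegenerate (n := m) (z, k)
    have hl : l < n := (SimplexCategory.len_le_of_epi g).trans_lt hm
    refine ⟨l, hl, g, hg, y, hy, ?_⟩
    rw [hN m l hm hl]
    have h1 : z = (eop P g).toAlgHom y.1.1 := congrArg Prod.fst hy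
    have h2 : k = kop K g y.1.2 := congrArg Prod.snd hy
    rw [← h1, ← h2]
  obtain ⟨l₁, hl₁, g₁, hg₁, y₁, hy₁, e₁⟩ := key m₁ h₁ k₁ z₁
  obtain ⟨l₂, hl₂, g₂, hg₂, y₂, hy₂, e₂⟩ := key m₂ h₂ k₂ z₂
  rw [e₁, e₂, ← eop_comp, ← eop_comp]
  have f₁ : kop (prodSet P K) θ₁ (z₁, k₁) = kop (prodSet P K) (θ₁ ≫ g₁) y₁.1 := by
    rw [kop_comp, ← hy₁]
  have f₂ : kop (prodSet P K) θ₁ (z₁, k₁) = kop (prodSet P K) (θ₂ ≫ g₂) y₂.1 := by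
    rw [kop_comp, ← hy₂, kop_prodSet, kop_prodSet, hk, hz]
  have : Epi (θ₁ ≫ g₁) := epi_comp _ _
  have : Epi (θ₂ ≫ g₂) := epi_comp _ _
  obtain rfl := (prodSet P K).unique_nonDegenerate_dim _ (θ₁ ≫ g₁) y₁ f₁ (θ₂ ≫ g₂) y₂ f₂
  obtain rfl := (prodSet P K).unique_nonDegenerate_simplex _ (θ₁ ≫ g₁) y₁ f₁ (θ₂ ≫ g₂) y₂ f₂
  rw [(prodSet P K).unique_nonDegenerate_map _ (θ₁ ≫ g₁) y₁ f₁ (θ₂ ≫ g₂) y₁ f₂]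

/-- Three cases. For `k` in the prescribed part the value is given. If the pair `(z, k)` is
degenerate the value is forced by a lower dimension, consistently by `eq_of_decomposition`. If it is
nondegenerate, the lower lifts prescribe compatible faces, and acyclicity supplies a simplex with
these faces, or in dimension zero a preimage under the augmentation. -/
theorem exists_good [Fact p.Prime] {n : ℕ} (hE : ∀ a, a < n → D.Exists a)
    (hN : ∀ a b, a < n → b < n → D.Natural a b) (k : K _⦋n⦌) (z : (lv P n).carrier)
    (hz : z ∈ D.X n) : ∃ v, D.Good n (fun m _ => D.fn m) k z v := by
  have hdeg : z ∈ (lv P n).gr ((lv P n).deg z) :=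
    EvenAlg.mem_gr_deg ((D.free n).homogeneous z hz)
  by_cases hk : k ∈ D.L n
  · refine ⟨(D.G n k hk).toAlgHom z, fun _ => rfl, (D.G n k hk).map_gr _ _ hdeg,
      D.G_aug n k hk z, fun m hm θ => ?_, fun m hm θ s k' z' hs hk' hz' => ?_⟩
    · obtain ⟨φ, h1, h2, -⟩ := exists_hom (hE m hm) (kop K θ k)
      rw [h1, h2 (D.L_map θ k hk), D.G_natural]
    · have hkL : k' ∈ D.L m := by
        have := D.L_map s k hk
        rwa [hk', ← kop_comp, hs, kop_id] at this
      obtain ⟨φ, h1, h2, -⟩ := exists_hom (hE m hm) k'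
      subst hk'
      rw [h1, h2 hkL, D.G_natural, ← hz']
  · obtain ⟨l, g, hg, y, hy⟩ := (prodSet P K).exists_nonDegenerate (n := n) (z, k)
    have hyz : z = (eop P g).toAlgHom y.1.1 := congrArg Prod.fst hy
    have hyk : k = kop K g y.1.2 := congrArg Prod.snd hy
    rcases (SimplexCategory.len_le_of_epi g : l ≤ n).lt_or_eq with hl | hl
    · obtain ⟨φ, h1, h2, h3, -⟩ := exists_hom (hE l hl) y.1.2
      have : IsSplitEpi g := isSplitEpi_of_epi g
      have hs : section_ g ≫ g = 𝟙 _ := IsSplitEpi.id g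
      refine ⟨(eop Q g).toAlgHom (D.fn l y.1.2 y.1.1), fun h => absurd h hk, ?_, ?_,
        fun m hm θ => ?_, fun m hm θ s k' z' hs hk' hz' => ?_⟩
      · rw [h1]
        refine (eop Q g).map_gr _ _ (φ.map_gr _ _ ?_)
        have := (eop P (section_ g)).map_gr _ _ hdeg
        have e : (eop P (section_ g)).toAlgHom z = y.1.1 := by
          conv_lhs => rw [hyz, ← eop_comp, hs, eop_id]
        rwa [e] at this
      · rw [h1, aug_eop, h3]
        conv_rhs => rw [hyz, aug_eop]
      · rw [← eop_comp, hN m l hm hl, kop_comp, eop_comp, ← hyz, ← hyk]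
      · have : IsSplitEpi θ := ⟨⟨⟨s, hs⟩⟩⟩
        exact eq_of_decomposition hN hl hm g θ _ _ _ _ (hyk.symm.trans hk') (hyz.symm.trans hz')
    -- Here the nondegenerate pair already has dimension `n`; uniqueness of that dimension excludes
    -- any expression as a proper degeneracy, so the degeneracy clause is vacuous.
    · have hdegen : ∀ m (hm : m < n) (θ : SimplexCategory.mk n ⟶ SimplexCategory.mk m)
          (s : SimplexCategory.mk m ⟶ SimplexCategory.mk n) (k' : K _⦋m⦌) (z' : (lv P m).carrier),
          s ≫ θ = 𝟙 _ → k = kop K θ k' → z = (eop P θ).toAlgHom z' → False := by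
        intro m hm θ s k' z' hs hk' hz'
        have : IsSplitEpi θ := ⟨⟨⟨s, hs⟩⟩⟩
        obtain ⟨l', g', hg', y', hy'⟩ := (prodSet P K).exists_nonDegenerate (n := m) (z', k')
        have hln : l = n := hl
        have hl' : l' ≤ m := SimplexCategory.len_le_of_epi g'
        have f : kop (prodSet P K) g y.1 = kop (prodSet P K) (θ ≫ g') y'.1 := by
          refine hy.symm.trans ?_
          rw [kop_comp]
          refine Eq.trans ?_ (congrArg (kop (prodSet P K) θ) hy')
          rw [kop_prodSet, ← hk', ← hz']
        have : Epi (θ ≫ g') := epi_comp _ _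
        have hll : l = l' := (prodSet P K).unique_nonDegenerate_dim _ g y rfl (θ ≫ g') y' f
        omega
      obtain ⟨v, hv1, hv2, hv3⟩ : ∃ v ∈ (lv Q n).gr ((lv P n).deg z),
          (aug εQ n).toAlgHom v = (aug εP n).toAlgHom z ∧
          ∀ m (_ : m < n) (θ : SimplexCategory.mk m ⟶ SimplexCategory.mk n),
            (eop Q θ).toAlgHom v = D.fn m (kop K θ k) ((eop P θ).toAlgHom z) := by
        clear hdegen
        cases n with
        | zero =>
          obtain ⟨e, he, hea⟩ := D.acyclic.exists_preimage ((aug εP 0).map_gr _ _ hdeg)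
          exact ⟨e, he, hea, fun m hm => absurd hm (by omega)⟩
        | succ n =>
          obtain ⟨e, he, hei⟩ := D.acyclic.exists_filler
            (fun i : Fin (n + 2) => D.fn n (kop K (δ i) k) ((eop P (δ i)).toAlgHom z))
            (d := (lv P (n + 1)).deg z) (fun i => by
              obtain ⟨φ, h1, -⟩ := exists_hom (hE n (by omega)) (kop K (δ i) k)
              rw [h1]
              exact φ.map_gr _ _ ((eop P (δ i)).map_gr _ _ hdeg))
            ((aug εP (n + 1)).toAlgHom z) (fun i => by
              obtain ⟨φ, h1, -, h3, -⟩ := exists_hom (hE n (by omega)) (kop K (δ i) k)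
              rw [h1, h3, aug_eop])
            (fun m hm i j θ θ' h => by
              rw [hN m n (by omega) (by omega), hN m n (by omega) (by omega), ← kop_comp,
                ← kop_comp, ← eop_comp, ← eop_comp, h])
          refine ⟨e, he, ?_, fun m hm θ => ?_⟩
          · rw [← aug_eop εQ (δ 0), hei]
            obtain ⟨φ, h1, -, h3, -⟩ := exists_hom (hE n (by omega)) (kop K (δ 0) k)
            rw [h1, h3, aug_eop]
          · obtain ⟨i, θ', rfl⟩ := eq_comp_δ_of_not_surjective θ (fun hs => by
              have := Fintype.card_le_of_surjective _ hs
              simp at this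
              omega)
            rw [eop_comp, hei, hN m n hm (by omega), ← kop_comp, ← eop_comp]
      exact ⟨v, fun h => absurd h hk, hv1, hv2, hv3,
        fun m hm θ s k' z' hs hk' hz' => (hdegen m hm θ s k' z' hs hk' hz').elim⟩

/-- Values on generators extend to an algebra map as soon as the relations `z^p = z` hold. These
concern generators of degree zero, whose values are again of degree zero, where the identity holds
in every object. -/
theorem exists_of_lt [Fact p.Prime] {n : ℕ} (hE : ∀ a, a < n → D.Exists a)
    (hN : ∀ a b, a < n → b < n → D.Natural a b) : D.Exists n := by
  intro k
  choose v hv using fun z : D.X n => exists_good hE hN k z.1 z.2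
  obtain ⟨φ, hφ⟩ := (D.free n).exists_algHom v fun z hz =>
    (lv Q n).pow_p _ (by simpa [EvenAlg.deg_eq_zero hz] using (hv z).mem_gr)
  exact ⟨φ, fun z hz => by rw [hφ ⟨z, hz⟩]; exact hv ⟨z, hz⟩⟩

theorem natural_of_generators [Fact p.Prime] {a b : ℕ} (ha : D.Exists a) (hb : D.Exists b)
    (θ : SimplexCategory.mk a ⟶ SimplexCategory.mk b) (k : K _⦋b⦌)
    (h : ∀ z ∈ D.X b, (eop Q θ).toAlgHom (D.fn b k z) =
      D.fn a (kop K θ k) ((eop P θ).toAlgHom z)) (z : (lv P b).carrier) :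
    (eop Q θ).toAlgHom (D.fn b k z) = D.fn a (kop K θ k) ((eop P θ).toAlgHom z) := by
  obtain ⟨φ, h1, -⟩ := exists_algHom ha (kop K θ k)
  obtain ⟨ψ, h2, -⟩ := exists_algHom hb k
  rw [h1, h2] at h ⊢
  exact DFunLike.congr_fun ((D.free b).algHom_ext (φ := (eop Q θ).toAlgHom.comp ψ)
    (ψ := φ.comp (eop P θ).toAlgHom) h) z

/-- On generators, naturality for operators from lower dimensions is the face clause of `Good`, and
for the maps `σ i` it is the degeneracy clause, applicable because generators are stable under
degeneracies. All other operators involving dimension `n` factor through these. -/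
theorem natural_of_lt [Fact p.Prime] {n : ℕ} (hE : ∀ a, a < n + 1 → D.Exists a)
    (hN : ∀ a b, a < n → b < n → D.Natural a b) :
    ∀ a b, a < n + 1 → b < n + 1 → D.Natural a b := by
  have h1 : ∀ a, a < n → D.Natural a n := fun a ha θ k z =>
    natural_of_generators (hE a (by omega)) (hE n (by omega)) θ k (fun z hz => by
      obtain ⟨φ, h1, h2⟩ := exists_algHom (hE n (by omega)) k
      rw [h1]
      exact (h2 z hz).face a ha θ) z
  have h2 : ∀ m, n = m + 1 → ∀ (i : Fin (m + 1)) (k : K _⦋m⦌) (z : (lv P m).carrier),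
      (eop Q (σ i)).toAlgHom (D.fn m k z) = D.fn (m + 1) (kop K (σ i) k)
        ((eop P (σ i)).toAlgHom z) := by
    rintro m rfl i k z
    refine natural_of_generators (hE (m + 1) (by omega)) (hE m (by omega)) (σ i) k
      (fun z hz => ?_) z
    obtain ⟨φ, h1, h2⟩ := exists_algHom (hE (m + 1) (by omega)) (kop K (σ i) k)
    rw [h1]
    exact ((h2 _ (D.degen m i z hz)).degeneracy m (by omega) (σ i) (δ i.castSucc) k z
      δ_comp_σ_self rfl rfl).symm
  have h3 : ∀ b, b < n → D.Natural n b := by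
    intro b hb θ k z
    obtain ⟨m, rfl⟩ : ∃ m, n = m + 1 := ⟨n - 1, by omega⟩
    obtain ⟨i, θ', rfl⟩ := eq_σ_comp_of_not_injective θ (fun hs => by
      have := Fintype.card_le_of_injective _ hs
      simp at this
      omega)
    rw [eop_comp, hN m b (by omega) hb, h2 m rfl, eop_comp, kop_comp]
  intro a b ha hb
  rcases Nat.lt_succ_iff_lt_or_eq.1 ha with ha | rfl <;>
    rcases Nat.lt_succ_iff_lt_or_eq.1 hb with hb | rfl
  · exact hN a b ha hb
  · exact h1 a ha
  · exact h3 b hb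
  · intro θ k z
    -- An injective monotone endomap of `[n]` is the identity; any other endomap factors through
    -- some `σ i`.
    by_cases hθ : Function.Injective (SimplexCategory.Hom.toOrderHom θ)
    · have : Mono θ := SimplexCategory.mono_iff_injective.2 hθ
      rw [SimplexCategory.eq_id_of_mono θ, eop_id, eop_id, kop_id]
    · obtain _ | m := b
      · exact absurd (fun x y _ => Subsingleton.elim (α := Fin 1) x y) hθ
      · obtain ⟨i, θ', rfl⟩ := eq_σ_comp_of_not_injective θ hθ
        rw [eop_comp, h1 m (by omega), h2 m rfl, eop_comp, kop_comp]

variable (D) in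
theorem exists_and_natural [Fact p.Prime] (n : ℕ) :
    (∀ a, a < n → D.Exists a) ∧ ∀ a b, a < n → b < n → D.Natural a b := by
  induction n with
  | zero => exact ⟨fun a h => absurd h (by omega), fun a b h => absurd h (by omega)⟩
  | succ n ih =>
    have hE : ∀ a, a < n + 1 → D.Exists a := fun a ha => by
      rcases Nat.lt_succ_iff_lt_or_eq.1 ha with ha | rfl
      · exact ih.1 a ha
      · exact exists_of_lt ih.1 ih.2
    exact ⟨hE, natural_of_lt hE ih.2⟩

variable (D) in
/-- Every relative lifting problem has a solution. -/
theorem exists_solution [Fact p.Prime] :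
    ∃ H : ∀ (n : ℕ), K _⦋n⦌ → EvenAlg.Hom (lv P n) (lv Q n),
      (∀ (a b : ℕ) (θ : SimplexCategory.mk a ⟶ SimplexCategory.mk b) (k : K _⦋b⦌)
        (z : (lv P b).carrier), (eop Q θ).toAlgHom ((H b k).toAlgHom z) =
          (H a (kop K θ k)).toAlgHom ((eop P θ).toAlgHom z)) ∧
      (∀ (n : ℕ) (k : K _⦋n⦌) (z : (lv P n).carrier),
        (aug εQ n).toAlgHom ((H n k).toAlgHom z) = (aug εP n).toAlgHom z) ∧
      ∀ (n : ℕ) (k : K _⦋n⦌) (hk : k ∈ D.L n), H n k = D.G n k hk := by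
  choose H h1 h2 h3 _ using fun (n : ℕ) (k : K _⦋n⦌) =>
    exists_hom ((D.exists_and_natural (n + 1)).1 n (by omega)) k
  refine ⟨H, fun a b θ k z => ?_, h3, h2⟩
  rw [← h1, ← h1]
  exact (D.exists_and_natural (max a b + 1)).2 a b (by omega) (by omega) θ k z

end LiftProblem

end Lifting

/-! ### Maps of almost free resolutions and homotopy invariance -/

section Invariance

open SimplexCategory Simplicial

variable {p : ℕ}

theorem Omega.map_el {A B : Type} [CommRing A] [Algebra (ZMod p) A] [CommRing B]
    [Algebra (ZMod p) B] (f : A →ₐ[ZMod p] B) (a : A) :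
    Omega.map p f (Omega.el p a) = Omega.el p (f a) :=
  Omega.lift_el p _ _ a

theorem Omega.map_d {A B : Type} [CommRing A] [Algebra (ZMod p) A] [CommRing B]
    [Algebra (ZMod p) B] (f : A →ₐ[ZMod p] B) (a : A) :
    Omega.map p f (Omega.d p a) = Omega.d p (f a) :=
  Omega.lift_d p _ _ a

theorem Omega.map_comp_apply {A B C : Type} [CommRing A] [Algebra (ZMod p) A] [CommRing B]
    [Algebra (ZMod p) B] [CommRing C] [Algebra (ZMod p) C] (g : B →ₐ[ZMod p] C)
    (f : A →ₐ[ZMod p] B) (w : Omega p A) :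
    Omega.map p (g.comp f) w = Omega.map p g (Omega.map p f w) := by
  have : Omega.map p (g.comp f) = (Omega.map p g).comp (Omega.map p f) :=
    Omega.algHom_ext p (fun a => by simp [Omega.map_el]) fun a => by simp [Omega.map_d]
  rw [this]; rfl

theorem Omega.map_id_apply {A : Type} [CommRing A] [Algebra (ZMod p) A] (w : Omega p A) :
    Omega.map p (AlgHom.id (ZMod p) A) w = w := by
  have : Omega.map p (AlgHom.id (ZMod p) A) = AlgHom.id _ _ :=
    Omega.algHom_ext p (fun a => by simp [Omega.map_el]) fun a => by simp [Omega.map_d]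
  rw [this]; rfl

/-- The component of a simplicial map in degree `n`. -/
def comp {P Q : SimplicialObject (EvenAlg p)} (f : P ⟶ Q) (n : ℕ) :
    EvenAlg.Hom (lv P n) (lv Q n) :=
  f.app (Opposite.op (SimplexCategory.mk n))

theorem eop_comp_apply {P Q : SimplicialObject (EvenAlg p)} (f : P ⟶ Q) {a b : ℕ}
    (θ : SimplexCategory.mk a ⟶ SimplexCategory.mk b) (z : (lv P b).carrier) :
    (eop Q θ).toAlgHom ((comp f b).toAlgHom z) = (comp f a).toAlgHom ((eop P θ).toAlgHom z) :=
  DFunLike.congr_fun (congrArg EvenAlg.Hom.toAlgHom (f.naturality θ.op).symm) z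

theorem aug_comp_apply {A : EvenAlg p} {P Q : SimplicialObject (EvenAlg p)}
    {εP : P ⟶ (SimplicialObject.const (EvenAlg p)).obj A}
    {εQ : Q ⟶ (SimplicialObject.const (EvenAlg p)).obj A} {f : P ⟶ Q} (hf : f ≫ εQ = εP)
    (n : ℕ) (z : (lv P n).carrier) :
    (aug εQ n).toAlgHom ((comp f n).toAlgHom z) = (aug εP n).toAlgHom z := by
  subst hf; rfl

/-- The simplicial set with a single simplex in each dimension. -/
def pointSet : SSet.{0} where
  obj _ := Unit
  map _ := TypeCat.ofHom fun k => k

/-- The simplicial set of monotone maps `[n] → [1]`. -/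
def intervalSet : SSet.{0} where
  obj n := Fin (n.unop.len + 1) →o Fin 2
  map θ := TypeCat.ofHom fun k => k.comp (SimplexCategory.Hom.toOrderHom θ.unop)

/-- The values of a simplex of `intervalSet`. -/
def intervalSet.val {n : ℕ} (k : intervalSet _⦋n⦌) (i : Fin (n + 1)) : Fin 2 :=
  (show Fin (n + 1) →o Fin 2 from k) i

/-- The absolute lifting problem: the parameter set is a point and nothing is prescribed. -/
theorem exists_map_of_isAlmostFreeResolution [Fact p.Prime] {A : EvenAlg p}
    {P Q : SimplicialObject (EvenAlg p)}
    {εP : P ⟶ (SimplicialObject.const (EvenAlg p)).obj A}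
    {εQ : Q ⟶ (SimplicialObject.const (EvenAlg p)).obj A}
    (hP : IsAlmostFreeResolution P εP) (hQ : IsAlmostFreeResolution Q εQ) :
    ∃ f : P ⟶ Q, f ≫ εQ = εP := by
  obtain ⟨X, hX, hσ⟩ := hP.almostFree
  obtain ⟨H, h1, h2, -⟩ := LiftProblem.exists_solution (εP := εP) (εQ := εQ) (K := pointSet)
    { X := X, free := hX, degen := hσ, acyclic := hQ
      L := fun _ => ∅
      L_map := fun _ _ h => h.elim
      G := fun _ _ h => h.elim
      G_natural := fun _ _ h => h.elim
      G_aug := fun _ _ h => h.elim }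
  refine ⟨{ app := fun n => H n.unop.len (), naturality := fun a b θ => ?_ }, ?_⟩
  · refine EvenAlg.Hom.ext (AlgHom.ext fun z => ?_)
    exact (h1 _ _ θ.unop () z).symm
  · ext n
    refine EvenAlg.Hom.ext (AlgHom.ext fun z => ?_)
    exact h2 n.unop.len () z

/-- The homotopy of simplicial modules induced by a natural family of algebra maps. -/
def omegaHomotopy {P Q : SimplicialObject (EvenAlg p)}
    (H : ∀ n : ℕ, (Fin (n + 1) →o Fin 2) → EvenAlg.Hom (lv P n) (lv Q n))
    (hH : ∀ (a b : ℕ) (θ : SimplexCategory.mk a ⟶ SimplexCategory.mk b)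
      (k : Fin (b + 1) →o Fin 2) (z : (lv P b).carrier),
      (eop Q θ).toAlgHom ((H b k).toAlgHom z) =
        (H a (k.comp (SimplexCategory.Hom.toOrderHom θ))).toAlgHom ((eop P θ).toAlgHom z)) :
    LinHomotopy (omegaSimp P) (omegaSimp Q) where
  toFun n s := (Omega.map p (H n s).toAlgHom).toLinearMap
  natural {a b} θ s v := by
    refine (Omega.map_comp_apply (eop Q θ).toAlgHom (H b s).toAlgHom v).symm.trans
      (Eq.trans ?_ (Omega.map_comp_apply (H a _).toAlgHom (eop P θ).toAlgHom v))
    congr 2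
    exact AlgHom.ext fun z => hH a b θ s z

/-- Two maps of almost free resolutions over `A` agree on the homotopy of `Ω̄`. -/
theorem omega_map_sub_mem_boundaries [Fact p.Prime] {A : EvenAlg p}
    {P Q : SimplicialObject (EvenAlg p)}
    {εP : P ⟶ (SimplicialObject.const (EvenAlg p)).obj A}
    {εQ : Q ⟶ (SimplicialObject.const (EvenAlg p)).obj A}
    (hP : IsAlmostFreeResolution P εP) (hQ : IsAlmostFreeResolution Q εQ)
    {f g : P ⟶ Q} (hf : f ≫ εQ = εP) (hg : g ≫ εQ = εP) {n : ℕ} {u : alv (omegaSimp P) n}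
    (hu : u ∈ cycles (omegaSimp P) n) :
    Omega.map p (comp f n).toAlgHom u - Omega.map p (comp g n).toAlgHom u ∈
      boundaries (omegaSimp Q) n := by
  classical
  obtain ⟨X, hX, hσ⟩ := hP.almostFree
  have hGa : ∀ (n : ℕ) (c : Prop) [Decidable c] (z : (lv P n).carrier),
      (aug εQ n).toAlgHom ((if c then comp g n else comp f n).toAlgHom z) =
        (aug εP n).toAlgHom z := by
    intro n c _ z
    split_ifs
    · exact aug_comp_apply hg n z
    · exact aug_comp_apply hf n z
  -- The parameters are the simplices of `Δ[1]`; the prescribed part consists of the constant maps,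
  -- that is, the two endpoints, with `g` at `0` and `f` at `1`.
  obtain ⟨H, h1, -, h3⟩ := LiftProblem.exists_solution (εP := εP) (εQ := εQ) (K := intervalSet)
    { X := X, free := hX, degen := hσ, acyclic := hQ
      L := fun n => {k | ∀ i, intervalSet.val k i = intervalSet.val k 0}
      L_map := fun {a b} θ k hk i => (hk (SimplexCategory.Hom.toOrderHom θ i)).trans (hk _).symm
      G := fun n k _ => if intervalSet.val k 0 = 0 then comp g n else comp f n
      G_natural := fun {a b} θ k hk z => by
        have e : intervalSet.val k 0 = intervalSet.val (kop intervalSet θ k) 0 := (hk _).symm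
        rw [← e]
        split_ifs
        · exact eop_comp_apply g θ z
        · exact eop_comp_apply f θ z
      G_aug := fun n k _ z => hGa n _ z }
  have h4 := (omegaHomotopy (P := P) (Q := Q) H h1).sub_mem_boundaries hu
  -- The step function with no zeros is constantly `1`; the one with `n+1` zeros is constantly `0`.
  have e0 : H n (step n 0) = comp f n := h3 n (step n 0) fun i => rfl
  have e1 : H n (step n (n + 1)) = comp g n := h3 n (step n (n + 1)) fun i => by
    change (if i.val < n + 1 then (0 : Fin 2) else 1) = if 0 < n + 1 then (0 : Fin 2) else 1
    rw [if_pos i.isLt, if_pos (Nat.succ_pos n)]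
  change Omega.map p (H n (step n 0)).toAlgHom u -
    Omega.map p (H n (step n (n + 1))).toAlgHom u ∈ _ at h4
  rwa [e0, e1] at h4

end Invariance

/-! ### The resolution of a truncated polynomial algebra -/

section Resolution

open SimplexCategory MvPolynomial

variable (p r : ℕ)

/-- The number of elements that a monotone map sends below `j`. -/
def cut {a b : ℕ} (θ : Fin (a + 1) →o Fin (b + 1)) (j : ℕ) : ℕ :=
  (Finset.univ.filter fun k => (θ k).val < j).card

/-- Monotonicity makes `{k | θ k < j}` an initial segment, so its cardinality determines it. This
adjunction-like property characterizes `cut` and yields its contravariant functoriality. -/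
theorem lt_cut_iff {a b : ℕ} (θ : Fin (a + 1) →o Fin (b + 1)) (j : ℕ) (l : Fin (a + 1)) :
    l.val < cut θ j ↔ (θ l).val < j := by
  constructor
  · intro h
    by_contra h'
    have hs : (Finset.univ.filter fun k => (θ k).val < j) ⊆
        Finset.univ.filter fun k : Fin (a + 1) => k.val < l.val := by
      intro k hk
      simp only [Finset.mem_filter, Finset.mem_univ, true_and] at hk ⊢
      by_contra hlt
      have : θ l ≤ θ k := θ.monotone (not_lt.1 hlt)
      exact h' (lt_of_le_of_lt this hk)
    have := Finset.card_le_card hs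
    rw [Fin.card_filter_val_lt] at this
    have : cut θ j ≤ min (a + 1) l.val := this
    omega
  · intro h
    have hs : (Finset.univ.filter fun k : Fin (a + 1) => k.val < l.val + 1) ⊆
        Finset.univ.filter fun k => (θ k).val < j := by
      intro k hk
      simp only [Finset.mem_filter, Finset.mem_univ, true_and] at hk ⊢
      have : θ k ≤ θ l := θ.monotone (Nat.lt_succ_iff.1 hk)
      exact lt_of_le_of_lt this h
    have := Finset.card_le_card hs
    rw [Fin.card_filter_val_lt] at this
    have : min (a + 1) (l.val + 1) ≤ cut θ j := this
    have := l.isLt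
    omega

theorem cut_le {a b : ℕ} (θ : Fin (a + 1) →o Fin (b + 1)) (j : ℕ) : cut θ j ≤ a + 1 :=
  (Finset.card_filter_le _ _).trans (by simp)

theorem cut_eq_of_forall {a b : ℕ} (θ : Fin (a + 1) →o Fin (b + 1)) (j c : ℕ) (hc : c ≤ a + 1)
    (h : ∀ l : Fin (a + 1), l.val < c ↔ (θ l).val < j) : cut θ j = c := by
  have h1 : ∀ l : Fin (a + 1), l.val < cut θ j ↔ l.val < c := fun l => by
    rw [lt_cut_iff, h]
  have h2 := cut_le θ j
  by_contra hne
  rcases Nat.lt_or_gt_of_ne hne with hlt | hlt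
  · exact absurd ((h1 ⟨cut θ j, by omega⟩).2 hlt) (lt_irrefl _)
  · exact absurd ((h1 ⟨c, by omega⟩).1 hlt) (lt_irrefl _)

theorem cut_comp {a b c : ℕ} (θ : Fin (a + 1) →o Fin (b + 1)) (φ : Fin (b + 1) →o Fin (c + 1))
    (j : ℕ) : cut (φ.comp θ) j = cut θ (cut φ j) :=
  (cut_eq_of_forall θ _ _ (cut_le _ _) fun l => by
    rw [lt_cut_iff, lt_cut_iff]; rfl).symm

theorem cut_mono {a b : ℕ} (θ : Fin (a + 1) →o Fin (b + 1)) : Monotone (cut θ) :=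
  fun _ _ h => Finset.card_le_card fun k hk => by
    simp only [Finset.mem_filter, Finset.mem_univ, true_and] at hk ⊢
    exact lt_of_lt_of_le hk h

theorem cut_zero {a b : ℕ} (θ : Fin (a + 1) →o Fin (b + 1)) : cut θ 0 = 0 := by
  simp [cut]

theorem cut_of_lt {a b : ℕ} (θ : Fin (a + 1) →o Fin (b + 1)) (j : ℕ) (hj : b < j) :
    cut θ j = a + 1 :=
  cut_eq_of_forall θ _ _ le_rfl fun l => by
    have := (θ l).isLt
    constructor <;> intro _ <;> omega

theorem cut_step {n i : ℕ} (hi : i ≤ n + 1) : cut (step n i) 1 = i := by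
  refine cut_eq_of_forall _ _ _ hi fun l => ?_
  change l.val < i ↔ (if l.val < i then (0 : Fin 2) else 1).val < 1
  split_ifs with h <;> simp [h]

variable [Fact p.Prime]

theorem resHom_resY {a b : ℕ} (θ : Fin (a + 1) →o Fin (b + 1)) (j : ℕ) :
    resHom p r θ (resY p r b j) = resY p r a (cut θ j) :=
  resVal_y p r θ j

theorem resHom_X_none {a b : ℕ} (θ : Fin (a + 1) →o Fin (b + 1)) :
    resHom p r θ (X none) = X none := by
  rw [resHom, aeval_X]; rfl

theorem resY_zero (q : ℕ) : resY p r q 0 = X none ^ (r + 1) := rfl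

theorem resY_succ {q : ℕ} (j : Fin q) : resY p r q (j.val + 1) = X (some j) := by
  rw [resY, if_neg (by omega), dif_pos (by simp)]
  rfl

theorem resY_of_lt {q j : ℕ} (h : q < j) : resY p r q j = 0 := by
  rw [resY, if_neg (by omega), dif_neg (by omega)]

variable {p r} in
/-- Every element of `R_q` is a combination of products of the `y_j` and one `x^a`, `a ≤ r`. -/
theorem res_induction {q : ℕ} {C : MvPolynomial (Option (Fin q)) (ZMod p) → Prop}
    (add : ∀ f g, C f → C g → C (f + g)) (smul : ∀ (c : ZMod p) f, C f → C (c • f))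
    (pow : ∀ a, a ≤ r → C (X none ^ a)) (mul : ∀ f j, C f → C (f * resY p r q j))
    (f : MvPolynomial (Option (Fin q)) (ZMod p)) : C f := by
  have hpow : ∀ j n f, C f → C (f * resY p r q j ^ n) := by
    intro j n
    induction n with
    | zero => intro f hf; simpa using hf
    | succ n ih => intro f hf; rw [pow_succ, ← mul_assoc]; exact mul _ _ (ih f hf)
  have hprod : ∀ (s : Finset (Fin q)) (e : Fin q → ℕ) f, C f →
      C (f * ∏ j ∈ s, resY p r q (j.val + 1) ^ e j) := by
    intro s e
    induction s using Finset.induction_on with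
    | empty => intro f hf; simpa using hf
    | insert j s hj ih =>
      intro f hf
      rw [Finset.prod_insert hj, ← mul_assoc]
      exact ih _ (hpow _ _ _ hf)
  induction f using MvPolynomial.induction_on' with
  | monomial m c =>
    -- Division with remainder of the exponent of `x` by `r+1`: the quotient becomes a power of `y_0
    -- = x^{r+1}` and the remainder is at most `r`.
    have e : (monomial m c : MvPolynomial (Option (Fin q)) (ZMod p)) =
        c • ((X none ^ (m none % (r + 1)) * resY p r q 0 ^ (m none / (r + 1))) *
          ∏ j : Fin q, resY p r q (j.val + 1) ^ m (some j)) := by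
      rw [resY_zero, ← pow_mul, ← pow_add, Nat.mod_add_div, monomial_eq,
        Finsupp.prod_fintype _ _ (fun i => pow_zero _), Fintype.prod_option, smul_eq_C_mul]
      simp only [resY_succ]
    rw [e]
    exact smul _ _ (hprod _ _ _ (hpow _ _ _ (pow _ (Nat.lt_succ_iff.1 (Nat.mod_lt _ r.succ_pos)))))
  | add f g hf hg => exact add f g hf hg

/-- The linear endomorphism of `R_q` that sends `x^a ∏ y_j^{n_j}` with `a ≤ r`, where `j` runs from
`0` to `q`, to `x^a ∏ y_{max(i,j)}^{n_j}`. -/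
def contraction (q i : ℕ) :
    MvPolynomial (Option (Fin q)) (ZMod p) →ₗ[ZMod p] MvPolynomial (Option (Fin q)) (ZMod p) :=
  (basisMonomials (Option (Fin q)) (ZMod p)).constr (ZMod p) fun m =>
    X none ^ (m none % (r + 1)) * resY p r q i ^ (m none / (r + 1)) *
      ∏ j : Fin q, resY p r q (max i (j.val + 1)) ^ m (some j)

theorem contraction_monomial (q i : ℕ) (m : Option (Fin q) →₀ ℕ) (c : ZMod p) :
    contraction p r q i (monomial m c) = c • (X none ^ (m none % (r + 1)) *
      resY p r q i ^ (m none / (r + 1)) *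
      ∏ j : Fin q, resY p r q (max i (j.val + 1)) ^ m (some j)) := by
  have : (monomial m c : MvPolynomial (Option (Fin q)) (ZMod p)) =
      c • basisMonomials (Option (Fin q)) (ZMod p) m := by
    rw [coe_basisMonomials, smul_monomial, smul_eq_mul, mul_one]
  rw [this, map_smul, contraction, Module.Basis.constr_basis]

theorem contraction_pow (q i a : ℕ) (ha : a ≤ r) :
    contraction p r q i (X none ^ a) = X none ^ a := by
  rw [X_pow_eq_monomial, contraction_monomial]
  simp [Nat.mod_eq_of_lt (Nat.lt_succ_of_le ha), Nat.div_eq_of_lt (Nat.lt_succ_of_le ha),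
    X_pow_eq_monomial]

/-- The point of the normal form is that `y_0` behaves like every other `y_j`: multiplying by it
adds `r+1` to the exponent of `x`, which changes the quotient by one and leaves the remainder alone.
This rule and the values on `x^a`, `a ≤ r`, determine the operator. -/
theorem contraction_mul (q i : ℕ) (f : MvPolynomial (Option (Fin q)) (ZMod p)) (j : ℕ) :
    contraction p r q i (f * resY p r q j) = contraction p r q i f * resY p r q (max i j) := by
  induction f using MvPolynomial.induction_on' with
  | add f g hf hg => rw [add_mul, map_add, hf, hg, map_add, add_mul]
  | monomial m c =>
    rcases Nat.eq_zero_or_pos j with rfl | hj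
    · rw [resY_zero, X_pow_eq_monomial, monomial_mul, contraction_monomial, contraction_monomial]
      simp [Nat.add_div_right, pow_succ]
      ring_nf
    · rcases lt_or_ge q j with hq | hq
      · rw [resY_of_lt p r hq, resY_of_lt p r (lt_of_lt_of_le hq (le_max_right i j)), mul_zero,
          mul_zero, map_zero]
      · obtain ⟨l, rfl⟩ : ∃ l : Fin q, j = l.val + 1 := ⟨⟨j - 1, by omega⟩, by simp; omega⟩
        rw [resY_succ, X, monomial_mul, contraction_monomial, contraction_monomial]
        have : ∏ k : Fin q, resY p r q (max i (k.val + 1)) ^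
            ((m + Finsupp.single (some l) 1 : Option (Fin q) →₀ ℕ) (some k)) =
            (∏ k : Fin q, resY p r q (max i (k.val + 1)) ^ m (some k)) *
              resY p r q (max i (l.val + 1)) := by
          simp only [Finsupp.add_apply, pow_add, Finset.prod_mul_distrib]
          congr 1
          rw [Finset.prod_eq_single l]
          · simp
          · intro k _ hk
            rw [Finsupp.single_apply, if_neg (by simpa using hk.symm), pow_zero]
          · simp
        rw [this]
        simp
        ring_nf

/-- Operators act on the indices of the `y_j` through the monotone function `cut θ`, and monotone
functions commute with `max`. This is the naturality that makes the family a simplicial homotopy,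
running from the identity at `i = 0` to the projection at `i = q+1`. -/
theorem resHom_contraction {a b : ℕ} (θ : Fin (a + 1) →o Fin (b + 1)) (i : ℕ)
    (f : MvPolynomial (Option (Fin b)) (ZMod p)) :
    resHom p r θ (contraction p r b i f) = contraction p r a (cut θ i) (resHom p r θ f) := by
  induction f using res_induction (r := r) with
  | add f g hf hg => simp only [map_add, hf, hg]
  | smul c f hf => simp only [map_smul, hf]
  | pow n hn => rw [contraction_pow p r _ _ _ hn, map_pow, resHom_X_none, contraction_pow p r _ _ _ hn]
  | mul f j hf =>
    rw [contraction_mul, map_mul, hf, map_mul, resHom_resY, resHom_resY, contraction_mul,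
      (cut_mono θ).map_max]

theorem contraction_zero (q : ℕ) (f : MvPolynomial (Option (Fin q)) (ZMod p)) :
    contraction p r q 0 f = f := by
  induction f using res_induction (r := r) with
  | add f g hf hg => rw [map_add, hf, hg]
  | smul c f hf => rw [map_smul, hf]
  | pow n hn => rw [contraction_pow p r _ _ _ hn]
  | mul f j hf => rw [contraction_mul, hf, Nat.zero_max]

theorem resAugHom_resY (q j : ℕ) : resAugHom p r q (resY p r q j) = 0 := by
  rw [resY]
  split_ifs
  · rw [map_pow, resAugHom, aeval_X]
    exact TruncPoly.x_pow
  · rw [resAugHom, aeval_X]; rfl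
  · exact map_zero _

theorem resAugHom_X_none (q : ℕ) : resAugHom p r q (X none) = TruncPoly.x p r := by
  rw [resAugHom, aeval_X]; rfl

theorem resAugHom_resHom {a b : ℕ} (θ : Fin (a + 1) →o Fin (b + 1))
    (f : MvPolynomial (Option (Fin b)) (ZMod p)) :
    resAugHom p r a (resHom p r θ f) = resAugHom p r b f :=
  DFunLike.congr_fun (resAugHom_comp p r θ) f

theorem resAugHom_surjective (q : ℕ) : Function.Surjective (resAugHom p r q) := by
  intro z
  obtain ⟨f, rfl⟩ := Ideal.Quotient.mk_surjective z
  refine ⟨Polynomial.aeval (X none) f, ?_⟩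
  rw [← Polynomial.aeval_algHom_apply, resAugHom_X_none]
  have h : (Ideal.Quotient.mkₐ (ZMod p) (Ideal.span {(Polynomial.X : Polynomial (ZMod p)) ^ (r + 1)})) =
      Polynomial.aeval (TruncPoly.x p r) := Polynomial.algHom_ext (by simp [TruncPoly.x])
  exact (DFunLike.congr_fun h f).symm

/-- At `i = q+1` every `y_j`, including `y_0`, is replaced by `y_{q+1} = 0`. What remains sets the
variables `y_j` to zero and takes the remainder modulo `x^{r+1}`, so it depends only on the image in
`A`. -/
theorem contraction_eq_zero {q : ℕ} {f : MvPolynomial (Option (Fin q)) (ZMod p)}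
    (hf : resAugHom p r q f = 0) : contraction p r q (q + 1) f = 0 := by
  set ρ : MvPolynomial (Option (Fin q)) (ZMod p) →ₐ[ZMod p] Polynomial (ZMod p) :=
    aeval fun i => i.elim Polynomial.X fun _ => 0
  have hρX : ρ (X none) = Polynomial.X := by
    rw [aeval_X]; rfl
  have h1 : ∀ g, resAugHom p r q g = Ideal.Quotient.mk _ (ρ g) := by
    intro g
    have : resAugHom p r q = (Ideal.Quotient.mkₐ (ZMod p) _).comp ρ := by
      refine MvPolynomial.algHom_ext fun i => ?_
      rw [AlgHom.comp_apply, resAugHom, aeval_X, aeval_X]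
      cases i
      · rfl
      · exact (map_zero _).symm
    rw [this]; rfl
  have hmonic : (Polynomial.X ^ (r + 1) : Polynomial (ZMod p)).Monic := Polynomial.monic_X_pow _
  have h2 : ∀ g, contraction p r q (q + 1) g =
      Polynomial.aeval (X none) (ρ g %ₘ Polynomial.X ^ (r + 1)) := by
    intro g
    induction g using res_induction (r := r) with
    | add f g hf hg => rw [map_add, hf, hg, map_add, Polynomial.add_modByMonic, map_add]
    | smul c f hf => rw [map_smul, hf, map_smul, Polynomial.smul_modByMonic, map_smul]
    | pow n hn =>
      rw [contraction_pow p r _ _ _ hn, map_pow, hρX, (Polynomial.modByMonic_eq_self_iff hmonic).2]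
      · simp
      · rw [Polynomial.degree_X_pow, Polynomial.degree_X_pow]
        exact_mod_cast Nat.lt_succ_of_le hn
    | mul f j hf =>
      rw [contraction_mul, resY_of_lt p r (lt_of_lt_of_le q.lt_succ_self (le_max_left _ _)),
        mul_zero, map_mul]
      have : Polynomial.X ^ (r + 1) ∣ ρ (resY p r q j) := by
        rw [← Ideal.mem_span_singleton, ← Ideal.Quotient.eq_zero_iff_mem, ← h1, resAugHom_resY]
      rw [(Polynomial.modByMonic_eq_zero_iff_dvd hmonic).2 (this.mul_left _), map_zero]
  rw [h2, (Polynomial.modByMonic_eq_zero_iff_dvd hmonic).2, map_zero]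
  rw [← Ideal.mem_span_singleton, ← Ideal.Quotient.eq_zero_iff_mem, ← h1, hf]

/-- Stated as a factorization through `A`, the vanishing survives tensoring with an exterior
algebra; this is the form needed for `mem_boundaries_untw`. -/
theorem exists_section (q : ℕ) :
    ∃ s : TruncPoly p r →ₗ[ZMod p] MvPolynomial (Option (Fin q)) (ZMod p),
      s ∘ₗ (resAugHom p r q).toLinearMap = contraction p r q (q + 1) := by
  refine ⟨(LinearMap.ker (resAugHom p r q).toLinearMap).liftQ (contraction p r q (q + 1))
    (fun f hf => contraction_eq_zero p r hf) ∘ₗ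
    ((resAugHom p r q).toLinearMap.quotKerEquivOfSurjective
      (resAugHom_surjective p r q)).symm.toLinearMap, LinearMap.ext fun f => ?_⟩
  have : ((resAugHom p r q).toLinearMap.quotKerEquivOfSurjective
      (resAugHom_surjective p r q)).symm (resAugHom p r q f) =
      (LinearMap.ker (resAugHom p r q).toLinearMap).mkQ f := by
    rw [LinearEquiv.symm_apply_eq]
    rfl
  simp only [LinearMap.comp_apply, LinearEquiv.coe_coe, AlgHom.toLinearMap_apply, this]
  exact Submodule.liftQ_apply _ _ _

variable {p r}
variable {N : ℕ} (hN : 0 < N) (hE : Even N)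

/-- The contraction of `R_•` onto `A`. -/
def resHomotopy : LinHomotopy (forgetSimp (res p r hN hE)) (forgetSimp (res p r hN hE)) where
  toFun n s := contraction p r n (cut s 1)
  natural {a b} θ s v := by
    change resHom p r (SimplexCategory.Hom.toOrderHom θ) (contraction p r b (cut s 1) v) =
      contraction p r a (cut (s.comp (SimplexCategory.Hom.toOrderHom θ)) 1)
        (resHom p r (SimplexCategory.Hom.toOrderHom θ) v)
    rw [cut_comp]
    exact resHom_contraction p r _ _ _

theorem mem_boundaries_res {q : ℕ} {z : alv (forgetSimp (res p r hN hE)) q}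
    (hz : z ∈ cycles (forgetSimp (res p r hN hE)) q) (h0 : resAugHom p r q z = 0) :
    z ∈ boundaries (forgetSimp (res p r hN hE)) q := by
  have h := (resHomotopy hN hE).sub_mem_boundaries hz
  have e0 : (resHomotopy hN hE).toFun q (step q 0) z = z := by
    change contraction p r q (cut (step q 0) 1) z = z
    rw [cut_step (Nat.zero_le _)]
    exact contraction_zero p r q z
  have e1 : (resHomotopy hN hE).toFun q (step q (q + 1)) z = 0 := by
    change contraction p r q (cut (step q (q + 1)) 1) z = 0
    rw [cut_step le_rfl]
    exact contraction_eq_zero p r h0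
  rwa [e0, e1, sub_zero] at h

theorem isFreeOn_resObj (q : ℕ) :
    (resObj p r hN hE q).IsFreeOn (Set.range (X : Option (Fin q) →
      MvPolynomial (Option (Fin q)) (ZMod p))) := by
  set e : Option (Fin q) → Set.range (X : Option (Fin q) →
      MvPolynomial (Option (Fin q)) (ZMod p)) := fun i => ⟨X i, i, rfl⟩
  set π := MvPolynomial.aeval (R := ZMod p) (Subtype.val : Set.range (X : Option (Fin q) →
      MvPolynomial (Option (Fin q)) (ZMod p)) → _)
  have h1 : ∀ f, π (rename e f) = f := by
    intro f
    have : π.comp (rename e) = AlgHom.id _ _ := MvPolynomial.algHom_ext fun i => by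
      simp [π, e]
    exact DFunLike.congr_fun this f
  have h2 : ∀ f, rename e (π f) = f := by
    intro f
    have : (rename e).comp π = AlgHom.id _ _ := MvPolynomial.algHom_ext fun i => by
      obtain ⟨_, j, rfl⟩ := i
      simp [π, e]
    exact DFunLike.congr_fun this f
  refine ⟨?_, fun f => ⟨rename e f, h1 f⟩, ?_⟩
  · rintro _ ⟨i, rfl⟩
    exact ⟨resWeight r N q i, isWeightedHomogeneous_X (ZMod p) (resWeight r N q) i⟩
  -- All weights are positive, so there are no generators of degree zero and no relations `z^p = z`.
  · have hemp : {f : MvPolynomial (Set.range (X : Option (Fin q) →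
        MvPolynomial (Option (Fin q)) (ZMod p))) (ZMod p) | ∃ z : Set.range (X : Option (Fin q) →
        MvPolynomial (Option (Fin q)) (ZMod p)), z.1 ∈ (resObj p r hN hE q).gr 0 ∧
          f = X z ^ p - X z} = ∅ := by
      refine Set.eq_empty_iff_forall_notMem.2 ?_
      rintro _ ⟨⟨_, i, rfl⟩, hz, -⟩
      exact resWeight_pos hN q i ((isWeightedHomogeneous_X (ZMod p) (resWeight r N q) i).inj_right
        (X_ne_zero i) hz)
    exact ((RingHom.injective_iff_ker_eq_bot _).1 (Function.LeftInverse.injective h2)).trans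
      (Ideal.span_empty.symm.trans (congrArg Ideal.span hemp).symm)

variable (p r) in
theorem isAlmostFreeResolution_res :
    IsAlmostFreeResolution (res p r hN hE) (resAug p r hN hE) where
  almostFree := by
    refine ⟨fun q => Set.range (X : Option (Fin q) → MvPolynomial (Option (Fin q)) (ZMod p)),
      isFreeOn_resObj hN hE, ?_⟩
    rintro q i _ ⟨k, rfl⟩
    change resHom p r (SimplexCategory.Hom.toOrderHom (σ i)) (X k) ∈ _
    cases k with
    | none => rw [resHom_X_none]; exact ⟨none, rfl⟩
    | some j =>
      rw [← resY_succ p r j, resHom_resY]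
      set c := cut (SimplexCategory.Hom.toOrderHom (σ i)) (j.val + 1)
      -- A degeneracy sends `y_{j+1}` to `y_c` with `1 ≤ c ≤ q+1`, which is again a variable,
      -- neither `y_0` nor zero.
      have h1 : 0 < c := (lt_cut_iff _ _ 0).2 (by
        change (i.predAbove 0).val < _
        simp)
      have h2 : ¬ q + 1 < c := fun h => by
        have := (lt_cut_iff (SimplexCategory.Hom.toOrderHom (σ i)) (j.val + 1)
          (Fin.last (q + 1))).1 h
        change (i.predAbove (Fin.last (q + 1))).val < j.val + 1 at this
        rw [Fin.predAbove_right_last, Fin.val_last] at this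
        omega
      exact ⟨some ⟨c - 1, by omega⟩, by rw [← resY_succ]; congr 1; simp; omega⟩
  surjective := resAugHom_surjective p r 0
  ker_eq z := by
    refine ⟨fun h => mem_boundaries_res hN hE Submodule.mem_top h, fun h => ?_⟩
    obtain ⟨w, hw, rfl⟩ := (mem_boundaries _).1 h
    have h1 : resHom p r (SimplexCategory.Hom.toOrderHom (δ (Fin.succ (0 : Fin 1)))) w = 0 :=
      (mem_normalized_succ _).1 hw 0
    refine (resAugHom_resHom p r _ _).trans ((resAugHom_resHom p r _ _).symm.trans
      ((congrArg (resAugHom p r 0) h1).trans (map_zero _)))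
  exact i := by
    refine le_antisymm (fun z hz => mem_boundaries_res hN hE hz ?_) (boundaries_le_cycles _)
    have h1 : resHom p r (SimplexCategory.Hom.toOrderHom (δ 0)) z = 0 :=
      (mem_cycles_succ _).1 hz 0
    exact (resAugHom_resHom p r _ _).symm.trans
      ((congrArg (resAugHom p r i) h1).trans (map_zero _))

end Resolution

/-! ### Exterior algebras on the generators `dy_1, …, dy_q` -/

section Exterior

open SimplexCategory

/-- The product of the `g a` for `a ∈ S` in increasing order. -/
def sortedProd {M : Type*} [Monoid M] {n : ℕ} (g : Fin n → M) (S : Finset (Fin n)) : M :=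
  ((S.sort (· ≤ ·)).map g).prod

/-! ### Ordered products of anticommuting elements -/

section SortedProd

variable {n : ℕ}

theorem sortedProd_empty {M : Type*} [Monoid M] (g : Fin n → M) : sortedProd g ∅ = 1 := by
  simp [sortedProd]

theorem sortedProd_insert {M : Type*} [Monoid M] (g : Fin n → M) {a : Fin n} {S : Finset (Fin n)}
    (h : ∀ b ∈ S, a < b) : sortedProd g (insert a S) = g a * sortedProd g S := by
  rw [sortedProd, Finset.sort_insert _ (fun b hb => (h b hb).le) fun ha => lt_irrefl _ (h a ha),
    List.map_cons, List.prod_cons, sortedProd]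

theorem sortedProd_univ {M : Type*} [Monoid M] (g : Fin n → M) :
    sortedProd g Finset.univ = (List.ofFn g).prod := by
  rw [sortedProd, Fin.sort_univ, List.ofFn_eq_map]

theorem sortedProd_eq_ofFn {M : Type*} [Monoid M] (g : Fin n → M) {S : Finset (Fin n)} {m : ℕ}
    (h : S.card = m) : sortedProd g S = (List.ofFn fun i => g (S.orderEmbOfFin h i)).prod := by
  rw [sortedProd]
  congr 1
  refine List.ext_getElem (by simp [h]) fun i h1 h2 => ?_
  simp [Finset.orderEmbOfFin_apply]

variable {k B : Type*} [CommRing k] [Ring B] [Algebra k B] {g : Fin n → B}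

/-- Moving `g a` to its place in the ordered product costs one sign for each smaller index it
passes. -/
theorem mul_sortedProd (hg : ∀ a b, g a * g b = -(g b * g a)) {a : Fin n} {S : Finset (Fin n)}
    (ha : a ∉ S) : g a * sortedProd g S =
      (-1 : k) ^ (S.filter fun b => b < a).card • sortedProd g (insert a S) := by
  induction S using Finset.induction_on_min with
  | empty =>
    rw [sortedProd_insert g (by simp)]
    simp
  | insert m S hm ih =>
    have ham : a ≠ m := fun h => ha (h ▸ Finset.mem_insert_self m S)
    have haS : a ∉ S := fun h => ha (Finset.mem_insert_of_mem h)
    rcases lt_or_gt_of_ne ham with hlt | hlt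
    · have h1 : ∀ b ∈ insert m S, a < b := by
        intro b hb
        rcases Finset.mem_insert.1 hb with rfl | hb
        · exact hlt
        · exact hlt.trans (hm b hb)
      rw [sortedProd_insert g h1, Finset.filter_false_of_mem fun b hb => (h1 b hb).not_gt]
      simp
    · have h1 : ∀ b ∈ insert a S, m < b := by
        intro b hb
        rcases Finset.mem_insert.1 hb with rfl | hb
        · exact hlt
        · exact hm b hb
      rw [Finset.insert_comm a m S, sortedProd_insert g h1, sortedProd_insert g hm,
        ← mul_assoc, hg, neg_mul, mul_assoc, ih haS, Finset.filter_insert, if_pos hlt,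
        Finset.card_insert_of_notMem fun h => lt_irrefl _ (hm m (Finset.mem_filter.1 h).1),
        pow_succ, mul_smul_comm, mul_neg_one, neg_smul]

/-- The exponent counts the pairs `(c, b)` in `M × S` with `b < c`. For `S = Mᶜ` it is exactly the
exponent `ε(μ)` in the shuffle product. -/
theorem sortedProd_mul_sortedProd (hg : ∀ a b, g a * g b = -(g b * g a)) {M S : Finset (Fin n)}
    (h : Disjoint M S) : sortedProd g M * sortedProd g S =
      (-1 : k) ^ (∑ c ∈ M, (S.filter fun b => b < c).card) • sortedProd g (M ∪ S) := by
  induction M using Finset.induction_on_min with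
  | empty => simp [sortedProd_empty]
  | insert m M hm ih =>
    rw [Finset.disjoint_insert_left] at h
    have hmM : m ∉ M := fun h => lt_irrefl _ (hm m h)
    rw [sortedProd_insert g hm, mul_assoc, ih h.2, mul_smul_comm,
      mul_sortedProd (k := k) hg (by simp [h.1, hmM]), smul_smul, ← pow_add,
      Finset.sum_insert hmM, Finset.insert_union, Finset.filter_union,
      Finset.filter_false_of_mem (s := M) fun b hb => (hm b hb).not_gt, Finset.empty_union,
      add_comm]

end SortedProd

variable (p : ℕ)

/-- The exterior algebra on `dx, dy_1, …, dy_q`. -/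
abbrev Ext (q : ℕ) : Type := ExteriorAlgebra (ZMod p) (Fin (q + 1) → ZMod p)

/-- The vector `dx`. -/
def vecX (q : ℕ) : Fin (q + 1) → ZMod p := Pi.single 0 1

/-- The vector `dy_j`, with `dy_j = 0` for `j = 0` and `j > q`. -/
def vecY (q j : ℕ) : Fin (q + 1) → ZMod p :=
  if h : 1 ≤ j ∧ j ≤ q then Pi.single ⟨j, by omega⟩ 1 else 0

theorem vecY_zero (q : ℕ) : vecY p q 0 = 0 := by
  rw [vecY, dif_neg (by omega)]

theorem vecY_of_lt {q j : ℕ} (h : q < j) : vecY p q j = 0 := by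
  rw [vecY, dif_neg (by omega)]

theorem vecY_succ {q : ℕ} (j : Fin q) : vecY p q (j.val + 1) = Pi.single j.succ 1 := by
  rw [vecY, dif_pos (by omega)]
  rfl

theorem vecY_apply_zero (q j : ℕ) : vecY p q j 0 = 0 := by
  rw [vecY]
  split_ifs with h
  · rw [Pi.single_apply, if_neg]
    intro h'
    have := congrArg Fin.val h'
    simp at this
    omega
  · rfl

theorem exists_eq_succ {q j : ℕ} (h1 : 1 ≤ j) (h2 : j ≤ q) : ∃ l : Fin q, j = l.val + 1 :=
  ⟨⟨j - 1, by omega⟩, by simp; omega⟩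

variable {p} in
theorem vec_hom_ext {M : Type*} [AddCommGroup M] [Module (ZMod p) M] {q : ℕ}
    {f g : (Fin (q + 1) → ZMod p) →ₗ[ZMod p] M} (hx : f (vecX p q) = g (vecX p q))
    (hy : ∀ j : Fin q, f (vecY p q (j.val + 1)) = g (vecY p q (j.val + 1))) : f = g := by
  refine (Pi.basisFun (ZMod p) (Fin (q + 1))).ext fun j => ?_
  rw [Pi.basisFun_apply]
  cases j using Fin.cases with
  | zero => exact hx
  | succ j => simpa only [vecY_succ] using hy j

/-- The linear map with given values on `dx` and the `dy_j`. -/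
def vecLift {M : Type*} [AddCommGroup M] [Module (ZMod p) M] (q : ℕ) (x : M) (y : ℕ → M) :
    (Fin (q + 1) → ZMod p) →ₗ[ZMod p] M :=
  (Pi.basisFun (ZMod p) (Fin (q + 1))).constr (ZMod p) (Fin.cases x fun j => y (j.val + 1))

theorem vecLift_vecX {M : Type*} [AddCommGroup M] [Module (ZMod p) M] (q : ℕ) (x : M) (y : ℕ → M) :
    vecLift p q x y (vecX p q) = x := by
  rw [vecX, ← Pi.basisFun_apply, vecLift, Module.Basis.constr_basis, Fin.cases_zero]

theorem vecLift_vecY {M : Type*} [AddCommGroup M] [Module (ZMod p) M] (q : ℕ) (x : M) (y : ℕ → M)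
    (j : Fin q) : vecLift p q x y (vecY p q (j.val + 1)) = y (j.val + 1) := by
  rw [vecY_succ, ← Pi.basisFun_apply, vecLift, Module.Basis.constr_basis, Fin.cases_succ]

theorem vecLift_mem {M : Type*} [AddCommGroup M] [Module (ZMod p) M] (q : ℕ) {x : M} {y : ℕ → M}
    (K : Submodule (ZMod p) M) (hx : x ∈ K) (hy : ∀ j, y j ∈ K) (v : Fin (q + 1) → ZMod p) :
    vecLift p q x y v ∈ K := by
  rw [vecLift, Module.Basis.constr_apply_fintype]
  refine Submodule.sum_mem _ fun i _ => Submodule.smul_mem _ _ ?_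
  cases i using Fin.cases with
  | zero => exact hx
  | succ i => exact hy _

/-- The linear map `dx ↦ dx`, `dy_j ↦ dy_{j'}` induced by a monotone map. -/
def vecHom {a b : ℕ} (θ : Fin (a + 1) →o Fin (b + 1)) :
    (Fin (b + 1) → ZMod p) →ₗ[ZMod p] (Fin (a + 1) → ZMod p) :=
  vecLift p b (vecX p a) fun j => vecY p a (cut θ j)

theorem vecHom_vecX {a b : ℕ} (θ : Fin (a + 1) →o Fin (b + 1)) :
    vecHom p θ (vecX p b) = vecX p a :=
  vecLift_vecX p b _ _

theorem vecHom_vecY {a b : ℕ} (θ : Fin (a + 1) →o Fin (b + 1)) (j : ℕ) :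
    vecHom p θ (vecY p b j) = vecY p a (cut θ j) := by
  rcases Nat.eq_zero_or_pos j with rfl | hj
  · rw [vecY_zero, map_zero, cut_zero, vecY_zero]
  · rcases lt_or_ge b j with hb | hb
    · rw [vecY_of_lt p hb, map_zero, cut_of_lt θ j hb, vecY_of_lt p (Nat.lt_succ_self a)]
    · obtain ⟨l, rfl⟩ := exists_eq_succ hj hb
      exact vecLift_vecY p b _ _ l

theorem vecHom_apply_zero {a b : ℕ} (θ : Fin (a + 1) →o Fin (b + 1)) (v : Fin (b + 1) → ZMod p) :
    vecHom p θ v 0 = v 0 := by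
  have : LinearMap.proj 0 ∘ₗ vecHom p θ = LinearMap.proj (R := ZMod p) 0 := by
    refine vec_hom_ext ?_ fun j => ?_
    · rw [LinearMap.comp_apply, vecHom_vecX]
      simp [vecX]
    · rw [LinearMap.comp_apply, vecHom_vecY]
      simp [vecY_apply_zero]
  exact LinearMap.congr_fun this v

theorem cut_id {a j : ℕ} (hj : j ≤ a + 1) : cut (OrderHom.id : Fin (a + 1) →o Fin (a + 1)) j = j :=
  cut_eq_of_forall _ _ _ hj fun _ => Iff.rfl

/-- The algebra map induced by a monotone map. -/
def extHom {a b : ℕ} (θ : Fin (a + 1) →o Fin (b + 1)) : Ext p b →ₐ[ZMod p] Ext p a :=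
  ExteriorAlgebra.map (vecHom p θ)

/-- The element `dx` of the exterior algebra. -/
def extX (q : ℕ) : Ext p q := ExteriorAlgebra.ι (ZMod p) (vecX p q)

/-- The element `dy_j` of the exterior algebra. -/
def extY (q j : ℕ) : Ext p q := ExteriorAlgebra.ι (ZMod p) (vecY p q j)

theorem extHom_extX {a b : ℕ} (θ : Fin (a + 1) →o Fin (b + 1)) :
    extHom p θ (extX p b) = extX p a := by
  rw [extX, extHom, ExteriorAlgebra.map_apply_ι, vecHom_vecX, extX]

theorem extHom_extY {a b : ℕ} (θ : Fin (a + 1) →o Fin (b + 1)) (j : ℕ) :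
    extHom p θ (extY p b j) = extY p a (cut θ j) := by
  rw [extY, extHom, ExteriorAlgebra.map_apply_ι, vecHom_vecY, extY]

theorem extY_zero (q : ℕ) : extY p q 0 = 0 := by rw [extY, vecY_zero, map_zero]

theorem extY_of_lt {q j : ℕ} (h : q < j) : extY p q j = 0 := by rw [extY, vecY_of_lt p h, map_zero]

/-- The generator `dy_{j+1}` of the exterior algebra. -/
def extGen (q : ℕ) (j : Fin q) : Ext p q := extY p q (j.val + 1)

theorem extGen_anticomm (q : ℕ) (i j : Fin q) :
    extGen p q i * extGen p q j = -(extGen p q j * extGen p q i) :=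
  eq_neg_of_add_eq_zero_left (ExteriorAlgebra.ι_add_mul_swap _ _)

theorem extGen_mul_extX (q : ℕ) (i : Fin q) :
    extGen p q i * extX p q = -(extX p q * extGen p q i) :=
  eq_neg_of_add_eq_zero_left (ExteriorAlgebra.ι_add_mul_swap _ _)

theorem extX_mul_extX (q : ℕ) : extX p q * extX p q = 0 := ExteriorAlgebra.ι_sq_zero _

theorem sortedProd_mul_extX (q : ℕ) (S : Finset (Fin q)) :
    sortedProd (extGen p q) S * extX p q =
      (-1 : ZMod p) ^ S.card • (extX p q * sortedProd (extGen p q) S) := by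
  induction S using Finset.induction_on_min with
  | empty => simp [sortedProd_empty]
  | insert m S hm ih =>
    rw [sortedProd_insert _ hm, mul_assoc, ih, mul_smul_comm, ← mul_assoc, extGen_mul_extX,
      Finset.card_insert_of_notMem fun h => lt_irrefl _ (hm m h), pow_succ, mul_neg_one, neg_smul,
      neg_mul, smul_neg, mul_assoc]

/-- The element `dy_1 ⋯ dy_q`. -/
def extTop (q : ℕ) : Ext p q := sortedProd (extGen p q) Finset.univ

theorem extTop_eq (q : ℕ) : extTop p q = (List.ofFn (extGen p q)).prod := sortedProd_univ _

/-- The `q` vectors lie in the hyperplane of vanishing zeroth coordinate, which has dimension `m <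
q`, so they are linearly dependent. -/
theorem ofFn_ι_eq_zero [Fact p.Prime] {m q : ℕ} (h : m < q) (v : Fin q → Fin (m + 1) → ZMod p)
    (hv : ∀ i, v i 0 = 0) : (List.ofFn fun i => ExteriorAlgebra.ι (ZMod p) (v i)).prod = 0 := by
  have h0 : (List.ofFn fun i => ExteriorAlgebra.ι (ZMod p) (Fin.tail (v i))).prod = 0 := by
    rw [← ExteriorAlgebra.ιMulti_apply]
    refine AlternatingMap.map_linearDependent _ _ fun hv => ?_
    have := hv.fintype_card_le_finrank
    simp at this
    omega
  set incl : (Fin m → ZMod p) →ₗ[ZMod p] (Fin (m + 1) → ZMod p) :=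
    LinearMap.pi (Fin.cases 0 fun i => LinearMap.proj i)
  have h1 : (fun i => ExteriorAlgebra.ι (ZMod p) (v i)) =
      ExteriorAlgebra.map incl ∘ fun i => ExteriorAlgebra.ι (ZMod p) (Fin.tail (v i)) := by
    funext i
    rw [Function.comp_apply, ExteriorAlgebra.map_apply_ι]
    congr 1
    funext l
    cases l using Fin.cases with
    | zero => exact hv i
    | succ l => rfl
  rw [h1, ← List.map_ofFn, ← map_list_prod, h0, map_zero]

/-- In the untwisted setting every operator to a smaller dimension kills `dy_1⋯dy_b`, since the
images of the `dy_j` lie in the span of the fewer generators `dy_1, …, dy_a`. -/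
theorem extHom_extTop [Fact p.Prime] {a b : ℕ} (h : a < b) (θ : Fin (a + 1) →o Fin (b + 1)) :
    extHom p θ (extTop p b) = 0 := by
  rw [extTop_eq, map_list_prod, List.map_ofFn]
  simp only [Function.comp_def, extGen, extHom_extY]
  exact ofFn_ι_eq_zero p h _ fun i => vecY_apply_zero p _ _

/-- The exterior algebra is spanned by the products of distinct generators. -/
theorem ext_mem_span (q : ℕ) (t : Ext p q) :
    t ∈ Submodule.span (ZMod p) (Set.range (sortedProd (extGen p q)) ∪
      Set.range fun S => extX p q * sortedProd (extGen p q) S) := by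
  set M := Submodule.span (ZMod p) (Set.range (sortedProd (extGen p q)) ∪
      Set.range fun S => extX p q * sortedProd (extGen p q) S)
  have hX : ∀ t ∈ M, extX p q * t ∈ M := by
    intro t ht
    induction ht using Submodule.span_induction with
    | mem t ht =>
      rcases ht with ⟨S, rfl⟩ | ⟨S, rfl⟩
      · exact Submodule.subset_span (Or.inr ⟨S, rfl⟩)
      · rw [← mul_assoc, extX_mul_extX, zero_mul]
        exact Submodule.zero_mem _
    | zero => rw [mul_zero]; exact Submodule.zero_mem _
    | add a b _ _ ha hb => rw [mul_add]; exact Submodule.add_mem _ ha hb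
    | smul c a _ ha => rw [mul_smul_comm]; exact Submodule.smul_mem _ _ ha
  have hS : ∀ j S, extGen p q j * sortedProd (extGen p q) S ∈
      Submodule.span (ZMod p) (Set.range (sortedProd (extGen p q))) := by
    intro j S
    by_cases hj : j ∈ S
    · suffices extGen p q j * sortedProd (extGen p q) S = 0 by
        rw [this]; exact Submodule.zero_mem _
      induction S using Finset.induction_on_min with
      | empty => exact absurd hj (Finset.notMem_empty _)
      | insert m S hm ih =>
        rw [sortedProd_insert _ hm, ← mul_assoc]
        rcases Finset.mem_insert.1 hj with rfl | hj
        · rw [extGen, extY, ExteriorAlgebra.ι_sq_zero, zero_mul]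
        · rw [extGen_anticomm, neg_mul, mul_assoc, ih hj, mul_zero, neg_zero]
    · rw [mul_sortedProd (k := ZMod p) (extGen_anticomm p q) hj]
      exact Submodule.smul_mem _ _ (Submodule.subset_span ⟨_, rfl⟩)
  have hY : ∀ j, ∀ t ∈ M, extGen p q j * t ∈ M := by
    intro j t ht
    induction ht using Submodule.span_induction with
    | mem t ht =>
      have hM : Submodule.span (ZMod p) (Set.range (sortedProd (extGen p q))) ≤ M :=
        Submodule.span_mono Set.subset_union_left
      rcases ht with ⟨S, rfl⟩ | ⟨S, rfl⟩
      · exact hM (hS j S)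
      · rw [← mul_assoc, extGen_mul_extX, neg_mul, mul_assoc]
        exact Submodule.neg_mem _ (hX _ (hM (hS j S)))
    | zero => rw [mul_zero]; exact Submodule.zero_mem _
    | add a b _ _ ha hb => rw [mul_add]; exact Submodule.add_mem _ ha hb
    | smul c a _ ha => rw [mul_smul_comm]; exact Submodule.smul_mem _ _ ha
  induction t using CliffordAlgebra.left_induction with
  | algebraMap c =>
    rw [Algebra.algebraMap_eq_smul_one, ← sortedProd_empty (extGen p q)]
    exact Submodule.smul_mem _ _ (Submodule.subset_span (Or.inl ⟨_, rfl⟩))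
  | add a b ha hb => exact Submodule.add_mem _ ha hb
  | ι_mul t v ht =>
    have hv : v = ∑ i, v i • Pi.basisFun (ZMod p) (Fin (q + 1)) i := by
      exact ((Pi.basisFun (ZMod p) (Fin (q + 1))).sum_repr v).symm
    rw [hv, map_sum, Finset.sum_mul]
    refine Submodule.sum_mem _ fun i _ => ?_
    rw [map_smul, smul_mul_assoc, Pi.basisFun_apply]
    refine Submodule.smul_mem _ _ ?_
    cases i using Fin.cases with
    | zero => exact hX _ ht
    | succ i =>
      rw [← vecY_succ]
      exact hY i _ ht

/-- The contraction with `dx`. -/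
def extContr (q : ℕ) : Ext p q →ₗ[ZMod p] Ext p q :=
  CliffordAlgebra.contractLeft (LinearMap.proj 0)

theorem extContr_one (q : ℕ) : extContr p q 1 = 0 := CliffordAlgebra.contractLeft_one _ _

theorem extContr_ι_mul (q : ℕ) (v : Fin (q + 1) → ZMod p) (t : Ext p q) :
    extContr p q (ExteriorAlgebra.ι (ZMod p) v * t) =
      v 0 • t - ExteriorAlgebra.ι (ZMod p) v * extContr p q t :=
  CliffordAlgebra.contractLeft_ι_mul _ _ _

theorem extContr_extX_mul (q : ℕ) (t : Ext p q) :
    extContr p q (extX p q * t) = t - extX p q * extContr p q t := by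
  rw [extX, extContr_ι_mul, vecX, Pi.single_eq_same, one_smul]

theorem extContr_extGen_mul (q : ℕ) (j : Fin q) (t : Ext p q) :
    extContr p q (extGen p q j * t) = -(extGen p q j * extContr p q t) := by
  rw [extGen, extY, extContr_ι_mul, vecY_apply_zero, zero_smul, zero_sub]

theorem extContr_sortedProd (q : ℕ) (S : Finset (Fin q)) :
    extContr p q (sortedProd (extGen p q) S) = 0 := by
  induction S using Finset.induction_on_min with
  | empty => rw [sortedProd_empty, extContr_one]
  | insert m S hm ih => rw [sortedProd_insert _ hm, extContr_extGen_mul, ih, mul_zero, neg_zero]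

/-- The contraction only involves the coordinate along `dx`, which operators preserve. -/
theorem extHom_extContr {a b : ℕ} (θ : Fin (a + 1) →o Fin (b + 1)) (t : Ext p b) :
    extHom p θ (extContr p b t) = extContr p a (extHom p θ t) := by
  induction t using CliffordAlgebra.left_induction with
  | algebraMap c =>
    rw [AlgHom.commutes, Algebra.algebraMap_eq_smul_one, Algebra.algebraMap_eq_smul_one]
    simp only [map_smul, extContr_one, map_zero]
  | add s t hs ht => rw [map_add, map_add, hs, ht, map_add, map_add]
  | ι_mul t v ht =>
    refine (congrArg (extHom p θ) (extContr_ι_mul p b v t)).trans ?_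
    rw [map_sub, map_smul, map_mul, ht]
    refine Eq.trans ?_ (congrArg (extContr p a) (map_mul (extHom p θ) _ _).symm)
    have h : extHom p θ (ExteriorAlgebra.ι (ZMod p) v) =
        ExteriorAlgebra.ι (ZMod p) (vecHom p θ v) := ExteriorAlgebra.map_apply_ι _ _
    refine Eq.trans ?_ (congrArg (fun z => extContr p a (z * _)) h.symm)
    rw [h, extContr_ι_mul, vecHom_apply_zero]

/-- The coefficient of `dy_1 ⋯ dy_q`. -/
def extCoeff (q : ℕ) : Ext p q →ₗ[ZMod p] ZMod p :=
  (Pi.basisFun (ZMod p) (Fin (q + 1))).ExteriorAlgebra.coord Finset.univ ∘ₗ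
    LinearMap.mulLeft (ZMod p) (extX p q)

theorem extCoeff_extX_mul (q : ℕ) (t : Ext p q) : extCoeff p q (extX p q * t) = 0 := by
  rw [extCoeff, LinearMap.comp_apply, LinearMap.mulLeft_apply, ← mul_assoc, extX_mul_extX, zero_mul,
    map_zero]

theorem extCoeff_extTop (q : ℕ) : extCoeff p q (extTop p q) = 1 := by
  -- Multiplication by `dx` turns the monomial `dy_1⋯dy_q` into the top basis element, whose
  -- coordinate is 1.
  have h : extX p q * extTop p q =
      (Pi.basisFun (ZMod p) (Fin (q + 1))).ExteriorAlgebra Finset.univ := by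
    rw [ExteriorAlgebra.basis_apply_ofCard _ (rfl : Finset.univ.card = Finset.univ.card),
      ExteriorAlgebra.ιMulti_family, ExteriorAlgebra.ιMulti_apply]
    have := sortedProd_eq_ofFn (fun i : Fin (q + 1) => ExteriorAlgebra.ι (ZMod p)
      (Pi.basisFun (ZMod p) (Fin (q + 1)) i)) (rfl : Finset.univ.card = Finset.univ.card)
    refine Eq.trans ?_ this
    rw [sortedProd_univ, List.ofFn_succ, List.prod_cons, extTop_eq]
    congr 3
    · rw [Pi.basisFun_apply]; rfl
    · funext i
      rw [extGen, extY, vecY_succ, Pi.basisFun_apply]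
  rw [extCoeff, LinearMap.comp_apply, LinearMap.mulLeft_apply, h, Module.Basis.coord_apply,
    Module.Basis.repr_self, Finsupp.single_eq_same]

/-- The image of `dy_1 ⋯ dy_i` under the iterated degeneracy attached to `S`. -/
theorem extHom_collapse {n i : ℕ} {S : Finset (Fin n)} (hS : S.card = i) :
    extHom p (collapse S i) (extTop p i) = sortedProd (extGen p n) S := by
  rw [extTop_eq, map_list_prod, List.map_ofFn, sortedProd_eq_ofFn _ hS]
  congr 2
  funext j
  rw [Function.comp_apply, extGen, extHom_extY, extGen]
  congr 1
  have hj := (S.orderEmbOfFin hS j).isLt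
  -- The collapse map sends `l` to the number of elements of `S` below `l`. This number is at most
  -- `j` exactly when `l` does not exceed the `j`-th element of `S`, counted from zero, so
  -- `dy_{j+1}` goes to the generator indexed by that element.
  refine cut_eq_of_forall _ _ _ (by omega) fun l => ?_
  change _ ↔ min (S.filter fun k => k.val < l.val).card i < j.val + 1
  have hcard : (S.filter fun k => k.val < l.val).card =
      (Finset.univ.filter fun t : Fin i => (S.orderEmbOfFin hS t).val < l.val).card := by
    have : (S.filter fun k => k.val < l.val) =
        (Finset.univ.filter fun t : Fin i => (S.orderEmbOfFin hS t).val < l.val).map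
          (S.orderEmbOfFin hS).toEmbedding := by
      ext k
      simp only [Finset.mem_filter, Finset.mem_map, Finset.mem_univ, true_and]
      constructor
      · rintro ⟨hk, hkl⟩
        have : k ∈ Set.range (S.orderEmbOfFin hS) := by
          rw [Finset.range_orderEmbOfFin]; exact hk
        obtain ⟨t, rfl⟩ := this
        exact ⟨t, hkl, rfl⟩
      · rintro ⟨t, ht, rfl⟩
        exact ⟨Finset.orderEmbOfFin_mem _ _ _, ht⟩
    rw [this, Finset.card_map]
  have hlt : min (S.filter fun k => k.val < l.val).card i < j.val + 1 ↔
      (S.filter fun k => k.val < l.val).card < j.val + 1 := by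
    have := j.isLt
    omega
  rw [hlt, hcard]
  constructor
  · intro h
    refine lt_of_le_of_lt (Finset.card_le_card (t := Finset.univ.filter fun t : Fin i =>
      t.val < j.val) ?_) ?_
    · intro t ht
      simp only [Finset.mem_filter, Finset.mem_univ, true_and] at ht ⊢
      have h1 : S.orderEmbOfFin hS t < S.orderEmbOfFin hS j := by
        rw [Fin.lt_def]; omega
      exact Fin.lt_def.1 ((S.orderEmbOfFin hS).lt_iff_lt.1 h1)
    · rw [Fin.card_filter_val_lt]
      omega
  · intro h
    by_contra hlj
    have := Finset.card_le_card (s := Finset.univ.filter fun t : Fin i => t.val < j.val + 1)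
      (t := Finset.univ.filter fun t : Fin i => (S.orderEmbOfFin hS t).val < l.val) (by
        intro t ht
        simp only [Finset.mem_filter, Finset.mem_univ, true_and] at ht ⊢
        have h1 : S.orderEmbOfFin hS t ≤ S.orderEmbOfFin hS j :=
          (S.orderEmbOfFin hS).le_iff_le.2 (Fin.le_def.2 (by omega))
        have := Fin.le_def.1 h1
        omega)
    rw [Fin.card_filter_val_lt] at this
    have := j.isLt
    omega

/-- The sign computation behind `γ_i(ω) γ_j(ω) = (i+j choose i) γ_{i+j}(ω)`. -/
theorem extHom_collapse_mul {i j : ℕ} {S : Finset (Fin (i + j))} (hS : S.card = i) :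
    (-1 : ZMod p) ^ (∑ k ∈ S, (Sᶜ.filter fun a => a < k).card) •
      (extHom p (collapse S i) (extTop p i) * extHom p (collapse Sᶜ j) (extTop p j)) =
        extTop p (i + j) := by
  have hS' : Sᶜ.card = j := by
    rw [Finset.card_compl, hS, Fintype.card_fin]; omega
  -- Sorting the product of the two complementary monomials produces the shuffle sign a second time,
  -- and the two signs cancel.
  rw [extHom_collapse p hS, extHom_collapse p hS',
    sortedProd_mul_sortedProd (k := ZMod p) (extGen_anticomm p _) disjoint_compl_right,
    Finset.union_compl, smul_smul, ← pow_add, Even.neg_one_pow ⟨_, rfl⟩, one_smul, extTop]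

end Exterior

/-! ### Forms with coefficients in a commutative algebra -/

section Forms

open SimplexCategory TensorProduct

variable (p : ℕ)

/-- The algebra `S ⊗ Λ(dx, dy_1, …, dy_q)`. -/
abbrev Form (S : Type) [CommRing S] [Algebra (ZMod p) S] (q : ℕ) : Type :=
  S ⊗[ZMod p] Ext p q

variable {S : Type} [CommRing S] [Algebra (ZMod p) S]

variable (S) in
/-- The forms of degree one. -/
def oneForm (q : ℕ) : Submodule (ZMod p) (Form p S q) :=
  Submodule.span (ZMod p) {w | ∃ s v, w = s ⊗ₜ ExteriorAlgebra.ι (ZMod p) v}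

variable {p}

theorem tmul_mem_oneForm {q : ℕ} (s : S) (v : Fin (q + 1) → ZMod p) :
    s ⊗ₜ ExteriorAlgebra.ι (ZMod p) v ∈ oneForm p S q :=
  Submodule.subset_span ⟨s, v, rfl⟩

theorem oneForm_anticomm {q : ℕ} {x y : Form p S q} (hx : x ∈ oneForm p S q)
    (hy : y ∈ oneForm p S q) : x * y = -(y * x) := by
  induction hx using Submodule.span_induction with
  | mem x hx =>
    obtain ⟨s, v, rfl⟩ := hx
    induction hy using Submodule.span_induction with
    | mem y hy =>
      obtain ⟨t, w, rfl⟩ := hy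
      rw [Algebra.TensorProduct.tmul_mul_tmul, Algebra.TensorProduct.tmul_mul_tmul, mul_comm t s,
        ← TensorProduct.tmul_neg]
      exact congrArg _ (eq_neg_of_add_eq_zero_left (ExteriorAlgebra.ι_add_mul_swap _ _))
    | zero => rw [mul_zero, zero_mul, neg_zero]
    | add a b _ _ ha hb => rw [mul_add, add_mul, ha, hb, neg_add]
    | smul c a _ ha => rw [mul_smul_comm, smul_mul_assoc, ha, smul_neg]
  | zero => rw [mul_zero, zero_mul, neg_zero]
  | add a b _ _ ha hb => rw [mul_add, add_mul, ha, hb, neg_add]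
  | smul c a _ ha => rw [mul_smul_comm, smul_mul_assoc, ha, smul_neg]

theorem oneForm_mul_self {q : ℕ} {x : Form p S q} (hx : x ∈ oneForm p S q) : x * x = 0 := by
  induction hx using Submodule.span_induction with
  | mem x hx =>
    obtain ⟨s, v, rfl⟩ := hx
    rw [Algebra.TensorProduct.tmul_mul_tmul, ExteriorAlgebra.ι_sq_zero, TensorProduct.tmul_zero]
  | zero => rw [mul_zero]
  | add a b ha' hb' ha hb =>
    rw [mul_add, add_mul, add_mul, ha, hb, oneForm_anticomm ha' hb']
    simp
  | smul c a _ ha => rw [mul_smul_comm, smul_mul_assoc, ha, smul_zero, smul_zero]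

theorem form_commute {q : ℕ} (s : S) (w : Form p S q) : Commute (s ⊗ₜ 1) w :=
  Algebra.commutes s w

theorem form_induction {q : ℕ} {C : Form p S q → Prop} (one : C 1)
    (add : ∀ s t, C s → C t → C (s + t)) (smul : ∀ s t, C t → C (s ⊗ₜ 1 * t))
    (ι : ∀ v t, C t → C (1 ⊗ₜ ExteriorAlgebra.ι (ZMod p) v * t)) (t : Form p S q) : C t := by
  have h : ∀ t : Ext p q, C (1 ⊗ₜ t) := by
    intro t
    induction t using CliffordAlgebra.left_induction with
    | algebraMap c =>
      have := smul (algebraMap (ZMod p) S c) 1 one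
      rwa [mul_one, Algebra.algebraMap_eq_smul_one, TensorProduct.smul_tmul,
        ← Algebra.algebraMap_eq_smul_one] at this
    | add a b ha hb => rw [TensorProduct.tmul_add]; exact add _ _ ha hb
    | ι_mul t v ht =>
      have := ι v _ ht
      rwa [Algebra.TensorProduct.tmul_mul_tmul, one_mul] at this
  induction t using TensorProduct.induction_on with
  | zero => have := smul 0 1 one; rwa [TensorProduct.zero_tmul, zero_mul] at this
  | tmul s t =>
    have := smul s _ (h t)
    rwa [Algebra.TensorProduct.tmul_mul_tmul, mul_one, one_mul] at this
  | add a b ha hb => exact add _ _ ha hb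

/-- Right multiples of `dx` are also left multiples, because `dx` anticommutes with one-forms. This
allows computing modulo `dx` inside products, as in `extX_mul_tw`. -/
theorem exists_extX_mul_eq {q : ℕ} (t : Form p S q) :
    ∃ w, 1 ⊗ₜ extX p q * t = w * 1 ⊗ₜ extX p q := by
  induction t using form_induction with
  | one => exact ⟨1, by rw [mul_one, one_mul]⟩
  | add s t hs ht =>
    obtain ⟨a, ha⟩ := hs
    obtain ⟨b, hb⟩ := ht
    exact ⟨a + b, by rw [mul_add, ha, hb, add_mul]⟩
  | smul s t ht =>
    obtain ⟨a, ha⟩ := ht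
    exact ⟨s ⊗ₜ 1 * a, by rw [← mul_assoc, ← (form_commute s _).eq, mul_assoc, ha, mul_assoc]⟩
  | ι v t ht =>
    obtain ⟨a, ha⟩ := ht
    refine ⟨-(1 ⊗ₜ ExteriorAlgebra.ι (ZMod p) v * a), ?_⟩
    have h : (1 : S) ⊗ₜ[ZMod p] extX p q * 1 ⊗ₜ ExteriorAlgebra.ι (ZMod p) v =
        -(1 ⊗ₜ ExteriorAlgebra.ι (ZMod p) v * 1 ⊗ₜ extX p q) :=
      oneForm_anticomm (tmul_mem_oneForm _ _) (tmul_mem_oneForm _ _)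
    rw [← mul_assoc, h, neg_mul, mul_assoc, neg_mul, mul_assoc, ha]

section Lift

variable {B : Type} [Ring B] [Algebra (ZMod p) B]

/-- The universal property of `S ⊗ Λ(dx, dy_1, …, dy_q)`. -/
def formLift {q : ℕ} (f : S →ₐ[ZMod p] B) (L : (Fin (q + 1) → ZMod p) →ₗ[ZMod p] B)
    (hL : ∀ v, L v * L v = 0) (hc : ∀ s v, Commute (f s) (L v)) : Form p S q →ₐ[ZMod p] B :=
  Algebra.TensorProduct.lift f (ExteriorAlgebra.lift (ZMod p) ⟨L, hL⟩) (by
    intro s t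
    induction t using CliffordAlgebra.left_induction with
    | algebraMap c =>
      rw [AlgHom.commutes]
      exact (Algebra.commutes c (f s)).symm
    | add a b ha hb => rw [map_add]; exact ha.add_right hb
    | ι_mul t v ht =>
      rw [map_mul]
      refine Commute.mul_right ?_ ht
      have : ExteriorAlgebra.lift (ZMod p) ⟨L, hL⟩ (ExteriorAlgebra.ι (ZMod p) v) = L v :=
        ExteriorAlgebra.lift_ι_apply _ _ _ _
      exact this ▸ hc s v)

variable {q : ℕ} (f : S →ₐ[ZMod p] B) (L : (Fin (q + 1) → ZMod p) →ₗ[ZMod p] B)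
    (hL : ∀ v, L v * L v = 0) (hc : ∀ s v, Commute (f s) (L v))

theorem formLift_tmul_one (s : S) : formLift f L hL hc (s ⊗ₜ 1) = f s := by
  rw [formLift, Algebra.TensorProduct.lift_tmul, map_one, mul_one]

theorem formLift_ι (v : Fin (q + 1) → ZMod p) :
    formLift f L hL hc (1 ⊗ₜ ExteriorAlgebra.ι (ZMod p) v) = L v := by
  rw [formLift, Algebra.TensorProduct.lift_tmul, map_one, one_mul, ExteriorAlgebra.lift_ι_apply]

theorem form_hom_ext {f g : Form p S q →ₐ[ZMod p] B} (hs : ∀ s : S, f (s ⊗ₜ 1) = g (s ⊗ₜ 1))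
    (hx : f (1 ⊗ₜ extX p q) = g (1 ⊗ₜ extX p q))
    (hy : ∀ j : Fin q, f (1 ⊗ₜ extGen p q j) = g (1 ⊗ₜ extGen p q j)) : f = g := by
  refine Algebra.TensorProduct.ext (AlgHom.ext hs) (ExteriorAlgebra.hom_ext ?_)
  exact vec_hom_ext hx hy

end Lift

variable {S' : Type} [CommRing S'] [Algebra (ZMod p) S']

/-- The form `dy_j` for `j > 0`, and `z dx` for `j = 0`. -/
def twY (z : S) (q j : ℕ) : Form p S q :=
  if j = 0 then z ⊗ₜ extX p q else 1 ⊗ₜ extY p q j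

theorem twY_mem (z : S) (q j : ℕ) : twY z q j ∈ oneForm p S q := by
  rw [twY]
  split_ifs
  · exact tmul_mem_oneForm _ _
  · exact tmul_mem_oneForm _ _

theorem twY_zero (z : S) (q : ℕ) : twY (p := p) z q 0 = z ⊗ₜ extX p q := rfl

theorem twY_of_ne_zero (z : S) (q : ℕ) {j : ℕ} (hj : j ≠ 0) :
    twY (p := p) z q j = 1 ⊗ₜ extY p q j := if_neg hj

theorem twY_of_lt (z : S) {q j : ℕ} (h : q < j) : twY (p := p) z q j = 0 := by
  rw [twY_of_ne_zero z q (by omega), extY_of_lt p h, TensorProduct.tmul_zero]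

/-- The algebra map of forms that is induced by a monotone map if `d y_0 = z dx`. -/
def tw (φ : S →ₐ[ZMod p] S') (z : S') {a b : ℕ} (θ : Fin (a + 1) →o Fin (b + 1)) :
    Form p S b →ₐ[ZMod p] Form p S' a :=
  formLift (Algebra.TensorProduct.includeLeft.comp φ)
    (vecLift p b (1 ⊗ₜ extX p a) fun j => twY z a (cut θ j))
    (fun v => oneForm_mul_self (vecLift_mem p b _ (tmul_mem_oneForm _ _) (fun _ => twY_mem _ _ _) v))
    fun s _ => form_commute (φ s) _

section Tw

variable (φ : S →ₐ[ZMod p] S') {a b : ℕ} (θ : Fin (a + 1) →o Fin (b + 1))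

theorem tw_tmul_one (z : S') (s : S) : tw φ z θ (s ⊗ₜ 1) = φ s ⊗ₜ 1 :=
  formLift_tmul_one _ _ _ _ _

theorem tw_extX (z : S') : tw φ z θ (1 ⊗ₜ extX p b) = 1 ⊗ₜ extX p a :=
  (formLift_ι _ _ _ _ _).trans (vecLift_vecX p b _ _)

theorem tw_smul_extX (z : S') (s : S) : tw φ z θ (s ⊗ₜ extX p b) = φ s ⊗ₜ extX p a := by
  have h : s ⊗ₜ[ZMod p] extX p b = s ⊗ₜ 1 * 1 ⊗ₜ extX p b := by
    rw [Algebra.TensorProduct.tmul_mul_tmul, one_mul, mul_one]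
  rw [h, map_mul, tw_tmul_one, tw_extX, Algebra.TensorProduct.tmul_mul_tmul, one_mul, mul_one]

theorem tw_extGen (z : S') (j : Fin b) :
    tw φ z θ (1 ⊗ₜ extGen p b j) = twY z a (cut θ (j.val + 1)) :=
  (formLift_ι _ _ _ _ _).trans (vecLift_vecY p b _ _ j)

/-- The condition `φ z = z'` keeps the convention `dy_0 = z dx` stable under operators, and it is
all that functoriality (`tw_comp`) requires. -/
theorem tw_twY {z : S} {z' : S'} (h : φ z = z') (j : ℕ) :
    tw φ z' θ (twY z b j) = twY z' a (cut θ j) := by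
  rcases Nat.eq_zero_or_pos j with rfl | hj
  · rw [twY_zero, cut_zero, tw_smul_extX, h, twY_zero]
  · rcases lt_or_ge b j with hb | hb
    · rw [twY_of_lt z hb, map_zero, cut_of_lt θ j hb, twY_of_lt _ (Nat.lt_succ_self a)]
    · obtain ⟨l, rfl⟩ := exists_eq_succ hj hb
      rw [twY_of_ne_zero z b (by omega)]
      exact tw_extGen φ θ z' l

theorem tw_comp {S'' : Type} [CommRing S''] [Algebra (ZMod p) S''] (φ' : S' →ₐ[ZMod p] S'')
    {c : ℕ} (ψ : Fin (b + 1) →o Fin (c + 1)) {z : S'} {z' : S''} (h : φ' z = z') :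
    tw (φ'.comp φ) z' (ψ.comp θ) = (tw φ' z' θ).comp (tw φ z ψ) := by
  refine form_hom_ext (fun s => ?_) ?_ fun j => ?_
  · rw [AlgHom.comp_apply, tw_tmul_one, tw_tmul_one, tw_tmul_one, AlgHom.comp_apply]
  · rw [AlgHom.comp_apply, tw_extX, tw_extX, tw_extX]
  · rw [AlgHom.comp_apply, tw_extGen, tw_extGen, tw_twY φ' θ h, cut_comp]

theorem tw_id (z : S) : tw (AlgHom.id (ZMod p) S) z (OrderHom.id : Fin (a + 1) →o Fin (a + 1)) =
    AlgHom.id (ZMod p) _ := by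
  refine form_hom_ext (fun s => ?_) ?_ fun j => ?_
  · rw [tw_tmul_one, AlgHom.id_apply, AlgHom.id_apply]
  · rw [tw_extX, AlgHom.id_apply]
  · rw [tw_extGen, cut_id (by omega), twY_of_ne_zero _ _ (by omega), AlgHom.id_apply, extGen]

/-- The algebra map of forms that is induced by a monotone map if `d y_0 = 0`. -/
def untw (φ : S →ₐ[ZMod p] S') {a b : ℕ} (θ : Fin (a + 1) →o Fin (b + 1)) :
    Form p S b →ₐ[ZMod p] Form p S' a :=
  Algebra.TensorProduct.map φ (extHom p θ)

theorem untw_tmul (s : S) (t : Ext p b) : untw φ θ (s ⊗ₜ t) = φ s ⊗ₜ extHom p θ t := rfl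

theorem tw_zero : tw φ 0 θ = untw φ θ := by
  refine form_hom_ext (fun s => ?_) ?_ fun j => ?_
  · rw [tw_tmul_one, untw_tmul, map_one]
  · rw [tw_extX, untw_tmul, map_one, extHom_extX]
  · rw [tw_extGen, untw_tmul, map_one, extGen, extHom_extY, twY]
    split_ifs with h
    · rw [h, extY_zero, TensorProduct.zero_tmul, TensorProduct.tmul_zero]
    · rfl

/-- If `θ 0 = 0`, then no `dy_j` with `j > 0` is sent to `dy_0`. Thus all degeneracies and all faces
`d_j` with `j > 0` are untwisted, and the twist is carried by `d_0` alone among the structure maps.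
-/
theorem tw_eq_untw (hθ : θ 0 = 0) (z : S') : tw φ z θ = untw φ θ := by
  refine form_hom_ext (fun s => ?_) ?_ fun j => ?_
  · rw [tw_tmul_one, untw_tmul, map_one]
  · rw [tw_extX, untw_tmul, map_one, extHom_extX]
  · have h : cut θ (j.val + 1) ≠ 0 := by
      have := (lt_cut_iff θ (j.val + 1) 0).2 (by rw [hθ]; simp)
      omega
    rw [tw_extGen, untw_tmul, map_one, extGen, extHom_extY, twY_of_ne_zero _ _ h]

theorem untw_id : untw (AlgHom.id (ZMod p) S) (OrderHom.id : Fin (a + 1) →o Fin (a + 1)) =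
    AlgHom.id (ZMod p) _ := by
  rw [← tw_zero, tw_id]

theorem untw_comp {S'' : Type} [CommRing S''] [Algebra (ZMod p) S''] (φ' : S' →ₐ[ZMod p] S'')
    {c : ℕ} (ψ : Fin (b + 1) →o Fin (c + 1)) :
    untw (φ'.comp φ) (ψ.comp θ) = (untw φ' θ).comp (untw φ ψ) := by
  rw [← tw_zero, ← tw_zero, ← tw_zero, tw_comp φ θ φ' ψ (map_zero φ')]

/-- Modulo `dx` the two maps agree. -/
theorem extX_mul_tw (z : S') (t : Form p S b) :
    1 ⊗ₜ extX p a * tw φ z θ t = 1 ⊗ₜ extX p a * untw φ θ t := by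
  have h1 : ∀ v, 1 ⊗ₜ extX p a * tw φ z θ (1 ⊗ₜ ExteriorAlgebra.ι (ZMod p) v) =
      1 ⊗ₜ extX p a * untw φ θ (1 ⊗ₜ ExteriorAlgebra.ι (ZMod p) v) := by
    intro v
    set l : (Fin (b + 1) → ZMod p) →ₗ[ZMod p] Form p S b :=
      TensorProduct.mk (ZMod p) S (Ext p b) 1 ∘ₗ ExteriorAlgebra.ι (ZMod p)
    have h : LinearMap.mulLeft (ZMod p) (1 ⊗ₜ extX p a) ∘ₗ (tw φ z θ).toLinearMap ∘ₗ l =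
        LinearMap.mulLeft (ZMod p) (1 ⊗ₜ extX p a) ∘ₗ (untw φ θ).toLinearMap ∘ₗ l := by
      refine vec_hom_ext ?_ fun j => ?_
      · change 1 ⊗ₜ extX p a * tw φ z θ (1 ⊗ₜ extX p b) = 1 ⊗ₜ extX p a * untw φ θ (1 ⊗ₜ extX p b)
        rw [tw_extX, untw_tmul, map_one, extHom_extX]
      · change 1 ⊗ₜ extX p a * tw φ z θ (1 ⊗ₜ extGen p b j) =
          1 ⊗ₜ extX p a * untw φ θ (1 ⊗ₜ extGen p b j)
        rw [tw_extGen, untw_tmul, map_one, extGen, extHom_extY, twY]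
        split_ifs with h
        · rw [h, extY_zero, Algebra.TensorProduct.tmul_mul_tmul, extX_mul_extX]
          simp
        · rfl
    exact LinearMap.congr_fun h v
  induction t using form_induction with
  | one => rw [map_one, map_one]
  | add s t hs ht => rw [map_add, map_add, mul_add, mul_add, hs, ht]
  | smul s t ht =>
    rw [map_mul, map_mul, tw_tmul_one, untw_tmul, map_one, ← mul_assoc, ← mul_assoc,
      ← (form_commute (φ s) _).eq, mul_assoc, mul_assoc, ht]
  | ι v t ht =>
    -- Moving `dx` across the image of the one-form puts it next to the image of `t`, where the
    -- induction hypothesis applies.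
    obtain ⟨w, hw⟩ := exists_extX_mul_eq (untw φ θ (1 ⊗ₜ ExteriorAlgebra.ι (ZMod p) v))
    rw [map_mul, map_mul, ← mul_assoc, ← mul_assoc, h1, hw, mul_assoc, mul_assoc, ht]

end Tw

/-- The contraction of forms with `dx`. -/
def formContr (S : Type) [CommRing S] [Algebra (ZMod p) S] (q : ℕ) :
    Form p S q →ₗ[ZMod p] Form p S q :=
  (extContr p q).lTensor S

theorem formContr_tmul {q : ℕ} (s : S) (t : Ext p q) :
    formContr S q (s ⊗ₜ t) = s ⊗ₜ extContr p q t := rfl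

/-- Contraction is a null homotopy for multiplication by `dx`. In particular `dx · t = 0` forces `t
= dx · ι t`, where `ι` denotes the contraction; this exactness drives the filtration argument below.
-/
theorem formContr_extX_mul {q : ℕ} (t : Form p S q) :
    formContr S q (1 ⊗ₜ extX p q * t) = t - 1 ⊗ₜ extX p q * formContr S q t := by
  induction t using TensorProduct.induction_on with
  | zero => rw [mul_zero, map_zero, mul_zero, sub_zero]
  | tmul s t =>
    rw [Algebra.TensorProduct.tmul_mul_tmul, formContr_tmul, formContr_tmul, extContr_extX_mul,
      Algebra.TensorProduct.tmul_mul_tmul, TensorProduct.tmul_sub, one_mul]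
  | add a b ha hb => rw [mul_add, map_add, ha, hb, map_add, mul_add]; abel

theorem untw_formContr (φ : S →ₐ[ZMod p] S') {a b : ℕ} (θ : Fin (a + 1) →o Fin (b + 1))
    (t : Form p S b) : untw φ θ (formContr S b t) = formContr S' a (untw φ θ t) := by
  induction t using TensorProduct.induction_on with
  | zero => rw [map_zero, map_zero, map_zero]
  | tmul s t => rw [formContr_tmul, untw_tmul, untw_tmul, formContr_tmul, extHom_extContr]
  | add a b ha hb => rw [map_add, map_add, ha, hb, map_add, map_add]

end Forms

/-! ### The simplicial algebras of forms over `R_•` and over `A` -/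

section FormSimp

open SimplexCategory TensorProduct

variable (p : ℕ)

/-- The form `a dy_1 ⋯ dy_q + b dx dy_1 ⋯ dy_q`. -/
def topForm {S : Type} [CommRing S] [Algebra (ZMod p) S] (q : ℕ) (a b : S) : Form p S q :=
  a ⊗ₜ extTop p q + b ⊗ₜ (extX p q * extTop p q)

section TopForm

variable {p} {S S' : Type} [CommRing S] [Algebra (ZMod p) S] [CommRing S'] [Algebra (ZMod p) S']

theorem untw_topForm [Fact p.Prime] (φ : S →ₐ[ZMod p] S') {a b : ℕ}
    (θ : Fin (a + 1) →o Fin (b + 1)) (h : a < b) (s t : S) : untw φ θ (topForm p b s t) = 0 := by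
  rw [topForm, map_add, untw_tmul, untw_tmul, map_mul, extHom_extTop p h, mul_zero,
    TensorProduct.tmul_zero, TensorProduct.tmul_zero, add_zero]

theorem tw_δ_zero_extGen (φ : S →ₐ[ZMod p] S') (z : S') (q : ℕ) (j : Fin q) :
    tw φ z (Hom.toOrderHom (δ (n := q) 0)) (1 ⊗ₜ extGen p (q + 1) j.succ) = 1 ⊗ₜ extGen p q j := by
  have h : cut (Hom.toOrderHom (δ (n := q) 0)) (j.succ.val + 1) = j.val + 1 := by
    refine cut_eq_of_forall _ _ _ (show j.val + 1 ≤ q + 1 by omega) fun l => ?_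
    change _ ↔ (Fin.succAbove 0 l).val < _
    simp
  refine (tw_extGen φ _ z j.succ).trans ?_
  rw [h, twY_of_ne_zero _ _ (Nat.succ_ne_zero _), extGen]

theorem tw_δ_zero_extGen_zero (φ : S →ₐ[ZMod p] S') (z : S') (q : ℕ) :
    tw φ z (Hom.toOrderHom (δ (n := q) 0)) (1 ⊗ₜ extGen p (q + 1) 0) = z ⊗ₜ extX p q := by
  have h : cut (Hom.toOrderHom (δ (n := q) 0)) (((0 : Fin (q + 1)) : ℕ) + 1) = 0 := by
    refine cut_eq_of_forall _ _ _ (Nat.zero_le _) fun l => ?_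
    change _ ↔ (Fin.succAbove 0 l).val < _
    simp
  refine (tw_extGen φ _ z 0).trans ?_
  rw [h, twY_zero]

theorem tmul_ofFn_prod {q m : ℕ} (g : Fin m → Ext p q) :
    (1 : S) ⊗ₜ[ZMod p] (List.ofFn g).prod = (List.ofFn fun i => (1 : S) ⊗ₜ[ZMod p] g i).prod := by
  have := map_list_prod (Algebra.TensorProduct.includeRight (R := ZMod p) (A := S) (B := Ext p q))
    (List.ofFn g)
  rw [List.map_ofFn] at this
  exact this

/-- The face `d_0` lowers the index of each `dy_{j+1}` with `j ≥ 1` by one and sends `dy_1` to `dy_0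
= z dx`; the summand that already contains `dx` dies because `dx² = 0`. This is the whole
differential of the normalized complex over `A`. -/
theorem tw_δ_zero_topForm (φ : S →ₐ[ZMod p] S') (z : S') (q : ℕ) (s t : S) :
    tw φ z (Hom.toOrderHom (δ (n := q) 0)) (topForm p (q + 1) s t) =
      topForm p q 0 (φ s * z) := by
  have h1 : tw φ z (Hom.toOrderHom (δ (n := q) 0)) (1 ⊗ₜ extTop p (q + 1)) =
      z ⊗ₜ (extX p q * extTop p q) := by
    rw [extTop_eq, tmul_ofFn_prod, map_list_prod, List.map_ofFn, List.ofFn_succ, List.prod_cons]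
    have h2 : (fun i : Fin q => (⇑(tw φ z (Hom.toOrderHom (δ (n := q) 0))) ∘ fun i =>
        (1 : S) ⊗ₜ[ZMod p] extGen p (q + 1) i) i.succ) =
        fun i => (1 : S') ⊗ₜ[ZMod p] extGen p q i := by
      funext i
      exact tw_δ_zero_extGen φ z q i
    rw [h2, ← tmul_ofFn_prod, ← extTop_eq]
    refine (congrArg (· * _) (tw_δ_zero_extGen_zero φ z q)).trans ?_
    rw [Algebra.TensorProduct.tmul_mul_tmul, mul_one]
  have h3 : ∀ (s : S) (w : Ext p (q + 1)), s ⊗ₜ[ZMod p] w = s ⊗ₜ 1 * 1 ⊗ₜ w := by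
    intro s w
    rw [Algebra.TensorProduct.tmul_mul_tmul, one_mul, mul_one]
  have h4 : (1 : S) ⊗ₜ[ZMod p] (extX p (q + 1) * extTop p (q + 1)) =
      1 ⊗ₜ extX p (q + 1) * 1 ⊗ₜ extTop p (q + 1) := by
    rw [Algebra.TensorProduct.tmul_mul_tmul, one_mul]
  rw [topForm, h3 s, h3 t, h4, map_add, map_mul, map_mul, map_mul, h1]
  rw [tw_tmul_one, tw_tmul_one]
  have h5 : tw φ z (Hom.toOrderHom (δ (n := q) 0)) (1 ⊗ₜ extX p (q + 1)) = 1 ⊗ₜ extX p q :=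
    tw_extX φ _ z
  rw [h5]
  simp only [Algebra.TensorProduct.tmul_mul_tmul, topForm, TensorProduct.zero_tmul, zero_add,
    one_mul]
  rw [← mul_assoc, extX_mul_extX, zero_mul, TensorProduct.tmul_zero, add_zero]

/-- The coefficient of `dy_1 ⋯ dy_q`. -/
def coeffZero (S : Type) [CommRing S] [Algebra (ZMod p) S] (q : ℕ) : Form p S q →ₗ[ZMod p] S :=
  (TensorProduct.rid (ZMod p) S).toLinearMap ∘ₗ (extCoeff p q).lTensor S

/-- The coefficient of `dx dy_1 ⋯ dy_q`. -/
def coeffOne (S : Type) [CommRing S] [Algebra (ZMod p) S] (q : ℕ) : Form p S q →ₗ[ZMod p] S :=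
  coeffZero S q ∘ₗ formContr S q

theorem coeffZero_tmul {q : ℕ} (s : S) (w : Ext p q) :
    coeffZero S q (s ⊗ₜ w) = extCoeff p q w • s := by
  rw [coeffZero, LinearMap.comp_apply, LinearMap.lTensor_tmul]
  exact TensorProduct.rid_tmul _ _

theorem coeffZero_topForm (q : ℕ) (a b : S) : coeffZero S q (topForm p q a b) = a := by
  rw [topForm, map_add, coeffZero_tmul, coeffZero_tmul, extCoeff_extTop, extCoeff_extX_mul,
    one_smul, zero_smul, add_zero]

theorem coeffOne_topForm (q : ℕ) (a b : S) : coeffOne S q (topForm p q a b) = b := by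
  have h : extContr p q (extTop p q) = 0 := extContr_sortedProd p q _
  rw [coeffOne, LinearMap.comp_apply, topForm, map_add, formContr_tmul, formContr_tmul,
    extContr_extX_mul, h, mul_zero, sub_zero, TensorProduct.tmul_zero, zero_add, coeffZero_tmul,
    extCoeff_extTop, one_smul]

end TopForm

theorem cycles_le_normalized {p : ℕ} {V : SimplicialObject (AlgCat.{0} (ZMod p))} (q : ℕ) :
    cycles V q ≤ normalized V q := by
  cases q with
  | zero => exact le_rfl
  | succ q => exact inf_le_left

theorem σ_zero {n : ℕ} (j : Fin (n + 1)) : Hom.toOrderHom (σ j) 0 = 0 :=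
  Fin.predAbove_right_zero (i := j)

/-- A product of generators in which `dy_{j+1}` does not occur is degenerate. -/
theorem exists_extHom_σ_eq {p : ℕ} {q : ℕ} (j : Fin (q + 1)) {S : Finset (Fin (q + 1))} (hj : j ∉ S) :
    ∃ t, extHom p (Hom.toOrderHom (σ j)) t = sortedProd (extGen p (q + 1)) S := by
  -- The image is a subalgebra, so it suffices to hit each generator `dy_{i+1}` with `i ≠ j`: from
  -- `dy_{i+1}` if `i < j`, and from `dy_i` if `i > j`.
  refine Subalgebra.list_prod_mem (extHom p (Hom.toOrderHom (σ j))).range (fun x hx => ?_)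
  obtain ⟨i, hi, rfl⟩ := List.mem_map.1 hx
  have hij : i ≠ j := fun h => hj (h ▸ (Finset.mem_sort _).1 hi)
  rcases lt_or_gt_of_ne hij with h | h
  · refine ⟨extY p q (i.val + 1), ?_⟩
    refine (extHom_extY p _ _).trans (congrArg (extY p (q + 1)) ?_)
    refine cut_eq_of_forall _ _ _ (show i.val + 1 ≤ q + 1 + 1 by omega) fun l => ?_
    change _ ↔ (Fin.predAbove j l).val < _
    have := Fin.lt_def.1 h
    rw [Fin.predAbove]
    split_ifs with hl
    · have := Fin.lt_def.1 hl
      simp at this ⊢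
      omega
    · simp
  · refine ⟨extY p q i.val, ?_⟩
    refine (extHom_extY p _ _).trans (congrArg (extY p (q + 1)) ?_)
    refine cut_eq_of_forall _ _ _ (show i.val + 1 ≤ q + 1 + 1 by omega) fun l => ?_
    change _ ↔ (Fin.predAbove j l).val < _
    have := Fin.lt_def.1 h
    rw [Fin.predAbove]
    split_ifs with hl
    · have := Fin.lt_def.1 hl
      simp at this ⊢
      omega
    · have := Fin.le_def.1 (not_lt.1 hl)
      simp at this ⊢
      omega

/-- The coefficient algebra `R_q`. -/
abbrev Res (q : ℕ) : Type := MvPolynomial (Option (Fin q)) (ZMod p)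

variable [Fact p.Prime] (r : ℕ)

/-- The element `(r + 1) x^r` of `R_q`. -/
def resZ (q : ℕ) : Res p q := ((r : ZMod p) + 1) • MvPolynomial.X none ^ r

/-- The element `(r + 1) x^r` of `A`. -/
def truncZ : TruncPoly p r := ((r : ZMod p) + 1) • TruncPoly.x p r ^ r

theorem resHom_resZ {a b : ℕ} (θ : Fin (a + 1) →o Fin (b + 1)) :
    resHom p r θ (resZ p r b) = resZ p r a := by
  rw [resZ, map_smul, map_pow, resHom_X_none, resZ]

theorem resAugHom_resZ (q : ℕ) : resAugHom p r q (resZ p r q) = truncZ p r := by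
  rw [resZ, map_smul, map_pow, resAugHom_X_none, truncZ]

/-- The simplicial algebra of forms over `R_•`, with `d y_0 = (r+1) x^r dx`. -/
def formSimp : SimplicialObject (AlgCat.{0} (ZMod p)) where
  obj a := AlgCat.of (ZMod p) (Form p (Res p a.unop.len) a.unop.len)
  map {_ b} θ := AlgCat.ofHom (tw (resHom p r (Hom.toOrderHom θ.unop)) (resZ p r b.unop.len)
    (Hom.toOrderHom θ.unop))
  map_id a := by
    apply AlgCat.hom_ext
    refine Eq.trans ?_ (tw_id (resZ p r a.unop.len))
    exact congrArg (fun φ => tw φ _ _) (resHom_id p r a.unop.len)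
  map_comp {a b c} θ φ := by
    apply AlgCat.hom_ext
    refine Eq.trans ?_ (tw_comp _ _ _ _ (resHom_resZ p r (Hom.toOrderHom φ.unop)))
    exact congrArg (fun φ => tw φ _ _) (resHom_comp p r _ _)

/-- The simplicial algebra of forms over `R_•`, with `d y_0 = 0`. -/
def untwSimp : SimplicialObject (AlgCat.{0} (ZMod p)) where
  obj a := AlgCat.of (ZMod p) (Form p (Res p a.unop.len) a.unop.len)
  map {_ b} θ := AlgCat.ofHom (untw (resHom p r (Hom.toOrderHom θ.unop)) (Hom.toOrderHom θ.unop))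
  map_id a := by
    apply AlgCat.hom_ext
    refine Eq.trans ?_ untw_id
    exact congrArg (fun φ => untw φ _) (resHom_id p r a.unop.len)
  map_comp {a b c} θ φ := by
    apply AlgCat.hom_ext
    refine Eq.trans ?_ (untw_comp _ _ _ _)
    exact congrArg (fun φ => untw φ _) (resHom_comp p r _ _)

/-- The simplicial algebra of forms over `A`, with `d y_0 = (r+1) x^r dx`. -/
def truncSimp : SimplicialObject (AlgCat.{0} (ZMod p)) where
  obj a := AlgCat.of (ZMod p) (Form p (TruncPoly p r) a.unop.len)
  map {_ b} θ := AlgCat.ofHom (tw (AlgHom.id (ZMod p) (TruncPoly p r)) (truncZ p r)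
    (Hom.toOrderHom θ.unop))
  map_id a := by
    apply AlgCat.hom_ext
    exact tw_id (truncZ p r)
  map_comp {a b c} θ φ := by
    apply AlgCat.hom_ext
    exact tw_comp (AlgHom.id (ZMod p) (TruncPoly p r)) _ (AlgHom.id (ZMod p) (TruncPoly p r)) _ rfl

/-- The reduction of forms over `R_q` to forms over `A`. -/
def red (q : ℕ) : Form p (Res p q) q →ₐ[ZMod p] Form p (TruncPoly p r) q :=
  Algebra.TensorProduct.map (resAugHom p r q) (AlgHom.id (ZMod p) _)

theorem red_tmul (q : ℕ) (s : Res p q) (t : Ext p q) :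
    red p r q (s ⊗ₜ t) = resAugHom p r q s ⊗ₜ t := rfl

/-- Written as a twisted map over the identity operator, reduction commutes with simplicial
operators by `tw_comp` alone. -/
theorem red_eq_tw (q : ℕ) : red p r q = tw (resAugHom p r q) (truncZ p r) OrderHom.id := by
  refine form_hom_ext (fun s => ?_) ?_ fun j => ?_
  · rw [red_tmul, tw_tmul_one]
  · rw [red_tmul, tw_extX, map_one]
  · rw [red_tmul, tw_extGen, cut_id (by omega), twY_of_ne_zero _ _ (by omega), extGen, map_one]

theorem red_tw {a b : ℕ} (θ : Fin (a + 1) →o Fin (b + 1)) (t : Form p (Res p b) b) :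
    red p r a (tw (resHom p r θ) (resZ p r a) θ t) =
      tw (AlgHom.id (ZMod p) (TruncPoly p r)) (truncZ p r) θ (red p r b t) := by
  have h1 := tw_comp (resHom p r θ) OrderHom.id (resAugHom p r a) θ (z := resZ p r a)
    (resAugHom_resZ p r a)
  have h2 := tw_comp (resAugHom p r b) θ (AlgHom.id (ZMod p) (TruncPoly p r)) OrderHom.id
    (z := truncZ p r) (z' := truncZ p r) rfl
  rw [resAugHom_comp] at h1
  rw [red_eq_tw, red_eq_tw, ← AlgHom.comp_apply, ← AlgHom.comp_apply, ← h1, ← h2]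
  rfl

/-- The contraction of `R_•` onto `A`, extended to forms. -/
def untwHomotopy : LinHomotopy (untwSimp p r) (untwSimp p r) where
  toFun n s := (contraction p r n (cut s 1)).rTensor (Ext p n)
  natural {a b} θ s v := by
    change untw (resHom p r (Hom.toOrderHom θ)) (Hom.toOrderHom θ)
        ((contraction p r b (cut s 1)).rTensor (Ext p b) v) =
      (contraction p r a (cut (s.comp (Hom.toOrderHom θ)) 1)).rTensor (Ext p a)
        (untw (resHom p r (Hom.toOrderHom θ)) (Hom.toOrderHom θ) v)
    revert v
    intro (v : Form p (Res p b) b)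
    induction v using TensorProduct.induction_on with
    | zero => simp only [map_zero]
    | tmul f t =>
      rw [LinearMap.rTensor_tmul, untw_tmul, untw_tmul, LinearMap.rTensor_tmul,
        resHom_contraction, cut_comp]
    | add u v hu hv => rw [map_add, map_add, hu, hv, map_add, map_add]

variable {p r}

/-- The contraction acts on coefficients and is only linear over `𝔽_p`, so it extends to forms when
operators act on coefficients and exterior factors separately. This fails for the twisted operators,
where `dy_0` multiplies the coefficient by `(r+1) x^r`. -/
theorem mem_boundaries_untw {q : ℕ} {t : Form p (Res p q) q} (ht : t ∈ cycles (untwSimp p r) q)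
    (h0 : red p r q t = 0) : t ∈ boundaries (untwSimp p r) q := by
  have h := (untwHomotopy p r).sub_mem_boundaries ht
  have e0 : (untwHomotopy p r).toFun q (step q 0) t = t := by
    change (contraction p r q (cut (step q 0) 1)).rTensor (Ext p q) t = t
    have : contraction p r q (cut (step q 0) 1) = LinearMap.id := by
      refine LinearMap.ext fun f => ?_
      rw [cut_step (Nat.zero_le _), contraction_zero, LinearMap.id_apply]
    rw [this, LinearMap.rTensor_id, LinearMap.id_apply]
  have e1 : (untwHomotopy p r).toFun q (step q (q + 1)) t = 0 := by
    change (contraction p r q (cut (step q (q + 1)) 1)).rTensor (Ext p q) t = 0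
    obtain ⟨s, hs⟩ := exists_section p r q
    rw [cut_step le_rfl, ← hs, LinearMap.rTensor_comp, LinearMap.comp_apply]
    exact (congrArg _ h0).trans (map_zero _)
  have e : (untwHomotopy p r).toFun q (step q 0) t - (untwHomotopy p r).toFun q (step q (q + 1)) t =
      t := (congrArg₂ (· - ·) e0 e1).trans (sub_zero _)
  exact e ▸ h

theorem δ_succ_zero {n : ℕ} (j : Fin (n + 1)) : Hom.toOrderHom (δ j.succ) 0 = 0 :=
  Fin.succAbove_ne_zero_zero (Fin.succ_ne_zero j)

theorem op_δ_succ_formSimp {n : ℕ} (j : Fin (n + 1)) (t : Form p (Res p (n + 1)) (n + 1)) :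
    op (formSimp p r) (δ j.succ) t = untw (resHom p r (Hom.toOrderHom (δ j.succ)))
      (Hom.toOrderHom (δ j.succ)) t :=
  DFunLike.congr_fun (tw_eq_untw _ _ (δ_succ_zero j) _) t

theorem op_δ_succ_truncSimp {n : ℕ} (j : Fin (n + 1))
    (t : Form p (TruncPoly p r) (n + 1)) : op (truncSimp p r) (δ j.succ) t =
      untw (AlgHom.id (ZMod p) (TruncPoly p r)) (Hom.toOrderHom (δ j.succ)) t :=
  DFunLike.congr_fun (tw_eq_untw _ _ (δ_succ_zero j) _) t

theorem topForm_mem_normalized_formSimp {q : ℕ} (a b : Res p (q + 1)) :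
    topForm p (q + 1) a b ∈ normalized (formSimp p r) (q + 1) :=
  (mem_normalized_succ _).2 fun j =>
    (op_δ_succ_formSimp j _).trans (untw_topForm _ _ (Nat.lt_succ_self q) a b)

theorem topForm_mem_normalized_truncSimp {q : ℕ} (a b : TruncPoly p r) :
    topForm p (q + 1) a b ∈ normalized (truncSimp p r) (q + 1) :=
  (mem_normalized_succ _).2 fun j =>
    (op_δ_succ_truncSimp j _).trans (untw_topForm _ _ (Nat.lt_succ_self q) a b)

theorem red_mem_normalized {q : ℕ} {t : Form p (Res p q) q}
    (ht : t ∈ normalized (formSimp p r) q) : red p r q t ∈ normalized (truncSimp p r) q := by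
  cases q with
  | zero => trivial
  | succ q =>
    refine (mem_normalized_succ _).2 fun j => ?_
    refine (red_tw p r (Hom.toOrderHom (δ j.succ)) t).symm.trans ?_
    exact (congrArg _ ((mem_normalized_succ _).1 ht j)).trans (map_zero _)

theorem red_topForm (q : ℕ) (a b : Res p q) :
    red p r q (topForm p q a b) = topForm p q (resAugHom p r q a) (resAugHom p r q b) := by
  rw [topForm, map_add, red_tmul, red_tmul, topForm]

theorem exists_red_eq_topForm (q : ℕ) (a b : TruncPoly p r) :
    ∃ a' b', red p r q (topForm p q a' b') = topForm p q a b := by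
  obtain ⟨a', rfl⟩ := resAugHom_surjective p r q a
  obtain ⟨b', rfl⟩ := resAugHom_surjective p r q b
  exact ⟨a', b', red_topForm q a' b'⟩

/-- The monomials omitting some `dy_j` lie in `D` by assumption; the only others are `dy_1⋯dy_q` and
`dx dy_1⋯dy_q`. -/
theorem exists_sub_topForm_mem {q : ℕ} (D : Submodule (ZMod p) (Form p (TruncPoly p r) q))
    (hD : ∀ (a : TruncPoly p r) (j : Fin q) (S : Finset (Fin q)), j ∉ S →
      a ⊗ₜ sortedProd (extGen p q) S ∈ D ∧ a ⊗ₜ (extX p q * sortedProd (extGen p q) S) ∈ D)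
    (w : Form p (TruncPoly p r) q) : ∃ a b, w - topForm p q a b ∈ D := by
  have hadd : ∀ {v w : Form p (TruncPoly p r) q}, (∃ a b, v - topForm p q a b ∈ D) →
      (∃ a b, w - topForm p q a b ∈ D) → ∃ a b, v + w - topForm p q a b ∈ D := by
    rintro v w ⟨a, b, h⟩ ⟨a', b', h'⟩
    refine ⟨a + a', b + b', ?_⟩
    have := Submodule.add_mem _ h h'
    rw [topForm, TensorProduct.add_tmul, TensorProduct.add_tmul]
    rw [topForm, topForm] at this
    convert this using 1
    abel
  induction w using TensorProduct.induction_on with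
  | zero => exact ⟨0, 0, by simp [topForm]⟩
  | tmul c t =>
    induction ext_mem_span p q t using Submodule.span_induction generalizing c with
    | mem t ht =>
      rcases ht with ⟨S, rfl⟩ | ⟨S, rfl⟩
      · by_cases hS : ∃ j, j ∉ S
        · obtain ⟨j, hj⟩ := hS
          exact ⟨0, 0, by simpa [topForm] using (hD c j S hj).1⟩
        · obtain rfl : S = Finset.univ := Finset.eq_univ_iff_forall.2 (by simpa using hS)
          exact ⟨c, 0, by simp [topForm, extTop]⟩
      · by_cases hS : ∃ j, j ∉ S
        · obtain ⟨j, hj⟩ := hS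
          exact ⟨0, 0, by simpa [topForm] using (hD c j S hj).2⟩
        · obtain rfl : S = Finset.univ := Finset.eq_univ_iff_forall.2 (by simpa using hS)
          exact ⟨0, c, by simp [topForm, extTop]⟩
    | zero => exact ⟨0, 0, by simp [topForm]⟩
    | add a b _ _ ha hb => rw [TensorProduct.tmul_add]; exact hadd (ha c) (hb c)
    | smul k a _ ha => rw [← TensorProduct.smul_tmul]; exact ha (k • c)
  | add v w hv hw => exact hadd hv hw

/-- A monomial that omits some `dy_j` is degenerate, so every form is a top form modulo degenerate
ones; top forms are normalized, and a normalized degenerate element is zero. Hence the normalized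
complex over `A` is two copies of `A` in each dimension. -/
theorem exists_eq_topForm {q : ℕ} {w : Form p (TruncPoly p r) q}
    (hw : w ∈ normalized (truncSimp p r) q) : ∃ a b, w = topForm p q a b := by
  cases q with
  | zero =>
    obtain ⟨a, b, h⟩ := exists_sub_topForm_mem (r := r) (q := 0) ⊥ (fun _ j => j.elim0) w
    exact ⟨a, b, sub_eq_zero.1 h⟩
  | succ q =>
    obtain ⟨a, b, h⟩ := exists_sub_topForm_mem (r := r) (q := q + 1)
      (⨆ k : Fin (q + 1), LinearMap.range (op (truncSimp p r) (σ k)).toLinearMap) (by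
        intro a j S hj
        obtain ⟨t, ht⟩ := exists_extHom_σ_eq (p := p) j hj
        have hle := le_iSup (fun k : Fin (q + 1) =>
          LinearMap.range (op (truncSimp p r) (σ k)).toLinearMap) j
        have hop : ∀ w : Form p (TruncPoly p r) q, op (truncSimp p r) (σ j) w =
            untw (AlgHom.id (ZMod p) (TruncPoly p r)) (Hom.toOrderHom (σ j)) w := fun w =>
          DFunLike.congr_fun (tw_eq_untw _ _ (σ_zero j) _) w
        constructor
        · refine hle ⟨a ⊗ₜ[ZMod p] t, (hop (a ⊗ₜ[ZMod p] t)).trans ?_⟩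
          exact congrArg (fun w => a ⊗ₜ[ZMod p] w) ht
        · refine hle ⟨a ⊗ₜ[ZMod p] (extX p q * t), (hop (a ⊗ₜ[ZMod p] (extX p q * t))).trans ?_⟩
          refine congrArg (fun w => a ⊗ₜ[ZMod p] w) ?_
          refine (map_mul (extHom p (Hom.toOrderHom (σ j))) (extX p q) t).trans ?_
          exact congrArg₂ (· * ·) (extHom_extX p (Hom.toOrderHom (σ j))) ht) w
    refine ⟨a, b, sub_eq_zero.1 ?_⟩
    exact eq_zero_of_mem_normalized_of_degenerate
      (Submodule.sub_mem _ hw (topForm_mem_normalized_truncSimp a b)) h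

/-- A boundary reduces to a multiple of `(r+1) x^r dx dy_1 ⋯ dy_q`. -/
theorem red_of_mem_boundaries {q : ℕ} {t : Form p (Res p q) q}
    (ht : t ∈ boundaries (formSimp p r) q) :
    ∃ c, red p r q t = topForm p q 0 (c * truncZ p r) := by
  obtain ⟨w, hw, rfl⟩ : ∃ w : Form p (Res p (q + 1)) (q + 1),
    w ∈ normalized (formSimp p r) (q + 1) ∧ tw (resHom p r (Hom.toOrderHom (δ (n := q) 0)))
      (resZ p r q) (Hom.toOrderHom (δ (n := q) 0)) w = t := ht
  obtain ⟨a, b, h⟩ := exists_eq_topForm (red_mem_normalized hw)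
  refine ⟨a, (red_tw p r (Hom.toOrderHom (δ (n := q) 0)) w).trans ?_⟩
  exact (congrArg _ h).trans (tw_δ_zero_topForm _ _ _ _ _)

/-- The reduction of a cycle is a top form, and this product is the coefficient of `dx dy_1⋯dy_q` in
its zeroth face. -/
theorem coeffZero_red_mul {q : ℕ} {t : Form p (Res p (q + 1)) (q + 1)}
    (ht : t ∈ cycles (formSimp p r) (q + 1)) :
    coeffZero _ (q + 1) (red p r (q + 1) t) * truncZ p r = 0 := by
  obtain ⟨a, b, h⟩ := exists_eq_topForm (red_mem_normalized ht.1)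
  have h1 : tw (AlgHom.id (ZMod p) (TruncPoly p r)) (truncZ p r) (Hom.toOrderHom (δ (n := q) 0))
      (red p r (q + 1) t) = 0 :=
    (red_tw p r (Hom.toOrderHom (δ (n := q) 0)) t).symm.trans
      ((congrArg _ ((mem_cycles_succ _).1 ht 0)).trans (map_zero _))
  have h2 := (congrArg _ h.symm).trans h1
  have h3 := (tw_δ_zero_topForm _ _ _ _ _).symm.trans h2
  have h4 := congrArg (coeffOne _ q) h3
  rw [coeffOne_topForm, map_zero] at h4
  rw [h, coeffZero_topForm]
  exact h4

/-- Normalization only involves the faces `d_j` with `j > 0`, which agree in the twisted and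
untwisted objects, and contraction commutes with untwisted operators. -/
theorem formContr_mem_normalized {q : ℕ} {w : Form p (Res p (q + 1)) (q + 1)}
    (hw : w ∈ normalized (untwSimp p r) (q + 1)) :
    formContr _ (q + 1) w ∈ normalized (formSimp p r) (q + 1) ∧
    1 ⊗ₜ extX p (q + 1) * formContr _ (q + 1) w ∈ normalized (formSimp p r) (q + 1) := by
  have h : ∀ j : Fin (q + 1), untw (resHom p r (Hom.toOrderHom (δ j.succ)))
      (Hom.toOrderHom (δ j.succ)) (formContr _ (q + 1) w) = 0 := fun j => by
    have h1 : untw (resHom p r (Hom.toOrderHom (δ j.succ)))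
      (Hom.toOrderHom (δ j.succ)) w = 0 := (mem_normalized_succ _).1 hw j
    exact (untw_formContr _ _ _).trans ((congrArg _ h1).trans (map_zero _))
  constructor
  · exact (mem_normalized_succ _).2 fun j => (op_δ_succ_formSimp j _).trans (h j)
  · refine (mem_normalized_succ _).2 fun j => (op_δ_succ_formSimp j _).trans ?_
    exact (map_mul _ _ _).trans ((congrArg _ (h j)).trans (mul_zero _))

/-- The case of multiples of `dx`. By exactness `t = dx · ι t`, and multiples of `dx` do not see the
twist, so `t` is also an untwisted cycle and has an untwisted filler `w`. Then `dx · ι w` fills `t`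
in the twisted object. -/
theorem mem_boundaries_formSimp_of_extX_mul {q : ℕ} {t : Form p (Res p q) q}
    (ht : t ∈ cycles (formSimp p r) q) (h0 : red p r q t = 0)
    (hX : 1 ⊗ₜ extX p q * t = 0) : t ∈ boundaries (formSimp p r) q := by
  have hc : 1 ⊗ₜ extX p q * formContr _ q t = t := by
    have := formContr_extX_mul t
    rw [hX, map_zero] at this
    exact (sub_eq_zero.1 this.symm).symm
  have hu : t ∈ cycles (untwSimp p r) q := mem_cycles_of_op fun m θ hθ => by
    have h1 : tw (resHom p r (Hom.toOrderHom θ)) (resZ p r m) (Hom.toOrderHom θ) t = 0 :=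
      op_eq_zero_of_mem_cycles ht θ hθ
    have key : ∀ θ : Fin (m + 1) →o Fin (q + 1), tw (resHom p r θ) (resZ p r m) θ t = 0 →
        untw (resHom p r θ) θ t = 0 := by
      intro θ h
      rw [← hc, map_mul, tw_extX] at h
      rw [← hc, map_mul, untw_tmul, map_one, extHom_extX, ← extX_mul_tw _ _ (resZ p r m), h]
    exact key _ h1
  obtain ⟨w, hw, hwt⟩ : ∃ w : Form p (Res p (q + 1)) (q + 1),
    w ∈ normalized (untwSimp p r) (q + 1) ∧ untw (resHom p r (Hom.toOrderHom (δ (n := q) 0)))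
      (Hom.toOrderHom (δ (n := q) 0)) w = t := mem_boundaries_untw hu h0
  refine (mem_boundaries _).2 ⟨_, (formContr_mem_normalized hw).2, ?_⟩
  have key : ∀ θ : Fin (q + 1) →o Fin (q + 1 + 1), untw (resHom p r θ) θ w = t →
      tw (resHom p r θ) (resZ p r q) θ (1 ⊗ₜ extX p (q + 1) * formContr _ (q + 1) w) = t := by
    intro θ h
    rw [map_mul, tw_extX, extX_mul_tw, untw_formContr, h, hc]
  exact key _ hwt

/-- The general case is reduced to multiples of `dx`. The product `dx · t` is an untwisted cycle
with zero reduction, so it has an untwisted filler `w`. A corrected `ι w` has a twisted boundary `d`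
with `dx · d = dx · t`, and then `t - d` is covered by the previous lemma. -/
theorem mem_boundaries_formSimp_of_red {q : ℕ} {t : Form p (Res p q) q}
    (ht : t ∈ cycles (formSimp p r) q) (h0 : red p r q t = 0) :
    t ∈ boundaries (formSimp p r) q := by
  have hu : 1 ⊗ₜ extX p q * t ∈ cycles (untwSimp p r) q := mem_cycles_of_op fun m θ hθ => by
    have h1 : tw (resHom p r (Hom.toOrderHom θ)) (resZ p r m) (Hom.toOrderHom θ) t = 0 :=
      op_eq_zero_of_mem_cycles ht θ hθ
    have key : ∀ θ : Fin (m + 1) →o Fin (q + 1), tw (resHom p r θ) (resZ p r m) θ t = 0 →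
        untw (resHom p r θ) θ (1 ⊗ₜ extX p q * t) = 0 := by
      intro θ h
      rw [map_mul, untw_tmul, map_one, extHom_extX, ← extX_mul_tw _ _ (resZ p r m), h, mul_zero]
    exact key _ h1
  obtain ⟨w, hw, hwt⟩ : ∃ w : Form p (Res p (q + 1)) (q + 1),
    w ∈ normalized (untwSimp p r) (q + 1) ∧ untw (resHom p r (Hom.toOrderHom (δ (n := q) 0)))
      (Hom.toOrderHom (δ (n := q) 0)) w = 1 ⊗ₜ extX p q * t :=
    mem_boundaries_untw hu (by rw [map_mul, h0, mul_zero])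
  have hw' := (formContr_mem_normalized hw).1
  obtain ⟨a, b, hab⟩ := exists_eq_topForm (red_mem_normalized hw')
  obtain ⟨a', b', hab'⟩ := exists_red_eq_topForm (r := r) (q + 1) a b
  -- Subtracting a top form makes the reduction of `w'`, hence that of its boundary `d`, vanish. It
  -- does not affect `dx · d`, because untwisted faces kill top forms.
  set w' : Form p (Res p (q + 1)) (q + 1) := formContr _ (q + 1) w - topForm p (q + 1) a' b'
  have hn : w' ∈ normalized (formSimp p r) (q + 1) :=
    Submodule.sub_mem _ hw' (topForm_mem_normalized_formSimp a' b')
  have hr : red p r (q + 1) w' = 0 := by rw [map_sub, hab, hab', sub_self]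
  set d : Form p (Res p q) q := tw (resHom p r (Hom.toOrderHom (δ (n := q) 0)))
      (resZ p r q) (Hom.toOrderHom (δ (n := q) 0)) w'
  have hd : d ∈ boundaries (formSimp p r) q := ⟨w', hn, rfl⟩
  have hrd : red p r q d = 0 :=
    (red_tw p r (Hom.toOrderHom (δ (n := q) 0)) w').trans ((congrArg _ hr).trans (map_zero _))
  have hXd : 1 ⊗ₜ extX p q * d = 1 ⊗ₜ extX p q * t := by
    refine (extX_mul_tw _ _ _ _).trans ?_
    have h1 : untw (resHom p r (Hom.toOrderHom (δ (n := q) 0))) (Hom.toOrderHom (δ (n := q) 0)) w' =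
        t - 1 ⊗ₜ extX p q * formContr _ q t := by
      refine (map_sub _ _ _).trans ?_
      refine (congrArg₂ (· - ·) (untw_formContr _ _ w)
        (untw_topForm _ _ (Nat.lt_succ_self q) a' b')).trans ?_
      refine (sub_zero _).trans ?_
      exact (congrArg (formContr _ q) hwt).trans (formContr_extX_mul t)
    refine (congrArg _ h1).trans ?_
    rw [mul_sub, ← mul_assoc, Algebra.TensorProduct.tmul_mul_tmul, extX_mul_extX,
      TensorProduct.tmul_zero, zero_mul, sub_zero]
  have hfin : t - d ∈ boundaries (formSimp p r) q :=
    mem_boundaries_formSimp_of_extX_mul (Submodule.sub_mem _ ht (boundaries_le_cycles _ hd))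
      (by rw [map_sub, h0, hrd, sub_zero]) (by rw [mul_sub, hXd, sub_self])
  have := Submodule.add_mem _ hfin hd
  exact (sub_add_cancel t d) ▸ this

/-- Lifting `c dy_1⋯dy_{q+1}` to `R_{q+1}` and applying `d_0` gives a boundary with the prescribed
reduction; the difference reduces to zero. -/
theorem mem_boundaries_formSimp {q : ℕ} {t : Form p (Res p q) q}
    (ht : t ∈ cycles (formSimp p r) q) (c : TruncPoly p r)
    (h0 : red p r q t = topForm p q 0 (c * truncZ p r)) : t ∈ boundaries (formSimp p r) q := by
  obtain ⟨a', b', hab'⟩ := exists_red_eq_topForm (r := r) (q + 1) c 0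
  set d : Form p (Res p q) q := tw (resHom p r (Hom.toOrderHom (δ (n := q) 0)))
      (resZ p r q) (Hom.toOrderHom (δ (n := q) 0)) (topForm p (q + 1) a' b')
  have hd : d ∈ boundaries (formSimp p r) q := ⟨_, topForm_mem_normalized_formSimp a' b', rfl⟩
  have hrd : red p r q d = topForm p q 0 (c * truncZ p r) :=
    (red_tw p r (Hom.toOrderHom (δ (n := q) 0)) _).trans
      ((congrArg _ hab').trans (tw_δ_zero_topForm _ _ _ _ _))
  have hfin : t - d ∈ boundaries (formSimp p r) q :=
    mem_boundaries_formSimp_of_red (Submodule.sub_mem _ ht (boundaries_le_cycles _ hd))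
      (by rw [map_sub, h0, hrd, sub_self])
  have := Submodule.add_mem _ hfin hd
  exact (sub_add_cancel t d) ▸ this

end FormSimp

/-! ### The algebra `Ω̄(A)` -/

section OmegaBasic

namespace Omega

variable (p : ℕ) {A : Type} [CommRing A] [Algebra (ZMod p) A]

theorem el_one : Omega.el p (1 : A) = 1 := by
  simpa using Omega.el_algebraMap p (A := A) 1

theorem el_zero : Omega.el p (0 : A) = 0 := by
  have := Omega.el_smul p (0 : ZMod p) (0 : A)
  rwa [zero_smul, zero_smul] at this

variable (A) in
/-- The inclusion of `A` into `Ω̄(A)`. -/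
def elHom : A →ₐ[ZMod p] Omega p A where
  toFun := Omega.el p
  map_one' := el_one p
  map_mul' := Omega.el_mul p
  map_zero' := el_zero p
  map_add' := Omega.el_add p
  commutes' := Omega.el_algebraMap p

variable (A) in
/-- The linear map `a ↦ da`. -/
def dLin : A →ₗ[ZMod p] Omega p A where
  toFun := Omega.d p
  map_add' := Omega.d_add p
  map_smul' := Omega.d_smul p

theorem d_one : Omega.d p (1 : A) = 0 := by
  simpa [el_one] using Omega.d_mul p (1 : A) 1

theorem d_zero : Omega.d p (0 : A) = 0 := map_zero (dLin p A)

theorem el_commute (a : A) (w : Omega p A) : Commute (Omega.el p a) w := by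
  induction w using Omega.induction with
  | hel b => exact Omega.el_comm_el p a b
  | hd b => exact Omega.el_comm_d p a b
  | hadd u v hu hv => exact hu.add_right hv
  | hmul u v hu hv => exact hu.mul_right hv

theorem bar_el (a : A) : Omega.bar p (Omega.el p a) = Omega.el p a := Omega.lift_el p _ _ a

theorem bar_d (a : A) : Omega.bar p (Omega.d p a) = -Omega.d p a := Omega.lift_d p _ _ a

theorem deRham_el (a : A) : Omega.deRham p (Omega.el p a) = Omega.d p a :=
  Omega.signedDer_el p _ _ a

theorem deRham_d (a : A) : Omega.deRham p (Omega.d p a) = 0 := Omega.signedDer_d p _ _ a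

theorem deRham_mul (u v : Omega p A) :
    Omega.deRham p (u * v) = Omega.deRham p u * v + Omega.bar p u * Omega.deRham p v :=
  Omega.signedDer_mul p _ _ u v

theorem deRham_d_mul (a : A) (v : Omega p A) :
    Omega.deRham p (Omega.d p a * v) = -(Omega.d p a * Omega.deRham p v) := by
  rw [deRham_mul, deRham_d, zero_mul, zero_add, bar_d, neg_mul]

theorem deRham_one : Omega.deRham p (1 : Omega p A) = 0 := by
  rw [← el_one, deRham_el, d_one]

theorem deRham_d_prod (l : List A) : Omega.deRham p (l.map (Omega.d p)).prod = 0 := by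
  induction l with
  | nil => rw [List.map_nil, List.prod_nil, deRham_one]
  | cons a l ih => rw [List.map_cons, List.prod_cons, deRham_d_mul, ih, mul_zero, neg_zero]

variable {p}
variable (E : Derivation (ZMod p) A A)

theorem contract_el (a : A) : Omega.contract E (Omega.el p a) = 0 := Omega.signedDer_el p _ _ a

theorem contract_d (a : A) : Omega.contract E (Omega.d p a) = Omega.el p (E a) :=
  Omega.signedDer_d p _ _ a

theorem contract_mul (u v : Omega p A) : Omega.contract E (u * v) =
    Omega.contract E u * v + Omega.bar p u * Omega.contract E v :=
  Omega.signedDer_mul p _ _ u v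

theorem contract_one : Omega.contract E (1 : Omega p A) = 0 := by rw [← el_one, contract_el]

theorem contract_d_mul (a : A) (v : Omega p A) : Omega.contract E (Omega.d p a * v) =
    Omega.el p (E a) * v - Omega.d p a * Omega.contract E v := by
  rw [contract_mul, contract_d, bar_d, neg_mul, sub_eq_add_neg]

/-- Cartan's formula for a product of exact forms of weight one. -/
theorem deRham_contract_d_prod (w : A → ZMod p) (l : List A) (hw : ∀ a ∈ l, E a = w a • a) :
    Omega.deRham p (Omega.contract E (l.map (Omega.d p)).prod) =
      (l.map w).sum • (l.map (Omega.d p)).prod := by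
  induction l with
  | nil =>
    rw [List.map_nil, List.prod_nil, contract_one, map_zero, List.map_nil, List.sum_nil, zero_smul]
  | cons a l ih =>
    rw [List.map_cons, List.prod_cons, contract_d_mul, map_sub, deRham_mul, deRham_d_prod, mul_zero,
      add_zero, deRham_d_mul, ih fun b hb => hw b (List.mem_cons_of_mem _ hb), deRham_el,
      hw a List.mem_cons_self, Omega.d_smul, smul_mul_assoc, mul_smul_comm, sub_neg_eq_add,
      List.map_cons, List.sum_cons, add_smul]

variable {B : Type} [CommRing B] [Algebra (ZMod p) B] (f : A →ₐ[ZMod p] B)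

theorem map_bar (w : Omega p A) :
    Omega.map p f (Omega.bar p w) = Omega.bar p (Omega.map p f w) := by
  induction w using Omega.induction with
  | hel a => rw [bar_el, Omega.map_el, bar_el]
  | hd a => rw [bar_d, map_neg, Omega.map_d, bar_d]
  | hadd u v hu hv => rw [map_add, map_add, hu, hv, map_add, map_add]
  | hmul u v hu hv => rw [map_mul, map_mul, hu, hv, map_mul, map_mul]

theorem map_deRham (w : Omega p A) :
    Omega.map p f (Omega.deRham p w) = Omega.deRham p (Omega.map p f w) := by
  induction w using Omega.induction with
  | hel a => rw [deRham_el, Omega.map_el, deRham_el, Omega.map_d]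
  | hd a => rw [deRham_d, map_zero, Omega.map_d, deRham_d]
  | hadd u v hu hv => rw [map_add, map_add, hu, hv, map_add, map_add]
  | hmul u v hu hv =>
    rw [deRham_mul, map_add, map_mul, map_mul, map_bar, hu, hv, map_mul, deRham_mul]

theorem map_contract {E' : Derivation (ZMod p) B B} (h : ∀ a, f (E a) = E' (f a)) (w : Omega p A) :
    Omega.map p f (Omega.contract E w) = Omega.contract E' (Omega.map p f w) := by
  induction w using Omega.induction with
  | hel a => rw [contract_el, map_zero, Omega.map_el, contract_el]
  | hd a => rw [contract_d, Omega.map_el, Omega.map_d, contract_d, h]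
  | hadd u v hu hv => rw [map_add, map_add, hu, hv, map_add, map_add]
  | hmul u v hu hv =>
    rw [contract_mul, map_add, map_mul, map_mul, map_bar, hu, hv, map_mul, contract_mul]

variable {C : Type} [Ring C] [Algebra (ZMod p) C]

/-- Algebra maps out of `Ω̄` of a polynomial algebra are determined by their values on the
variables and their differentials. -/
theorem algHom_ext_mvPolynomial {ι : Type} {f g : Omega p (MvPolynomial ι (ZMod p)) →ₐ[ZMod p] C}
    (h1 : ∀ i, f (Omega.el p (MvPolynomial.X i)) = g (Omega.el p (MvPolynomial.X i)))
    (h2 : ∀ i, f (Omega.d p (MvPolynomial.X i)) = g (Omega.d p (MvPolynomial.X i))) : f = g := by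
  have h3 : f.comp (elHom p _) = g.comp (elHom p _) := MvPolynomial.algHom_ext h1
  have h3' : ∀ a, f (Omega.el p a) = g (Omega.el p a) := DFunLike.congr_fun h3
  refine Omega.algHom_ext p h3' fun a => ?_
  induction a using MvPolynomial.induction_on with
  | C c =>
    rw [MvPolynomial.C_eq_smul_one, Omega.d_smul, d_one, smul_zero, map_zero, map_zero]
  | add a b ha hb => rw [Omega.d_add, map_add, map_add, ha, hb]
  | mul_X a i ha =>
    rw [Omega.d_mul, map_add, map_mul, map_mul, map_add, map_mul, map_mul, ha, h2, h3', h3']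

end Omega

end OmegaBasic

/-! ### The internal grading of `Ω̄` -/

section OmegaGraded

open Omega

variable {p : ℕ} {A B : EvenAlg p}

theorem mem_omegaGr_of_list {n m : ℕ} {a : A.carrier} (ha : a ∈ A.gr m) (l : List (ℕ × A.carrier))
    (hl : ∀ x ∈ l, x.2 ∈ A.gr x.1) (h : m + (l.map Prod.fst).sum = n + l.length) :
    Omega.el p a * (l.map fun x => Omega.d p x.2).prod ∈ Omega.gr A n := by
  refine Submodule.subset_span ⟨l.length, m, a, fun i => (l.get i).1, fun i => (l.get i).2, ha,
    fun i => hl _ (List.get_mem _ _), ?_, ?_⟩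
  · rw [← h]
    congr 1
    rw [← List.sum_ofFn]
    congr 1
    exact List.ext_getElem (by simp) fun i h1 h2 => by simp
  · congr 2
    exact List.ext_getElem (by simp) fun i h1 h2 => by simp

theorem omegaGr_induction {n : ℕ} {C : (u : Omega p A.carrier) → u ∈ Omega.gr A n → Prop}
    (zero : C 0 (Submodule.zero_mem _))
    (add : ∀ u v hu hv, C u hu → C v hv → C (u + v) (Submodule.add_mem _ hu hv))
    (smul : ∀ (c : ZMod p) u hu, C u hu → C (c • u) (Submodule.smul_mem _ c hu))
    (prod : ∀ (m : ℕ) (a : A.carrier) (l : List (ℕ × A.carrier)) (ha : a ∈ A.gr m)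
      (hl : ∀ x ∈ l, x.2 ∈ A.gr x.1) (h : m + (l.map Prod.fst).sum = n + l.length),
      C (Omega.el p a * (l.map fun x => Omega.d p x.2).prod) (mem_omegaGr_of_list ha l hl h))
    {u : Omega p A.carrier} (hu : u ∈ Omega.gr A n) : C u hu := by
  induction hu using Submodule.span_induction with
  | mem u hu =>
    obtain ⟨k, m, a, e, b, ha, hb, hs, rfl⟩ := hu
    have := prod m a (List.ofFn fun i => (e i, b i)) ha
      (fun x hx => by obtain ⟨i, rfl⟩ := (List.mem_ofFn' _ _).1 hx; exact hb i)
      (by rw [List.map_ofFn, List.sum_ofFn, List.length_ofFn]; exact hs)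
    simp only [List.map_ofFn] at this
    exact this
  | zero => exact zero
  | add u v hu' hv' hu hv => exact add u v hu' hv' hu hv
  | smul c u hu' hu => exact smul c u hu' hu

theorem mul_mem_omegaGr {m n : ℕ} {u v : Omega p A.carrier} (hu : u ∈ Omega.gr A m)
    (hv : v ∈ Omega.gr A n) : u * v ∈ Omega.gr A (m + n) := by
  induction hu using omegaGr_induction with
  | zero => rw [zero_mul]; exact Submodule.zero_mem _
  | add u u' _ _ hu hu' => rw [add_mul]; exact Submodule.add_mem _ hu hu'
  | smul c u _ hu => rw [smul_mul_assoc]; exact Submodule.smul_mem _ _ hu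
  | prod k a l ha hl h =>
    induction hv using omegaGr_induction with
    | zero => rw [mul_zero]; exact Submodule.zero_mem _
    | add u u' _ _ hu hu' => rw [mul_add]; exact Submodule.add_mem _ hu hu'
    | smul c u _ hu => rw [mul_smul_comm]; exact Submodule.smul_mem _ _ hu
    | prod k' a' l' ha' hl' h' =>
      have hg := A.gradedMonoid
      have := mem_omegaGr_of_list (p := p) (SetLike.mul_mem_graded ha ha') (l ++ l') (n := m + n)
        (fun x hx => (List.mem_append.1 hx).elim (hl x) (hl' x)) (by
          rw [List.map_append, List.sum_append, List.length_append]; omega)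
      rw [List.map_append, List.prod_append, Omega.el_mul] at this
      rw [mul_assoc, ← mul_assoc _ (Omega.el p a'), ← (el_commute p a' _).eq, mul_assoc]
      rwa [mul_assoc] at this

theorem el_mem_omegaGr {n : ℕ} {a : A.carrier} (ha : a ∈ A.gr n) : Omega.el p a ∈ Omega.gr A n := by
  simpa using mem_omegaGr_of_list (p := p) (n := n) ha [] (by simp) (by simp)

theorem one_mem_omegaGr : (1 : Omega p A.carrier) ∈ Omega.gr A 0 := by
  rw [← el_one]
  have := A.gradedMonoid
  exact el_mem_omegaGr (SetLike.one_mem_graded A.gr)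

theorem d_mem_omegaGr {n : ℕ} {a : A.carrier} (ha : a ∈ A.gr (n + 1)) :
    Omega.d p a ∈ Omega.gr A n := by
  have hg := A.gradedMonoid
  have := mem_omegaGr_of_list (p := p) (n := n) (SetLike.one_mem_graded A.gr) [(n + 1, a)]
    (by simpa using ha) (by simp)
  simpa [el_one] using this

theorem map_mem_omegaGr (f : EvenAlg.Hom A B) {n : ℕ} {u : Omega p A.carrier}
    (hu : u ∈ Omega.gr A n) : Omega.map p f.toAlgHom u ∈ Omega.gr B n := by
  induction hu using omegaGr_induction with
  | zero => rw [map_zero]; exact Submodule.zero_mem _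
  | add u u' _ _ hu hu' => rw [map_add]; exact Submodule.add_mem _ hu hu'
  | smul c u _ hu => rw [map_smul]; exact Submodule.smul_mem _ _ hu
  | prod m a l ha hl h =>
    have := mem_omegaGr_of_list (p := p) (n := n) (f.map_gr m a ha)
      (l.map fun x => (x.1, f.toAlgHom x.2)) (by
        intro x hx
        obtain ⟨y, hy, rfl⟩ := List.mem_map.1 hx
        exact f.map_gr _ _ (hl y hy)) (by
        rw [List.map_map, List.length_map]; exact h)
    rw [List.map_map] at this
    have e : (⇑(Omega.map p f.toAlgHom) ∘ fun x : ℕ × A.carrier => Omega.d p x.2) =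
        (fun x : ℕ × B.carrier => Omega.d p x.2) ∘ fun x => (x.1, f.toAlgHom x.2) :=
      funext fun x => Omega.map_d _ _
    rw [map_mul, Omega.map_el, map_list_prod, List.map_map, e]
    exact this

/-- The involution contributes one sign per factor `da_l`. In a nonzero monomial all the homogeneous
elements have even degree, so the number of such factors has the parity of the total degree;
monomials with an odd-degree entry are zero. -/
theorem bar_of_mem_omegaGr {n : ℕ} {u : Omega p A.carrier} (hu : u ∈ Omega.gr A n) :
    Omega.bar p u = (-1 : Omega p A.carrier) ^ n * u := by
  induction hu using omegaGr_induction with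
  | zero => rw [map_zero, mul_zero]
  | add u u' _ _ hu hu' => rw [map_add, hu, hu', mul_add]
  | smul c u _ hu => rw [map_smul, hu, mul_smul_comm]
  | prod m a l ha hl h =>
    rw [map_mul, bar_el]
    have h0 : ∀ l : List (ℕ × A.carrier), Omega.bar p (l.map fun x => Omega.d p x.2).prod =
        (-1) ^ l.length * (l.map fun x => Omega.d p x.2).prod := by
      intro l
      induction l with
      | nil => simp
      | cons x l ih =>
        rw [List.map_cons, List.prod_cons, map_mul, ih, bar_d, List.length_cons, pow_succ]
        have : Commute ((-1 : Omega p A.carrier) ^ l.length) (Omega.d p x.2) :=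
          (Commute.neg_one_left _).pow_left _
        rw [mul_assoc, neg_mul, neg_mul, one_mul, mul_neg, ← mul_assoc, ← mul_assoc, this.eq]
    have hodd : ∀ {k : ℕ} {b : A.carrier}, b ∈ A.gr k → ¬ Even k → b = 0 := by
      intro k b hb hk
      rw [A.gr_odd k (Nat.not_even_iff_odd.1 hk)] at hb
      exact (Submodule.mem_bot _).1 hb
    by_cases hm : Even m
    · by_cases hall : ∀ x ∈ l, Even x.1
      · have hs : Even (l.map Prod.fst).sum := by
          clear h hl
          induction l with
          | nil => simp
          | cons x l ih =>
            rw [List.map_cons, List.sum_cons]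
            exact (hall x List.mem_cons_self).add
              (ih fun y hy => hall y (List.mem_cons_of_mem _ hy))
        have hpar : Even (n + l.length) := h ▸ hm.add hs
        have hsgn : (-1 : Omega p A.carrier) ^ l.length = (-1) ^ n := by
          rcases Nat.even_or_odd n with hn | hn
          · rw [hn.neg_one_pow, ((Nat.even_add.1 hpar).1 hn).neg_one_pow]
          · have : Odd l.length := Nat.not_even_iff_odd.1 fun h' =>
              Nat.not_even_iff_odd.2 hn ((Nat.even_add.1 hpar).2 h')
            rw [hn.neg_one_pow, this.neg_one_pow]
        have hc : Commute (Omega.el p a) ((-1 : Omega p A.carrier) ^ n) := el_commute p _ _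
        rw [h0, hsgn, ← mul_assoc, hc.eq, mul_assoc]
      · push Not at hall
        obtain ⟨x, hx, hx'⟩ := hall
        have : (l.map fun x => Omega.d p x.2).prod = 0 := by
          refine List.prod_eq_zero (List.mem_map.2 ⟨x, hx, ?_⟩)
          rw [hodd (hl x hx) (by simpa using hx'), d_zero]
        rw [this, map_zero, mul_zero, mul_zero]
    · rw [hodd ha hm, el_zero, zero_mul, zero_mul, mul_zero]

theorem d_prod_mem_omegaGr (l : List (ℕ × A.carrier)) (hl : ∀ x ∈ l, x.2 ∈ A.gr (x.1 + 1)) :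
    (l.map fun x => Omega.d p x.2).prod ∈ Omega.gr A (l.map Prod.fst).sum := by
  induction l with
  | nil => simpa using one_mem_omegaGr
  | cons x l ih =>
    simp only [List.map_cons, List.prod_cons, List.sum_cons]
    exact mul_mem_omegaGr (d_mem_omegaGr (hl x List.mem_cons_self))
      (ih fun y hy => hl y (List.mem_cons_of_mem _ hy))

theorem contract_d_prod_mem_omegaGr {E : Derivation (ZMod p) A.carrier A.carrier}
    (l : List (ℕ × A.carrier)) (hl : ∀ x ∈ l, x.2 ∈ A.gr (x.1 + 1))
    (hE : ∀ x ∈ l, E x.2 ∈ A.gr (x.1 + 1)) :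
    Omega.contract E (l.map fun x => Omega.d p x.2).prod ∈
      Omega.gr A ((l.map Prod.fst).sum + 1) := by
  induction l with
  | nil =>
    simp only [List.map_nil, List.prod_nil, contract_one]
    exact Submodule.zero_mem _
  | cons x l ih =>
    simp only [List.map_cons, List.prod_cons, List.sum_cons, contract_d_mul]
    have hl' : ∀ y ∈ l, y.2 ∈ A.gr (y.1 + 1) := fun y hy => hl y (List.mem_cons_of_mem _ hy)
    refine Submodule.sub_mem _ ?_ ?_
    · rw [add_right_comm]
      exact mul_mem_omegaGr (el_mem_omegaGr (hE x List.mem_cons_self)) (d_prod_mem_omegaGr l hl')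
    · rw [add_assoc]
      exact mul_mem_omegaGr (d_mem_omegaGr (hl x List.mem_cons_self))
        (ih hl' fun y hy => hE y (List.mem_cons_of_mem _ hy))

/-- The linear map that sends a homogeneous element `a` of degree `n` to `t^n f(a)`. -/
def homogenize (A : EvenAlg p) (f : A.carrier →ₗ[ZMod p] Omega p A.carrier) (e : ℕ → ℤ) :
    A.carrier →ₗ[ZMod p] AddMonoidAlgebra (Omega p A.carrier) ℤ :=
  DirectSum.toModule (ZMod p) ℕ _ (fun n =>
    AddMonoidAlgebra.lsingle (e n) ∘ₗ f ∘ₗ (A.gr n).subtype) ∘ₗ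
    (LinearEquiv.ofBijective (DirectSum.coeLinearMap A.gr) A.isInternal).symm.toLinearMap

theorem homogenize_of_mem (f : A.carrier →ₗ[ZMod p] Omega p A.carrier) (e : ℕ → ℤ) {n : ℕ}
    {a : A.carrier} (ha : a ∈ A.gr n) :
    homogenize A f e a = AddMonoidAlgebra.single (e n) (f a) := by
  have h : (LinearEquiv.ofBijective (DirectSum.coeLinearMap A.gr) A.isInternal).symm a =
      DirectSum.lof (ZMod p) ℕ (fun n => A.gr n) n ⟨a, ha⟩ := by
    rw [LinearEquiv.symm_apply_eq]
    exact (DirectSum.coeLinearMap_lof A.gr n ⟨a, ha⟩).symm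
  simp only [homogenize, LinearMap.comp_apply, LinearEquiv.coe_coe, h]
  rw [DirectSum.toModule_lof]
  rfl

variable (A) in
/-- The values of the grading map on generators. -/
def gradingVal : OmegaGen A.carrier → AddMonoidAlgebra (Omega p A.carrier) ℤ
  | .el a => homogenize A (elHom p A.carrier).toLinearMap (fun n => n) a
  -- Exponents are integers because `da` has formal degree `-1` for `a` of degree zero.
  | .d a => homogenize A (dLin p A.carrier) (fun n => n - 1) a

theorem gradingVal_el {n : ℕ} {a : A.carrier} (ha : a ∈ A.gr n) :
    gradingVal A (.el a) = AddMonoidAlgebra.single (n : ℤ) (Omega.el p a) :=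
  homogenize_of_mem _ _ ha

theorem gradingVal_d {n : ℕ} {a : A.carrier} (ha : a ∈ A.gr n) :
    gradingVal A (.d a) = AddMonoidAlgebra.single ((n : ℤ) - 1) (Omega.d p a) :=
  homogenize_of_mem _ _ ha

theorem gradingVal_el_add (a b : A.carrier) :
    gradingVal A (.el (a + b)) = gradingVal A (.el a) + gradingVal A (.el b) :=
  map_add (homogenize A _ _) a b

theorem gradingVal_d_add (a b : A.carrier) :
    gradingVal A (.d (a + b)) = gradingVal A (.d a) + gradingVal A (.d b) :=
  map_add (homogenize A _ _) a b

theorem gradingVal_d_comm_d (a b : A.carrier) :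
    gradingVal A (.d a) * gradingVal A (.d b) = -(gradingVal A (.d b) * gradingVal A (.d a)) := by
  induction a using A.induction_homogeneous with
  | hom m a ha =>
    induction b using A.induction_homogeneous with
    | hom n b hb =>
      rw [gradingVal_d ha, gradingVal_d hb, AddMonoidAlgebra.single_mul_single,
        AddMonoidAlgebra.single_mul_single, Omega.d_comm_d, add_comm, ← AddMonoidAlgebra.single_neg]
    | add b b' hb hb' => rw [gradingVal_d_add, mul_add, add_mul, hb, hb', neg_add]
  | add a a' ha ha' => rw [gradingVal_d_add, mul_add, add_mul, ha, ha', neg_add]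

variable (A) in
/-- The algebra map `u ↦ t^n u` for `u` of degree `n`. -/
def grading : Omega p A.carrier →ₐ[ZMod p] AddMonoidAlgebra (Omega p A.carrier) ℤ :=
  Omega.lift p (gradingVal A) (by
    have hg := A.gradedMonoid
    intro u v h
    cases h with
    | el_add a b => simp only [FreeAlgebra.lift_ι_apply, map_add, gradingVal_el_add]
    | el_algebraMap c =>
      rw [FreeAlgebra.lift_ι_apply, AlgHom.commutes, Algebra.algebraMap_eq_smul_one]
      have h1 := gradingVal_el (p := p) (SetLike.one_mem_graded A.gr)
      have h2 : gradingVal A (.el (c • (1 : A.carrier))) = c • gradingVal A (.el (1 : A.carrier)) :=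
        map_smul (homogenize A _ _) c 1
      rw [h2, h1, el_one, Algebra.algebraMap_eq_smul_one]
      rfl
    | el_mul a b =>
      simp only [FreeAlgebra.lift_ι_apply, map_mul]
      induction a using A.induction_homogeneous with
      | hom m a ha =>
        induction b using A.induction_homogeneous with
        | hom n b hb =>
          rw [gradingVal_el ha, gradingVal_el hb, gradingVal_el (SetLike.mul_mem_graded ha hb),
            AddMonoidAlgebra.single_mul_single, Omega.el_mul, Nat.cast_add]
        | add b b' hb hb' => rw [mul_add, gradingVal_el_add, gradingVal_el_add, mul_add, hb, hb']
      | add a a' ha ha' => rw [add_mul, gradingVal_el_add, gradingVal_el_add, add_mul, ha, ha']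
    | d_add a b => simp only [FreeAlgebra.lift_ι_apply, map_add, gradingVal_d_add]
    | d_smul c a =>
      simp only [FreeAlgebra.lift_ι_apply, map_smul]
      exact map_smul (homogenize A _ _) c a
    | d_mul a b =>
      simp only [FreeAlgebra.lift_ι_apply, map_mul, map_add]
      induction a using A.induction_homogeneous with
      | hom m a ha =>
        induction b using A.induction_homogeneous with
        | hom n b hb =>
          rw [gradingVal_el ha, gradingVal_el hb, gradingVal_d ha, gradingVal_d hb,
            gradingVal_d (SetLike.mul_mem_graded ha hb), AddMonoidAlgebra.single_mul_single,
            AddMonoidAlgebra.single_mul_single, Omega.d_mul, Nat.cast_add,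
            AddMonoidAlgebra.single_add]
          congr 2 <;> ring
        | add b b' hb hb' =>
          rw [mul_add, gradingVal_el_add, gradingVal_d_add, gradingVal_d_add, mul_add, add_mul, hb,
            hb']
          abel
      | add a a' ha ha' =>
        rw [add_mul, gradingVal_el_add, gradingVal_d_add, gradingVal_d_add, mul_add, add_mul, ha,
          ha']
        abel
    | el_comm_d a b =>
      simp only [FreeAlgebra.lift_ι_apply, map_mul]
      induction a using A.induction_homogeneous with
      | hom m a ha =>
        induction b using A.induction_homogeneous with
        | hom n b hb =>
          rw [gradingVal_el ha, gradingVal_d hb, AddMonoidAlgebra.single_mul_single,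
            AddMonoidAlgebra.single_mul_single, Omega.el_comm_d, add_comm]
        | add b b' hb hb' => rw [gradingVal_d_add, mul_add, add_mul, hb, hb']
      | add a a' ha ha' => rw [gradingVal_el_add, mul_add, add_mul, ha, ha']
    | d_comm_d a b =>
      simp only [FreeAlgebra.lift_ι_apply, map_mul, map_neg]
      exact gradingVal_d_comm_d a b
    | d_sq a =>
      simp only [FreeAlgebra.lift_ι_apply, map_mul, map_zero]
      induction a using A.induction_homogeneous with
      | hom m a ha =>
        rw [gradingVal_d ha, AddMonoidAlgebra.single_mul_single, Omega.d_sq,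
          AddMonoidAlgebra.single_zero]
      | add a a' ha ha' =>
        rw [gradingVal_d_add, mul_add, add_mul, add_mul, ha, ha', gradingVal_d_comm_d a' a]
        simp)

theorem grading_el {n : ℕ} {a : A.carrier} (ha : a ∈ A.gr n) :
    grading A (Omega.el p a) = AddMonoidAlgebra.single (n : ℤ) (Omega.el p a) :=
  (Omega.lift_el p _ _ a).trans (gradingVal_el ha)

theorem grading_d {n : ℕ} {a : A.carrier} (ha : a ∈ A.gr n) :
    grading A (Omega.d p a) = AddMonoidAlgebra.single ((n : ℤ) - 1) (Omega.d p a) :=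
  (Omega.lift_d p _ _ a).trans (gradingVal_d ha)

theorem grading_of_mem {n : ℕ} {u : Omega p A.carrier} (hu : u ∈ Omega.gr A n) :
    grading A u = AddMonoidAlgebra.single (n : ℤ) u := by
  induction hu using omegaGr_induction with
  | zero => rw [map_zero, AddMonoidAlgebra.single_zero]
  | add u u' _ _ hu hu' => rw [map_add, hu, hu', AddMonoidAlgebra.single_add]
  | smul c u _ hu => rw [map_smul, hu]; exact AddMonoidAlgebra.smul_single _ _ _
  | prod m a l ha hl h =>
    have h0 : ∀ l : List (ℕ × A.carrier), (∀ x ∈ l, x.2 ∈ A.gr x.1) →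
        grading A (l.map fun x => Omega.d p x.2).prod =
          AddMonoidAlgebra.single (((l.map Prod.fst).sum : ℤ) - l.length)
            (l.map fun x => Omega.d p x.2).prod := by
      intro l hl
      induction l with
      | nil => simp
      | cons x l ih =>
        rw [List.map_cons, List.prod_cons, map_mul, ih fun y hy => hl y (List.mem_cons_of_mem _ hy),
          grading_d (hl x List.mem_cons_self), AddMonoidAlgebra.single_mul_single]
        congr 1
        simp
        ring
    rw [map_mul, grading_el ha, h0 l hl, AddMonoidAlgebra.single_mul_single]
    congr 1
    have := congrArg (Nat.cast : ℕ → ℤ) h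
    push_cast at this ⊢
    linarith

theorem grading_map (f : EvenAlg.Hom A B) (u : Omega p A.carrier) :
    grading B (Omega.map p f.toAlgHom u) =
      AddMonoidAlgebra.mapAlgHom ℤ (Omega.map p f.toAlgHom) (grading A u) := by
  have h : (grading B).comp (Omega.map p f.toAlgHom) =
      (AddMonoidAlgebra.mapAlgHom ℤ (Omega.map p f.toAlgHom)).comp (grading A) := by
    refine Omega.algHom_ext p (fun a => ?_) fun a => ?_
    · rw [AlgHom.comp_apply, AlgHom.comp_apply]
      induction a using A.induction_homogeneous with
      | hom n a ha =>
        rw [Omega.map_el, grading_el ha, grading_el (f.map_gr n a ha)]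
        refine Eq.trans ?_ (AddMonoidAlgebra.mapRingHom_single _ _ _).symm
        exact congrArg _ (Omega.map_el _ _).symm
      | add a b ha hb => rw [Omega.el_add, map_add, map_add, ha, hb, map_add, map_add]
    · rw [AlgHom.comp_apply, AlgHom.comp_apply]
      induction a using A.induction_homogeneous with
      | hom n a ha =>
        rw [Omega.map_d, grading_d ha, grading_d (f.map_gr n a ha)]
        refine Eq.trans ?_ (AddMonoidAlgebra.mapRingHom_single _ _ _).symm
        exact congrArg _ (Omega.map_d _ _).symm
      | add a b ha hb => rw [Omega.d_add, map_add, map_add, ha, hb, map_add, map_add]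
  exact DFunLike.congr_fun h u

variable (A) in
/-- The projection of `Ω̄(A)` onto the part of degree `n`. -/
def omegaProj (n : ℕ) : Omega p A.carrier →ₗ[ZMod p] Omega p A.carrier :=
  Finsupp.lapply (n : ℤ) ∘ₗ (AddMonoidAlgebra.coeffLinearEquiv (ZMod p)).toLinearMap ∘ₗ
    (grading A).toLinearMap

theorem omegaProj_apply (n : ℕ) (u : Omega p A.carrier) :
    omegaProj A n u = (grading A u).coeff n := rfl

theorem omegaProj_of_mem {m : ℕ} (n : ℕ) {u : Omega p A.carrier} (hu : u ∈ Omega.gr A m) :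
    omegaProj A n u = if m = n then u else 0 := by
  rw [omegaProj_apply, grading_of_mem hu, AddMonoidAlgebra.coeff_single, Finsupp.single_apply]
  simp

theorem map_omegaProj (f : EvenAlg.Hom A B) (n : ℕ) (u : Omega p A.carrier) :
    Omega.map p f.toAlgHom (omegaProj A n u) = omegaProj B n (Omega.map p f.toAlgHom u) := by
  rw [omegaProj_apply, omegaProj_apply, grading_map]
  simp

end OmegaGraded

/-! ### Shuffle products of cycles -/

section Shuffle

open SimplexCategory

theorem shuffle_eq {p : ℕ} (V : SimplicialObject (AlgCat.{0} (ZMod p))) {i j : ℕ} (u : alv V i)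
    (v : alv V j) : shuffle V u v =
      ∑ μ ∈ Finset.powersetCard i (Finset.univ : Finset (Fin (i + j))),
        (-1 : ZMod p) ^ (∑ k ∈ μ, (μᶜ.filter fun a => a < k).card) •
          (op V (mkHom (collapse μ i)) u * op V (mkHom (collapse μᶜ j)) v) := rfl

theorem map_shuffle {p : ℕ} {V W : SimplicialObject (AlgCat.{0} (ZMod p))}
    (F : ∀ n, alv V n →ₐ[ZMod p] alv W n)
    (hF : ∀ (a b : ℕ) (θ : SimplexCategory.mk a ⟶ SimplexCategory.mk b) (v : alv V b),
      op W θ (F b v) = F a (op V θ v)) {i j : ℕ} (u : alv V i) (v : alv V j) :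
    F (i + j) (shuffle V u v) = shuffle W (F i u) (F j v) := by
  rw [shuffle_eq, shuffle_eq, map_sum]
  refine Finset.sum_congr rfl fun μ _ => ?_
  rw [map_smul, map_mul, hF, hF]

/-! ### Adjacent transpositions of shuffles -/

section Swap

variable {n : ℕ} {a b : Fin n}

theorem mem_map_swap (S : Finset (Fin n)) (x : Fin n) :
    x ∈ S.map (Equiv.swap a b).toEmbedding ↔ Equiv.swap a b x ∈ S := by
  rw [Finset.mem_map_equiv, Equiv.symm_swap]

theorem map_swap_compl (S : Finset (Fin n)) :
    (S.map (Equiv.swap a b).toEmbedding)ᶜ = Sᶜ.map (Equiv.swap a b).toEmbedding := by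
  ext x
  rw [Finset.mem_compl, mem_map_swap, mem_map_swap, Finset.mem_compl]

theorem card_filter_map_swap (S : Finset (Fin n)) (s : ℕ) (h : a.val < s ↔ b.val < s) :
    ((S.map (Equiv.swap a b).toEmbedding).filter fun k => k.val < s).card =
      (S.filter fun k => k.val < s).card := by
  have : (S.map (Equiv.swap a b).toEmbedding).filter (fun k => k.val < s) =
      (S.filter fun k => k.val < s).map (Equiv.swap a b).toEmbedding := by
    ext x
    rw [Finset.mem_filter, mem_map_swap, mem_map_swap, Finset.mem_filter]
    refine and_congr_right fun _ => ?_
    rw [Equiv.swap_apply_def]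
    split_ifs with h1 h2
    · rw [h1, h]
    · rw [h2, h]
    · rfl
  rw [this, Finset.card_map]

/-- Exchanging neighbours `a ∈ μ` and `a+1 ∉ μ` creates exactly one new pair of an element of `μ`
above an element of its complement, so the sign of the shuffle changes. -/
theorem sum_card_filter_map_swap (hab : a.val + 1 = b.val) {μ : Finset (Fin n)} (ha : a ∈ μ)
    (hb : b ∉ μ) :
    ∑ k ∈ μ.map (Equiv.swap a b).toEmbedding,
      ((μ.map (Equiv.swap a b).toEmbedding)ᶜ.filter fun c => c < k).card =
    ∑ k ∈ μ, (μᶜ.filter fun c => c < k).card + 1 := by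
  have hlt : a < b := Fin.lt_def.2 (by omega)
  have hne : a ≠ b := hlt.ne
  rw [Finset.sum_map, ← Finset.add_sum_erase _ _ ha, ← Finset.add_sum_erase μ _ ha, map_swap_compl]
  have h1 : ∑ x ∈ μ.erase a, ((Finset.map (Equiv.swap a b).toEmbedding μᶜ).filter
      fun c => c < (Equiv.swap a b).toEmbedding x).card =
      ∑ x ∈ μ.erase a, (μᶜ.filter fun c => c < x).card := by
    refine Finset.sum_congr rfl fun x hx => ?_
    have hxa : x ≠ a := Finset.ne_of_mem_erase hx
    have hxb : x ≠ b := fun h => hb (h ▸ Finset.mem_of_mem_erase hx)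
    have hx' : (Equiv.swap a b).toEmbedding x = x := Equiv.swap_apply_of_ne_of_ne hxa hxb
    rw [hx']
    refine card_filter_map_swap μᶜ x.val ?_
    have := Fin.val_ne_of_ne hxa
    have := Fin.val_ne_of_ne hxb
    omega
  have h2 : ((Finset.map (Equiv.swap a b).toEmbedding μᶜ).filter
      fun c => c < (Equiv.swap a b).toEmbedding a).card = (μᶜ.filter fun c => c < a).card + 1 := by
    have hx' : (Equiv.swap a b).toEmbedding a = b := Equiv.swap_apply_left a b
    have : (Finset.map (Equiv.swap a b).toEmbedding μᶜ).filter (fun c => c < b) =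
        insert a (μᶜ.filter fun c => c < a) := by
      ext x
      rw [Finset.mem_filter, mem_map_swap, Finset.mem_insert, Finset.mem_filter, Equiv.swap_apply_def]
      split_ifs with h1 h2
      · rw [h1]
        simp [hb, hlt]
      · rw [h2]
        simp [hne.symm, hlt.not_gt]
      · have := Fin.val_ne_of_ne h1
        simp only [h1, false_or, Fin.lt_def]
        refine and_congr_right fun _ => ?_
        omega
    rw [hx', this, Finset.card_insert_of_notMem (by simp)]
  rw [h1, h2]
  ring

end Swap

variable {p : ℕ} {V : SimplicialObject (AlgCat.{0} (ZMod p))}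

/-- If the collapse map jumps on every step adjacent to the vertex `l`, its value at `l` is attained
nowhere else. Omitting `l` makes the map non-surjective, and the cycle `u` dies. -/
theorem op_δ_collapse_eq_zero {m n : ℕ} {u : alv V m} (hu : u ∈ cycles V m)
    {S : Finset (Fin (n + 1))} (hS : S.card = m) (l : Fin (n + 2))
    (h1 : ∀ k : Fin (n + 1), k.val + 1 = l.val → k ∈ S)
    (h2 : ∀ k : Fin (n + 1), k.val = l.val → k ∈ S) :
    op V (δ l) (op V (mkHom (collapse S m)) u) = 0 := by
  rw [← op_comp]
  refine op_eq_zero_of_mem_cycles hu _ fun hs => ?_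
  obtain ⟨t, ht⟩ := hs (collapse S m l)
  set s : Fin (n + 2) := l.succAbove t
  have hsl : s ≠ l := Fin.succAbove_ne l t
  have ht' : min (S.filter fun k => k.val < s.val).card m =
      min (S.filter fun k => k.val < l.val).card m := congrArg Fin.val ht
  have hle : ∀ c, (S.filter fun k => k.val < c).card ≤ m := fun c =>
    hS ▸ Finset.card_filter_le _ _
  rw [min_eq_left (hle _), min_eq_left (hle _)] at ht'
  have hsl' := Fin.val_ne_of_ne hsl
  rcases lt_or_gt_of_ne hsl' with h | h
  · have hk : l.val - 1 < n + 1 := by have := l.isLt; omega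
    have : (S.filter fun k => k.val < s.val) ⊂ (S.filter fun k => k.val < l.val) := by
      refine Finset.ssubset_iff_subset_ne.2 ⟨?_, fun heq => ?_⟩
      · intro x hx
        rw [Finset.mem_filter] at hx ⊢
        exact ⟨hx.1, hx.2.trans h⟩
      · have h3 : (⟨l.val - 1, hk⟩ : Fin (n + 1)) ∈ S.filter fun k => k.val < l.val :=
          Finset.mem_filter.2 ⟨h1 ⟨l.val - 1, hk⟩ (show l.val - 1 + 1 = l.val by omega),
            show l.val - 1 < l.val by omega⟩
        rw [← heq, Finset.mem_filter] at h3
        have := h3.2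
        simp at this
        omega
    have := Finset.card_lt_card this
    omega
  · have hk : l.val < n + 1 := by have := s.isLt; omega
    have : (S.filter fun k => k.val < l.val) ⊂ (S.filter fun k => k.val < s.val) := by
      refine Finset.ssubset_iff_subset_ne.2 ⟨?_, fun heq => ?_⟩
      · intro x hx
        rw [Finset.mem_filter] at hx ⊢
        exact ⟨hx.1, hx.2.trans h⟩
      · have h3 : (⟨l.val, hk⟩ : Fin (n + 1)) ∈ S.filter fun k => k.val < s.val :=
          Finset.mem_filter.2 ⟨h2 _ rfl, h⟩
        rw [← heq, Finset.mem_filter] at h3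
        have := h3.2
        simp at this
    have := Finset.card_lt_card this
    omega

/-- Deleting the vertex `l` merges the steps `l-1` and `l`, so it no longer matters which of the two
belongs to `S`. -/
theorem op_δ_collapse_map_swap {m n : ℕ} (u : alv V m) (S : Finset (Fin (n + 1))) (l : Fin (n + 2))
    {a b : Fin (n + 1)} (hab : a.val + 1 = b.val) (hb : b.val = l.val) :
    op V (δ l) (op V (mkHom (collapse (S.map (Equiv.swap a b).toEmbedding) m)) u) =
      op V (δ l) (op V (mkHom (collapse S m)) u) := by
  rw [← op_comp, ← op_comp]
  congr 2
  refine SimplexCategory.Hom.ext _ _ (OrderHom.ext _ _ (funext fun t => Fin.ext ?_))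
  change min ((S.map (Equiv.swap a b).toEmbedding).filter
      fun k => k.val < (l.succAbove t).val).card m =
    min (S.filter fun k => k.val < (l.succAbove t).val).card m
  rw [card_filter_map_swap]
  have := Fin.val_ne_of_ne (Fin.succAbove_ne l t)
  omega

/-- In the `l`-th face, a shuffle for which the steps adjacent to `l` all lie in `μ`, or all in its
complement, contributes zero. The others cancel in pairs under exchanging the steps `l-1` and `l`,
since the two faces agree and the signs are opposite. The total dimension is a separate variable so
that it can be split into cases. -/
theorem shuffleSum_mem_cycles {i j n : ℕ} (hn : i + j = n) {u : alv V i} {v : alv V j}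
    (hu : u ∈ cycles V i) (hv : v ∈ cycles V j) :
    ∑ μ ∈ Finset.powersetCard i (Finset.univ : Finset (Fin n)),
      (-1 : ZMod p) ^ (∑ k ∈ μ, (μᶜ.filter fun a => a < k).card) •
        (op V (mkHom (collapse μ i)) u * op V (mkHom (collapse μᶜ j)) v) ∈ cycles V n := by
  cases n with
  | zero => exact Submodule.mem_top
  | succ n =>
    refine (mem_cycles_succ V).2 fun l => ?_
    rw [map_sum]
    have hcard : ∀ μ ∈ Finset.powersetCard i (Finset.univ : Finset (Fin (n + 1))),
        μ.card = i ∧ μᶜ.card = j := by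
      intro μ hμ
      have h1 := (Finset.mem_powersetCard.1 hμ).2
      refine ⟨h1, ?_⟩
      rw [Finset.card_compl, h1, Fintype.card_fin]
      omega
    have hzero : ∀ μ ∈ Finset.powersetCard i (Finset.univ : Finset (Fin (n + 1))),
        ((∀ k : Fin (n + 1), k.val + 1 = l.val ∨ k.val = l.val → k ∈ μ) ∨
          (∀ k : Fin (n + 1), k.val + 1 = l.val ∨ k.val = l.val → k ∉ μ)) →
        op V (δ l) ((-1 : ZMod p) ^ (∑ k ∈ μ, (μᶜ.filter fun a => a < k).card) •
          (op V (mkHom (collapse μ i)) u * op V (mkHom (collapse μᶜ j)) v)) = 0 := by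
      rintro μ hμ (h | h)
      · rw [map_smul, map_mul, op_δ_collapse_eq_zero hu (hcard μ hμ).1 l
          (fun k hk => h k (Or.inl hk)) (fun k hk => h k (Or.inr hk)), zero_mul, smul_zero]
      · rw [map_smul, map_mul, op_δ_collapse_eq_zero hv (hcard μ hμ).2 l
          (fun k hk => Finset.mem_compl.2 (h k (Or.inl hk)))
          (fun k hk => Finset.mem_compl.2 (h k (Or.inr hk))), mul_zero, smul_zero]
    by_cases hl : 0 < l.val ∧ l.val < n + 1
    · obtain ⟨a, ha⟩ : ∃ a : Fin (n + 1), a.val + 1 = l.val := ⟨⟨l.val - 1, by omega⟩, by simp; omega⟩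
      obtain ⟨b, hb⟩ : ∃ b : Fin (n + 1), b.val = l.val := ⟨⟨l.val, hl.2⟩, rfl⟩
      have hab : a.val + 1 = b.val := by omega
      have hk : ∀ k : Fin (n + 1), k.val + 1 = l.val ∨ k.val = l.val ↔ k = a ∨ k = b := by
        intro k
        rw [Fin.ext_iff, Fin.ext_iff]
        omega
      have hzero' : ∀ μ ∈ Finset.powersetCard i (Finset.univ : Finset (Fin (n + 1))),
          (a ∈ μ ↔ b ∈ μ) →
          op V (δ l) ((-1 : ZMod p) ^ (∑ k ∈ μ, (μᶜ.filter fun a => a < k).card) •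
            (op V (mkHom (collapse μ i)) u * op V (mkHom (collapse μᶜ j)) v)) = 0 := by
        intro μ hμ h
        refine hzero μ hμ ?_
        by_cases ha : a ∈ μ
        · left
          intro k hk'
          rcases (hk k).1 hk' with rfl | rfl
          · exact ha
          · exact h.1 ha
        · right
          intro k hk'
          rcases (hk k).1 hk' with rfl | rfl
          · exact ha
          · exact fun hb => ha (h.2 hb)
      have hmem : ∀ μ ∈ Finset.powersetCard i (Finset.univ : Finset (Fin (n + 1))),
          μ.map (Equiv.swap a b).toEmbedding ∈
            Finset.powersetCard i (Finset.univ : Finset (Fin (n + 1))) := by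
        intro μ hμ
        rw [Finset.mem_powersetCard] at hμ ⊢
        exact ⟨Finset.subset_univ _, by rw [Finset.card_map, hμ.2]⟩
      have hmap2 : ∀ μ : Finset (Fin (n + 1)), (μ.map (Equiv.swap a b).toEmbedding).map
          (Equiv.swap a b).toEmbedding = μ := by
        intro μ
        ext x
        rw [mem_map_swap, mem_map_swap, Equiv.swap_apply_self]
      have hneg : ∀ μ : Finset (Fin (n + 1)), a ∈ μ → b ∉ μ →
          op V (δ l) ((-1 : ZMod p) ^ (∑ k ∈ μ, (μᶜ.filter fun a => a < k).card) •
            (op V (mkHom (collapse μ i)) u * op V (mkHom (collapse μᶜ j)) v)) +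
          op V (δ l) ((-1 : ZMod p) ^ (∑ k ∈ μ.map (Equiv.swap a b).toEmbedding,
            ((μ.map (Equiv.swap a b).toEmbedding)ᶜ.filter fun a => a < k).card) •
            (op V (mkHom (collapse (μ.map (Equiv.swap a b).toEmbedding) i)) u *
              op V (mkHom (collapse (μ.map (Equiv.swap a b).toEmbedding)ᶜ j)) v)) = 0 := by
        intro μ ha' hb'
        rw [sum_card_filter_map_swap hab ha' hb', map_smul, map_smul, map_mul, map_mul,
          op_δ_collapse_map_swap u μ l hab hb, map_swap_compl, op_δ_collapse_map_swap v μᶜ l hab hb,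
          pow_succ, mul_neg_one, neg_smul, add_neg_cancel]
      refine Finset.sum_involution (fun μ _ => μ.map (Equiv.swap a b).toEmbedding) ?_ ?_ ?_ ?_
      · intro μ hμ
        by_cases ha' : a ∈ μ
        · by_cases hb' : b ∈ μ
          · rw [hzero' μ hμ (iff_of_true ha' hb'), zero_add]
            refine hzero' _ (hmem μ hμ) ?_
            rw [mem_map_swap, mem_map_swap, Equiv.swap_apply_left, Equiv.swap_apply_right]
            exact iff_of_true hb' ha'
          · exact hneg μ ha' hb'
        · by_cases hb' : b ∈ μ
          · have := hneg (μ.map (Equiv.swap a b).toEmbedding)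
              (by rw [mem_map_swap, Equiv.swap_apply_left]; exact hb')
              (by rw [mem_map_swap, Equiv.swap_apply_right]; exact ha')
            rw [hmap2, add_comm] at this
            exact this
          · rw [hzero' μ hμ (iff_of_false ha' hb'), zero_add]
            refine hzero' _ (hmem μ hμ) ?_
            rw [mem_map_swap, mem_map_swap, Equiv.swap_apply_left, Equiv.swap_apply_right]
            exact iff_of_false hb' ha'
      · intro μ hμ hne heq
        refine hne (hzero' μ hμ ?_)
        have := mem_map_swap (a := a) (b := b) μ a
        rw [heq, Equiv.swap_apply_left] at this
        exact this
      · exact fun μ hμ => hmem μ hμ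
      · exact fun μ _ => hmap2 μ
    · refine Finset.sum_eq_zero fun μ hμ => hzero μ hμ ?_
      have hl' := l.isLt
      -- At the two end vertices there is only one adjacent step, so every term vanishes on its own.
      obtain ⟨c, hc⟩ : ∃ c : Fin (n + 1), ∀ k : Fin (n + 1),
          k.val + 1 = l.val ∨ k.val = l.val → k = c := by
        rcases Nat.eq_zero_or_pos l.val with h0 | h0
        · exact ⟨0, fun k hk => Fin.ext (show k.val = 0 by omega)⟩
        · exact ⟨Fin.last n, fun k hk => Fin.ext (show k.val = n by have := k.isLt; omega)⟩
      by_cases h : c ∈ μ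
      · exact Or.inl fun k hk => hc k hk ▸ h
      · exact Or.inr fun k hk => hc k hk ▸ h

theorem shuffle_mem_cycles {i j : ℕ} {u : alv V i} {v : alv V j}
    (hu : u ∈ cycles V i) (hv : v ∈ cycles V j) : shuffle V u v ∈ cycles V (i + j) :=
  shuffleSum_mem_cycles rfl hu hv

theorem shuffle_mem_omegaSimpGr {P : SimplicialObject (EvenAlg p)} {i j m n : ℕ}
    {u : alv (omegaSimp P) i} {v : alv (omegaSimp P) j} (hu : u ∈ omegaSimpGr P i m)
    (hv : v ∈ omegaSimpGr P j n) :
    shuffle (omegaSimp P) u v ∈ omegaSimpGr P (i + j) (m + n) := by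
  rw [shuffle_eq]
  refine Submodule.sum_mem _ fun μ _ => Submodule.smul_mem _ _ ?_
  exact mul_mem_omegaGr (map_mem_omegaGr (eop P (mkHom (collapse μ i))) hu)
    (map_mem_omegaGr (eop P (mkHom (collapse μᶜ j))) hv)

theorem deRham_map_mul_map {A B C : EvenAlg p} (f : EvenAlg.Hom A C) (g : EvenAlg.Hom B C) {n : ℕ}
    {u : Omega p A.carrier} (hu : u ∈ Omega.gr A n) (v : Omega p B.carrier) :
    Omega.deRham p (Omega.map p f.toAlgHom u * Omega.map p g.toAlgHom v) =
      Omega.map p f.toAlgHom (Omega.deRham p u) * Omega.map p g.toAlgHom v +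
      (-1 : ZMod p) ^ n •
        (Omega.map p f.toAlgHom u * Omega.map p g.toAlgHom (Omega.deRham p v)) := by
  rw [Omega.deRham_mul, bar_of_mem_omegaGr (map_mem_omegaGr f hu), Omega.map_deRham,
    Omega.map_deRham, mul_assoc, Algebra.smul_def, map_pow, map_neg, map_one]

/-- The de Rham differential of `Ω̄ P_i`. -/
def deRhamOp (P : SimplicialObject (EvenAlg p)) (i : ℕ) :
    alv (omegaSimp P) i →ₗ[ZMod p] alv (omegaSimp P) i :=
  Omega.deRham p

theorem op_deRhamOp (P : SimplicialObject (EvenAlg p)) {a b : ℕ}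
    (θ : SimplexCategory.mk a ⟶ SimplexCategory.mk b) (u : alv (omegaSimp P) b) :
    op (omegaSimp P) θ (deRhamOp P b u) = deRhamOp P a (op (omegaSimp P) θ u) :=
  Omega.map_deRham (eop P θ).toAlgHom u

/-- The de Rham differential is a derivation for the shuffle product. -/
theorem deRham_shuffle {P : SimplicialObject (EvenAlg p)} {i j n : ℕ}
    {u : alv (omegaSimp P) i} (v : alv (omegaSimp P) j) (hu : u ∈ omegaSimpGr P i n) :
    deRhamOp P (i + j) (shuffle (omegaSimp P) u v) =
      shuffle (omegaSimp P) (deRhamOp P i u) v +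
      (-1 : ZMod p) ^ n • shuffle (omegaSimp P) u (deRhamOp P j v) := by
  rw [shuffle_eq, shuffle_eq, shuffle_eq, map_sum, Finset.smul_sum, ← Finset.sum_add_distrib]
  refine Finset.sum_congr rfl fun μ _ => ?_
  rw [map_smul, smul_comm, ← smul_add]
  exact congrArg _ (deRham_map_mul_map (eop P (mkHom (collapse μ i)))
    (eop P (mkHom (collapse μᶜ j))) hu v)

end Shuffle

/-! ### The symbol of a cycle of `Ω̄ R_•` -/

section Symbol

open SimplexCategory TensorProduct MvPolynomial

section Natural

variable {p : ℕ} {V W : SimplicialObject (AlgCat.{0} (ZMod p))}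
  (F : ∀ n, alv V n →ₗ[ZMod p] alv W n)

theorem map_mem_cycles
    (hF : ∀ (a b : ℕ) (θ : SimplexCategory.mk a ⟶ SimplexCategory.mk b) (v : alv V b),
      op W θ (F b v) = F a (op V θ v))
    {n : ℕ} {u : alv V n} (hu : u ∈ cycles V n) : F n u ∈ cycles W n :=
  mem_cycles_of_op fun m θ hθ => by
    rw [hF, op_eq_zero_of_mem_cycles hu θ hθ, map_zero]

theorem map_mem_normalized
    (hF : ∀ (a b : ℕ) (θ : SimplexCategory.mk a ⟶ SimplexCategory.mk b) (v : alv V b),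
      op W θ (F b v) = F a (op V θ v))
    {n : ℕ} {u : alv V n} (hu : u ∈ normalized V n) :
    F n u ∈ normalized W n := by
  cases n with
  | zero => exact Submodule.mem_top
  | succ n =>
    refine (mem_normalized_succ W).2 fun j => ?_
    rw [hF, (mem_normalized_succ V).1 hu j, map_zero]

theorem map_mem_boundaries
    (hF : ∀ (a b : ℕ) (θ : SimplexCategory.mk a ⟶ SimplexCategory.mk b) (v : alv V b),
      op W θ (F b v) = F a (op V θ v))
    {n : ℕ} {u : alv V n} (hu : u ∈ boundaries V n) :
    F n u ∈ boundaries W n := by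
  obtain ⟨w, hw, rfl⟩ := (mem_boundaries V).1 hu
  exact (mem_boundaries W).2 ⟨F (n + 1) w, map_mem_normalized F hF hw, hF _ _ _ _⟩

end Natural

variable (p : ℕ)

/-- The universal derivation of `R_q`, with values in forms. -/
def formD (q : ℕ) : Derivation (ZMod p) (Res p q) (Form p (Res p q) q) :=
  mkDerivation (ZMod p) fun
    | none => 1 ⊗ₜ extX p q
    | some j => 1 ⊗ₜ extGen p q j

theorem formD_mul (q : ℕ) (f g : Res p q) :
    formD p q (f * g) = f ⊗ₜ 1 * formD p q g + g ⊗ₜ 1 * formD p q f := by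
  rw [Derivation.leibniz, Algebra.smul_def, Algebra.smul_def]
  rfl

theorem formD_X_none (q : ℕ) : formD p q (X none) = 1 ⊗ₜ extX p q := mkDerivation_X _ _ _

theorem formD_X_some (q : ℕ) (j : Fin q) : formD p q (X (some j)) = 1 ⊗ₜ extGen p q j :=
  mkDerivation_X _ _ _

theorem tmul_mul_mem_oneForm {S : Type} [CommRing S] [Algebra (ZMod p) S] {q : ℕ} (s : S)
    {w : Form p S q} (hw : w ∈ oneForm p S q) : s ⊗ₜ 1 * w ∈ oneForm p S q := by
  induction hw using Submodule.span_induction with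
  | mem w hw =>
    obtain ⟨t, v, rfl⟩ := hw
    rw [Algebra.TensorProduct.tmul_mul_tmul, one_mul]
    exact tmul_mem_oneForm _ _
  | zero => rw [mul_zero]; exact Submodule.zero_mem _
  | add a b _ _ ha hb => rw [mul_add]; exact Submodule.add_mem _ ha hb
  | smul c a _ ha => rw [mul_smul_comm]; exact Submodule.smul_mem _ _ ha

theorem formD_mem_oneForm (q : ℕ) (f : Res p q) : formD p q f ∈ oneForm p (Res p q) q := by
  induction f using MvPolynomial.induction_on with
  | C c =>
    have : formD p q (C c) = 0 := (formD p q).map_algebraMap c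
    rw [this]
    exact Submodule.zero_mem _
  | add f g hf hg => rw [map_add]; exact Submodule.add_mem _ hf hg
  | mul_X f i hf =>
    rw [formD_mul]
    refine Submodule.add_mem _ (tmul_mul_mem_oneForm p _ ?_) (tmul_mul_mem_oneForm p _ hf)
    cases i with
    | none => rw [formD_X_none]; exact tmul_mem_oneForm _ _
    | some j => rw [formD_X_some]; exact tmul_mem_oneForm _ _

/-- The algebra map from `Ω̄(R_q)` to forms: `f ↦ f`, `df ↦ df`. -/
def toForm (q : ℕ) : Omega p (Res p q) →ₐ[ZMod p] Form p (Res p q) q :=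
  Omega.lift p (fun
    | .el f => f ⊗ₜ 1
    | .d f => formD p q f) (by
    intro u v h
    cases h with
    | el_add a b => simp [TensorProduct.add_tmul]
    | el_algebraMap c =>
      simp only [FreeAlgebra.lift_ι_apply, AlgHom.commutes]
      rfl
    | el_mul a b => simp
    | d_add a b => simp
    | d_smul c a => simp
    | d_mul a b => simpa using formD_mul p q a b
    | el_comm_d a b => simpa using (form_commute a (formD p q b)).eq
    | d_comm_d a b =>
      simpa using oneForm_anticomm (formD_mem_oneForm p q a) (formD_mem_oneForm p q b)
    | d_sq a => simpa using oneForm_mul_self (formD_mem_oneForm p q a))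

theorem toForm_el (q : ℕ) (f : Res p q) : toForm p q (Omega.el p f) = f ⊗ₜ 1 :=
  Omega.lift_el p _ _ f

theorem toForm_d (q : ℕ) (f : Res p q) : toForm p q (Omega.d p f) = formD p q f :=
  Omega.lift_d p _ _ f

variable [Fact p.Prime]

/-- The inverse of `toForm`. -/
def fromForm (q : ℕ) : Form p (Res p q) q →ₐ[ZMod p] Omega p (Res p q) :=
  formLift (Omega.elHom p (Res p q))
    (Omega.dLin p (Res p q) ∘ₗ vecLift p q (X none) fun j => resY p 0 q j)
    (fun _ => Omega.d_sq p _) fun s _ => Omega.el_commute p s _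

theorem fromForm_tmul_one (q : ℕ) (f : Res p q) : fromForm p q (f ⊗ₜ 1) = Omega.el p f :=
  formLift_tmul_one _ _ _ _ _

theorem fromForm_extX (q : ℕ) : fromForm p q (1 ⊗ₜ extX p q) = Omega.d p (X none) :=
  (formLift_ι _ _ _ _ _).trans (congrArg (Omega.d p) (vecLift_vecX p q _ _))

theorem fromForm_extGen (q : ℕ) (j : Fin q) :
    fromForm p q (1 ⊗ₜ extGen p q j) = Omega.d p (X (some j)) :=
  (formLift_ι _ _ _ _ _).trans
    (congrArg (Omega.d p) ((vecLift_vecY p q _ _ j).trans (resY_succ p 0 j)))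

theorem fromForm_toForm (q : ℕ) (u : Omega p (Res p q)) : fromForm p q (toForm p q u) = u := by
  have : (fromForm p q).comp (toForm p q) = AlgHom.id _ _ := by
    refine Omega.algHom_ext_mvPolynomial (fun i => ?_) fun i => ?_
    · rw [AlgHom.comp_apply, toForm_el, fromForm_tmul_one, AlgHom.id_apply]
    · rw [AlgHom.comp_apply, toForm_d, AlgHom.id_apply]
      cases i with
      | none => rw [formD_X_none, fromForm_extX]
      | some j => rw [formD_X_some, fromForm_extGen]
  exact DFunLike.congr_fun this u

theorem toForm_fromForm (q : ℕ) (t : Form p (Res p q) q) : toForm p q (fromForm p q t) = t := by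
  have : (toForm p q).comp (fromForm p q) = AlgHom.id _ _ := by
    refine form_hom_ext (fun s => ?_) ?_ fun j => ?_
    · rw [AlgHom.comp_apply, fromForm_tmul_one, toForm_el, AlgHom.id_apply]
    · rw [AlgHom.comp_apply, fromForm_extX, toForm_d, formD_X_none, AlgHom.id_apply]
    · rw [AlgHom.comp_apply, fromForm_extGen, toForm_d, formD_X_some, AlgHom.id_apply]
  exact DFunLike.congr_fun this t

variable (r : ℕ)

/-- The origin of the twist: `d(x^{r+1}) = (r+1) x^r dx`. -/
theorem formD_resY (q j : ℕ) (hj : j ≤ q + 1) : formD p q (resY p r q j) = twY (resZ p r q) q j := by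
  rcases Nat.eq_zero_or_pos j with rfl | h0
  · rw [resY_zero, twY_zero, Derivation.leibniz_pow, formD_X_none, resZ, Nat.add_sub_cancel,
      TensorProduct.smul_tmul', smul_eq_mul, mul_one, ← Nat.cast_smul_eq_nsmul (ZMod p),
      TensorProduct.smul_tmul', Nat.cast_add, Nat.cast_one]
  · rcases lt_or_ge q j with h | h
    · rw [resY_of_lt p r h, map_zero, twY_of_lt _ h]
    · obtain ⟨l, rfl⟩ := exists_eq_succ h0 h
      rw [resY_succ, formD_X_some, twY_of_ne_zero _ _ (Nat.succ_ne_zero _), extGen]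

/-- Together with `fromForm` this identifies the simplicial algebra `Ω̄ R_•` with the twisted forms.
Both sides are algebra maps, so comparison on the variables and their differentials suffices. -/
theorem toForm_map {a b : ℕ} (θ : Fin (a + 1) →o Fin (b + 1)) (u : Omega p (Res p b)) :
    toForm p a (Omega.map p (resHom p r θ) u) =
      tw (resHom p r θ) (resZ p r a) θ (toForm p b u) := by
  have : (toForm p a).comp (Omega.map p (resHom p r θ)) =
      (tw (resHom p r θ) (resZ p r a) θ).comp (toForm p b) := by
    refine Omega.algHom_ext_mvPolynomial (fun i => ?_) fun i => ?_
    · rw [AlgHom.comp_apply, AlgHom.comp_apply, Omega.map_el, toForm_el, toForm_el, tw_tmul_one]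
    · rw [AlgHom.comp_apply, AlgHom.comp_apply, Omega.map_d, toForm_d, toForm_d]
      cases i with
      | none => rw [resHom_X_none, formD_X_none, formD_X_none, tw_extX]
      | some j =>
        rw [← resY_succ p r, resHom_resY, formD_resY p r _ _ (cut_le _ _), resY_succ, formD_X_some,
          tw_extGen]
  exact DFunLike.congr_fun this u

/-- The reduction of `Ω̄(R_q)` to forms over `A`. -/
def symb (q : ℕ) : Omega p (Res p q) →ₐ[ZMod p] Form p (TruncPoly p r) q :=
  (red p r q).comp (toForm p q)

theorem symb_apply (q : ℕ) (u : Omega p (Res p q)) : symb p r q u = red p r q (toForm p q u) := rfl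

theorem symb_el (q : ℕ) (f : Res p q) : symb p r q (Omega.el p f) = resAugHom p r q f ⊗ₜ 1 := by
  rw [symb_apply, toForm_el, red_tmul]

theorem symb_dX_none (q : ℕ) : symb p r q (Omega.d p (X none)) = 1 ⊗ₜ extX p q := by
  rw [symb_apply, toForm_d, formD_X_none, red_tmul, map_one]

theorem symb_dX_some (q : ℕ) (j : Fin q) :
    symb p r q (Omega.d p (X (some j))) = 1 ⊗ₜ extGen p q j := by
  rw [symb_apply, toForm_d, formD_X_some, red_tmul, map_one]

theorem symb_map {a b : ℕ} (θ : Fin (a + 1) →o Fin (b + 1)) (u : Omega p (Res p b)) :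
    symb p r a (Omega.map p (resHom p r θ) u) =
      tw (AlgHom.id (ZMod p) (TruncPoly p r)) (truncZ p r) θ (symb p r b u) := by
  rw [symb_apply, toForm_map, red_tw, symb_apply]

variable {p r}
variable {N : ℕ} (hN : 0 < N) (hE : Even N)

theorem toForm_op {a b : ℕ} (θ : SimplexCategory.mk a ⟶ SimplexCategory.mk b)
    (v : alv (omegaSimp (res p r hN hE)) b) :
    op (formSimp p r) θ ((toForm p b).toLinearMap v) =
      (toForm p a).toLinearMap (op (omegaSimp (res p r hN hE)) θ v) :=
  (toForm_map p r (Hom.toOrderHom θ) v).symm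

theorem fromForm_op {a b : ℕ} (θ : SimplexCategory.mk a ⟶ SimplexCategory.mk b)
    (v : alv (formSimp p r) b) :
    op (omegaSimp (res p r hN hE)) θ ((fromForm p b).toLinearMap v) =
      (fromForm p a).toLinearMap (op (formSimp p r) θ v) := by
  have h1 : op (formSimp p r) θ v = (toForm p a).toLinearMap
      (op (omegaSimp (res p r hN hE)) θ ((fromForm p b).toLinearMap v)) := by
    refine Eq.trans ?_ (toForm_op hN hE θ _)
    exact congrArg _ (toForm_fromForm p b v).symm
  rw [h1]
  exact (fromForm_toForm p a _).symm

theorem toForm_mem_cycles {q : ℕ} {u : Omega p (Res p q)}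
    (hu : u ∈ cycles (omegaSimp (res p r hN hE)) q) : toForm p q u ∈ cycles (formSimp p r) q :=
  map_mem_cycles (V := omegaSimp (res p r hN hE)) (W := formSimp p r)
    (fun n => (toForm p n).toLinearMap) (fun _ _ => toForm_op hN hE) hu

theorem fromForm_mem_cycles {q : ℕ} {t : Form p (Res p q) q} (ht : t ∈ cycles (formSimp p r) q) :
    fromForm p q t ∈ cycles (omegaSimp (res p r hN hE)) q :=
  map_mem_cycles (V := formSimp p r) (W := omegaSimp (res p r hN hE))
    (fun n => (fromForm p n).toLinearMap) (fun _ _ => fromForm_op hN hE) ht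

/-- The symbol of a cycle. -/
theorem symb_eq_topForm {q : ℕ} {u : Omega p (Res p q)}
    (hu : u ∈ cycles (omegaSimp (res p r hN hE)) q) :
    symb p r q u = topForm p q (coeffZero _ q (symb p r q u)) (coeffOne _ q (symb p r q u)) := by
  obtain ⟨a, b, h⟩ := exists_eq_topForm (red_mem_normalized
    (cycles_le_normalized q (toForm_mem_cycles hN hE hu)))
  rw [symb_apply, h, coeffZero_topForm, coeffOne_topForm]

/-- The symbol of a boundary is a multiple of `(r+1) x^r dx dy_1⋯dy_q`, and a cycle with such a
symbol is a boundary. Thus the two coefficients, the second taken modulo `(r+1) x^r`, determine the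
homotopy class. -/
theorem mem_boundaries_res_iff {q : ℕ} {u : Omega p (Res p q)}
    (hu : u ∈ cycles (omegaSimp (res p r hN hE)) q) :
    u ∈ boundaries (omegaSimp (res p r hN hE)) q ↔ coeffZero _ q (symb p r q u) = 0 ∧
      coeffOne _ q (symb p r q u) ∈ Ideal.span {truncZ p r} := by
  constructor
  · intro h
    obtain ⟨c, hc⟩ := red_of_mem_boundaries (map_mem_boundaries (V := omegaSimp (res p r hN hE))
      (W := formSimp p r) (fun n => (toForm p n).toLinearMap) (fun _ _ => toForm_op hN hE) h)
    have hc' : symb p r q u = topForm p q 0 (c * truncZ p r) := hc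
    rw [hc', coeffZero_topForm, coeffOne_topForm]
    exact ⟨rfl, Ideal.mem_span_singleton'.2 ⟨c, rfl⟩⟩
  · rintro ⟨h0, h1⟩
    obtain ⟨c, hc⟩ := Ideal.mem_span_singleton'.1 h1
    have h2 := symb_eq_topForm hN hE hu
    rw [h0, ← hc] at h2
    have h3 := map_mem_boundaries (V := formSimp p r) (W := omegaSimp (res p r hN hE))
      (fun n => (fromForm p n).toLinearMap) (fun _ _ => fromForm_op hN hE)
      (mem_boundaries_formSimp (toForm_mem_cycles hN hE hu) c h2)
    exact (fromForm_toForm p q u) ▸ h3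

theorem coeffZero_symb_mul {q : ℕ} {u : Omega p (Res p (q + 1))}
    (hu : u ∈ cycles (omegaSimp (res p r hN hE)) (q + 1)) :
    coeffZero _ (q + 1) (symb p r (q + 1) u) * truncZ p r = 0 :=
  coeffZero_red_mul (toForm_mem_cycles hN hE hu)

theorem tw_collapse_topForm {n i : ℕ} {μ : Finset (Fin n)} (hμ : μ.card = i)
    (a b : TruncPoly p r) :
    tw (AlgHom.id (ZMod p) (TruncPoly p r)) (truncZ p r) (collapse μ i) (topForm p i a b) =
      a ⊗ₜ sortedProd (extGen p n) μ + b ⊗ₜ (extX p n * sortedProd (extGen p n) μ) := by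
  have h0 : collapse μ i 0 = 0 := by
    refine Fin.ext ?_
    change min (μ.filter fun k => k.val < 0).card i = 0
    simp
  rw [tw_eq_untw _ _ h0, topForm, map_add, untw_tmul, untw_tmul, map_mul, extHom_extX,
    extHom_collapse p hμ]
  rfl

/-- The symbol of a shuffle product. -/
theorem symb_shuffle {i j : ℕ} {u : Omega p (Res p i)} {v : Omega p (Res p j)}
    {a b a' b' : TruncPoly p r} (hu : symb p r i u = topForm p i a b)
    (hv : symb p r j v = topForm p j a' b') :
    symb p r (i + j) (shuffle (omegaSimp (res p r hN hE)) u v) =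
      ((i + j).choose i : ZMod p) • topForm p (i + j) (a * a')
        (b * a' + (-1 : ZMod p) ^ i • (a * b')) := by
  -- Every shuffle contributes the same term, so the sum is that term times the number `(i+j choose
  -- i)` of shuffles.
  have hterm : ∀ μ ∈ Finset.powersetCard i (Finset.univ : Finset (Fin (i + j))),
      (-1 : ZMod p) ^ (∑ k ∈ μ, (μᶜ.filter fun a => a < k).card) •
        (tw (AlgHom.id (ZMod p) (TruncPoly p r)) (truncZ p r) (collapse μ i) (topForm p i a b) *
          tw (AlgHom.id (ZMod p) (TruncPoly p r)) (truncZ p r) (collapse μᶜ j)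
            (topForm p j a' b')) =
      topForm p (i + j) (a * a') (b * a' + (-1 : ZMod p) ^ i • (a * b')) := by
    intro μ hμ
    have h1 := (Finset.mem_powersetCard.1 hμ).2
    have h2 : μᶜ.card = j := by
      rw [Finset.card_compl, h1, Fintype.card_fin]; omega
    have hs := extHom_collapse_mul p h1
    rw [extHom_collapse p h1, extHom_collapse p h2] at hs
    set s := (-1 : ZMod p) ^ (∑ k ∈ μ, (μᶜ.filter fun a => a < k).card)
    set E := sortedProd (extGen p (i + j)) μ
    set E' := sortedProd (extGen p (i + j)) μᶜ
    set x := extX p (i + j)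
    have hEx : E * x = (-1 : ZMod p) ^ i • (x * E) := by
      have := sortedProd_mul_extX p (i + j) μ
      rwa [h1] at this
    -- Moving `dx` to the front past `i` of the `dy_j` produces the sign `(-1)^i`.
    have e1 : E * (x * E') = (-1 : ZMod p) ^ i • (x * (E * E')) := by
      rw [← mul_assoc, hEx, smul_mul_assoc, mul_assoc]
    have e2 : x * E * (x * E') = 0 := by
      rw [mul_assoc, e1, mul_smul_comm, ← mul_assoc, extX_mul_extX, zero_mul, smul_zero]
    rw [tw_collapse_topForm h1, tw_collapse_topForm h2, add_mul, mul_add, mul_add]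
    simp only [Algebra.TensorProduct.tmul_mul_tmul]
    rw [e1, e2, mul_assoc x, TensorProduct.tmul_zero, add_zero, topForm, ← hs]
    simp only [TensorProduct.add_tmul, TensorProduct.tmul_smul, smul_add, mul_smul_comm,
      TensorProduct.smul_tmul']
    rw [add_assoc, add_comm (_ ⊗ₜ _) (_ ⊗ₜ _), smul_comm s]
  refine Eq.trans (congrArg (symb p r (i + j)) (shuffle_eq _ _ _)) ?_
  refine (map_sum (symb p r (i + j)) _ _).trans ?_
  refine (Finset.sum_congr (g := fun _ => topForm p (i + j) (a * a')
    (b * a' + (-1 : ZMod p) ^ i • (a * b'))) rfl fun μ hμ => ?_).trans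
      ((Finset.sum_const _).trans ?_)
  · refine Eq.trans ?_ (hterm μ hμ)
    refine (map_smul (symb p r (i + j)) _ _).trans (congrArg _ ?_)
    refine (map_mul (symb p r (i + j)) _ _).trans ?_
    rw [← hu, ← hv]
    exact congrArg₂ _ (symb_map p r (collapse μ i) u) (symb_map p r (collapse μᶜ j) v)
  · rw [Finset.card_powersetCard, Finset.card_fin, Nat.cast_smul_eq_nsmul]

end Symbol

/-! ### Cycles that represent the generators -/

section Representatives

open SimplexCategory TensorProduct MvPolynomial

section Vars

variable (p : ℕ)

/-- The variables `y_1, …, y_q` of `R_q`. -/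
def yVars (q : ℕ) : List (Res p q) := List.ofFn fun j : Fin q => X (some j)

/-- The form `dy_1 ⋯ dy_q`. -/
def dY (q : ℕ) : Omega p (Res p q) := ((yVars p q).map (Omega.d p)).prod

/-- The form `dx dy_1 ⋯ dy_q`. -/
def dXY (q : ℕ) : Omega p (Res p q) := ((X none :: yVars p q).map (Omega.d p)).prod

theorem dXY_eq (q : ℕ) : dXY p q = Omega.d p (X none) * dY p q := by
  rw [dXY, List.map_cons, List.prod_cons, dY]

/-- The variables of `R_q` with their degrees, decreased by one. -/
def degVars (r N q : ℕ) : List (ℕ × Res p q) :=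
  List.ofFn fun j : Fin q => ((r + 1) * N - 1, X (some j))

theorem degVars_sum (r N q : ℕ) :
    ((degVars p r N q).map Prod.fst).sum = q * ((r + 1) * N - 1) := by
  rw [degVars, List.map_ofFn, List.sum_ofFn]
  simp only [Function.comp_def, Finset.sum_const, Finset.card_univ, Fintype.card_fin,
    smul_eq_mul]

theorem degVars_prod (r N q : ℕ) :
    ((degVars p r N q).map fun x => Omega.d p x.2).prod = dY p q := by
  rw [dY, yVars, degVars, List.map_ofFn, List.map_ofFn]
  rfl

theorem cons_degVars_sum (r N q : ℕ) :
    (((N - 1, X none) :: degVars p r N q).map Prod.fst).sum =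
      q * ((r + 1) * N - 1) + (N - 1) := by
  rw [List.map_cons, List.sum_cons, degVars_sum, add_comm]

theorem cons_degVars_prod (r N q : ℕ) :
    (((N - 1, X none) :: degVars p r N q).map fun x => Omega.d p x.2).prod = dXY p q := by
  rw [List.map_cons, List.prod_cons, degVars_prod, dXY_eq]

variable [Fact p.Prime] (r : ℕ)

theorem symb_dY (q : ℕ) : symb p r q (dY p q) = topForm p q 1 0 := by
  rw [dY, map_list_prod, yVars, List.map_ofFn, List.map_ofFn, topForm, TensorProduct.zero_tmul,
    add_zero, extTop_eq, tmul_ofFn_prod]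
  refine congrArg (fun g : Fin q → _ => (List.ofFn g).prod) (funext fun j => ?_)
  exact symb_dX_some p r q j

theorem symb_dXY (q : ℕ) : symb p r q (dXY p q) = topForm p q 0 1 := by
  rw [dXY_eq, map_mul, symb_dX_none, symb_dY, topForm, topForm, TensorProduct.zero_tmul,
    TensorProduct.zero_tmul, add_zero, zero_add, Algebra.TensorProduct.tmul_mul_tmul, one_mul]

theorem toForm_dY (q : ℕ) : toForm p q (dY p q) = topForm p q 1 0 := by
  rw [dY, map_list_prod, yVars, List.map_ofFn, List.map_ofFn, topForm, TensorProduct.zero_tmul,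
    add_zero, extTop_eq, tmul_ofFn_prod]
  refine congrArg (fun g : Fin q → _ => (List.ofFn g).prod) (funext fun j => ?_)
  exact (toForm_d p q _).trans (formD_X_some p q j)

theorem toForm_dXY (q : ℕ) : toForm p q (dXY p q) = topForm p q 0 1 := by
  rw [dXY_eq, map_mul, toForm_dY, toForm_d, formD_X_none, topForm, topForm,
    TensorProduct.zero_tmul, TensorProduct.zero_tmul, add_zero, zero_add,
    Algebra.TensorProduct.tmul_mul_tmul, one_mul]

/-- The only face that could be nonzero is `d_0`, and its coefficient is the image of `a (r+1) x^r`.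
This covers `dx dy_1⋯dy_q` always, and `dy_1⋯dy_q` when `r+1 = 0` in `𝔽_p`. -/
theorem topForm_mem_cycles_formSimp (q : ℕ) (a b : Res p q) (h : a * resZ p r q = 0) :
    topForm p q a b ∈ cycles (formSimp p r) q := by
  cases q with
  | zero => trivial
  | succ q =>
    have h0 : resHom p r (Hom.toOrderHom (δ (n := q) 0)) a * resZ p r q = 0 := by
      rw [← resHom_resZ p r (Hom.toOrderHom (δ (n := q) 0)), ← map_mul]
      exact (congrArg _ h).trans (map_zero _)
    refine ⟨topForm_mem_normalized_formSimp a b, ?_⟩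
    refine (tw_δ_zero_topForm _ (resZ p r q) q a b).trans ?_
    have h1 : topForm p q (0 : Res p q) 0 = 0 := by
      rw [topForm, TensorProduct.zero_tmul, TensorProduct.zero_tmul, add_zero]
    exact (congrArg (topForm p q 0) h0).trans h1

theorem resEuler_X_none (q : ℕ) : resEuler p r q (X none) = X none := mkDerivation_X _ _ _

theorem resEuler_X_some (q : ℕ) (j : Fin q) :
    resEuler p r q (X (some j)) = ((r : ZMod p) + 1) • X (some j) := mkDerivation_X _ _ _

/-- The weights are chosen so that `y_0 = x^{r+1}` also has weight `r+1`. Hence the derivation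
commutes with all simplicial operators, and contraction with it is a simplicial map. -/
theorem resEuler_resY (q j : ℕ) :
    resEuler p r q (resY p r q j) = ((r : ZMod p) + 1) • resY p r q j := by
  rcases Nat.eq_zero_or_pos j with rfl | h0
  · rw [resY_zero, Derivation.leibniz_pow, resEuler_X_none, Nat.add_sub_cancel, smul_eq_mul,
      ← pow_succ, ← Nat.cast_smul_eq_nsmul (ZMod p), Nat.cast_add, Nat.cast_one]
  · rcases lt_or_ge q j with h | h
    · rw [resY_of_lt p r h, map_zero, smul_zero]
    · obtain ⟨l, rfl⟩ := exists_eq_succ h0 h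
      rw [resY_succ, resEuler_X_some]

theorem resHom_resEuler {a b : ℕ} (θ : Fin (a + 1) →o Fin (b + 1)) (f : Res p b) :
    resHom p r θ (resEuler p r b f) = resEuler p r a (resHom p r θ f) := by
  induction f using MvPolynomial.induction_on with
  | C c =>
    have h1 : resEuler p r b (C c) = 0 := (resEuler p r b).map_algebraMap c
    have h2 : resHom p r θ (C c) = C c := (resHom p r θ).commutes c
    have h3 : resEuler p r a (C c) = 0 := (resEuler p r a).map_algebraMap c
    rw [h1, h2, h3, map_zero]
  | add f g hf hg => rw [map_add, map_add, hf, hg, map_add, map_add]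
  | mul_X f i hf =>
    have hi : resHom p r θ (resEuler p r b (X i)) = resEuler p r a (resHom p r θ (X i)) := by
      cases i with
      | none => rw [resEuler_X_none, resHom_X_none, resEuler_X_none]
      | some j => rw [resEuler_X_some, map_smul, ← resY_succ p r, resHom_resY, resEuler_resY]
    rw [Derivation.leibniz, map_add, smul_eq_mul, smul_eq_mul, map_mul, map_mul, hf, hi, map_mul,
      Derivation.leibniz, smul_eq_mul, smul_eq_mul]

theorem symb_contract_d_prod (q : ℕ) (E : Derivation (ZMod p) (Res p q) (Res p q))
    (l : List (Res p q)) (h : ∀ a ∈ l, resAugHom p r q (E a) = 0) :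
    symb p r q (Omega.contract E (l.map (Omega.d p)).prod) = 0 := by
  induction l with
  | nil => rw [List.map_nil, List.prod_nil, Omega.contract_one, map_zero]
  | cons a l ih =>
    rw [List.map_cons, List.prod_cons, Omega.contract_d_mul, map_sub, map_mul, map_mul, symb_el,
      h a List.mem_cons_self, TensorProduct.zero_tmul, zero_mul,
      ih fun b hb => h b (List.mem_cons_of_mem _ hb), mul_zero, sub_zero]

/-- Contracting a `dy_j` yields a multiple of `y_j`, which vanishes in `A`; only the term that
contracts `dx` survives. -/
theorem symb_contract_dXY (q : ℕ) :
    symb p r q (Omega.contract (resEuler p r q) (dXY p q)) = topForm p q (TruncPoly.x p r) 0 := by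
  have h : symb p r q (Omega.contract (resEuler p r q) (dY p q)) = 0 := by
    refine symb_contract_d_prod p r q _ _ fun a ha => ?_
    obtain ⟨j, rfl⟩ := (List.mem_ofFn' _ _).1 ha
    rw [resEuler_X_some, map_smul, ← resY_succ p r, resAugHom_resY p r q, smul_zero]
  rw [dXY_eq, Omega.contract_d_mul, map_sub, map_mul, map_mul, h, mul_zero, sub_zero, symb_el,
    resEuler_X_none, resAugHom_X_none, symb_dY, topForm, topForm, TensorProduct.zero_tmul,
    add_zero, add_zero, Algebra.TensorProduct.tmul_mul_tmul, one_mul,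
    mul_one]

theorem symb_el_X_none : symb p r 0 (Omega.el p (X none)) = topForm p 0 (TruncPoly.x p r) 0 := by
  rw [symb_el, resAugHom_X_none, topForm, TensorProduct.zero_tmul, add_zero, extTop_eq,
    List.ofFn_zero, List.prod_nil]

theorem symb_d_X_none : symb p r 0 (Omega.d p (X none)) = topForm p 0 0 1 := by
  have h := symb_dXY p r 0
  rwa [dXY_eq, dY, yVars, List.ofFn_zero, List.map_nil, List.prod_nil, mul_one] at h

theorem symb_one : symb p r 0 1 = topForm p 0 1 0 := by
  have h := symb_dY p r 0
  rwa [dY, yVars, List.ofFn_zero, List.map_nil, List.prod_nil] at h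

/-- Since `dx dy_1⋯dy_q` is closed, Cartan's formula gives the Lie derivative along the Euler
derivation, which scales the form by its total weight. -/
theorem deRham_contract_dXY (q : ℕ) :
    Omega.deRham p (Omega.contract (resEuler p r q) (dXY p q)) =
      (1 + ((r : ZMod p) + 1) * q) • dXY p q := by
  -- The weight function takes the value 1 on `x`; its value `r+1` is used only on the variables
  -- `y_j`.
  have h := Omega.deRham_contract_d_prod (resEuler p r q)
    (fun a => open Classical in if a = X none then 1 else (r : ZMod p) + 1) (X none :: yVars p q) ?_
  · rw [dXY, h, List.map_cons, List.sum_cons, if_pos rfl, yVars, List.map_ofFn, List.sum_ofFn]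
    congr 2
    rw [Finset.sum_congr rfl (g := fun _ => (r : ZMod p) + 1) fun j _ => ?_]
    · rw [Finset.sum_const, Finset.card_univ, Fintype.card_fin, nsmul_eq_mul, mul_comm]
    · exact if_neg fun h => by simpa using X_injective h
  · intro a ha
    rcases List.mem_cons.1 ha with rfl | ha
    · rw [resEuler_X_none, if_pos rfl, one_smul]
    · obtain ⟨j, rfl⟩ := (List.mem_ofFn' _ _).1 ha
      rw [resEuler_X_some, if_neg fun h => by simpa using X_injective h]

end Vars

variable {p : ℕ} [Fact p.Prime] {r N : ℕ} (hN : 0 < N) (hE : Even N)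

theorem resOmega_eq (q : ℕ) : resOmega p r hN hE q = dY p q := by
  rw [dY, yVars, List.map_ofFn]
  rfl

theorem resDX_mul_resOmega (q : ℕ) :
    resDX p r hN hE q * resOmega p r hN hE q = dXY p q := by
  refine Eq.trans (congrArg (resDX p r hN hE q * ·) (resOmega_eq hN hE q)) ?_
  exact (dXY_eq p q).symm

theorem resTheta_dXY (q : ℕ) :
    resTheta p r hN hE q (resDX p r hN hE q * resOmega p r hN hE q) =
      Omega.contract (resEuler p r q) (dXY p q) :=
  congrArg (Omega.contract (resEuler p r q)) (resDX_mul_resOmega hN hE q)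

theorem dXY_mem_cycles (q : ℕ) :
    (dXY p q : Omega p (Res p q)) ∈ cycles (omegaSimp (res p r hN hE)) q := by
  rw [← fromForm_toForm p q (dXY p q), toForm_dXY]
  exact fromForm_mem_cycles hN hE (topForm_mem_cycles_formSimp p r q 0 1 (zero_mul _))

theorem dY_mem_cycles (q : ℕ) (h : (r : ZMod p) + 1 = 0) :
    (dY p q : Omega p (Res p q)) ∈ cycles (omegaSimp (res p r hN hE)) q := by
  rw [← fromForm_toForm p q (dY p q), toForm_dY]
  exact fromForm_mem_cycles hN hE (topForm_mem_cycles_formSimp p r q 1 0 (by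
    rw [resZ, h, zero_smul, mul_zero]))

/-- Contraction with the Euler derivation is natural in the simplicial operators, so it preserves
cycles. -/
theorem contract_dXY_mem_cycles (q : ℕ) :
    Omega.contract (resEuler p r q) (dXY p q) ∈ cycles (omegaSimp (res p r hN hE)) q :=
  map_mem_cycles (V := omegaSimp (res p r hN hE)) (W := omegaSimp (res p r hN hE))
    (fun n => resTheta p r hN hE n)
    (fun _ b θ v => Omega.map_contract (resEuler p r b) (resHom p r (Hom.toOrderHom θ))
      (resHom_resEuler p r _) v)
    (dXY_mem_cycles hN hE q)

theorem X_mem_resGr (q : ℕ) (i : Option (Fin q)) :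
    (X i : Res p q) ∈ (resObj p r hN hE q).gr (resWeight r N q i - 1 + 1) := by
  rw [Nat.sub_add_cancel (Nat.one_le_iff_ne_zero.2 (resWeight_pos hN q i))]
  exact isWeightedHomogeneous_X _ _ i

theorem dY_mem_gr (q : ℕ) :
    (dY p q : Omega p (Res p q)) ∈ omegaSimpGr (res p r hN hE) q (q * ((r + 1) * N - 1)) := by
  have h := d_prod_mem_omegaGr (A := resObj p r hN hE q) (degVars p r N q) fun x hx => by
    obtain ⟨j, rfl⟩ := (List.mem_ofFn' _ _).1 hx
    exact X_mem_resGr hN hE q (some j)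
  rw [← degVars_sum p r N q]
  exact degVars_prod p r N q ▸ h

theorem dXY_list_mem (q : ℕ) (x : ℕ × Res p q) (hx : x ∈ (N - 1, X none) :: degVars p r N q) :
    x.2 ∈ (resObj p r hN hE q).gr (x.1 + 1) := by
  rcases List.mem_cons.1 hx with rfl | hx
  · exact X_mem_resGr hN hE q none
  · obtain ⟨j, rfl⟩ := (List.mem_ofFn' _ _).1 hx
    exact X_mem_resGr hN hE q (some j)

theorem dXY_mem_gr (q : ℕ) : (dXY p q : Omega p (Res p q)) ∈
    omegaSimpGr (res p r hN hE) q (q * ((r + 1) * N - 1) + (N - 1)) := by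
  have h := d_prod_mem_omegaGr (A := resObj p r hN hE q) _ (dXY_list_mem hN hE q)
  rw [← cons_degVars_sum p r N q]
  exact cons_degVars_prod p r N q ▸ h

theorem contract_dXY_mem_gr (q : ℕ) : Omega.contract (resEuler p r q) (dXY p q) ∈
    omegaSimpGr (res p r hN hE) q (q * ((r + 1) * N - 1) + (N - 1) + 1) := by
  have h := contract_d_prod_mem_omegaGr (A := resObj p r hN hE q) (E := resEuler p r q) _
    (dXY_list_mem hN hE q) fun x hx => by
      have h1 := dXY_list_mem hN hE q x hx
      rcases List.mem_cons.1 hx with rfl | hx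
      · exact (congrArg (· ∈ (resObj p r hN hE q).gr _) (resEuler_X_none p r q)).mpr h1
      · obtain ⟨j, rfl⟩ := (List.mem_ofFn' _ _).1 hx
        exact (congrArg (· ∈ (resObj p r hN hE q).gr _) (resEuler_X_some p r q j)).mpr
          (Submodule.smul_mem _ _ h1)
  rw [← cons_degVars_sum p r N q]
  exact cons_degVars_prod p r N q ▸ h

end Representatives

/-! ### An extended divided power algebra -/

section GammaAlg

variable {k A B : Type} [CommRing k] [CommRing A] [CommRing B] [Algebra k A] [Algebra k B]
  (π : A →ₐ[k] B)

/-- Families of pairs `(a, b)_i`, which stand for `(a + b dx) γ_i` with `dx` of odd degree. -/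
def GammaAlg (_ : A →ₐ[k] B) : Type := ℕ →₀ A × B

instance : AddCommGroup (GammaAlg π) := inferInstanceAs (AddCommGroup (ℕ →₀ A × B))

instance : Module k (GammaAlg π) := inferInstanceAs (Module k (ℕ →₀ A × B))

namespace GammaAlg

/-- The inclusion of the summand with index `i`. -/
def incl (i : ℕ) : A × B →ₗ[k] GammaAlg π := Finsupp.lsingle i

/-- The projection to the summand with index `i`. -/
def proj (i : ℕ) : GammaAlg π →ₗ[k] A × B := Finsupp.lapply i

theorem proj_incl (i j : ℕ) (s : A × B) : proj π j (incl π i s) = if i = j then s else 0 :=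
  Finsupp.single_apply

theorem induction {C : GammaAlg π → Prop} (zero : C 0) (add : ∀ u v, C u → C v → C (u + v))
    (incl : ∀ i s, C (incl π i s)) (u : GammaAlg π) : C u :=
  Finsupp.induction_linear u zero add incl

/-- The product of `(a, b)_i` and `(a', b')_j`. -/
def pairMul (i j : ℕ) : A × B →ₗ[k] A × B →ₗ[k] A × B :=
  -- This copies the shuffle product of symbols: `(-1)^i` comes from moving `dx` past `γ_i`, and the
  -- `dx`-coefficients multiply in the quotient `B` of `A` in which they are defined.
  LinearMap.mk₂ k (fun s t => ((i + j).choose i : k) •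
      (s.1 * t.1, s.2 * π t.1 + (-1 : k) ^ i • (π s.1 * t.2)))
    (fun s s' t => by
      refine Prod.ext ?_ ?_ <;> simp only [Prod.smul_fst, Prod.smul_snd, Prod.fst_add,
        Prod.snd_add, map_add] <;> simp only [Algebra.smul_def] <;> ring)
    (fun c s t => by
      refine Prod.ext ?_ ?_ <;> simp only [Prod.smul_fst, Prod.smul_snd, map_smul] <;>
        simp only [Algebra.smul_def] <;> ring)
    (fun s t t' => by
      refine Prod.ext ?_ ?_ <;> simp only [Prod.smul_fst, Prod.smul_snd, Prod.fst_add,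
        Prod.snd_add, map_add] <;> simp only [Algebra.smul_def] <;> ring)
    (fun c s t => by
      refine Prod.ext ?_ ?_ <;> simp only [Prod.smul_fst, Prod.smul_snd, map_smul] <;>
        simp only [Algebra.smul_def] <;> ring)

/-- The product as a bilinear map. -/
def mulLin : GammaAlg π →ₗ[k] GammaAlg π →ₗ[k] GammaAlg π :=
  Finsupp.lsum k fun i => LinearMap.flip (Finsupp.lsum k fun j =>
    ((pairMul π i j).compr₂ (incl π (i + j))).flip)

instance : Mul (GammaAlg π) := ⟨fun u v => mulLin π u v⟩

theorem mul_def (u v : GammaAlg π) : u * v = mulLin π u v := rfl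

theorem incl_mul_incl (i j : ℕ) (s t : A × B) : incl π i s * incl π j t =
    incl π (i + j) (((i + j).choose i : k) •
      (s.1 * t.1, s.2 * π t.1 + (-1 : k) ^ i • (π s.1 * t.2))) := by
  have h1 : ∀ v, mulLin π (incl π i s) v = (LinearMap.flip (Finsupp.lsum k fun j =>
      ((pairMul π i j).compr₂ (incl π (i + j))).flip)) s v := fun v =>
    congrArg (fun f : GammaAlg π →ₗ[k] GammaAlg π => f v) (Finsupp.lsum_single _ _ _ _)
  have h2 := Finsupp.lsum_single k (fun j => ((pairMul π i j).compr₂ (incl π (i + j))).flip) j t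
  exact (h1 _).trans (congrArg (fun f : A × B →ₗ[k] GammaAlg π => f s) h2)

instance : One (GammaAlg π) := ⟨incl π 0 (1, 0)⟩

theorem one_def : (1 : GammaAlg π) = incl π 0 (1, 0) := rfl

theorem mul_assoc' (u v w : GammaAlg π) : u * v * w = u * (v * w) := by
  induction u using induction with
  | zero => simp only [mul_def, map_zero, LinearMap.zero_apply]
  | add u u' hu hu' =>
    simp only [mul_def, map_add, LinearMap.add_apply] at hu hu' ⊢
    rw [hu, hu']
  | incl i s =>
  induction v using induction with
  | zero => simp only [mul_def, map_zero, LinearMap.zero_apply]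
  | add u u' hu hu' =>
    simp only [mul_def, map_add, LinearMap.add_apply] at hu hu' ⊢
    rw [hu, hu']
  | incl j t =>
  induction w using induction with
  | zero => simp only [mul_def, map_zero]
  | add u u' hu hu' =>
    simp only [mul_def, map_add] at hu hu' ⊢
    rw [hu, hu']
  | incl l q =>
  rw [incl_mul_incl, incl_mul_incl, incl_mul_incl, incl_mul_incl, add_assoc]
  obtain ⟨a, b⟩ := s
  obtain ⟨a', b'⟩ := t
  obtain ⟨a'', b''⟩ := q
  -- The trinomial identity behind associativity of divided powers.
  have hc : (i + (j + l)).choose (i + j) * (i + j).choose i =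
      (i + (j + l)).choose i * (j + l).choose j := by
    rw [Nat.choose_mul (Nat.le_add_right i j), Nat.add_sub_cancel_left, Nat.add_sub_cancel_left]
  have hA := congrArg (Nat.cast (R := A)) hc
  have hB := congrArg (Nat.cast (R := B)) hc
  rw [Nat.cast_mul, Nat.cast_mul] at hA hB
  congr 1
  refine Prod.ext ?_ ?_
  · simp only [Prod.smul_mk]
    simp only [Algebra.smul_def, map_natCast]
    linear_combination (a * a' * a'') * hA
  · simp only [Prod.smul_mk]
    simp only [Algebra.smul_def, map_natCast, map_mul, map_pow,
      map_neg, map_one, pow_add]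
    linear_combination (b * π a' * π a'' + (-1) ^ i * π a * b' * π a'' +
      (-1) ^ i * (-1) ^ j * π a * π a' * b'') * hB

theorem one_mul' (u : GammaAlg π) : 1 * u = u := by
  induction u using induction with
  | zero => rw [mul_def, map_zero]
  | add u u' hu hu' =>
    rw [mul_def] at hu hu' ⊢
    rw [map_add, hu, hu']
  | incl i s =>
    rw [one_def, incl_mul_incl, zero_add]
    simp

theorem mul_one' (u : GammaAlg π) : u * 1 = u := by
  induction u using induction with
  | zero => rw [mul_def, map_zero, LinearMap.zero_apply]
  | add u u' hu hu' =>
    rw [mul_def] at hu hu' ⊢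
    rw [map_add, LinearMap.add_apply, hu, hu']
  | incl i s =>
    rw [one_def, incl_mul_incl, add_zero]
    simp

instance : Ring (GammaAlg π) :=
  { (inferInstance : AddCommGroup (GammaAlg π)) with
    left_distrib := fun u v w => (mulLin π u).map_add v w
    right_distrib := fun u v w => (mulLin π).map_add₂ u v w
    zero_mul := fun u => (mulLin π).map_zero₂ u
    mul_zero := fun u => (mulLin π u).map_zero
    mul_assoc := mul_assoc' π
    one_mul := one_mul' π
    mul_one := mul_one' π }

instance : Algebra k (GammaAlg π) :=
  Algebra.ofModule (fun c u v => (mulLin π).map_smul₂ c u v) fun c u v => (mulLin π u).map_smul c v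

end GammaAlg

end GammaAlg

/-! ### Bigraded commutative algebras given by generators and relations -/

section BigradedAlg

namespace BigradedAlg

variable {p : ℕ} {G : Type} {bideg : G → ℕ × ℕ} {rel : Set (FreeAlgebra (ZMod p) G)}

theorem gen_mul_gen (g h : G) : (gen g * gen h : BigradedAlg p bideg rel) =
    (-1 : ZMod p) ^ ((bideg g).1 * (bideg h).1 + (bideg g).2 * (bideg h).2) • (gen h * gen g) := by
  have := RingQuot.mkAlgHom_rel (ZMod p) (BigradedRel.comm (p := p) (bideg := bideg) (rel := rel) g h)
  rw [map_mul, map_smul, map_mul] at this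
  exact this

theorem lift_gen_eq_zero {w : FreeAlgebra (ZMod p) G} (hw : w ∈ rel) :
    FreeAlgebra.lift (ZMod p) (gen : G → BigradedAlg p bideg rel) w = 0 := by
  have h := RingQuot.mkAlgHom_rel (ZMod p) (BigradedRel.rel (p := p) (bideg := bideg) w hw)
  have h' : FreeAlgebra.lift (ZMod p) (gen : G → BigradedAlg p bideg rel) =
      RingQuot.mkAlgHom (ZMod p) (BigradedRel p bideg rel) :=
    FreeAlgebra.hom_ext (funext fun g => FreeAlgebra.lift_ι_apply _ _)
  rw [h']
  exact h.trans (map_zero _)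

/-- The universal property of a bigraded commutative algebra. -/
def lift {R : Type} [Ring R] [Algebra (ZMod p) R] (f : G → R)
    (hcomm : ∀ g h, f g * f h = (-1 : ZMod p) ^ ((bideg g).1 * (bideg h).1 +
      (bideg g).2 * (bideg h).2) • (f h * f g))
    (hrel : ∀ w ∈ rel, FreeAlgebra.lift (ZMod p) f w = 0) :
    BigradedAlg p bideg rel →ₐ[ZMod p] R :=
  RingQuot.liftAlgHom (ZMod p) ⟨FreeAlgebra.lift (ZMod p) f, by
    intro u v h
    cases h with
    | comm g h => simpa using hcomm g h
    | rel _ hw => exact (hrel _ hw).trans (map_zero _).symm⟩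

theorem lift_gen {R : Type} [Ring R] [Algebra (ZMod p) R] (f : G → R)
    (hcomm : ∀ g h, f g * f h = (-1 : ZMod p) ^ ((bideg g).1 * (bideg h).1 +
      (bideg g).2 * (bideg h).2) • (f h * f g))
    (hrel : ∀ w ∈ rel, FreeAlgebra.lift (ZMod p) f w = 0) (g : G) :
    lift f hcomm hrel (gen g : BigradedAlg p bideg rel) = f g :=
  (RingQuot.liftAlgHom_mkAlgHom_apply ..).trans (FreeAlgebra.lift_ι_apply ..)

theorem eq_top_of_gen_mul_mem (S : Submodule (ZMod p) (BigradedAlg p bideg rel)) (h1 : 1 ∈ S)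
    (h : ∀ g, ∀ s ∈ S, gen g * s ∈ S) : S = ⊤ := by
  refine eq_top_iff.2 fun w _ => ?_
  have key : ∀ w : BigradedAlg p bideg rel, ∀ s ∈ S, w * s ∈ S := by
    intro w
    obtain ⟨w, rfl⟩ : ∃ v, RingQuot.mkAlgHom (ZMod p) (BigradedRel p bideg rel) v = w :=
      RingQuot.mkAlgHom_surjective (ZMod p) (BigradedRel p bideg rel) w
    induction w using FreeAlgebra.induction with
    | grade0 c =>
      intro s hs
      rw [AlgHom.commutes]
      exact (Algebra.smul_def c s) ▸ S.smul_mem c hs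
    | grade1 g => exact h g
    | mul u v hu hv =>
      intro s hs
      rw [map_mul]
      exact (mul_assoc _ _ s).symm ▸ hu _ (hv _ hs)
    | add u v hu hv =>
      intro s hs
      rw [map_add]
      exact (add_mul _ _ s).symm ▸ S.add_mem (hu _ hs) (hv _ hs)
  simpa using key w 1 h1

theorem span_prod_eq_top : Submodule.span (ZMod p)
    (Set.range fun l : List G => ((l.map gen).prod : BigradedAlg p bideg rel)) = ⊤ := by
  refine eq_top_of_gen_mul_mem _ (Submodule.subset_span ⟨[], rfl⟩) fun g s hs => ?_
  induction hs using Submodule.span_induction with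
  | mem s hs =>
    obtain ⟨l, rfl⟩ := hs
    exact Submodule.subset_span ⟨g :: l, rfl⟩
  | zero => rw [mul_zero]; exact Submodule.zero_mem _
  | add s t _ _ hs ht => rw [mul_add]; exact Submodule.add_mem _ hs ht
  | smul c s _ hs => rw [mul_smul_comm]; exact Submodule.smul_mem _ _ hs

end BigradedAlg

end BigradedAlg

/-! ### Products in the algebra of pairs and a normal form criterion -/

section Products

variable {k A B : Type} [CommRing k] [CommRing A] [CommRing B] [Algebra k A] [Algebra k B]
  (π : A →ₐ[k] B)

namespace GammaAlg

theorem even_mul_even (i j : ℕ) (a a' : A) : incl π i (a, 0) * incl π j (a', 0) =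
    incl π (i + j) (((i + j).choose i : k) • (a * a', 0)) := by
  rw [incl_mul_incl]
  simp

theorem even_mul_odd (i j : ℕ) (a : A) (b : B) : incl π i (a, 0) * incl π j (0, b) =
    incl π (i + j) (((i + j).choose i : k) • (0, (-1 : k) ^ i • (π a * b))) := by
  rw [incl_mul_incl]
  simp

theorem odd_mul_even (i j : ℕ) (a : A) (b : B) : incl π i (0, b) * incl π j (a, 0) =
    incl π (i + j) (((i + j).choose i : k) • (0, π a * b)) := by
  rw [incl_mul_incl]
  simp [mul_comm]

theorem odd_mul_odd (i j : ℕ) (b b' : B) : incl π i (0, b) * incl π j (0, b') = 0 := by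
  rw [incl_mul_incl]
  refine (congrArg (incl π (i + j)) ?_).trans (map_zero _)
  simp

theorem even_comm (i j : ℕ) (a a' : A) :
    incl π i (a, 0) * incl π j (a', 0) = incl π j (a', 0) * incl π i (a, 0) := by
  rw [even_mul_even, even_mul_even, add_comm j i, Nat.choose_symm_add, mul_comm]

theorem even_odd_comm (i j : ℕ) (a : A) (b : B) : incl π i (a, 0) * incl π j (0, b) =
    (-1 : k) ^ i • (incl π j (0, b) * incl π i (a, 0)) := by
  rw [even_mul_odd, odd_mul_even, ← map_smul, add_comm j i, Nat.choose_symm_add,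
    smul_comm ((-1 : k) ^ i), Prod.smul_mk ((-1 : k) ^ i), smul_zero]

theorem odd_even_comm (i j : ℕ) (a : A) (b : B) : incl π i (0, b) * incl π j (a, 0) =
    (-1 : k) ^ j • (incl π j (a, 0) * incl π i (0, b)) := by
  rw [even_odd_comm, smul_smul, ← pow_add, Even.neg_one_pow ⟨j, rfl⟩, one_smul]

/-- The inclusion `a ↦ (a, 0)_0`. -/
def inclZero : A →ₐ[k] GammaAlg π :=
  AlgHom.ofLinearMap (incl π 0 ∘ₗ LinearMap.inl k A B) rfl fun a a' => by
    refine Eq.trans ?_ (even_mul_even π 0 0 a a').symm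
    simp

theorem inclZero_apply (a : A) : inclZero π a = incl π 0 (a, 0) := rfl

/-- By `htop` every element of `M` is a sum of terms `f(ξ) e_i + g(ξ) o_i`, and `Θ` sends such a
term to the pair `(f(x) c_i, π(g(x)))` at index `i`. Distinct indices cannot interfere, so a sum in
the kernel has each pair zero, and `h1`, `h2` say that each term then already vanishes in `M`. The
relations of `M` therefore only need to be strong enough to give this spanning set and these
annihilators. The image consists of sums of pairs whose first entry at index `i` is a multiple of
`c_i`. -/
theorem injective_and_mem_range {M : Type} [Ring M] [Algebra k M] (Θ : M →ₐ[k] GammaAlg π)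
    (x : A) (hx : Function.Surjective (Polynomial.aeval (R := k) x))
    (hπ : Function.Surjective π) (ξ : M) (e o : ℕ → M)
    (c : ℕ → A) (hξ : Θ ξ = incl π 0 (x, 0)) (he : ∀ i, Θ (e i) = incl π i (c i, 0))
    (ho : ∀ i, Θ (o i) = incl π i (0, 1))
    (h1 : ∀ (i : ℕ) (f : Polynomial k), Polynomial.aeval x f * c i = 0 → Polynomial.aeval ξ f * e i = 0)
    (h2 : ∀ (i : ℕ) (f : Polynomial k), π (Polynomial.aeval x f) = 0 → Polynomial.aeval ξ f * o i = 0)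
    (htop : Submodule.span k {m | ∃ (f : Polynomial k) (i : ℕ), m = Polynomial.aeval ξ f * e i ∨
      m = Polynomial.aeval ξ f * o i} = ⊤) :
    Function.Injective Θ ∧ ∀ i a b, incl π i (a * c i, b) ∈ Θ.toLinearMap.range := by
  let ψ (i : ℕ) : Polynomial k × Polynomial k →ₗ[k] M :=
    LinearMap.coprod (LinearMap.mulRight k (e i) ∘ₗ (Polynomial.aeval ξ).toLinearMap)
      (LinearMap.mulRight k (o i) ∘ₗ (Polynomial.aeval ξ).toLinearMap)
  have hψ : ∀ i f g, ψ i (f, g) = Polynomial.aeval ξ f * e i + Polynomial.aeval ξ g * o i :=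
    fun i f g => rfl
  have hΘ : ∀ i f g, Θ (ψ i (f, g)) =
      incl π i (Polynomial.aeval x f * c i, π (Polynomial.aeval x g)) := by
    intro i f g
    have h : ∀ f : Polynomial k, Θ (Polynomial.aeval ξ f) = incl π 0 (Polynomial.aeval x f, 0) := by
      intro f
      rw [← Polynomial.aeval_algHom_apply, hξ, ← inclZero_apply, Polynomial.aeval_algHom_apply,
        inclZero_apply]
    rw [hψ, map_add, map_mul, map_mul, h, h, he, ho, even_mul_even, even_mul_odd, zero_add,
      Nat.choose_zero_right, Nat.cast_one, one_smul, one_smul, pow_zero, one_smul, mul_one,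
      ← map_add, Prod.mk_add_mk, add_zero, zero_add]
  let Ψ : (ℕ →₀ Polynomial k × Polynomial k) →ₗ[k] M := Finsupp.lsum k ψ
  have hΨ : ∀ m, ∃ s, Ψ s = m := by
    refine LinearMap.range_eq_top.1 (eq_top_iff.2 ?_)
    rw [← htop, Submodule.span_le]
    rintro _ ⟨f, i, rfl | rfl⟩
    · exact ⟨Finsupp.single i (f, 0), (Finsupp.lsum_single _ _ _ _).trans (by simp [hψ])⟩
    · exact ⟨Finsupp.single i (0, f), (Finsupp.lsum_single _ _ _ _).trans (by simp [hψ])⟩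
  constructor
  · refine (injective_iff_map_eq_zero Θ).2 fun m hm => ?_
    obtain ⟨s, rfl⟩ := hΨ m
    have hs : ∀ i, ψ i (s i) = 0 := by
      intro i
      have h : proj π i (Θ (Ψ s)) =
          (Polynomial.aeval x (s i).1 * c i, π (Polynomial.aeval x (s i).2)) := by
        have hlin : proj π i ∘ₗ Θ.toLinearMap ∘ₗ Ψ = LinearMap.prodMap
            (LinearMap.mulRight k (c i) ∘ₗ (Polynomial.aeval x).toLinearMap)
            (π.toLinearMap ∘ₗ (Polynomial.aeval x).toLinearMap) ∘ₗ Finsupp.lapply i := by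
          refine Finsupp.lhom_ext fun j t => ?_
          have e1 : Ψ (Finsupp.single j t) = ψ j (t.1, t.2) := Finsupp.lsum_single _ _ _ _
          have e2 : proj π i (Θ (Ψ (Finsupp.single j t))) =
              if j = i then (Polynomial.aeval x t.1 * c j, π (Polynomial.aeval x t.2)) else 0 := by
            rw [e1, hΘ, proj_incl]
          refine e2.trans ?_
          rw [LinearMap.comp_apply, Finsupp.lapply_apply, Finsupp.single_apply]
          split_ifs with h
          · rw [h]
            rfl
          · rw [map_zero]
        exact LinearMap.congr_fun hlin s
      rw [hm, map_zero] at h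
      have h' := Prod.mk.inj h.symm
      refine (hψ i (s i).1 (s i).2).trans ?_
      rw [h1 i _ h'.1, h2 i _ h'.2, add_zero]
    refine (Finsupp.lsum_apply _ _ _).trans (Finset.sum_eq_zero fun i _ => hs i)
  · intro i a b
    obtain ⟨f, rfl⟩ := hx a
    obtain ⟨b, rfl⟩ := hπ b
    obtain ⟨g, rfl⟩ := hx b
    exact ⟨ψ i (f, g), hΘ i f g⟩

end GammaAlg

end Products

namespace BigradedAlg

variable {p : ℕ} {G : Type} {bideg : G → ℕ × ℕ} {rel : Set (FreeAlgebra (ZMod p) G)}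

/-- Since `ξ` is central, a generator moves past `f(ξ)`; stability of the span reduces to the
products of generators with the `e_i` and `o_i`. -/
theorem span_aeval_mul_eq_top (ξ : BigradedAlg p bideg rel) (e o : ℕ → BigradedAlg p bideg rel)
    (S : Submodule (ZMod p) (BigradedAlg p bideg rel))
    (hS : S = Submodule.span (ZMod p) {m | ∃ (f : Polynomial (ZMod p)) (i : ℕ),
      m = Polynomial.aeval ξ f * e i ∨ m = Polynomial.aeval ξ f * o i})
    (h1 : 1 ∈ S) (hξ : ∀ g, Commute (gen g) ξ) (he : ∀ g i, gen g * e i ∈ S)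
    (ho : ∀ g i, gen g * o i ∈ S) : S = ⊤ := by
  have hcomm : ∀ (g : G) (f : Polynomial (ZMod p)), Commute (gen g) (Polynomial.aeval ξ f) := by
    intro g f
    induction f using Polynomial.induction_on' with
    | add f f' hf hf' => rw [map_add]; exact hf.add_right hf'
    | monomial n c =>
      rw [Polynomial.aeval_monomial]
      exact (Algebra.commute_algebraMap_right c (gen g)).mul_right ((hξ g).pow_right n)
  have hmul : ∀ f : Polynomial (ZMod p), ∀ s ∈ S, Polynomial.aeval ξ f * s ∈ S := by
    intro f s hs
    rw [hS] at hs ⊢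
    induction hs using Submodule.span_induction with
    | mem s hs =>
      obtain ⟨f', i, rfl | rfl⟩ := hs
      · exact Submodule.subset_span ⟨f * f', i, Or.inl (by rw [map_mul, mul_assoc])⟩
      · exact Submodule.subset_span ⟨f * f', i, Or.inr (by rw [map_mul, mul_assoc])⟩
    | zero => rw [mul_zero]; exact Submodule.zero_mem _
    | add s t _ _ hs ht => rw [mul_add]; exact Submodule.add_mem _ hs ht
    | smul c s _ hs => rw [mul_smul_comm]; exact Submodule.smul_mem _ _ hs
  refine eq_top_of_gen_mul_mem S h1 fun g s hs => ?_
  rw [hS] at hs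
  induction hs using Submodule.span_induction with
  | mem s hs =>
    obtain ⟨f, i, rfl | rfl⟩ := hs
    · rw [← mul_assoc, (hcomm g f).eq, mul_assoc]
      exact hmul f _ (he g i)
    · rw [← mul_assoc, (hcomm g f).eq, mul_assoc]
      exact hmul f _ (ho g i)
  | zero => rw [mul_zero]; exact Submodule.zero_mem _
  | add s t _ _ hs ht => rw [mul_add]; exact Submodule.add_mem _ hs ht
  | smul c s _ hs => rw [mul_smul_comm]; exact Submodule.smul_mem _ _ hs

end BigradedAlg

/-! ### The quotient of `A` by `(r+1) x^r` -/

section Trunc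

variable (p r : ℕ)

theorem TruncPoly.aeval_x (f : Polynomial (ZMod p)) :
    Polynomial.aeval (TruncPoly.x p r) f = Ideal.Quotient.mk _ f := by
  have := Polynomial.aeval_algHom_apply (Ideal.Quotient.mkₐ (ZMod p)
    (Ideal.span {(Polynomial.X : Polynomial (ZMod p)) ^ (r + 1)})) Polynomial.X f
  rw [Polynomial.aeval_X_left_apply] at this
  exact this

theorem TruncPoly.aeval_x_surjective :
    Function.Surjective (Polynomial.aeval (R := ZMod p) (TruncPoly.x p r)) := fun a => by
  obtain ⟨f, rfl⟩ := Ideal.Quotient.mk_surjective a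
  exact ⟨f, TruncPoly.aeval_x p r f⟩

theorem TruncPoly.aeval_x_eq_zero_iff (f : Polynomial (ZMod p)) :
    Polynomial.aeval (TruncPoly.x p r) f = 0 ↔ Polynomial.X ^ (r + 1) ∣ f := by
  rw [TruncPoly.aeval_x, Ideal.Quotient.eq_zero_iff_mem, Ideal.mem_span_singleton]

variable [Fact p.Prime]

/-- The quotient of `𝔽_p[x]/(x^{r+1})` by `(r + 1) x^r`. -/
abbrev ModZ : Type := TruncPoly p r ⧸ Ideal.span {truncZ p r}

/-- The projection to the quotient by `(r + 1) x^r`. -/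
def toModZ : TruncPoly p r →ₐ[ZMod p] ModZ p r := Ideal.Quotient.mkₐ _ _

theorem toModZ_surjective : Function.Surjective (toModZ p r) := Ideal.Quotient.mk_surjective

theorem toModZ_eq_zero_iff (a : TruncPoly p r) :
    toModZ p r a = 0 ↔ a ∈ Ideal.span {truncZ p r} := Ideal.Quotient.eq_zero_iff_mem

theorem toModZ_bijective (hz : (r : ZMod p) + 1 = 0) : Function.Bijective (toModZ p r) := by
  refine ⟨(injective_iff_map_eq_zero _).2 fun a ha => ?_, toModZ_surjective p r⟩
  rwa [toModZ_eq_zero_iff, truncZ, hz, zero_smul, Ideal.span_singleton_zero, Ideal.mem_bot] at ha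

/-- With `r+1` invertible the ideal is generated by `x^r`, so the quotient is `𝔽_p[x]/(x^r)`. -/
theorem toModZ_aeval_x_eq_zero_iff (hz : (r : ZMod p) + 1 ≠ 0) (f : Polynomial (ZMod p)) :
    toModZ p r (Polynomial.aeval (TruncPoly.x p r) f) = 0 ↔ Polynomial.X ^ r ∣ f := by
  rw [toModZ_eq_zero_iff, Ideal.mem_span_singleton']
  constructor
  · rintro ⟨a, ha⟩
    obtain ⟨g, rfl⟩ := TruncPoly.aeval_x_surjective p r a
    have h1 : Polynomial.aeval (TruncPoly.x p r)
        (f - Polynomial.X ^ r * ((r : ZMod p) + 1) • g) = 0 := by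
      rw [map_sub, map_mul, map_smul, map_pow, Polynomial.aeval_X, ← ha, truncZ, mul_smul_comm,
        mul_smul_comm, mul_comm, sub_self]
    rw [TruncPoly.aeval_x_eq_zero_iff] at h1
    exact (dvd_sub_left (dvd_mul_right _ _)).1 ((pow_dvd_pow Polynomial.X r.le_succ).trans h1)
  · rintro ⟨g, rfl⟩
    refine ⟨((r : ZMod p) + 1)⁻¹ • Polynomial.aeval (TruncPoly.x p r) g, ?_⟩
    rw [truncZ, smul_mul_smul_comm, inv_mul_cancel₀ hz, one_smul, map_mul, map_pow,
      Polynomial.aeval_X, mul_comm]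

end Trunc

/-! ### The presentation when `p ∣ r+1` -/

section DivCase

open BigradedAlg GammaAlg

variable {p r N : ℕ} {A B : Type} [CommRing A] [CommRing B] [Algebra (ZMod p) A]
  [Algebra (ZMod p) B] (π : A →ₐ[ZMod p] B) (x : A)

theorem odd_pred (hN : 0 < N) (hE : Even N) : ¬ Even (N - 1) :=
  Nat.not_even_iff_odd.2 (Nat.Even.sub_odd hN hE odd_one)

theorem odd_mul_pred (r : ℕ) (hN : 0 < N) (hE : Even N) : ¬ Even ((r + 1) * N - 1) :=
  odd_pred (Nat.mul_pos r.succ_pos hN) (hE.mul_left _)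

/-- The images of the generators `x`, `dx`, `γ_i` in the algebra of pairs. -/
def divVal : GenDiv → GammaAlg π
  | .x => incl π 0 (x, 0)
  | .dx => incl π 0 (0, 1)
  | .γ i => incl π i (1, 0)

/-- The internal degree of `x` is even, that of `dx` is odd, and that of `γ_i` has the parity of
`i`. For two divided powers the simplicial and internal signs cancel, and the only possible sign
between distinct generators is `(-1)^i` for `dx` against `γ_i`, as in the algebra of pairs. The
square of `dx` is zero on both sides. -/
theorem divVal_comm (hN : 0 < N) (hE : Even N) (g h : GenDiv) :
    divVal π x g * divVal π x h = (-1 : ZMod p) ^ ((g.bideg r N).1 * (h.bideg r N).1 +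
      (g.bideg r N).2 * (h.bideg r N).2) • (divVal π x h * divVal π x g) := by
  have h1 := odd_pred hN hE
  have h2 := odd_mul_pred r hN hE
  have key : ∀ (m n : ℕ) (u : GammaAlg π), (Even m ↔ Even n) →
      (-1 : ZMod p) ^ m • u = (-1 : ZMod p) ^ n • u := fun m n u h => by
    rw [neg_one_pow_congr h]
  have key' : ∀ (m : ℕ) (u : GammaAlg π), Even m → u = (-1 : ZMod p) ^ m • u := fun m u h => by
    rw [h.neg_one_pow, one_smul]
  cases g <;> cases h <;> simp only [divVal, GenDiv.bideg]
  · exact (even_comm _ _ _ _ _).trans <| key' _ _ (by simp [parity_simps, hE])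
  · rw [even_odd_comm]
    exact key _ _ _ (by simp [parity_simps, hE])
  · exact (even_comm _ _ _ _ _).trans <| key' _ _ (by simp [parity_simps, hE])
  · rw [odd_even_comm]
    exact key _ _ _ (by simp [parity_simps, hE])
  · rw [odd_mul_odd, smul_zero]
  · rw [odd_even_comm]
    exact key _ _ _ (by simp [parity_simps, h1, h2])
  · exact (even_comm _ _ _ _ _).trans <| key' _ _ (by simp [parity_simps, hE])
  · rw [even_odd_comm]
    exact key _ _ _ (by simp [parity_simps, h1, h2])
  · exact (even_comm _ _ _ _ _).trans <| key' _ _ (by simp [parity_simps, h2])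

theorem divVal_rel (hx : x ^ (r + 1) = 0) (w : FreeAlgebra (ZMod p) GenDiv) (hw : GenDiv.Relator p r w) :
    FreeAlgebra.lift (ZMod p) (divVal π x) w = 0 := by
  cases hw with
  | x_pow =>
    rw [map_pow, FreeAlgebra.lift_ι_apply, divVal, ← inclZero_apply, ← map_pow, hx, map_zero]
  | dx_sq => rw [map_pow, FreeAlgebra.lift_ι_apply, divVal, sq, odd_mul_odd]
  | γ_zero => rw [map_sub, map_one, FreeAlgebra.lift_ι_apply, divVal, one_def, sub_self]
  | γ_mul i j =>
    rw [map_sub, map_smul, map_mul, FreeAlgebra.lift_ι_apply, FreeAlgebra.lift_ι_apply,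
      FreeAlgebra.lift_ι_apply, divVal, divVal, divVal, even_mul_even, mul_one, map_smul, sub_self]

theorem AlgDiv.gen_x_pow : (gen .x : AlgDiv p r N) ^ (r + 1) = 0 := by
  simpa using lift_gen_eq_zero (bideg := GenDiv.bideg r N)
    (show _ ∈ {w | GenDiv.Relator p r w} from .x_pow)

theorem AlgDiv.gen_dx_mul : (gen .dx : AlgDiv p r N) * gen .dx = 0 := by
  simpa [sq] using lift_gen_eq_zero (bideg := GenDiv.bideg r N)
    (show _ ∈ {w | GenDiv.Relator p r w} from .dx_sq)

theorem AlgDiv.gen_γ_zero : (gen (.γ 0) : AlgDiv p r N) = 1 := by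
  have := lift_gen_eq_zero (bideg := GenDiv.bideg r N)
    (show _ ∈ {w | GenDiv.Relator p r w} from .γ_zero)
  rw [map_sub, map_one, FreeAlgebra.lift_ι_apply] at this
  exact sub_eq_zero.1 this

theorem AlgDiv.gen_γ_mul (i j : ℕ) : (gen (.γ i) : AlgDiv p r N) * gen (.γ j) =
    ((i + j).choose i : ZMod p) • gen (.γ (i + j)) := by
  have := lift_gen_eq_zero (bideg := GenDiv.bideg r N)
    (show _ ∈ {w | GenDiv.Relator p r w} from .γ_mul i j)
  rw [map_sub, map_smul, map_mul, FreeAlgebra.lift_ι_apply, FreeAlgebra.lift_ι_apply,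
    FreeAlgebra.lift_ι_apply] at this
  exact sub_eq_zero.1 this

theorem AlgDiv.commute_x (hE : Even N) (g : GenDiv) :
    Commute (gen g : AlgDiv p r N) (gen .x) := by
  have h := gen_mul_gen (p := p) (bideg := GenDiv.bideg r N) (rel := {w | GenDiv.Relator p r w}) g .x
  rwa [Even.neg_one_pow (by simp [GenDiv.bideg, hE]), one_smul] at h

/-- Commutativity brings powers of `x` to the front and `dx` next, and the divided power relations
merge the `γ_i` into one; `γ_0 = 1` accounts for the unit. -/
theorem AlgDiv.span_eq_top (hE : Even N) : Submodule.span (ZMod p)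
    {m : AlgDiv p r N | ∃ (f : Polynomial (ZMod p)) (i : ℕ),
      m = Polynomial.aeval (gen .x) f * gen (.γ i) ∨
      m = Polynomial.aeval (gen .x) f * (gen .dx * gen (.γ i))} = ⊤ := by
  set S := Submodule.span (ZMod p)
    {m : AlgDiv p r N | ∃ (f : Polynomial (ZMod p)) (i : ℕ),
      m = Polynomial.aeval (gen .x) f * gen (.γ i) ∨
      m = Polynomial.aeval (gen .x) f * (gen .dx * gen (.γ i))} with hS
  have m1 : ∀ (f : Polynomial (ZMod p)) (i : ℕ), Polynomial.aeval (gen .x) f * gen (.γ i) ∈ S :=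
    fun f i => Submodule.subset_span ⟨f, i, Or.inl rfl⟩
  have m2 : ∀ (f : Polynomial (ZMod p)) (i : ℕ),
      Polynomial.aeval (gen .x) f * (gen .dx * gen (.γ i)) ∈ S :=
    fun f i => Submodule.subset_span ⟨f, i, Or.inr rfl⟩
  have m3 : ∀ i, gen (.γ i) ∈ S := fun i => by simpa using m1 1 i
  have m4 : ∀ i, gen .dx * gen (.γ i) ∈ S := fun i => by simpa using m2 1 i
  refine span_aeval_mul_eq_top _ _ _ S hS ?_ (AlgDiv.commute_x hE) ?_ ?_
  · rw [← AlgDiv.gen_γ_zero]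
    exact m3 0
  · intro g i
    cases g with
    | x => simpa using m1 Polynomial.X i
    | dx => exact m4 i
    | γ j =>
      rw [AlgDiv.gen_γ_mul]
      exact S.smul_mem _ (m3 _)
  · intro g i
    cases g with
    | x => simpa using m2 Polynomial.X i
    | dx =>
      rw [← mul_assoc, AlgDiv.gen_dx_mul, zero_mul]
      exact S.zero_mem
    | γ j =>
      rw [← mul_assoc, gen_mul_gen, smul_mul_assoc, mul_assoc, AlgDiv.gen_γ_mul, mul_smul_comm]
      exact S.smul_mem _ (S.smul_mem _ (m4 _))

/-- Here `π` is bijective and `c_i = 1`, so both annihilator conditions reduce to `x^{r+1} = 0` and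
every pair is in the image. -/
theorem exists_algHom_algDiv (hN : 0 < N) (hE : Even N)
    (hx : Function.Surjective (Polynomial.aeval (R := ZMod p) x)) (hπ : Function.Bijective π)
    (h0 : ∀ f : Polynomial (ZMod p), Polynomial.aeval x f = 0 ↔ Polynomial.X ^ (r + 1) ∣ f) :
    ∃ Θ : AlgDiv p r N →ₐ[ZMod p] GammaAlg π, (∀ g, Θ (gen g) = divVal π x g) ∧
      Function.Injective Θ ∧ ∀ i s, incl π i s ∈ Θ.toLinearMap.range := by
  have hr : x ^ (r + 1) = 0 := by simpa using (h0 (Polynomial.X ^ (r + 1))).2 dvd_rfl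
  have hg := lift_gen (bideg := GenDiv.bideg r N) (rel := {w | GenDiv.Relator p r w})
    (divVal π x) (divVal_comm π x hN hE) (divVal_rel π x hr)
  refine ⟨lift (divVal π x) (divVal_comm π x hN hE) (divVal_rel π x hr), hg, ?_⟩
  have h1 : ∀ f : Polynomial (ZMod p), Polynomial.aeval x f = 0 →
      Polynomial.aeval (gen .x : AlgDiv p r N) f = 0 := by
    intro f hf
    obtain ⟨f, rfl⟩ := (h0 f).1 hf
    rw [map_mul, map_pow, Polynomial.aeval_X, AlgDiv.gen_x_pow, zero_mul]
  have h := injective_and_mem_range (M := AlgDiv p r N) π _ x hx hπ.2 (gen .x) (fun i => gen (.γ i))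
    (fun i => gen .dx * gen (.γ i)) (fun _ => 1) (hg .x) (fun i => hg (.γ i))
    (fun i => by
      rw [map_mul, hg, hg, divVal, divVal, odd_mul_even, zero_add, Nat.choose_zero_right,
        Nat.cast_one, one_smul, map_one, one_mul])
    (fun i f hf => by rw [h1 f (by rwa [mul_one] at hf), zero_mul])
    (fun i f hf => by rw [h1 f (hπ.1 (hf.trans (map_zero π).symm)), zero_mul])
    (by exact AlgDiv.span_eq_top (p := p) (r := r) hE)
  exact ⟨h.1, fun i s => by simpa using h.2 i s.1 s.2⟩

end DivCase

/-! ### The presentation when `p ∤ r+1` -/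

section NonDivCase

open BigradedAlg GammaAlg

variable {p r N : ℕ} {A B : Type} [CommRing A] [CommRing B] [Algebra (ZMod p) A]
  [Algebra (ZMod p) B] (π : A →ₐ[ZMod p] B) (x : A)

/-- The images of the generators `a_i`, `b_i` in the algebra of pairs. -/
def nonDivVal : GenNonDiv → GammaAlg π
  | .a i => incl π i (0, 1)
  | .b i => incl π i (x, 0)

/-- The internal degree of `b_i` has the parity of `i` and that of `a_i` the parity of `i+1`. So the
`b_i` commute with each other, `a_i` and `b_j` commute up to `(-1)^j`, and products of two `a_i`
vanish. -/
theorem nonDivVal_comm (hN : 0 < N) (hE : Even N) (g h : GenNonDiv) :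
    nonDivVal π x g * nonDivVal π x h = (-1 : ZMod p) ^ ((g.bideg r N).1 * (h.bideg r N).1 +
      (g.bideg r N).2 * (h.bideg r N).2) • (nonDivVal π x h * nonDivVal π x g) := by
  have h1 := odd_pred hN hE
  have h2 := odd_mul_pred r hN hE
  have key : ∀ (m n : ℕ) (u : GammaAlg π), (Even m ↔ Even n) →
      (-1 : ZMod p) ^ m • u = (-1 : ZMod p) ^ n • u := fun m n u h => by
    rw [neg_one_pow_congr h]
  have key' : ∀ (m : ℕ) (u : GammaAlg π), Even m → u = (-1 : ZMod p) ^ m • u := fun m u h => by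
    rw [h.neg_one_pow, one_smul]
  cases g <;> cases h <;> simp only [nonDivVal, GenNonDiv.bideg]
  · rw [odd_mul_odd, odd_mul_odd, smul_zero]
  · rw [odd_even_comm]
    exact key _ _ _ (by simp only [Nat.even_add, Nat.even_mul, h1, h2, Nat.not_even_one]; tauto)
  · rw [even_odd_comm]
    exact key _ _ _ (by simp only [Nat.even_add, Nat.even_mul, h1, h2, Nat.not_even_one]; tauto)
  · exact (even_comm _ _ _ _ _).trans <| key' _ _ (by simp [parity_simps, h1, h2])

theorem nonDivVal_rel (hx : x ^ (r + 1) = 0) (hπ : π x ^ r = 0) (w : FreeAlgebra (ZMod p) GenNonDiv)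
    (hw : GenNonDiv.Relator p r w) : FreeAlgebra.lift (ZMod p) (nonDivVal π x) w = 0 := by
  cases hw with
  | a_mul_a i j =>
    rw [map_mul, FreeAlgebra.lift_ι_apply, FreeAlgebra.lift_ι_apply, nonDivVal, nonDivVal,
      odd_mul_odd]
  | b_mul_b i j =>
    rw [map_sub, map_smul, map_mul, map_mul]
    simp only [FreeAlgebra.lift_ι_apply, nonDivVal]
    rw [even_mul_even, even_mul_even, ← map_smul, zero_add, Nat.choose_zero_right, Nat.cast_one,
      one_smul, sub_self]
  | a_mul_b i j =>
    rw [map_sub, map_smul, map_mul, map_mul]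
    simp only [FreeAlgebra.lift_ι_apply, nonDivVal]
    rw [odd_mul_even, even_mul_odd, ← map_smul, zero_add, Nat.choose_zero_right, Nat.cast_one,
      one_smul, pow_zero, one_smul, sub_self]
  | b_pow_mul_b i =>
    rw [map_mul, map_pow]
    simp only [FreeAlgebra.lift_ι_apply, nonDivVal]
    rw [← inclZero_apply, ← map_pow, inclZero_apply, even_mul_even, ← pow_succ, hx]
    exact (congrArg (incl π (0 + i)) (by simp)).trans (map_zero _)
  | b_pow_mul_a i =>
    rw [map_mul, map_pow]
    simp only [FreeAlgebra.lift_ι_apply, nonDivVal]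
    rw [← inclZero_apply, ← map_pow, inclZero_apply, even_mul_odd, map_pow, hπ]
    exact (congrArg (incl π (0 + i)) (by simp)).trans (map_zero _)

namespace AlgNonDiv

theorem gen_a_mul_a (i j : ℕ) : (gen (.a i) : AlgNonDiv p r N) * gen (.a j) = 0 := by
  have := lift_gen_eq_zero (bideg := GenNonDiv.bideg r N)
    (show _ ∈ {w | GenNonDiv.Relator p r w} from .a_mul_a i j)
  rwa [map_mul, FreeAlgebra.lift_ι_apply, FreeAlgebra.lift_ι_apply] at this

theorem gen_b_mul_b (i j : ℕ) : (gen (.b i) : AlgNonDiv p r N) * gen (.b j) =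
    ((i + j).choose i : ZMod p) • (gen (.b 0) * gen (.b (i + j))) := by
  have := lift_gen_eq_zero (bideg := GenNonDiv.bideg r N)
    (show _ ∈ {w | GenNonDiv.Relator p r w} from .b_mul_b i j)
  rw [map_sub, map_smul, map_mul, map_mul] at this
  simp only [FreeAlgebra.lift_ι_apply] at this
  exact sub_eq_zero.1 this

theorem gen_a_mul_b (i j : ℕ) : (gen (.a i) : AlgNonDiv p r N) * gen (.b j) =
    ((i + j).choose i : ZMod p) • (gen (.b 0) * gen (.a (i + j))) := by
  have := lift_gen_eq_zero (bideg := GenNonDiv.bideg r N)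
    (show _ ∈ {w | GenNonDiv.Relator p r w} from .a_mul_b i j)
  rw [map_sub, map_smul, map_mul, map_mul] at this
  simp only [FreeAlgebra.lift_ι_apply] at this
  exact sub_eq_zero.1 this

theorem gen_b_pow_mul_b (i : ℕ) : (gen (.b 0) : AlgNonDiv p r N) ^ r * gen (.b i) = 0 := by
  have := lift_gen_eq_zero (bideg := GenNonDiv.bideg r N)
    (show _ ∈ {w | GenNonDiv.Relator p r w} from .b_pow_mul_b i)
  rwa [map_mul, map_pow, FreeAlgebra.lift_ι_apply, FreeAlgebra.lift_ι_apply] at this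

theorem gen_b_pow_mul_a (i : ℕ) : (gen (.b 0) : AlgNonDiv p r N) ^ r * gen (.a i) = 0 := by
  have := lift_gen_eq_zero (bideg := GenNonDiv.bideg r N)
    (show _ ∈ {w | GenNonDiv.Relator p r w} from .b_pow_mul_a i)
  rwa [map_mul, map_pow, FreeAlgebra.lift_ι_apply, FreeAlgebra.lift_ι_apply] at this

theorem commute_b_zero (hN : 0 < N) (hE : Even N) (g : GenNonDiv) :
    Commute (gen g : AlgNonDiv p r N) (gen (.b 0)) := by
  have h := gen_mul_gen (p := p) (bideg := GenNonDiv.bideg r N)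
    (rel := {w | GenNonDiv.Relator p r w}) g (.b 0)
  rwa [Even.neg_one_pow (by
    simp [GenNonDiv.bideg, Nat.even_add_one, odd_pred hN hE]), one_smul] at h

/-- The elements `1, b_1, b_2, …`. -/
def e : ℕ → AlgNonDiv p r N
  | 0 => 1
  | i + 1 => gen (.b (i + 1))

/-- The defining relations trade any product `b_i b_j` or `a_i b_j` for a multiple of `b_0 b_{i+j}`
or `b_0 a_{i+j}`, so one generator of positive index and a polynomial in `b_0` suffice. At index
zero the basis element is `1`, of which `b_0` is already a multiple. -/
theorem span_eq_top (hN : 0 < N) (hE : Even N) : Submodule.span (ZMod p)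
    {m : AlgNonDiv p r N | ∃ (f : Polynomial (ZMod p)) (i : ℕ),
      m = Polynomial.aeval (gen (.b 0)) f * e i ∨
      m = Polynomial.aeval (gen (.b 0)) f * gen (.a i)} = ⊤ := by
  set S := Submodule.span (ZMod p)
    {m : AlgNonDiv p r N | ∃ (f : Polynomial (ZMod p)) (i : ℕ),
      m = Polynomial.aeval (gen (.b 0)) f * e i ∨
      m = Polynomial.aeval (gen (.b 0)) f * gen (.a i)} with hS
  have m1 : ∀ (f : Polynomial (ZMod p)) (i : ℕ), Polynomial.aeval (gen (.b 0)) f * e i ∈ S :=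
    fun f i => Submodule.subset_span ⟨f, i, Or.inl rfl⟩
  have m2 : ∀ (f : Polynomial (ZMod p)) (i : ℕ),
      Polynomial.aeval (gen (.b 0)) f * gen (.a i) ∈ S :=
    fun f i => Submodule.subset_span ⟨f, i, Or.inr rfl⟩
  have m3 : ∀ i, e i ∈ S := fun i => by simpa using m1 1 i
  have m4 : ∀ i, gen (.a i) ∈ S := fun i => by simpa using m2 1 i
  have m5 : ∀ i, gen (.b 0) * e i ∈ S := fun i => by simpa using m1 Polynomial.X i
  have m6 : ∀ i, gen (.b 0) * gen (.a i) ∈ S := fun i => by simpa using m2 Polynomial.X i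
  have m7 : ∀ i j, gen (.a i) * gen (.b j) ∈ S := fun i j => by
    rw [gen_a_mul_b]
    exact S.smul_mem _ (m6 _)
  refine span_aeval_mul_eq_top _ _ _ S hS (m3 0) (commute_b_zero hN hE) ?_ ?_
  · intro g i
    cases g with
    | a j =>
      cases i with
      | zero => rw [e, mul_one]; exact m4 j
      | succ i => exact m7 j (i + 1)
    | b j =>
      cases i with
      | zero =>
        cases j with
        | zero => exact m5 0
        | succ j => rw [e, mul_one]; exact m3 (j + 1)
      | succ i =>
        rw [e, gen_b_mul_b]
        exact S.smul_mem _ (m5 (j + i + 1))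
  · intro g i
    cases g with
    | a j =>
      rw [gen_a_mul_a]
      exact S.zero_mem
    | b j =>
      rw [gen_mul_gen]
      exact S.smul_mem _ (m7 _ _)

end AlgNonDiv

/-- The condition on the first entry for `i ≠ 0` is the one satisfied by symbols of cycles of
positive dimension. The relations `b_0^r b_i = 0` and `b_0^r a_i = 0` give exactly the annihilators
of `(x, 0)_i` and `(0, 1)_i`. -/
theorem exists_algHom_algNonDiv [Fact p.Prime] (hN : 0 < N) (hE : Even N)
    (hx : Function.Surjective (Polynomial.aeval (R := ZMod p) x)) (hπ : Function.Surjective π)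
    (h0 : ∀ f : Polynomial (ZMod p), Polynomial.aeval x f = 0 ↔ Polynomial.X ^ (r + 1) ∣ f)
    (hπ0 : ∀ f : Polynomial (ZMod p), π (Polynomial.aeval x f) = 0 ↔ Polynomial.X ^ r ∣ f) :
    ∃ Θ : AlgNonDiv p r N →ₐ[ZMod p] GammaAlg π, (∀ g, Θ (gen g) = nonDivVal π x g) ∧
      Function.Injective Θ ∧
      ∀ i s, (i ≠ 0 → s.1 * x ^ r = 0) → incl π i s ∈ Θ.toLinearMap.range := by
  have hr : x ^ (r + 1) = 0 := by simpa using (h0 (Polynomial.X ^ (r + 1))).2 dvd_rfl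
  have hπr : π x ^ r = 0 := by simpa using (hπ0 (Polynomial.X ^ r)).2 dvd_rfl
  have hg := lift_gen (bideg := GenNonDiv.bideg r N) (rel := {w | GenNonDiv.Relator p r w})
    (nonDivVal π x) (nonDivVal_comm π x hN hE) (nonDivVal_rel π x hr hπr)
  refine ⟨lift (nonDivVal π x) (nonDivVal_comm π x hN hE) (nonDivVal_rel π x hr hπr), hg, ?_⟩
  -- The coefficient is `1` at index zero, where symbols are unrestricted, and `x` at positive
  -- indices, where first entries must be multiples of `x`.
  have h := injective_and_mem_range (M := AlgNonDiv p r N) π _ x hx hπ (gen (.b 0)) AlgNonDiv.e (fun i => gen (.a i))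
    (fun i => if i = 0 then 1 else x) (hg (.b 0))
    (fun i => by
      cases i with
      | zero => rw [AlgNonDiv.e, map_one, if_pos rfl]; rfl
      | succ i => rw [AlgNonDiv.e, hg, if_neg i.succ_ne_zero]; rfl)
    (fun i => hg (.a i)) ?_ ?_
    (AlgNonDiv.span_eq_top (p := p) (r := r) hN hE)
  · refine ⟨h.1, fun i s hs => ?_⟩
    have hi := fun a => h.2 i a s.2
    split_ifs at hi with hi0
    · simpa using hi s.1
    · obtain ⟨f, hf⟩ := hx s.1
      have h1 : Polynomial.aeval x (f * Polynomial.X ^ r) = 0 := by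
        rw [map_mul, map_pow, Polynomial.aeval_X, hf, hs hi0]
      -- In `A`, annihilation by `x^r` means divisibility by `x`: cancel `X^r` in `X^{r+1} ∣ f X^r`.
      rw [h0, pow_succ', mul_dvd_mul_iff_right (pow_ne_zero _ Polynomial.X_ne_zero)] at h1
      obtain ⟨g, rfl⟩ := h1
      have h2 := hi (Polynomial.aeval x g)
      rw [map_mul, Polynomial.aeval_X, mul_comm] at hf
      rwa [hf] at h2
  · intro i f hf
    cases i with
    | zero =>
      rw [if_pos rfl, mul_one, h0] at hf
      obtain ⟨f, rfl⟩ := hf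
      rw [AlgNonDiv.e, mul_one, map_mul, map_pow, Polynomial.aeval_X, pow_succ,
        AlgNonDiv.gen_b_pow_mul_b, zero_mul]
    | succ i =>
      rw [if_neg i.succ_ne_zero] at hf
      have h1 : Polynomial.aeval x (f * Polynomial.X) = 0 := by
        rw [map_mul, Polynomial.aeval_X, hf]
      -- Likewise `f(x) x = 0` means `X^r ∣ f`, and `b_0^r b_{i+1} = 0` applies.
      rw [h0, pow_succ, mul_dvd_mul_iff_right Polynomial.X_ne_zero] at h1
      obtain ⟨g, rfl⟩ := h1
      rw [mul_comm, map_mul, map_pow, Polynomial.aeval_X, mul_assoc, AlgNonDiv.e,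
        AlgNonDiv.gen_b_pow_mul_b, mul_zero]
  · intro i f hf
    obtain ⟨g, rfl⟩ := (hπ0 f).1 hf
    rw [mul_comm, map_mul, map_pow, Polynomial.aeval_X, mul_assoc, AlgNonDiv.gen_b_pow_mul_a,
      mul_zero]

end NonDivCase

/-! ### Homotopy classes -/

section HtpyMap

variable {p : ℕ} {V W : SimplicialObject (AlgCat.{0} (ZMod p))}

theorem htpyClass_eq_of_sub_mem {i : ℕ} {u v : alv V i} (hu : u ∈ cycles V i) (hv : v ∈ cycles V i)
    (h : u - v ∈ boundaries V i) : htpyClass u hu = htpyClass v hv :=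
  congrArg (DirectSum.lof (ZMod p) ℕ (fun i => Htpy V i) i)
    ((Submodule.Quotient.eq _).2 (show (⟨u, hu⟩ - ⟨v, hv⟩ : cycles V i) ∈
      (boundaries V i).submoduleOf (cycles V i) from h))

theorem htpyClass_congr {i : ℕ} {u v : alv V i} (hu : u ∈ cycles V i) (h : u = v)
    (hv : v ∈ cycles V i) : htpyClass u hu = htpyClass v hv := by
  subst h; rfl

theorem htpyClass_add {i : ℕ} {u v : alv V i} (hu : u ∈ cycles V i) (hv : v ∈ cycles V i) :
    htpyClass (u + v) (Submodule.add_mem _ hu hv) = htpyClass u hu + htpyClass v hv :=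
  map_add (DirectSum.lof (ZMod p) ℕ (fun i => Htpy V i) i ∘ₗ Submodule.mkQ _)
    (⟨u, hu⟩ : cycles V i) ⟨v, hv⟩

theorem htpyClass_smul {i : ℕ} (c : ZMod p) {u : alv V i} (hu : u ∈ cycles V i) :
    htpyClass (c • u) (Submodule.smul_mem _ c hu) = c • htpyClass u hu :=
  map_smul (DirectSum.lof (ZMod p) ℕ (fun i => Htpy V i) i ∘ₗ Submodule.mkQ _) c
    (⟨u, hu⟩ : cycles V i)

theorem htpyClass_zero (i : ℕ) : htpyClass (V := V) (i := i) 0 (Submodule.zero_mem _) = 0 :=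
  map_zero (DirectSum.lof (ZMod p) ℕ (fun i => Htpy V i) i ∘ₗ Submodule.mkQ _)

theorem htpyAll_induction {C : HtpyAll V → Prop} (zero : C 0) (add : ∀ x y, C x → C y → C (x + y))
    (cls : ∀ (i : ℕ) (u : alv V i) (hu : u ∈ cycles V i), C (htpyClass u hu)) (x : HtpyAll V) :
    C x := by
  induction x using DirectSum.induction_on with
  | zero => exact zero
  | of i x =>
    obtain ⟨⟨u, hu⟩, rfl⟩ := Submodule.Quotient.mk_surjective _ x
    exact cls i u hu
  | add x y hx hy => exact add x y hx hy

theorem htpyAll_hom_ext {M : Type} [AddCommMonoid M] [Module (ZMod p) M]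
    {f g : HtpyAll V →ₗ[ZMod p] M}
    (h : ∀ (i : ℕ) (u : alv V i) (hu : u ∈ cycles V i), f (htpyClass u hu) = g (htpyClass u hu)) :
    f = g := by
  refine LinearMap.ext fun x => ?_
  induction x using htpyAll_induction with
  | zero => rw [map_zero, map_zero]
  | add x y hx hy => rw [map_add, map_add, hx, hy]
  | cls i u hu => exact h i u hu

variable (F : ∀ n, alv V n →ₗ[ZMod p] alv W n)
  (hF : ∀ (a b : ℕ) (θ : SimplexCategory.mk a ⟶ SimplexCategory.mk b) (v : alv V b),
      op W θ (F b v) = F a (op V θ v))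

/-- The map on `π_*` induced by a map of simplicial vector spaces. -/
def htpyMap : HtpyAll V →ₗ[ZMod p] HtpyAll W :=
  DirectSum.lmap fun i => Submodule.mapQ ((boundaries V i).submoduleOf (cycles V i))
    ((boundaries W i).submoduleOf (cycles W i))
    ((F i).restrict fun _ hu => map_mem_cycles F hF hu)
    fun _ hu => map_mem_boundaries F hF hu

theorem htpyMap_htpyClass {i : ℕ} {u : alv V i} (hu : u ∈ cycles V i) :
    htpyMap F hF (htpyClass u hu) = htpyClass (F i u) (map_mem_cycles F hF hu) :=
  DirectSum.lmap_lof _ _ _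

theorem htpyClass_mem_htpyGr {gr : ∀ i : ℕ, ℕ → Submodule (ZMod p) (alv V i)} {i n : ℕ}
    {u : alv V i} (hu : u ∈ cycles V i) (hg : u ∈ gr i n) : htpyClass u hu ∈ htpyGr V gr i n :=
  ⟨_, ⟨⟨u, hu⟩, hg, rfl⟩, rfl⟩

theorem exists_of_mem_htpyGr {gr : ∀ i : ℕ, ℕ → Submodule (ZMod p) (alv V i)} {i n : ℕ}
    {x : HtpyAll V} (hx : x ∈ htpyGr V gr i n) :
    ∃ (u : alv V i) (hu : u ∈ cycles V i), u ∈ gr i n ∧ htpyClass u hu = x := by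
  obtain ⟨_, ⟨⟨u, hu⟩, hg, rfl⟩, rfl⟩ := hx
  exact ⟨u, hu, hg, rfl⟩

end HtpyMap

/-! ### Induced maps and bidegree projections on the homotopy of `Ω̄` -/

section OmegaMap

variable {p : ℕ} {P Q : SimplicialObject (EvenAlg p)}

/-- The map on `Ω̄` induced by a simplicial map. -/
def omegaMap (f : P ⟶ Q) (n : ℕ) : alv (omegaSimp P) n →ₐ[ZMod p] alv (omegaSimp Q) n :=
  Omega.map p (comp f n).toAlgHom

theorem op_omegaMap (f : P ⟶ Q) (a b : ℕ) (θ : SimplexCategory.mk a ⟶ SimplexCategory.mk b)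
    (v : alv (omegaSimp P) b) :
    op (omegaSimp Q) θ (omegaMap f b v) = omegaMap f a (op (omegaSimp P) θ v) := by
  have h : (eop Q θ).toAlgHom.comp (comp f b).toAlgHom =
      (comp f a).toAlgHom.comp (eop P θ).toAlgHom := AlgHom.ext (eop_comp_apply f θ)
  have h1 := Omega.map_comp_apply (eop Q θ).toAlgHom (comp f b).toAlgHom v
  have h2 := Omega.map_comp_apply (comp f a).toAlgHom (eop P θ).toAlgHom v
  exact h1.symm.trans ((congrArg (fun φ => Omega.map p φ v) h).trans h2)

/-- The map on `π_* Ω̄` induced by a simplicial map. -/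
def omegaHtpyMap (f : P ⟶ Q) : HtpyAll (omegaSimp P) →ₗ[ZMod p] HtpyAll (omegaSimp Q) :=
  htpyMap (fun n => (omegaMap f n).toLinearMap) (op_omegaMap f)

theorem omegaMap_mem_cycles (f : P ⟶ Q) {i : ℕ} {u : alv (omegaSimp P) i}
    (hu : u ∈ cycles (omegaSimp P) i) : omegaMap f i u ∈ cycles (omegaSimp Q) i :=
  map_mem_cycles (fun n => (omegaMap f n).toLinearMap) (op_omegaMap f) hu

theorem omegaHtpyMap_htpyClass (f : P ⟶ Q) {i : ℕ} {u : alv (omegaSimp P) i}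
    (hu : u ∈ cycles (omegaSimp P) i) :
    omegaHtpyMap f (htpyClass u hu) = htpyClass (omegaMap f i u) (omegaMap_mem_cycles f hu) :=
  htpyMap_htpyClass _ _ hu

theorem omegaMap_shuffle (f : P ⟶ Q) {i j : ℕ} (u : alv (omegaSimp P) i)
    (v : alv (omegaSimp P) j) : omegaMap f (i + j) (shuffle (omegaSimp P) u v) =
      shuffle (omegaSimp Q) (omegaMap f i u) (omegaMap f j v) :=
  map_shuffle (fun n => omegaMap f n) (op_omegaMap f) u v

theorem omegaMap_deRhamOp (f : P ⟶ Q) {i : ℕ} (u : alv (omegaSimp P) i) :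
    omegaMap f i (deRhamOp P i u) = deRhamOp Q i (omegaMap f i u) :=
  Omega.map_deRham _ _

theorem omegaMap_mem_omegaSimpGr (f : P ⟶ Q) {i n : ℕ} {u : alv (omegaSimp P) i}
    (hu : u ∈ omegaSimpGr P i n) : omegaMap f i u ∈ omegaSimpGr Q i n :=
  map_mem_omegaGr (comp f i) hu

/-- The map on `π_* Ω̄` induced by the de Rham differential. -/
def deRhamHtpy (P : SimplicialObject (EvenAlg p)) :
    HtpyAll (omegaSimp P) →ₗ[ZMod p] HtpyAll (omegaSimp P) :=
  htpyMap (deRhamOp P) fun _ _ => op_deRhamOp P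

theorem deRhamOp_mem_cycles {i : ℕ} {u : alv (omegaSimp P) i} (hu : u ∈ cycles (omegaSimp P) i) :
    deRhamOp P i u ∈ cycles (omegaSimp P) i :=
  map_mem_cycles (deRhamOp P) (fun _ _ => op_deRhamOp P) hu

theorem deRhamHtpy_htpyClass {i : ℕ} {u : alv (omegaSimp P) i} (hu : u ∈ cycles (omegaSimp P) i) :
    deRhamHtpy P (htpyClass u hu) = htpyClass (deRhamOp P i u) (deRhamOp_mem_cycles hu) :=
  htpyMap_htpyClass _ _ hu

/-- The projection of `Ω̄ P_i` onto the part of degree `n`. -/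
def simpProj (P : SimplicialObject (EvenAlg p)) (n i : ℕ) :
    alv (omegaSimp P) i →ₗ[ZMod p] alv (omegaSimp P) i :=
  omegaProj (lv P i) n

theorem op_simpProj (P : SimplicialObject (EvenAlg p)) (n a b : ℕ)
    (θ : SimplexCategory.mk a ⟶ SimplexCategory.mk b) (u : alv (omegaSimp P) b) :
    op (omegaSimp P) θ (simpProj P n b u) = simpProj P n a (op (omegaSimp P) θ u) :=
  map_omegaProj (eop P θ) n u

/-- The projection of `π_* Ω̄ P` onto the part of bidegree `(i, n)`. -/
def bidegProj (P : SimplicialObject (EvenAlg p)) (i n : ℕ) :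
    HtpyAll (omegaSimp P) →ₗ[ZMod p] HtpyAll (omegaSimp P) :=
  DirectSum.lof (ZMod p) ℕ (fun i => Htpy (omegaSimp P) i) i ∘ₗ
    DirectSum.component (ZMod p) ℕ (fun i => Htpy (omegaSimp P) i) i ∘ₗ
      htpyMap (simpProj P n) (op_simpProj P n)

theorem bidegProj_of_mem {i n j m : ℕ} {x : HtpyAll (omegaSimp P)}
    (hx : x ∈ htpyGr (V := omegaSimp P) (omegaSimpGr P) j m) :
    bidegProj P i n x = if (j, m) = (i, n) then x else 0 := by
  obtain ⟨u, hu, hg, rfl⟩ := exists_of_mem_htpyGr (V := omegaSimp P) (gr := omegaSimpGr P) hx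
  have h1 : simpProj P n j u = if m = n then u else 0 := omegaProj_of_mem n hg
  have h2 : htpyMap (simpProj P n) (op_simpProj P n) (htpyClass u hu) =
      if m = n then htpyClass u hu else 0 := by
    rw [htpyMap_htpyClass]
    split_ifs at h1 ⊢
    · exact htpyClass_congr _ h1 _
    · exact (htpyClass_congr _ h1 (Submodule.zero_mem _)).trans (htpyClass_zero j)
  rw [bidegProj, LinearMap.comp_apply, LinearMap.comp_apply, h2]
  by_cases h : m = n
  · by_cases h' : j = i
    · subst h h'
      rw [if_pos rfl, if_pos rfl, htpyClass, DirectSum.component.lof_self]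
    · rw [if_pos h, if_neg (by simp [h']), htpyClass, DirectSum.component.of, dif_neg h', map_zero]
  · rw [if_neg h, if_neg (by simp [h]), map_zero, map_zero]

end OmegaMap

/-! ### The homotopy of `Ω̄ R` -/

section SymbolClass

variable {p : ℕ} [Fact p.Prime] {r N : ℕ} (hN : 0 < N) (hE : Even N)
  {B : Type} [CommRing B] [Algebra (ZMod p) B] (π : TruncPoly p r →ₐ[ZMod p] B)

/-- The coefficients of `dy_1 ⋯ dy_q` and `dx dy_1 ⋯ dy_q` in the symbol of a form. -/
def symbPair (q : ℕ) : Omega p (Res p q) →ₗ[ZMod p] TruncPoly p r × B :=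
  LinearMap.prod (coeffZero _ q) (π.toLinearMap ∘ₗ coeffOne _ q) ∘ₗ (symb p r q).toLinearMap

theorem symbPair_apply (q : ℕ) (u : Omega p (Res p q)) :
    symbPair π q u = (coeffZero _ q (symb p r q u), π (coeffOne _ q (symb p r q u))) := rfl

theorem symbPair_of_eq {q : ℕ} {u : Omega p (Res p q)} {a b : TruncPoly p r}
    (h : symb p r q u = topForm p q a b) : symbPair π q u = (a, π b) := by
  rw [symbPair_apply, h, coeffZero_topForm, coeffOne_topForm]

theorem symbPair_eq_zero_iff (hπ : ∀ a, π a = 0 ↔ a ∈ Ideal.span {truncZ p r}) {q : ℕ} {u : Omega p (Res p q)}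
    (hu : u ∈ cycles (omegaSimp (res p r hN hE)) q) :
    symbPair π q u = 0 ↔ u ∈ boundaries (omegaSimp (res p r hN hE)) q := by
  rw [mem_boundaries_res_iff hN hE hu, symbPair_apply, Prod.mk_eq_zero, hπ]

variable (hπ : ∀ a, π a = 0 ↔ a ∈ Ideal.span {truncZ p r})

/-- The map on `π_q Ω̄ R` given by the coefficients of the symbol. -/
def symbHtpy (q : ℕ) : Htpy (omegaSimp (res p r hN hE)) q →ₗ[ZMod p] TruncPoly p r × B :=
  Submodule.liftQ _ (symbPair π q ∘ₗ (cycles (omegaSimp (res p r hN hE)) q).subtype)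
    fun u hu => (symbPair_eq_zero_iff hN hE π hπ u.2).2 hu

theorem symbHtpy_injective (q : ℕ) : Function.Injective (symbHtpy hN hE π hπ q) := by
  refine (injective_iff_map_eq_zero _).2 fun x hx => ?_
  obtain ⟨⟨u, hu⟩, rfl⟩ := Submodule.Quotient.mk_surjective _ x
  exact (Submodule.Quotient.mk_eq_zero _).2 ((symbPair_eq_zero_iff hN hE π hπ hu).1 hx)

/-- The map on `π_* Ω̄ R` given by the coefficients of the symbol. -/
def symbHtpyAll : HtpyAll (omegaSimp (res p r hN hE)) →ₗ[ZMod p] GammaAlg π :=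
  DirectSum.toModule (ZMod p) ℕ _ fun i => GammaAlg.incl π i ∘ₗ symbHtpy hN hE π hπ i

theorem symbHtpyAll_htpyClass {i : ℕ} {u : Omega p (Res p i)}
    (hu : u ∈ cycles (omegaSimp (res p r hN hE)) i) :
    symbHtpyAll hN hE π hπ (htpyClass (V := omegaSimp (res p r hN hE)) u hu) =
      GammaAlg.incl π i (symbPair π i u) :=
  DirectSum.toModule_lof _ _ _

theorem symbHtpyAll_of_eq {i : ℕ} {u : Omega p (Res p i)}
    (hu : u ∈ cycles (omegaSimp (res p r hN hE)) i) {a b : TruncPoly p r}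
    (h : symb p r i u = topForm p i a b) :
    symbHtpyAll hN hE π hπ (htpyClass (V := omegaSimp (res p r hN hE)) u hu) =
      GammaAlg.incl π i (a, π b) :=
  (symbHtpyAll_htpyClass hN hE π hπ hu).trans (congrArg _ (symbPair_of_eq π h))

theorem proj_symbHtpyAll (i : ℕ) (x : HtpyAll (omegaSimp (res p r hN hE))) :
    GammaAlg.proj π i (symbHtpyAll hN hE π hπ x) = symbHtpy hN hE π hπ i (x i) := by
  have h : GammaAlg.proj π i ∘ₗ symbHtpyAll hN hE π hπ =
      symbHtpy hN hE π hπ i ∘ₗ DirectSum.component (ZMod p) ℕ _ i := by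
    refine DirectSum.linearMap_ext _ fun j => LinearMap.ext fun y => ?_
    refine (congrArg (GammaAlg.proj π i) (DirectSum.toModule_lof _ _ _)).trans ?_
    refine (GammaAlg.proj_incl π j i _).trans ?_
    refine Eq.trans ?_ (congrArg (symbHtpy hN hE π hπ i) (DirectSum.component.of _ _ _ _)).symm
    split_ifs with h
    · subst h; rfl
    · exact (map_zero _).symm
  exact LinearMap.congr_fun h x

theorem symbHtpyAll_injective : Function.Injective (symbHtpyAll hN hE π hπ) := by
  intro x y h
  refine DFinsupp.ext fun i => symbHtpy_injective hN hE π hπ i ?_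
  exact (proj_symbHtpyAll hN hE π hπ i x).symm.trans
    ((congrArg (GammaAlg.proj π i) h).trans (proj_symbHtpyAll hN hE π hπ i y))

/-- The product on the algebra of pairs was modelled on `symb_shuffle`, so the shuffle product
becomes multiplication of symbols. Injectivity of the symbol map then transports algebra identities
back to homotopy. -/
theorem symbHtpyAll_mul {i j : ℕ} {u : Omega p (Res p i)} {v : Omega p (Res p j)}
    (hu : u ∈ cycles (omegaSimp (res p r hN hE)) i) (hv : v ∈ cycles (omegaSimp (res p r hN hE)) j)
    (h : shuffle (omegaSimp (res p r hN hE)) u v ∈ cycles (omegaSimp (res p r hN hE)) (i + j)) :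
    symbHtpyAll hN hE π hπ (htpyClass (V := omegaSimp (res p r hN hE)) u hu) *
      symbHtpyAll hN hE π hπ (htpyClass (V := omegaSimp (res p r hN hE)) v hv) =
      symbHtpyAll hN hE π hπ (htpyClass (shuffle (omegaSimp (res p r hN hE)) u v) h) := by
  have hs := symb_shuffle hN hE (symb_eq_topForm hN hE hu) (symb_eq_topForm hN hE hv)
  have h1 : symbPair π (i + j) (shuffle (omegaSimp (res p r hN hE)) u v) =
      ((i + j).choose i : ZMod p) • ((symbPair π i u).1 * (symbPair π j v).1,
        (symbPair π i u).2 * π (symbPair π j v).1 +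
          (-1 : ZMod p) ^ i • (π (symbPair π i u).1 * (symbPair π j v).2)) := by
    refine (symbPair_apply π (i + j) _).trans ?_
    rw [hs, map_smul, map_smul, coeffZero_topForm, coeffOne_topForm, map_smul, map_add, map_mul,
      map_smul, map_mul]
    rfl
  refine (congrArg₂ (· * ·) (symbHtpyAll_htpyClass hN hE π hπ hu)
    (symbHtpyAll_htpyClass hN hE π hπ hv)).trans ?_
  exact (GammaAlg.incl_mul_incl π i j _ _).trans
    ((congrArg (GammaAlg.incl π (i + j)) h1).symm.trans (symbHtpyAll_htpyClass hN hE π hπ h).symm)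

theorem symbHtpyAll_one : symbHtpyAll hN hE π hπ
    (htpyClass (V := omegaSimp (res p r hN hE)) (i := 0) 1 Submodule.mem_top) = 1 :=
  (symbHtpyAll_of_eq hN hE π hπ (i := 0) (u := 1) trivial (symb_one p r)).trans (by rw [map_zero]; rfl)

end SymbolClass

/-! ### Isomorphisms onto `π_* Ω̄` -/

section Assembly

variable {p : ℕ} {P R : SimplicialObject (EvenAlg p)}

/-! ### From a presentation of the image to a presentation of the homotopy -/

section Presentation

variable {M : Type} [Ring M] [Algebra (ZMod p) M] (ι : HtpyAll (omegaSimp R) →ₗ[ZMod p] M)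
  (hι : Function.Injective ι)
  (hone : ι (htpyClass (V := omegaSimp R) (i := 0) 1 Submodule.mem_top) = 1)
  (hmul : ∀ (i j : ℕ) (u : alv (omegaSimp R) i) (v : alv (omegaSimp R) j)
    (hu : u ∈ cycles (omegaSimp R) i) (hv : v ∈ cycles (omegaSimp R) j),
    ι (htpyClass u hu) * ι (htpyClass v hv) =
      ι (htpyClass (shuffle (omegaSimp R) u v) (shuffle_mem_cycles hu hv)))
  {G : Type} {bideg : G → ℕ × ℕ} {rel : Set (FreeAlgebra (ZMod p) G)}
  (Θ : BigradedAlg p bideg rel →ₐ[ZMod p] M) (hΘ : Function.Injective Θ)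
  (u : ∀ g, alv (omegaSimp R) (bideg g).1) (hu : ∀ g, u g ∈ cycles (omegaSimp R) (bideg g).1)
  (hgr : ∀ g, u g ∈ omegaSimpGr R (bideg g).1 (bideg g).2)
  (hgen : ∀ g, Θ (BigradedAlg.gen g) = ι (htpyClass (u g) (hu g)))

include hmul in
theorem mul_mem_range_of_htpyClass {i : ℕ} {v : alv (omegaSimp R) i}
    (hv : v ∈ cycles (omegaSimp R) i) {m : M} (hm : m ∈ LinearMap.range ι) :
    ι (htpyClass v hv) * m ∈ LinearMap.range ι := by
  obtain ⟨x, rfl⟩ := hm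
  induction x using htpyAll_induction with
  | zero => rw [map_zero, mul_zero]; exact Submodule.zero_mem _
  | add x y hx hy => rw [map_add, mul_add]; exact Submodule.add_mem _ hx hy
  | cls j w hw => exact ⟨_, (hmul i j v w hv hw).symm⟩

include hone hmul hgen in
-- The image of the homotopy contains 1 and is closed under multiplication by the images of the
-- generators, which are classes of cycles.
theorem range_le_of_gen : LinearMap.range Θ.toLinearMap ≤ LinearMap.range ι := by
  have h : (LinearMap.range ι).comap Θ.toLinearMap = ⊤ := by
    refine BigradedAlg.eq_top_of_gen_mul_mem _ ⟨_, hone.trans (map_one Θ).symm⟩ fun g s hs => ?_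
    have := mul_mem_range_of_htpyClass ι hmul (hu g) hs
    rw [← hgen] at this
    exact (congrArg (· ∈ LinearMap.range ι) (map_mul Θ _ s)).mpr this
  rintro _ ⟨m, rfl⟩
  exact (congrArg (m ∈ ·) h).mpr trivial

include hι hone hmul hΘ hgr hgen in
/-- A presentation of the image of `π_* Ω̄ R` in an algebra is one of `π_* Ω̄ R`. -/
theorem exists_isBigradedAlgIso (hrange : LinearMap.range ι ≤ LinearMap.range Θ.toLinearMap) :
    ∃ E : BigradedAlg p bideg rel ≃ₗ[ZMod p] HtpyAll (omegaSimp R),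
      IsBigradedAlgIso R (BigradedAlg.gr p bideg rel) E ∧ ∀ m, ι (E m) = Θ m := by
  have hr := le_antisymm (range_le_of_gen ι hone hmul Θ u hu hgen) hrange
  let E : BigradedAlg p bideg rel ≃ₗ[ZMod p] HtpyAll (omegaSimp R) :=
    (LinearEquiv.ofInjective Θ.toLinearMap hΘ).trans
      ((LinearEquiv.ofEq _ _ hr).trans (LinearEquiv.ofInjective ι hι).symm)
  have hE : ∀ m, ι (E m) = Θ m := fun m =>
    LinearEquiv.ofInjective_symm_apply ι (h := hι) _
  have hE' : ∀ m x, E m = x ↔ Θ m = ι x := fun m x => by rw [← hE, hι.eq_iff]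
  have hEone : E 1 = htpyClass (V := omegaSimp R) (i := 0) 1 Submodule.mem_top :=
    (hE' _ _).2 ((map_one Θ).trans hone.symm)
  have hEmul : ∀ (i j : ℕ) (u : alv (omegaSimp R) i) (v : alv (omegaSimp R) j)
      (hu : u ∈ cycles (omegaSimp R) i) (hv : v ∈ cycles (omegaSimp R) j) (m m' : _),
      E m = htpyClass u hu → E m' = htpyClass v hv →
        E (m * m') = htpyClass (shuffle (omegaSimp R) u v) (shuffle_mem_cycles hu hv) := by
    intro i j u v hu hv m m' h h'
    rw [hE', map_mul, (hE' _ _).1 h, (hE' _ _).1 h', hmul]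
  -- A word in the generators is represented by an iterated shuffle product, whose internal degree
  -- is the sum of the degrees of its letters.
  have hword : ∀ l : List G, E (l.map BigradedAlg.gen).prod ∈
      htpyGr (omegaSimp R) (omegaSimpGr R) (l.map bideg).sum.1 (l.map bideg).sum.2 := by
    intro l
    induction l with
    | nil =>
      rw [List.map_nil, List.map_nil, List.prod_nil, List.sum_nil, hEone]
      exact htpyClass_mem_htpyGr (V := omegaSimp R) (gr := omegaSimpGr R) (i := 0) (u := 1) trivial
        one_mem_omegaGr
    | cons g l ih =>
      obtain ⟨v, hv, hvg, h⟩ := exists_of_mem_htpyGr (V := omegaSimp R) (gr := omegaSimpGr R) ih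
      rw [List.map_cons, List.map_cons, List.prod_cons, List.sum_cons,
        hEmul _ _ _ _ _ _ _ _ ((hE' _ _).2 (hgen g)) h.symm]
      exact htpyClass_mem_htpyGr _ (shuffle_mem_omegaSimpGr (hgr g) hvg)
  refine ⟨E, ⟨hEone, fun i j u v hu hv => ⟨shuffle_mem_cycles hu hv, ?_⟩, fun i n => ?_⟩, hE⟩
  · exact hEmul i j u v hu hv _ _ (E.apply_symm_apply _) (E.apply_symm_apply _)
  · apply le_antisymm
    · rw [BigradedAlg.gr, Submodule.map_span_le]
      rintro _ ⟨l, hl, rfl⟩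
      have := hword l
      rwa [hl] at this
    · intro x hx
      have h1 := bidegProj_of_mem (i := i) (n := n) hx
      rw [if_pos rfl] at h1
      -- Words span, and the projection to bidegree `(i, n)` keeps the words of that bidegree and
      -- kills all others. An element of that bidegree equals its projection, hence is a combination
      -- of such words.
      have h2 : ∀ m : BigradedAlg p bideg rel, bidegProj R i n (E m) ∈
          (BigradedAlg.gr p bideg rel i n).map E.toLinearMap := by
        intro m
        have hm : m ∈ Submodule.span (ZMod p) (Set.range fun l : List G =>
            ((l.map BigradedAlg.gen).prod : BigradedAlg p bideg rel)) := by
          rw [BigradedAlg.span_prod_eq_top]; trivial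
        induction hm using Submodule.span_induction with
        | mem m hm =>
          obtain ⟨l, rfl⟩ := hm
          refine (congrArg (· ∈ _) (bidegProj_of_mem (i := i) (n := n) (hword l))).mpr ?_
          split_ifs with h
          · exact ⟨_, Submodule.subset_span ⟨l, h, rfl⟩, rfl⟩
          · exact Submodule.zero_mem _
        | zero => rw [map_zero, map_zero]; exact Submodule.zero_mem _
        | add m m' _ _ h h' => rw [map_add, map_add]; exact Submodule.add_mem _ h h'
        | smul c m _ h => rw [map_smul, map_smul]; exact Submodule.smul_mem _ _ h
      have h3 := h2 (E.symm x)
      rwa [E.apply_symm_apply, h1] at h3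

end Presentation

/-! ### Transport to another resolution and the induced de Rham differential -/

section Transport

variable {M : Type} [Ring M] [Algebra (ZMod p) M] {gr : ℕ → ℕ → Submodule (ZMod p) M}

/-- Isomorphisms of bigraded algebras are transported along homotopy equivalences. -/
theorem IsBigradedAlgIso.trans_omegaHtpyMap {E : M ≃ₗ[ZMod p] HtpyAll (omegaSimp R)}
    (hE : IsBigradedAlgIso R gr E) {f : R ⟶ P} {g : P ⟶ R}
    {e : HtpyAll (omegaSimp R) ≃ₗ[ZMod p] HtpyAll (omegaSimp P)}
    (he : ∀ x, e x = omegaHtpyMap f x) (he' : ∀ x, e.symm x = omegaHtpyMap g x) :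
    IsBigradedAlgIso P gr (E.trans e) where
  map_one := by
    rw [LinearEquiv.trans_apply, hE.map_one, he]
    exact (omegaHtpyMap_htpyClass f (i := 0) (u := 1) trivial).trans
      (htpyClass_congr _ (_root_.map_one (omegaMap f 0)) _)
  map_mul i j u v hu hv := by
    refine ⟨shuffle_mem_cycles hu hv, e.symm.injective ?_⟩
    obtain ⟨h, h'⟩ := hE.map_mul i j (omegaMap g i u) (omegaMap g j v) (omegaMap_mem_cycles g hu)
      (omegaMap_mem_cycles g hv)
    rw [LinearEquiv.trans_apply, e.symm_apply_apply, LinearEquiv.trans_symm,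
      LinearEquiv.trans_apply, LinearEquiv.trans_apply, he', he', he', omegaHtpyMap_htpyClass,
      omegaHtpyMap_htpyClass, omegaHtpyMap_htpyClass, h']
    exact htpyClass_congr _ (omegaMap_shuffle g u v).symm _
  map_gr i n := by
    have h : ∀ {R P : SimplicialObject (EvenAlg p)} (f : R ⟶ P) (x : HtpyAll (omegaSimp R)),
        x ∈ htpyGr (omegaSimp R) (omegaSimpGr R) i n →
          omegaHtpyMap f x ∈ htpyGr (omegaSimp P) (omegaSimpGr P) i n := by
      intro R P f x hx
      obtain ⟨u, hu, hg, rfl⟩ := exists_of_mem_htpyGr (V := omegaSimp R) (gr := omegaSimpGr R) hx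
      rw [omegaHtpyMap_htpyClass]
      exact htpyClass_mem_htpyGr _ (omegaMap_mem_omegaSimpGr f hg)
    have h1 : (gr i n).map (E.trans e).toLinearMap =
        ((gr i n).map E.toLinearMap).map e.toLinearMap := Submodule.map_comp _ _ _
    rw [h1, hE.map_gr]
    refine le_antisymm ?_ fun x hx => ⟨e.symm x, ?_, e.apply_symm_apply x⟩
    · rintro _ ⟨x, hx, rfl⟩
      exact (congrArg (· ∈ _) (he x)).mpr (h f x hx)
    · exact (congrArg (· ∈ _) (he' x)).mpr (h g x hx)

/-- The de Rham differential induces a signed derivation. -/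
theorem IsBigradedAlgIso.exists_isInducedDeRham {Φ : M ≃ₗ[ZMod p] HtpyAll (omegaSimp P)}
    (hΦ : IsBigradedAlgIso P gr Φ) :
    ∃ D : M →ₗ[ZMod p] M, IsInducedDeRham P Φ D ∧ IsSignedDerivation gr D ∧
      ∀ m, Φ (D m) = deRhamHtpy P (Φ m) := by
  let D : M →ₗ[ZMod p] M := Φ.symm.toLinearMap ∘ₗ deRhamHtpy P ∘ₗ Φ.toLinearMap
  have hD : ∀ m, Φ (D m) = deRhamHtpy P (Φ m) := fun m => Φ.apply_symm_apply _
  have hmul : ∀ {i j : ℕ} {u : alv (omegaSimp P) i} {v : alv (omegaSimp P) j}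
      (hu : u ∈ cycles (omegaSimp P) i) (hv : v ∈ cycles (omegaSimp P) j) {m m' : M},
      Φ m = htpyClass u hu → Φ m' = htpyClass v hv →
        Φ (m * m') = htpyClass (shuffle (omegaSimp P) u v) (shuffle_mem_cycles hu hv) := by
    intro i j u v hu hv m m' h h'
    obtain ⟨_, h2⟩ := hΦ.map_mul i j u v hu hv
    rwa [← h, ← h', Φ.symm_apply_apply, Φ.symm_apply_apply] at h2
  refine ⟨D, fun i u hu => ⟨deRhamOp_mem_cycles hu, ?_⟩, fun i n m m' hm => ?_, hD⟩
  · rw [hD, Φ.apply_symm_apply, deRhamHtpy_htpyClass]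
    rfl
  · have hm' : Φ m ∈ htpyGr (omegaSimp P) (omegaSimpGr P) i n := by
      rw [← hΦ.map_gr]; exact ⟨m, hm, rfl⟩
    obtain ⟨u, hu, hg, h⟩ := exists_of_mem_htpyGr (V := omegaSimp P) (gr := omegaSimpGr P) hm'
    obtain ⟨y, rfl⟩ := Φ.symm.surjective m'
    induction y using htpyAll_induction with
    | zero => simp only [map_zero, mul_zero, add_zero]
    | add x y hx hy =>
      rw [map_add, mul_add, map_add, hx, hy, map_add, mul_add, mul_add, mul_add]
      abel
    | cls j v hv =>
      have hm1 : Φ (D m) = _ := (hD m).trans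
        ((congrArg _ h.symm).trans (deRhamHtpy_htpyClass hu))
      have hm2 := Φ.apply_symm_apply (htpyClass v hv)
      have hm3 : Φ (D (Φ.symm (htpyClass v hv))) = _ := (hD _).trans
        ((congrArg _ hm2).trans (deRhamHtpy_htpyClass hv))
      have hsmul : (-1 : M) ^ n * (m * D (Φ.symm (htpyClass v hv))) =
          (-1 : ZMod p) ^ n • (m * D (Φ.symm (htpyClass v hv))) := by
        rw [Algebra.smul_def, map_pow, map_neg, _root_.map_one]
      apply Φ.injective
      rw [hsmul, map_add, map_smul, hmul _ _ hm1 hm2, hmul hu _ h.symm hm3, hD,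
        hmul hu hv h.symm hm2, deRhamHtpy_htpyClass, ← htpyClass_smul, ← htpyClass_add]
      exact htpyClass_congr _ (deRham_shuffle v hg) _

end Transport

/-! ### Independence of the resolution -/

section Resolution

variable [Fact p.Prime] {A : EvenAlg p} {εR : R ⟶ (SimplicialObject.const (EvenAlg p)).obj A}
  {εP : P ⟶ (SimplicialObject.const (EvenAlg p)).obj A}

/-- Both the composite `f ≫ g` and the identity are endomorphisms of `R` over `A`, so they agree on
the homotopy of `Ω̄`. -/
theorem omegaHtpyMap_comp_eq_self (hR : IsAlmostFreeResolution R εR) {f : R ⟶ P} {g : P ⟶ R}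
    (hf : f ≫ εP = εR) (hg : g ≫ εR = εP) (x : HtpyAll (omegaSimp R)) :
    omegaHtpyMap g (omegaHtpyMap f x) = x := by
  have h : omegaHtpyMap g ∘ₗ omegaHtpyMap f = LinearMap.id := by
    refine htpyAll_hom_ext fun i u hu => ?_
    rw [LinearMap.comp_apply, omegaHtpyMap_htpyClass, omegaHtpyMap_htpyClass, LinearMap.id_apply]
    refine htpyClass_eq_of_sub_mem _ _ ?_
    have h1 := omega_map_sub_mem_boundaries hR hR (f := f ≫ g) (g := 𝟙 R)
      (by rw [Category.assoc, hg, hf]) (Category.id_comp _) hu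
    have h2 : Omega.map p (comp (f ≫ g) i).toAlgHom u = omegaMap g i (omegaMap f i u) :=
      Omega.map_comp_apply (comp g i).toAlgHom (comp f i).toAlgHom u
    have h3 : Omega.map p (comp (𝟙 R) i).toAlgHom u = u := Omega.map_id_apply u
    have h4 := congrArg₂ (· - ·) h2 h3
    exact (congrArg (· ∈ boundaries (omegaSimp R) i) h4).mp h1
  exact LinearMap.congr_fun h x

/-- Maps of almost free resolutions over `A` induce isomorphisms on `π_* Ω̄`. -/
theorem exists_omegaHtpyMap_equiv (hR : IsAlmostFreeResolution R εR)
    (hP : IsAlmostFreeResolution P εP) {f : R ⟶ P} (hf : f ≫ εP = εR) :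
    ∃ (g : P ⟶ R) (e : HtpyAll (omegaSimp R) ≃ₗ[ZMod p] HtpyAll (omegaSimp P)),
      (∀ x, e x = omegaHtpyMap f x) ∧ ∀ x, e.symm x = omegaHtpyMap g x := by
  obtain ⟨g, hg⟩ := exists_map_of_isAlmostFreeResolution hP hR
  exact ⟨g, LinearEquiv.ofLinearMap (omegaHtpyMap f) (omegaHtpyMap g)
    (LinearMap.ext (omegaHtpyMap_comp_eq_self hP hg hf))
    (LinearMap.ext (omegaHtpyMap_comp_eq_self hR hf hg)), fun _ => rfl, fun _ => rfl⟩

/-- A presentation of the image of `π_* Ω̄ R` in an algebra is one of `π_* Ω̄ P`. -/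
theorem exists_isBigradedAlgIso_of_resolution (hR : IsAlmostFreeResolution R εR)
    (hP : IsAlmostFreeResolution P εP) {f : R ⟶ P} (hf : f ≫ εP = εR)
    {M : Type} [Ring M] [Algebra (ZMod p) M] (ι : HtpyAll (omegaSimp R) →ₗ[ZMod p] M)
    (hι : Function.Injective ι)
    (hone : ι (htpyClass (V := omegaSimp R) (i := 0) 1 Submodule.mem_top) = 1)
    (hmul : ∀ (i j : ℕ) (u : alv (omegaSimp R) i) (v : alv (omegaSimp R) j)
      (hu : u ∈ cycles (omegaSimp R) i) (hv : v ∈ cycles (omegaSimp R) j),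
      ι (htpyClass u hu) * ι (htpyClass v hv) =
        ι (htpyClass (shuffle (omegaSimp R) u v) (shuffle_mem_cycles hu hv)))
    {G : Type} {bideg : G → ℕ × ℕ} {rel : Set (FreeAlgebra (ZMod p) G)}
    (Θ : BigradedAlg p bideg rel →ₐ[ZMod p] M) (hΘ : Function.Injective Θ)
    (hrange : LinearMap.range ι ≤ LinearMap.range Θ.toLinearMap)
    (u : ∀ g, alv (omegaSimp R) (bideg g).1) (hu : ∀ g, u g ∈ cycles (omegaSimp R) (bideg g).1)
    (hgr : ∀ g, u g ∈ omegaSimpGr R (bideg g).1 (bideg g).2)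
    (hgen : ∀ g, Θ (BigradedAlg.gen g) = ι (htpyClass (u g) (hu g))) :
    ∃ (Φ : BigradedAlg p bideg rel ≃ₗ[ZMod p] HtpyAll (omegaSimp P))
      (D : BigradedAlg p bideg rel →ₗ[ZMod p] BigradedAlg p bideg rel),
      IsBigradedAlgIso P (BigradedAlg.gr p _ _) Φ ∧
      (∀ g, IsRepresentedBy f (u g) (Φ (BigradedAlg.gen g))) ∧
      IsInducedDeRham P Φ D ∧ IsSignedDerivation (BigradedAlg.gr p _ _) D ∧
      ∀ g m, Θ m = ι (htpyClass (deRhamOp R _ (u g)) (deRhamOp_mem_cycles (hu g))) →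
        D (BigradedAlg.gen g) = m := by
  obtain ⟨E, hE, hEι⟩ := exists_isBigradedAlgIso ι hι hone hmul Θ hΘ u hu hgr hgen hrange
  obtain ⟨g, e, he, he'⟩ := exists_omegaHtpyMap_equiv hR hP hf
  have hΦ := hE.trans_omegaHtpyMap he he'
  obtain ⟨D, h1, h2, h3⟩ := hΦ.exists_isInducedDeRham
  have hrep : ∀ g, (E.trans e) (BigradedAlg.gen g) =
      htpyClass (omegaMap f _ (u g)) (omegaMap_mem_cycles f (hu g)) := fun g => by
    rw [LinearEquiv.trans_apply, he, hι ((hEι _).trans (hgen g)), omegaHtpyMap_htpyClass]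
  refine ⟨E.trans e, D, hΦ, fun g => ⟨omegaMap_mem_cycles f (hu g), hrep g⟩, h1, h2,
    fun g m hm => (E.trans e).injective ?_⟩
  rw [h3, hrep, deRhamHtpy_htpyClass, LinearEquiv.trans_apply, he, hι ((hEι _).trans hm),
    omegaHtpyMap_htpyClass]
  exact htpyClass_congr _ (omegaMap_deRhamOp f (u g)).symm _

end Resolution

end Assembly

/-! ### The two cases -/

section Cases

variable {p : ℕ} [Fact p.Prime] {r N : ℕ} (hN : 0 < N) (hE : Even N)
  {B : Type} [CommRing B] [Algebra (ZMod p) B] (π : TruncPoly p r →ₐ[ZMod p] B)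
  (hπ : ∀ a, π a = 0 ↔ a ∈ Ideal.span {truncZ p r})
  {P : SimplicialObject (EvenAlg p)}
  {ε : P ⟶ (SimplicialObject.const (EvenAlg p)).obj (trunc p r hN hE)}

theorem symbHtpyAll_of_eq_zero {i : ℕ} {u : Omega p (Res p i)}
    (hu : u ∈ cycles (omegaSimp (res p r hN hE)) i) (h : u = 0) :
    symbHtpyAll hN hE π hπ (htpyClass (V := omegaSimp (res p r hN hE)) u hu) = 0 := by
  refine (symbHtpyAll_htpyClass hN hE π hπ hu).trans ?_
  rw [h, map_zero, map_zero]

theorem range_symbHtpyAll_le {S : Submodule (ZMod p) (GammaAlg π)}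
    (hS : ∀ (i : ℕ) (u : Omega p (Res p i)), u ∈ cycles (omegaSimp (res p r hN hE)) i →
      GammaAlg.incl π i (symbPair π i u) ∈ S) :
    LinearMap.range (symbHtpyAll hN hE π hπ) ≤ S := by
  rintro _ ⟨x, rfl⟩
  induction x using htpyAll_induction with
  | zero => rw [map_zero]; exact Submodule.zero_mem _
  | add x y hx hy => rw [map_add]; exact Submodule.add_mem _ hx hy
  | cls i u hu =>
    exact (congrArg (· ∈ S) (symbHtpyAll_htpyClass hN hE π hπ hu)).mpr (hS i u hu)

/-- The cycles that represent `x`, `dx` and `γ_i(ω)`. -/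
def divRep (p r N : ℕ) : ∀ g : GenDiv, Omega p (Res p (g.bideg r N).1)
  | .x => Omega.el p (MvPolynomial.X none)
  | .dx => Omega.d p (MvPolynomial.X none)
  | .γ i => dY p i

theorem divRep_mem_cycles (hz : (r : ZMod p) + 1 = 0) :
    ∀ g, divRep p r N g ∈ cycles (omegaSimp (res p r hN hE)) (g.bideg r N).1
  | .x => trivial
  | .dx => trivial
  | .γ i => dY_mem_cycles hN hE i hz

theorem divRep_mem_gr : ∀ g : GenDiv,
    divRep p r N g ∈ omegaSimpGr (res p r hN hE) (g.bideg r N).1 (g.bideg r N).2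
  | .x => by
    have h := el_mem_omegaGr (A := resObj p r hN hE 0) (X_mem_resGr hN hE 0 none)
    exact (congrArg (fun n => divRep p r N .x ∈ omegaSimpGr (res p r hN hE) 0 n)
      (Nat.sub_add_cancel hN)).mp h
  | .dx => d_mem_omegaGr (A := resObj p r hN hE 0) (X_mem_resGr hN hE 0 none)
  | .γ i => dY_mem_gr hN hE i

theorem symbHtpyAll_divRep (hz : (r : ZMod p) + 1 = 0) : ∀ g, divVal π (TruncPoly.x p r) g =
    symbHtpyAll hN hE π hπ (htpyClass (V := omegaSimp (res p r hN hE)) (divRep p r N g)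
      (divRep_mem_cycles hN hE hz g))
  | .x => by
    refine Eq.trans ?_ (symbHtpyAll_of_eq hN hE π hπ _ (symb_el_X_none p r)).symm
    rw [map_zero]; rfl
  | .dx => by
    refine Eq.trans ?_ (symbHtpyAll_of_eq hN hE π hπ _ (symb_d_X_none p r)).symm
    rw [map_one]; rfl
  | .γ i => by
    refine Eq.trans ?_ (symbHtpyAll_of_eq hN hE π hπ _ (symb_dY p r i)).symm
    rw [map_zero]; rfl

include hπ in
theorem exists_isBigradedAlgIso_algDiv (hz : (r : ZMod p) + 1 = 0)
    (hb : Function.Bijective π) (hP : IsAlmostFreeResolution P ε) {f : res p r hN hE ⟶ P}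
    (hf : f ≫ ε = resAug p r hN hE) :
    ∃ (Φ : AlgDiv p r N ≃ₗ[ZMod p] HtpyAll (omegaSimp P))
      (D : AlgDiv p r N →ₗ[ZMod p] AlgDiv p r N),
      IsBigradedAlgIso P (BigradedAlg.gr p _ _) Φ ∧
      IsRepresentedBy f (resX p r hN hE 0) (Φ (BigradedAlg.gen .x)) ∧
      IsRepresentedBy f (resDX p r hN hE 0) (Φ (BigradedAlg.gen .dx)) ∧
      (∀ i : ℕ, IsRepresentedBy f (resOmega p r hN hE i) (Φ (BigradedAlg.gen (.γ i)))) ∧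
      IsInducedDeRham P Φ D ∧
      IsSignedDerivation (BigradedAlg.gr p _ _) D ∧
      D (BigradedAlg.gen .x) = BigradedAlg.gen .dx ∧
      D (BigradedAlg.gen .dx) = 0 ∧
      ∀ i : ℕ, D (BigradedAlg.gen (.γ i)) = 0 := by
  obtain ⟨Θ, hgen, hinj, hrange⟩ := exists_algHom_algDiv (r := r) π (TruncPoly.x p r) hN hE
    (TruncPoly.aeval_x_surjective p r) hb (TruncPoly.aeval_x_eq_zero_iff p r)
  obtain ⟨Φ, D, h1, h2, h3, h4, h5⟩ := exists_isBigradedAlgIso_of_resolution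
    (isAlmostFreeResolution_res p r hN hE) hP hf (symbHtpyAll hN hE π hπ)
    (symbHtpyAll_injective hN hE π hπ) (symbHtpyAll_one hN hE π hπ)
    (fun i j u v hu hv => symbHtpyAll_mul hN hE π hπ hu hv _) Θ hinj
    (range_symbHtpyAll_le hN hE π hπ fun i u _ => hrange i _)
    (divRep p r N) (divRep_mem_cycles hN hE hz) (divRep_mem_gr hN hE)
    (fun g => (hgen g).trans (symbHtpyAll_divRep hN hE π hπ hz g))
  refine ⟨Φ, D, h1, h2 .x, h2 .dx, fun i => ?_, h3, h4, h5 .x _ ?_, h5 .dx _ ?_,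
    fun i => h5 (.γ i) _ ?_⟩
  · exact (congrArg (fun w => IsRepresentedBy f w (Φ (BigradedAlg.gen (.γ i))))
      (resOmega_eq hN hE i)).mpr (h2 (.γ i))
  · refine ((hgen .dx).trans (symbHtpyAll_divRep hN hE π hπ hz .dx)).trans ?_
    exact congrArg (symbHtpyAll hN hE π hπ) (htpyClass_congr _ (Omega.deRham_el p _).symm _)
  · exact (map_zero Θ).trans (symbHtpyAll_of_eq_zero hN hE π hπ _ (Omega.deRham_d p _)).symm
  · exact (map_zero Θ).trans
      (symbHtpyAll_of_eq_zero hN hE π hπ _ (Omega.deRham_d_prod p (yVars p i))).symm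

variable (p r N) in
/-- The cycles that represent `a_i` and `b_i`. -/
def nonDivRep : ∀ g : GenNonDiv, Omega p (Res p (g.bideg r N).1)
  | .a i => dXY p i
  | .b i => Omega.contract (resEuler p r i) (dXY p i)

theorem nonDivRep_mem_cycles :
    ∀ g, nonDivRep p r N g ∈ cycles (omegaSimp (res p r hN hE)) (g.bideg r N).1
  | .a i => dXY_mem_cycles hN hE i
  | .b i => contract_dXY_mem_cycles hN hE i

theorem nonDivRep_mem_gr : ∀ g : GenNonDiv,
    nonDivRep p r N g ∈ omegaSimpGr (res p r hN hE) (g.bideg r N).1 (g.bideg r N).2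
  | .a i => dXY_mem_gr hN hE i
  | .b i => contract_dXY_mem_gr hN hE i

theorem symbHtpyAll_nonDivRep : ∀ g, nonDivVal π (TruncPoly.x p r) g =
    symbHtpyAll hN hE π hπ (htpyClass (V := omegaSimp (res p r hN hE)) (nonDivRep p r N g)
      (nonDivRep_mem_cycles hN hE g))
  | .a i => by
    refine Eq.trans ?_ (symbHtpyAll_of_eq hN hE π hπ _ (symb_dXY p r i)).symm
    rw [map_one]; rfl
  | .b i => by
    refine Eq.trans ?_ (symbHtpyAll_of_eq hN hE π hπ _ (symb_contract_dXY p r i)).symm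
    rw [map_zero]; rfl

/-- In positive dimension the cycle condition kills `a (r+1) x^r`, and here `r+1` is a unit. -/
theorem coeffZero_symb_mul_x_pow (hz : (r : ZMod p) + 1 ≠ 0) {i : ℕ} (hi : i ≠ 0)
    {u : Omega p (Res p i)} (hu : u ∈ cycles (omegaSimp (res p r hN hE)) i) :
    (symbPair π i u).1 * TruncPoly.x p r ^ r = 0 := by
  obtain ⟨q, rfl⟩ := Nat.exists_eq_succ_of_ne_zero hi
  have h := coeffZero_symb_mul hN hE hu
  rw [truncZ, mul_smul_comm] at h
  exact (smul_eq_zero_iff_right hz).1 h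

include hπ in
theorem exists_isBigradedAlgIso_algNonDiv (hz : (r : ZMod p) + 1 ≠ 0)
    (hs : Function.Surjective π)
    (hπ0 : ∀ f : Polynomial (ZMod p),
      π (Polynomial.aeval (TruncPoly.x p r) f) = 0 ↔ Polynomial.X ^ r ∣ f)
    (hP : IsAlmostFreeResolution P ε) {f : res p r hN hE ⟶ P}
    (hf : f ≫ ε = resAug p r hN hE) :
    ∃ (Φ : AlgNonDiv p r N ≃ₗ[ZMod p] HtpyAll (omegaSimp P))
      (D : AlgNonDiv p r N →ₗ[ZMod p] AlgNonDiv p r N),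
      IsBigradedAlgIso P (BigradedAlg.gr p _ _) Φ ∧
      (∀ i : ℕ, IsRepresentedBy f (resDX p r hN hE i * resOmega p r hN hE i)
        (Φ (BigradedAlg.gen (.a i)))) ∧
      (∀ i : ℕ, IsRepresentedBy f
        (resTheta p r hN hE i (resDX p r hN hE i * resOmega p r hN hE i))
        (Φ (BigradedAlg.gen (.b i)))) ∧
      IsInducedDeRham P Φ D ∧
      IsSignedDerivation (BigradedAlg.gr p _ _) D ∧
      ∀ i : ℕ, D (BigradedAlg.gen (.a i)) = 0 ∧
        D (BigradedAlg.gen (.b i)) = (1 + ((r : ZMod p) + 1) * i) • BigradedAlg.gen (.a i) := by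
  obtain ⟨Θ, hgen, hinj, hrange⟩ := exists_algHom_algNonDiv (r := r) π (TruncPoly.x p r) hN hE
    (TruncPoly.aeval_x_surjective p r) hs (TruncPoly.aeval_x_eq_zero_iff p r) hπ0
  obtain ⟨Φ, D, h1, h2, h3, h4, h5⟩ := exists_isBigradedAlgIso_of_resolution
    (isAlmostFreeResolution_res p r hN hE) hP hf (symbHtpyAll hN hE π hπ)
    (symbHtpyAll_injective hN hE π hπ) (symbHtpyAll_one hN hE π hπ)
    (fun i j u v hu hv => symbHtpyAll_mul hN hE π hπ hu hv _) Θ hinj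
    (range_symbHtpyAll_le hN hE π hπ fun i u hu =>
      hrange i _ fun hi => coeffZero_symb_mul_x_pow hN hE π hz hi hu)
    (nonDivRep p r N) (nonDivRep_mem_cycles hN hE) (nonDivRep_mem_gr hN hE)
    (fun g => (hgen g).trans (symbHtpyAll_nonDivRep hN hE π hπ g))
  refine ⟨Φ, D, h1, fun i => ?_, fun i => ?_, h3, h4, fun i => ⟨h5 (.a i) _ ?_, h5 (.b i) _ ?_⟩⟩
  · exact (congrArg (fun w => IsRepresentedBy f w (Φ (BigradedAlg.gen (.a i))))
      (resDX_mul_resOmega hN hE i)).mpr (h2 (.a i))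
  · exact (congrArg (fun w => IsRepresentedBy f w (Φ (BigradedAlg.gen (.b i))))
      (resTheta_dXY hN hE i)).mpr (h2 (.b i))
  · exact (map_zero Θ).trans (symbHtpyAll_of_eq_zero hN hE π hπ _
      (Omega.deRham_d_prod p (MvPolynomial.X none :: yVars p i))).symm
  · refine (map_smul Θ _ _).trans ((congrArg _ ((hgen (.a i)).trans
      (symbHtpyAll_nonDivRep hN hE π hπ (.a i)))).trans ?_)
    refine (map_smul (symbHtpyAll hN hE π hπ) _ _).symm.trans ?_
    exact congrArg (symbHtpyAll hN hE π hπ) ((htpyClass_smul _ _).symm.trans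
      (htpyClass_congr _ (deRham_contract_dXY p r i).symm _))

end Cases

end DerivedDeRham

end

theorem mainTheorem10 (p : ℕ) [Fact p.Prime] (hp : p ≠ 2) (r : ℕ) (hr : 1 ≤ r)
    (N : ℕ) (hN : 0 < N) (hE : Even N) :
    IsAlmostFreeResolution (res p r hN hE) (resAug p r hN hE) ∧
    ∀ (P : SimplicialObject (EvenAlg p))
      (ε : P ⟶ (SimplicialObject.const (EvenAlg p)).obj (trunc p r hN hE)),
      IsAlmostFreeResolution P ε →
      (∃ f : res p r hN hE ⟶ P, f ≫ ε = resAug p r hN hE) ∧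
      ∀ f : res p r hN hE ⟶ P, f ≫ ε = resAug p r hN hE →
        (p ∣ r + 1 →
          ∃ (Φ : AlgDiv p r N ≃ₗ[ZMod p] HtpyAll (omegaSimp P))
            (D : AlgDiv p r N →ₗ[ZMod p] AlgDiv p r N),
            IsBigradedAlgIso P (BigradedAlg.gr p _ _) Φ ∧
            IsRepresentedBy f (resX p r hN hE 0) (Φ (BigradedAlg.gen .x)) ∧
            IsRepresentedBy f (resDX p r hN hE 0) (Φ (BigradedAlg.gen .dx)) ∧
            (∀ i : ℕ, IsRepresentedBy f (resOmega p r hN hE i) (Φ (BigradedAlg.gen (.γ i)))) ∧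
            IsInducedDeRham P Φ D ∧
            IsSignedDerivation (BigradedAlg.gr p _ _) D ∧
            D (BigradedAlg.gen .x) = BigradedAlg.gen .dx ∧
            D (BigradedAlg.gen .dx) = 0 ∧
            ∀ i : ℕ, D (BigradedAlg.gen (.γ i)) = 0) ∧
        (¬ p ∣ r + 1 →
          ∃ (Φ : AlgNonDiv p r N ≃ₗ[ZMod p] HtpyAll (omegaSimp P))
            (D : AlgNonDiv p r N →ₗ[ZMod p] AlgNonDiv p r N),
            IsBigradedAlgIso P (BigradedAlg.gr p _ _) Φ ∧
            (∀ i : ℕ, IsRepresentedBy f (resDX p r hN hE i * resOmega p r hN hE i)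
              (Φ (BigradedAlg.gen (.a i)))) ∧
            (∀ i : ℕ, IsRepresentedBy f
              (resTheta p r hN hE i (resDX p r hN hE i * resOmega p r hN hE i))
              (Φ (BigradedAlg.gen (.b i)))) ∧
            IsInducedDeRham P Φ D ∧
            IsSignedDerivation (BigradedAlg.gr p _ _) D ∧
            ∀ i : ℕ, D (BigradedAlg.gen (.a i)) = 0 ∧
              D (BigradedAlg.gen (.b i)) = (1 + ((r : ZMod p) + 1) * i) • BigradedAlg.gen (.a i)) := by
  have hdvd : p ∣ r + 1 ↔ (r : ZMod p) + 1 = 0 := by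
    rw [← ZMod.natCast_eq_zero_iff, Nat.cast_add, Nat.cast_one]
  refine ⟨isAlmostFreeResolution_res p r hN hE, fun P ε hP =>
    ⟨exists_map_of_isAlmostFreeResolution (isAlmostFreeResolution_res p r hN hE) hP,
      fun f hf => ⟨fun h => ?_, fun h => ?_⟩⟩⟩
  · have hz := hdvd.1 h
    -- The ideal generated by `(r+1) x^r` is zero, so the `dx`-coefficients are also taken in `A`
    -- itself.
    exact exists_isBigradedAlgIso_algDiv (B := ModZ p r) hN hE (toModZ p r)
      (by exact toModZ_eq_zero_iff p r) hz (by exact toModZ_bijective p r hz) hP hf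
  · have hz : (r : ZMod p) + 1 ≠ 0 := fun hz => h (hdvd.2 hz)
    -- Now `r+1` is a unit of `𝔽_p`, and the `dx`-coefficients are taken in `𝔽_p[x]/(x^r)`.
    exact exists_isBigradedAlgIso_algNonDiv (B := ModZ p r) hN hE (toModZ p r)
      (by exact toModZ_eq_zero_iff p r) hz (by exact toModZ_surjective p r)
      (by exact toModZ_aeval_x_eq_zero_iff p r hz) hP hf
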